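/- Let $X$ be a connected, regular, Noetherian scheme, let $G$ be a finite group acting on $X$ with quotient $\pi\colon X\to Y=X/G$ (a finite $G$-invariant morphism with $\mathcal O_Y\cong(\pi_*\mathcal O_X)^G$), and assume that $2$ is invertible on $Y$. Assume that $\pi$ is flat and that the action is tame in the sense of Grothendieck–Murre: there is a divisor $b$ with normal crossings on $Y$ (possibly empty) such that $\pi$ is a $G$-torsor over $Y\setminus b$, and at each point $x$ of codimension one of $X$ lying over $b$ the ramification index $e_x$ is prime to the characteristic of the residue field $\kappa(x)$ and $\kappa(x)/\kappa(\pi(x))$ is separable. Assume also that the inertia group of every closed point of $X$ has odd order. Then every $e_x$ is odd; put $\mathcal D^{-1/2}_{X/Y}=\mathcal O_X\big(\sum_x\frac{e_x-1}{2}\overline{\{x\}}\big)$, the sum being over the points $x$ of codimension one. The group $G$ acts on $\pi_*\mathcal D^{-1/2}_{X/Y}$, where $g$ acts by $(g^{-1})^*$. A symmetric bundle on a scheme is a locally free sheaf of finite rank with a symmetric bilinear form whose adjoint map to the dual sheaf is an isomorphism. Let $(E,q)$ be a symmetric bundle on $Y$ and let $\rho$ be a homomorphism from $G$ to the group of isometries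 of $(E,q)$. (i) There is a (unique) symmetric bilinear form $\mathrm{Tr}_{X/Y}$ on $\pi_*\mathcal D^{-1/2}_{X/Y}$ with values in $\mathcal O_Y$ and $\mathrm{Tr}_{X/Y}(s,t)=\mathrm{Tr}_{K(X)/K(Y)}(st)$. On the invariants, for the diagonal action, $$E_{\rho,X}=(E\otimes_{\mathcal O_Y}\pi_*\mathcal D^{-1/2}_{X/Y})^G$$ there is a unique symmetric bilinear form $q_{\rho,X}=(q\otimes \mathrm{Tr}_{X/Y})^G$ such that, on every open set, $q_{\rho,X}(x,y)=(q\otimes\mathrm{Tr}_{X/Y})(m,y)$ whenever $x=\sum_{g\in G}g\,m$ with a section $m$ of $E\otimes\pi_*\mathcal D^{-1/2}_{X/Y}$. The pair $(E_{\rho,X},q_{\rho,X})$ is a symmetric bundle over $Y$. (ii) Let $\varphi\colon Z\to Y$ be flat, let $T'=Z\times_YX$ with projections $\pi'\colon T'\to Z$ and $\varphi'\colon T'\to X$, and put $\mathcal D^{-1/2}_{T'/Z}=\varphi'^*\mathcal D^{-1/2}_{X/Y}$. The $G$-action and the trace form on $\pi_*\mathcal D^{-1/2}_{X/Y}$ induce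 by base change a $G$-action and a symmetric form on $\pi'_*\mathcal D^{-1/2}_{T'/Z}$, and $q$, $\rho$ induce $\varphi^*q$, $\varphi^*\rho$ on $\varphi^*E$. The twist $(\varphi^*E)_{\varphi^*\rho,T'}=(\varphi^*E\otimes_{\mathcal O_Z}\pi'_*\mathcal D^{-1/2}_{T'/Z})^G$, with the form $(\varphi^*q\otimes\mathrm{Tr}_{T'/Z})^G$ defined and unique as in (i), is a symmetric bundle over $Z$, and the canonical base change map is an isometry $$\varphi^*(E_{\rho,X})\;\cong\;(\varphi^*E)_{\varphi^*\rho,T'} .$$ -/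

import Mathlib

open AlgebraicGeometry CategoryTheory CategoryTheory.Limits TopologicalSpace Opposite

universe u v

noncomputable section

namespace TameTwist

section FunctionField

variable {X Y : Scheme.{u}} [IsIntegral X] [IsIntegral Y]

lemma map_genericPoint (f : X ⟶ Y) [IsDominant f] : f (genericPoint X) = genericPoint Y := by
  refine ((genericPoint_spec Y).eq ?_).symm
  have h := (genericPoint_spec X).image f.continuous
  rw [Set.image_univ, f.denseRange.closure_range] at h
  exact h

/-- Pullback of rational functions along a dominant morphism: the homomorphism
`K(Y) → K(X)` of function fields. -/
def functionFieldMap (f : X ⟶ Y) [IsDominant f] : Y.functionField →+* X.functionField :=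
  (Y.presheaf.stalkSpecializes (specializes_of_eq (map_genericPoint f)) ≫
    f.stalkMap (genericPoint X)).hom

/-- The inclusion of the local ring `𝒪_{X,x}` into the function field `K(X)`. -/
def stalkToFunctionField (x : X) : X.presheaf.stalk x →+* X.functionField :=
  algebraMap (X.presheaf.stalk x) X.functionField

lemma functionFieldMap_stalk (f : X ⟶ Y) [IsDominant f] (x : X) (a : Y.presheaf.stalk (f x)) :
    functionFieldMap f (stalkToFunctionField (f x) a) =
      stalkToFunctionField x (f.stalkMap x a) := by
  have h := Scheme.Hom.stalkSpecializes_stalkMap_apply f (genericPoint X) x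
    ((genericPoint_spec X).specializes trivial) a
  change f.stalkMap (genericPoint X) (Y.presheaf.stalkSpecializes _
    (Y.presheaf.stalkSpecializes _ a)) = X.presheaf.stalkSpecializes _ (f.stalkMap x a)
  rw [← h]
  exact congrArg _ (TopCat.Presheaf.stalkSpecializes_comp_apply _ _ _ _)

/-- The value in `K(X)` of a regular function on `U` (which may be computed at any `x ∈ U`). -/
def toFunctionField (U : X.Opens) (x : U) : Γ(X, U) →+* X.functionField :=
  (stalkToFunctionField x.1).comp (X.presheaf.germ U x.1 x.2).hom

end FunctionField

section HalfCodifferent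

/-- The ramification index of `𝒪_{X,x}` over `𝒪_{Y,π(x)}`: the largest `n` such that
the maximal ideal of `𝒪_{Y,π(x)}` is mapped into the `n`-th power of that of `𝒪_{X,x}`. -/
def ramificationIndex {X Y : Scheme.{u}} (π : X ⟶ Y) (x : X) : ℕ :=
  letI := (π.stalkMap x).hom.toAlgebra
  (IsLocalRing.maximalIdeal (Y.presheaf.stalk (π x))).ramificationIdx'
    (IsLocalRing.maximalIdeal (X.presheaf.stalk x))

/-- The rational function `f` has a pole of order at most `k` at `x`, that is
`f · 𝔪_x ^ k ⊆ 𝒪_{X,x}`. If `𝒪_{X,x}` is a discrete valuation ring with valuation `v`, this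
says `v(f) ≥ -k`. -/
def HasPoleOrderLE {X : Scheme.{u}} [IsIntegral X] (x : X) (k : ℕ) (f : X.functionField) : Prop :=
  ∀ a ∈ IsLocalRing.maximalIdeal (X.presheaf.stalk x) ^ k, ∃ c : X.presheaf.stalk x,
    f * stalkToFunctionField x a = stalkToFunctionField x c

variable {X Y : Scheme.{u}} [IsIntegral X] (π : X ⟶ Y)

/-- The condition for a function `s : U → K(X)` to be a section over `U` of the sheaf
`𝒪_X(ω/2)`, where `ω = ∑ (e_x - 1) · closure {x}` is the sum over the points `x` of codimension
one. -/
def IsHalfCodiffSection (U : X.Opens) (s : U → X.functionField) : Prop :=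
  IsLocallyConstant s ∧ ∀ x : U, ringKrullDim (X.presheaf.stalk x.1) = 1 →
    HasPoleOrderLE x.1 ((ramificationIndex π x.1 - 1) / 2) (s x)

def halfCodiffSubgroup (U : X.Opens) : AddSubgroup (U → X.functionField) where
  carrier := {s | IsHalfCodiffSection π U s}
  zero_mem' := ⟨IsLocallyConstant.const 0, fun x _ a _ => ⟨0, by simp⟩⟩
  add_mem' {s t} hs ht := ⟨hs.1.add ht.1, fun x hx a ha => by
    obtain ⟨c, hc⟩ := hs.2 x hx a ha
    obtain ⟨d, hd⟩ := ht.2 x hx a ha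
    exact ⟨c + d, by rw [Pi.add_apply, add_mul, hc, hd, map_add]⟩⟩
  neg_mem' {s} hs := ⟨hs.1.neg, fun x hx a ha => by
    obtain ⟨c, hc⟩ := hs.2 x hx a ha
    exact ⟨-c, by rw [Pi.neg_apply, neg_mul, hc, map_neg]⟩⟩

lemma toFunctionField_eq (U : X.Opens) (x y : U) (r : Γ(X, U)) :
    toFunctionField U x r = toFunctionField U y r := by
  have : Nonempty U := ⟨x⟩
  simp only [toFunctionField, stalkToFunctionField, RingHom.comp_apply]
  erw [Scheme.algebraMap_germ_eq_germToFunctionField, Scheme.algebraMap_germ_eq_germToFunctionField]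

instance (U : X.Opens) : Module Γ(X, U) (halfCodiffSubgroup π U) where
  smul r s := ⟨fun x => toFunctionField U x r * s.1 x,
    (show IsLocallyConstant (fun x => toFunctionField U x r) from
      (IsLocallyConstant.iff_exists_open _).2 fun x =>
        ⟨Set.univ, isOpen_univ, trivial, fun y _ => toFunctionField_eq U y x r⟩).mul s.2.1,
    fun x hx a ha => by
      obtain ⟨c, hc⟩ := s.2.2 x hx a ha
      exact ⟨X.presheaf.germ U x.1 x.2 r * c, by
        rw [map_mul, ← hc, mul_assoc]; rfl⟩⟩
  one_smul s := Subtype.ext (funext fun x => by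
    change toFunctionField U x 1 * s.1 x = s.1 x; rw [map_one, one_mul])
  mul_smul r r' s := Subtype.ext (funext fun x => by
    change toFunctionField U x (r * r') * s.1 x =
      toFunctionField U x r * (toFunctionField U x r' * s.1 x)
    rw [map_mul, mul_assoc])
  smul_zero r := Subtype.ext (funext fun x => mul_zero (toFunctionField U x r))
  smul_add r s t := Subtype.ext (funext fun x => mul_add (toFunctionField U x r) (s.1 x) (t.1 x))
  add_smul r r' s := Subtype.ext (funext fun x => by
    change toFunctionField U x (r + r') * s.1 x =
      toFunctionField U x r * s.1 x + toFunctionField U x r' * s.1 x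
    rw [map_add, add_mul])
  zero_smul s := Subtype.ext (funext fun x => by
    change toFunctionField U x 0 * s.1 x = 0
    rw [map_zero, zero_mul])

/-- Restriction of sections. -/
def halfCodiffRes {U V : X.Opens} (h : V ≤ U) :
    halfCodiffSubgroup π U →+ halfCodiffSubgroup π V where
  toFun s := ⟨fun x => s.1 ⟨x.1, h x.2⟩,
    s.2.1.comp_continuous (continuous_inclusion h), fun x hx => s.2.2 ⟨x.1, h x.2⟩ hx⟩
  map_zero' := rfl
  map_add' _ _ := rfl

def halfCodiffAb : TopCat.Presheaf Ab.{u} X where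
  obj U := AddCommGrpCat.of (halfCodiffSubgroup π U.unop)
  map i := AddCommGrpCat.ofHom (halfCodiffRes π i.unop.le)

instance (U : (Opens X)ᵒᵖ) : Module (X.ringCatSheaf.obj.obj U) ((halfCodiffAb π).obj U) :=
  inferInstanceAs (Module Γ(X, U.unop) (halfCodiffSubgroup π U.unop))

def halfCodiffPresheaf : X.PresheafOfModules :=
  PresheafOfModules.ofPresheaf (halfCodiffAb π) (by
    intro U V i r s
    refine Subtype.ext (funext fun x => ?_)
    change toFunctionField U.unop ⟨x.1, i.unop.le x.2⟩ r * _ =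
      toFunctionField V.unop x (X.presheaf.map i r) * _
    congr 1
    simp only [toFunctionField, RingHom.comp_apply]
    erw [TopCat.Presheaf.germ_res_apply]
    rfl)

lemma halfCodiff_isSheaf : TopCat.Presheaf.IsSheaf (halfCodiffAb π) := by
  refine (TopCat.Presheaf.isSheaf_iff_isSheafUniqueGluing (halfCodiffAb π)).2 ?_
  intro ι U sf hsf
  choose i hi using fun x : ↥(iSup U) => Opens.mem_iSup.mp x.2
  have key : ∀ (x : ↥(iSup U)) (j : ι) (hj : x.1 ∈ U j),
      (sf (i x)).1 ⟨x.1, hi x⟩ = (sf j).1 ⟨x.1, hj⟩ := fun x j hj =>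
    congrFun (congrArg Subtype.val (hsf (i x) j)) ⟨x.1, hi x, hj⟩
  refine ⟨⟨fun x => (sf (i x)).1 ⟨x.1, hi x⟩, ?_, ?_⟩, ?_, ?_⟩
  · rw [IsLocallyConstant.iff_exists_open]
    intro x
    obtain ⟨W, hW, hxW, hc⟩ := (IsLocallyConstant.iff_exists_open _).1 (sf (i x)).2.1 ⟨x.1, hi x⟩
    obtain ⟨W', hW', rfl⟩ := isOpen_induced_iff.1 hW
    refine ⟨Subtype.val ⁻¹' (W' ∩ U (i x)), (hW'.inter (U (i x)).isOpen).preimage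
      continuous_subtype_val, ⟨hxW, hi x⟩, fun y hy => ?_⟩
    rw [key y (i x) hy.2]
    exact hc ⟨y.1, hy.2⟩ hy.1
  · intro x hx
    exact (sf (i x)).2.2 ⟨x.1, hi x⟩ hx
  · intro j
    exact Subtype.ext (funext fun x => key ⟨x.1, _⟩ j x.2)
  · intro t ht
    exact Subtype.ext (funext fun x =>
      congrFun (congrArg Subtype.val (ht (i x))) ⟨x.1, hi x⟩)

/-- The square root `𝒟_{X/Y}^{-1/2} = 𝒪_X(ω/2)` of the inverse different, as a sheaf of modules. -/
def halfCodifferent : X.Modules where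
  val := halfCodiffPresheaf π
  isSheaf := halfCodiff_isSheaf π

/-- The rational function underlying a section of `𝒟_{X/Y}^{-1/2}`, read off at a point of its
domain. -/
def halfCodifferent.value {U : X.Opens} (s : Γ(halfCodifferent π, U)) (x : U) : X.functionField :=
  (show halfCodiffSubgroup π U from s).1 x

end HalfCodifferent

section Action

variable {X Y : Scheme.{u}} {G : Type v} [Group G]

/-- The inertia group of `x`: the `g ∈ G` that fix `x` and act trivially on the residue field
`κ(x)`, that is, which fix the canonical morphism `Spec κ(x) → X`. -/
def inertia (act : G →* Aut X) (x : X) : Subgroup G where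
  carrier := {g | X.fromSpecResidueField x ≫ (act g).hom = X.fromSpecResidueField x}
  one_mem' := by
    change _ ≫ (act 1).hom = _
    rw [map_one]
    exact Category.comp_id _
  mul_mem' {g h} hg hh := by
    change _ ≫ (act (g * h)).hom = _
    rw [map_mul]
    change _ ≫ ((act h).hom ≫ (act g).hom) = _
    rw [← Category.assoc, hh, hg]
  inv_mem' {g} hg := by
    change _ ≫ (act g⁻¹).hom = _
    rw [map_inv]
    change _ ≫ (act g).inv = _
    exact (Iso.comp_inv_eq (act g)).2 (Eq.symm hg)

/-- `π : X → Y` is the quotient of `X` by the (left) action of the finite group `G`: it is finite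
and `G`-invariant, and `𝒪_Y → (π_* 𝒪_X)^G` is an isomorphism. -/
structure IsQuotient (act : G →* Aut X) (π : X ⟶ Y) : Prop where
  isFinite : IsFinite π
  invariant : ∀ g, (act g).hom ≫ π = π
  injective : ∀ V : Y.Opens, Function.Injective (π.app V)
  exists_of_invariant : ∀ (V : Y.Opens) (s : Γ(X, π ⁻¹ᵁ V)),
    (∀ (g : G) (h : π ⁻¹ᵁ V ≤ (act g).hom ⁻¹ᵁ (π ⁻¹ᵁ V)),
      (act g).hom.appLE (π ⁻¹ᵁ V) (π ⁻¹ᵁ V) h s = s) → ∃ r : Γ(Y, V), π.app V r = s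

/-- The morphism `G × X → X ×_Y X`, `(g, x) ↦ (g x, x)`. -/
def shear [Finite G] (act : G →* Aut X) (π : X ⟶ Y) (h : ∀ g, (act g).hom ≫ π = π) :
    (∐ fun _ : G => X) ⟶ pullback π π :=
  Sigma.desc fun g => pullback.lift (act g).hom (𝟙 X) (by rw [h g, Category.id_comp])

/-- Over the open subscheme `U` of `Y`, the morphism `π` is a torsor under the constant group `G`:
it is étale and surjective, and `G × X → X ×_Y X` is an isomorphism over `U`. -/
def IsTorsorOver [Finite G] (act : G →* Aut X) (π : X ⟶ Y) (h : ∀ g, (act g).hom ≫ π = π)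
    (U : Y.Opens) : Prop :=
  Etale (π ∣_ U) ∧ Surjective (π ∣_ U) ∧
    IsIso (shear act π h ∣_ ((pullback.fst π π ≫ π) ⁻¹ᵁ U))

/-- The closed subset `b` of `Y` is (the support of) a divisor with normal crossings: étale locally
near each of its points it is given by an equation `a_1 ⋯ a_n = 0`, where at each point the `a_i`
which vanish there form part of a regular system of parameters. -/
def HasNormalCrossings (b : Closeds Y) : Prop :=
  ∀ y ∈ b, ∃ (U : Scheme.{u}) (f : U ⟶ Y) (_ : Etale f), y ∈ Set.range f ∧
    ∃ (n : ℕ) (a : Fin n → Γ(U, ⊤)),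
      (∀ u : U, f u ∈ b ↔ ∃ i, U.presheaf.germ ⊤ u trivial (a i) ∈
        IsLocalRing.maximalIdeal (U.presheaf.stalk u)) ∧
      ∀ u : U, IsRegularLocalRing (U.presheaf.stalk u) ∧
        LinearIndependent (IsLocalRing.ResidueField (U.presheaf.stalk u))
          fun i : {i // U.presheaf.germ ⊤ u trivial (a i) ∈
              IsLocalRing.maximalIdeal (U.presheaf.stalk u)} =>
            (IsLocalRing.maximalIdeal (U.presheaf.stalk u)).toCotangent
              ⟨U.presheaf.germ ⊤ u trivial (a i.1), i.2⟩

/-- `π` is tamely ramified at `x`: the ramification index is prime to the residue characteristic,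
and the residue field extension is separable. -/
def IsTameAt (π : X ⟶ Y) (x : X) : Prop :=
  (ramificationIndex π x : X.residueField x) ≠ 0 ∧
    letI := (π.residueFieldMap x).hom.toAlgebra
    Algebra.IsSeparable (Y.residueField (π x)) (X.residueField x)

/-- A tame cover with group `G`, odd inertia and branch locus contained in the divisor with normal
crossings `b`: the group `G` acts on the regular scheme `X`, tamely in the sense of
Grothendieck and Murre, with flat quotient morphism `π : X → Y = X/G`. -/
structure IsTameOddCover [Finite G] (act : G →* Aut X) (π : X ⟶ Y) (b : Closeds Y) : Prop where
  regular : ∀ x : X, IsRegularLocalRing (X.presheaf.stalk x)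
  quotient : IsQuotient act π
  flat : Flat π
  normalCrossings : HasNormalCrossings b
  torsor : IsTorsorOver act π quotient.invariant b.compl
  tame : ∀ x : X, ringKrullDim (X.presheaf.stalk x) = 1 → π x ∈ b → IsTameAt π x
  odd_inertia : ∀ x : X, IsClosed {x} → Odd (Nat.card (inertia act x))

lemma IsQuotient.isDominant {act : G →* Aut X} {π : X ⟶ Y} (h : IsQuotient act π) :
    IsDominant π := by
  refine ⟨fun y => mem_closure_iff.2 fun U hU hy => ?_⟩
  by_contra hne
  have he : π ⁻¹ᵁ (⟨U, hU⟩ : Y.Opens) = ⊥ := by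
    ext x
    exact ⟨fun hx => hne ⟨π x, hx, x, rfl⟩, fun hx => hx.elim⟩
  have : Subsingleton Γ(X, π ⁻¹ᵁ (⟨U, hU⟩ : Y.Opens)) := by
    rw [he]; infer_instance
  have : Nonempty (⟨U, hU⟩ : Y.Opens) := ⟨⟨y, hy⟩⟩
  exact one_ne_zero (h.injective ⟨U, hU⟩ (Subsingleton.elim (π.app _ 1) (π.app _ 0)))


end Action

section GaloisAction

lemma maximalIdeal_map_le_iff {A A' B B' : Type u} [CommRing A] [CommRing A'] [CommRing B]
    [CommRing B'] [IsLocalRing A] [IsLocalRing A'] [IsLocalRing B] [IsLocalRing B']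
    (f : A →+* B) (f' : A' →+* B') (c : A' ≃+* A) (e : B' ≃+* B)
    (h : ∀ a, f (c a) = e (f' a)) (n : ℕ) :
    (IsLocalRing.maximalIdeal A).map f ≤ IsLocalRing.maximalIdeal B ^ n ↔
      (IsLocalRing.maximalIdeal A').map f' ≤ IsLocalRing.maximalIdeal B' ^ n := by
  have hA := IsLocalRing.map_ringEquiv_maximalIdeal c
  have hB := IsLocalRing.map_ringEquiv_maximalIdeal e
  have hc : f.comp (c : A' →+* A) = (e : B' →+* B).comp f' := RingHom.ext h
  have hm : Ideal.map e (Ideal.map f' (IsLocalRing.maximalIdeal A')) =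
      Ideal.map f (IsLocalRing.maximalIdeal A) := by
    rw [← hA]
    exact (Ideal.map_map f' (e : B' →+* B)).trans
      (hc ▸ (Ideal.map_map (c : A' →+* A) f).symm)
  rw [← hm, ← hB, ← Ideal.map_pow]
  exact ⟨fun hle => by
    have := Ideal.comap_mono (f := (e : B' →+* B)) hle
    rwa [show Ideal.comap (e : B' →+* B) (Ideal.map e _) = _ from
        Ideal.comap_map_of_bijective e e.bijective,
      show Ideal.comap (e : B' →+* B) (Ideal.map e _) = _ from
        Ideal.comap_map_of_bijective e e.bijective] at this, fun hle => Ideal.map_mono hle⟩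

variable {X Y : Scheme.{u}} (π : X ⟶ Y) (σ : X ⟶ X)

lemma apply_mem_preimage (h : σ ≫ π = π) {V : Y.Opens} {x : X} (hx : x ∈ π ⁻¹ᵁ V) :
    σ x ∈ π ⁻¹ᵁ V := by
  have hp : π x = π (σ x) := by conv_lhs => rw [← h, Scheme.Hom.comp_apply]
  change π (σ x) ∈ V
  rw [← hp]
  exact hx

/-- The self-map of `π⁻¹ V` induced by an automorphism `σ` of `X` over `Y`. -/
def preimageMap (h : σ ≫ π = π) (V : Y.Opens) : C(↥(π ⁻¹ᵁ V), ↥(π ⁻¹ᵁ V)) where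
  toFun x := ⟨σ x.1, apply_mem_preimage π σ h x.2⟩
  continuous_toFun := (σ.continuous.comp continuous_subtype_val).subtype_mk _

lemma germ_app_congr {f g : X ⟶ Y} (h : f = g) (V : Y.Opens) (r : Γ(Y, V)) (x : X)
    (hf : x ∈ f ⁻¹ᵁ V) (hg : x ∈ g ⁻¹ᵁ V) :
    X.presheaf.germ (f ⁻¹ᵁ V) x hf (f.app V r) = X.presheaf.germ (g ⁻¹ᵁ V) x hg (g.app V r) := by
  subst h
  rfl

/-- The isomorphism of local rings induced by an automorphism. -/
def stalkRingEquiv [IsIso σ] (x : X) : X.presheaf.stalk (σ x) ≃+* X.presheaf.stalk x :=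
  (asIso (σ.stalkMap x)).commRingCatIsoToRingEquiv

lemma ramificationIndex_apply [IsIso σ] (h : σ ≫ π = π) (x : X) :
    ramificationIndex π (σ x) = ramificationIndex π x := by
  have hp : π x = π (σ x) := by conv_lhs => rw [← h, Scheme.Hom.comp_apply]
  unfold ramificationIndex Ideal.ramificationIdx'
  congr 1
  ext n
  symm
  refine maximalIdeal_map_le_iff (π.stalkMap x).hom (π.stalkMap (σ x)).hom
    (Y.presheaf.stalkCongr (.of_eq hp.symm)).commRingCatIsoToRingEquiv
    (stalkRingEquiv σ x) (fun a => ?_) n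
  have h1 := Scheme.Hom.stalkMap_comp σ π x
  have h2 := Scheme.Hom.stalkMap_congr_hom _ _ h x
  rw [h1] at h2
  exact (congrArg (fun f => f.hom a) h2).symm

variable [IsIntegral X]

lemma HasPoleOrderLE.map {x : X} {k : ℕ} {f : X.functionField} [IsIso σ] [IsDominant σ]
    (hf : HasPoleOrderLE (σ x) k f) :
    HasPoleOrderLE x k (functionFieldMap σ f) := by
  intro a ha
  rw [← IsLocalRing.map_ringEquiv_maximalIdeal (stalkRingEquiv σ x), ← Ideal.map_pow,
    Ideal.mem_map_iff_of_surjective _ (stalkRingEquiv σ x).surjective] at ha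
  obtain ⟨b, hb, rfl⟩ := ha
  obtain ⟨c, hc⟩ := hf b hb
  refine ⟨σ.stalkMap x c, ?_⟩
  change _ * stalkToFunctionField x (σ.stalkMap x b) = _
  rw [← functionFieldMap_stalk, ← functionFieldMap_stalk, ← map_mul, hc]

/-- The map on sections of `𝒟_{X/Y}^{-1/2}` induced by an automorphism `σ` of `X` over `Y`:
`(σ^* s)(x) = σ^* (s (σ x))`. -/
def halfCodiffMap [IsIso σ] [IsDominant σ] (h : σ ≫ π = π) (V : Y.Opens) :
    halfCodiffSubgroup π (π ⁻¹ᵁ V) →+ halfCodiffSubgroup π (π ⁻¹ᵁ V) where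
  toFun s := ⟨fun x => functionFieldMap σ (s.1 (preimageMap π σ h V x)),
    (s.2.1.comp_continuous (preimageMap π σ h V).continuous).comp (functionFieldMap σ),
    fun x hx => by
      have := s.2.2 (preimageMap π σ h V x)
        ((ringKrullDim_eq_of_ringEquiv (stalkRingEquiv σ x.1)).trans hx)
      change HasPoleOrderLE (σ x.1) ((ramificationIndex π (σ x.1) - 1) / 2) _ at this
      rw [ramificationIndex_apply π σ h] at this
      exact this.map σ⟩
  map_zero' := Subtype.ext (funext fun x => map_zero (functionFieldMap σ))
  map_add' s t := Subtype.ext (funext fun x => map_add (functionFieldMap σ) _ _)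

lemma functionFieldMap_toFunctionField [IsDominant σ] (h : σ ≫ π = π) (V : Y.Opens)
    (r : Γ(Y, V)) (x : π ⁻¹ᵁ V) :
    functionFieldMap σ (toFunctionField (π ⁻¹ᵁ V) (preimageMap π σ h V x) (π.app V r)) =
      toFunctionField (π ⁻¹ᵁ V) x (π.app V r) := by
  have key := germ_app_congr h V r x.1 (apply_mem_preimage π σ h x.2) x.2
  refine (functionFieldMap_stalk σ x.1 _).trans (congrArg (stalkToFunctionField x.1) ?_)
  refine Eq.trans ?_ key
  refine (Scheme.Hom.germ_stalkMap_apply σ (π ⁻¹ᵁ V) x.1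
    (apply_mem_preimage π σ h x.2) (π.app V r)).trans ?_
  rw [Scheme.Hom.comp_app]
  rfl

/-- The action of an automorphism `σ` of `X` over `Y` on `π_* 𝒟_{X/Y}^{-1/2}` by pullback. -/
def galoisPullback [IsIso σ] [IsDominant σ] (h : σ ≫ π = π) :
    (Scheme.Modules.pushforward π).obj (halfCodifferent π) ⟶
      (Scheme.Modules.pushforward π).obj (halfCodifferent π) :=
  ⟨{ app := fun V => ModuleCat.ofHom
      (X := (((Scheme.Modules.pushforward π).obj (halfCodifferent π)).val.obj V))
      (Y := (((Scheme.Modules.pushforward π).obj (halfCodifferent π)).val.obj V))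
        { toFun := halfCodiffMap π σ h V.unop
          map_add' := map_add (halfCodiffMap π σ h V.unop)
          map_smul' := fun r s => Subtype.ext (funext fun x => by
            refine (map_mul (functionFieldMap σ) _ _).trans ?_
            exact congrArg (· * _) (functionFieldMap_toFunctionField π σ h V.unop r x)) }
     naturality := fun i => rfl }⟩

end GaloisAction

section Forms

variable {Y : Scheme.{u}}

/-- Restriction of sections of a sheaf of modules. -/
abbrev res (E : Y.Modules) {U V : Y.Opens} (h : V ≤ U) (s : Γ(E, U)) : Γ(E, V) :=
  E.presheaf.map (homOfLE h).op s

/-- A vector bundle: a locally free sheaf of modules of finite rank. Locally there is a frame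
`b_1, …, b_n` of sections in which every section has unique coordinates. -/
def IsVectorBundle (E : Y.Modules) : Prop :=
  ∀ y : Y, ∃ (U : Y.Opens) (_ : y ∈ U) (n : ℕ) (b : Fin n → Γ(E, U)),
    ∀ (V : Y.Opens) (h : V ≤ U) (s : Γ(E, V)),
      ∃! c : Fin n → Γ(Y, V), s = ∑ i, c i • res E h (b i)

/-- A symmetric `𝒪_Y`-bilinear form `E × E → 𝒪_Y` on a sheaf of modules. -/
structure SymmForm (E : Y.Modules) where
  form : ∀ U : Y.Opens, Γ(E, U) →ₗ[Γ(Y, U)] Γ(E, U) →ₗ[Γ(Y, U)] Γ(Y, U)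
  form_res : ∀ {U V : Y.Opens} (h : V ≤ U) (x y : Γ(E, U)),
    form V (res E h x) (res E h y) = Y.presheaf.map (homOfLE h).op (form U x y)
  symm : ∀ (U : Y.Opens) (x y : Γ(E, U)), form U x y = form U y x

/-- A section over `U` of the dual `E^∨ = ℋom(E, 𝒪_Y)`. -/
structure DualSection (E : Y.Modules) (U : Y.Opens) where
  toFun : ∀ V : Y.Opens, V ≤ U → Γ(E, V) →ₗ[Γ(Y, V)] Γ(Y, V)
  toFun_res : ∀ {V W : Y.Opens} (hV : V ≤ U) (h : W ≤ V) (x : Γ(E, V)),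
    toFun W (h.trans hV) (res E h x) = Y.presheaf.map (homOfLE h).op (toFun V hV x)

/-- The form is non-degenerate: the adjoint map `E → E^∨` is an isomorphism, that is, bijective on
sections over every open set. -/
def SymmForm.Nondegenerate {E : Y.Modules} (q : SymmForm E) : Prop :=
  ∀ (U : Y.Opens) (l : DualSection E U), ∃! x : Γ(E, U),
    ∀ (V : Y.Opens) (h : V ≤ U) (y : Γ(E, V)), q.form V (res E h x) y = l.toFun V h y

/-- `(E, q)` is a symmetric bundle. -/
structure IsSymmBundle (E : Y.Modules) (q : SymmForm E) : Prop where
  isVectorBundle : IsVectorBundle E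
  nondegenerate : q.Nondegenerate

end Forms

section Twist

variable {Y : Scheme.{u}}

/-- The presheaf `U ↦ E(U) ⊗ L(U)`. -/
def tensorPresheaf (E L : Y.Modules) : Y.PresheafOfModules :=
  PresheafOfModules.Monoidal.tensorObj (R := Y.presheaf) E.val L.val

/-- The tensor product of two sheaves of modules. -/
def tensor (E L : Y.Modules) : Y.Modules :=
  (PresheafOfModules.sheafification (𝟙 Y.ringCatSheaf.obj)).obj (tensorPresheaf E L)

/-- The section `a ⊗ b` of the tensor product. -/
def tmul {E L : Y.Modules} {U : Y.Opens} (a : Γ(E, U)) (b : Γ(L, U)) : Γ(tensor E L, U) :=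
  (((PresheafOfModules.sheafificationAdjunction (𝟙 Y.ringCatSheaf.obj)).unit.app
    (tensorPresheaf E L)).app (op U)).hom (TensorProduct.tmul Γ(Y, U) a b)

/-- The tensor product of two morphisms. -/
def tensorMap {E E' L L' : Y.Modules} (f : E ⟶ E') (g : L ⟶ L') : tensor E L ⟶ tensor E' L' :=
  (PresheafOfModules.sheafification (𝟙 Y.ringCatSheaf.obj)).map
    (PresheafOfModules.Monoidal.tensorHom (R := Y.presheaf) f.val g.val)

variable {G : Type v} [Group G] [Finite G]

/-- The subsheaf of invariants of a family of endomorphisms: the kernel of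
`(a_g - 1)_g : T → ∏ T`. -/
def invariants {T : Y.Modules} (a : G → (T ⟶ T)) : Y.Modules :=
  kernel (Pi.lift fun g => a g - 𝟙 T)

/-- The inclusion of the subsheaf of invariants. -/
def invariants.incl {T : Y.Modules} (a : G → (T ⟶ T)) : invariants a ⟶ T :=
  kernel.ι (Pi.lift fun g => a g - 𝟙 T)

/-- The diagonal action of `G` on `E ⊗ L`. -/
def diagonal {E L : Y.Modules} (ρ : G → (E ⟶ E)) (α : G → (L ⟶ L)) (g : G) :
    tensor E L ⟶ tensor E L :=
  tensorMap (ρ g) (α g)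

/-- The twist `(E ⊗ L)^G`. -/
abbrev twist {E L : Y.Modules} (ρ : G → (E ⟶ E)) (α : G → (L ⟶ L)) : Y.Modules :=
  invariants (diagonal ρ α)

/-- `t` is the form `q ⊗ b` on `E ⊗ L`. -/
def IsTensorForm {E L : Y.Modules} (q : SymmForm E) (b : SymmForm L)
    (t : SymmForm (tensor E L)) : Prop :=
  ∀ (U : Y.Opens) (x x' : Γ(E, U)) (s s' : Γ(L, U)),
    t.form U (tmul x s) (tmul x' s') = q.form U x x' * b.form U s s'

/-- `qX` is the form `(q ⊗ b)^G` on `(E ⊗ L)^G`: its value at `(x, y)` is `(q ⊗ b)(m, y)`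
whenever `x = ∑_g g m`. -/
def IsTwistForm {E L : Y.Modules} (ρ : G → (E ⟶ E)) (α : G → (L ⟶ L)) (q : SymmForm E)
    (b : SymmForm L) (qX : SymmForm (twist ρ α)) : Prop :=
  ∃ t : SymmForm (tensor E L), IsTensorForm q b t ∧
    ∀ (U : Y.Opens) (x y : Γ(twist ρ α, U)) (m : Γ(tensor E L, U)),
      (invariants.incl (diagonal ρ α)).app U x = ∑ᶠ g : G, (diagonal ρ α g).app U m →
        qX.form U x y = t.form U m ((invariants.incl (diagonal ρ α)).app U y)

end Twist

section TraceForm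

variable {X Y : Scheme.{u}} [IsIntegral X]

/-- The sheaf `π_* 𝒟_{X/Y}^{-1/2}` on `Y`. -/
abbrev pushHalfCodifferent (π : X ⟶ Y) : Y.Modules :=
  (Scheme.Modules.pushforward π).obj (halfCodifferent π)

/-- The trace form on `π_* 𝒟_{X/Y}^{-1/2}`: the form `(s, t) ↦ Tr_{K(X)/K(Y)} (s t)`. -/
def IsTraceForm [IsIntegral Y] (π : X ⟶ Y) (hπ : IsDominant π)
    (Tr : SymmForm (pushHalfCodifferent π)) : Prop :=
  letI := (functionFieldMap π).toAlgebra
  ∀ (U : Y.Opens) (s t : Γ(halfCodifferent π, π ⁻¹ᵁ U)) (x : X) (hx : x ∈ π ⁻¹ᵁ U),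
    toFunctionField U ⟨π x, hx⟩ (Tr.form U s t) =
      Algebra.trace Y.functionField X.functionField
        (halfCodifferent.value π s ⟨x, hx⟩ * halfCodifferent.value π t ⟨x, hx⟩)

variable {G : Type v} [Group G]

/-- The left action of `G` on `π_* 𝒟_{X/Y}^{-1/2}`: the element `g` acts by `(g⁻¹)^*`. -/
def galoisAction {act : G →* Aut X} {π : X ⟶ Y} (h : ∀ g, (act g).hom ≫ π = π) (g : G) :
    pushHalfCodifferent π ⟶ pushHalfCodifferent π :=
  let i : X ≅ X := act g⁻¹
  galoisPullback π i.hom (h g⁻¹)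

end TraceForm

section BaseChange

variable {X Y Z : Scheme.{u}}

/-- The value at a section `s` of `E` over `U` of a morphism `η : E → φ_* E'`, as a section of `E'`
over `φ⁻¹ U`. -/
def along {φ : Z ⟶ Y} {E : Y.Modules} {E' : Z.Modules}
    (η : E ⟶ (Scheme.Modules.pushforward φ).obj E') {U : Y.Opens} (s : Γ(E, U)) :
    Γ(E', φ ⁻¹ᵁ U) :=
  η.app U s

/-- The canonical morphism `E → φ_* φ^* E`. -/
def unitMap (φ : Z ⟶ Y) (E : Y.Modules) :
    E ⟶ (Scheme.Modules.pushforward φ).obj ((Scheme.Modules.pullback φ).obj E) :=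
  (Scheme.Modules.pullbackPushforwardAdjunction φ).unit.app E

/-- The form `q'` on `E'` is compatible with the form `q` on `E` via `η : E → φ_* E'`. -/
def IsCompatibleForm {φ : Z ⟶ Y} {E : Y.Modules} {E' : Z.Modules}
    (η : E ⟶ (Scheme.Modules.pushforward φ).obj E') (q : SymmForm E) (q' : SymmForm E') : Prop :=
  ∀ (U : Y.Opens) (x y : Γ(E, U)),
    q'.form (φ ⁻¹ᵁ U) (along η x) (along η y) = φ.app U (q.form U x y)

/-- For `X' = Z ×_Y X` with projections `π' : X' → Z` and `φ' : X' → X`, and a sheaf `L` on `X`, the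
canonical morphism `π_* L → φ_* π'_* φ'^* L`, whose adjoint is the base change morphism
`φ^* π_* L → π'_* φ'^* L`. -/
def baseChangeMap (φ : Z ⟶ Y) (π : X ⟶ Y) (L : X.Modules) :
    (Scheme.Modules.pushforward π).obj L ⟶ (Scheme.Modules.pushforward φ).obj
      ((Scheme.Modules.pushforward (pullback.fst φ π)).obj
        ((Scheme.Modules.pullback (pullback.snd φ π)).obj L)) :=
  (Scheme.Modules.pushforward π).map (unitMap (pullback.snd φ π) L) ≫
    (Scheme.Modules.pushforwardComp (pullback.snd φ π) π).hom.app _ ≫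
    (Scheme.Modules.pushforwardCongr (pullback.condition (f := φ) (g := π)).symm).hom.app _ ≫
    (Scheme.Modules.pushforwardComp (pullback.fst φ π) φ).inv.app _

/-- The sheaf `π'_* 𝒟_{X'/Z}^{-1/2}` on `Z`, where `X' = Z ×_Y X` with projections `π' : X' → Z` and
`φ' : X' → X`, and `𝒟_{X'/Z}^{-1/2} = φ'^* 𝒟_{X/Y}^{-1/2}`. -/
abbrev pushHalfCodifferentBC [IsIntegral X] (φ : Z ⟶ Y) (π : X ⟶ Y) : Z.Modules :=
  (Scheme.Modules.pushforward (pullback.fst φ π)).obj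
    ((Scheme.Modules.pullback (pullback.snd φ π)).obj (halfCodifferent π))

variable {G : Type v} [Group G] [Finite G]

/-- The isomorphism `e : φ^* ((E ⊗ L)^G) ≅ (E' ⊗ L')^G` is the canonical one, with respect to given
morphisms `η : E → φ_* E'` and `θ : L → φ_* L'`: it is induced by the morphism
`κ : E ⊗ L → φ_* (E' ⊗ L')` with `κ (x ⊗ s) = η x ⊗ θ s` (there is only one such `κ`). -/
def IsCanonicalIso {φ : Z ⟶ Y} {E L : Y.Modules} {E' L' : Z.Modules}
    (η : E ⟶ (Scheme.Modules.pushforward φ).obj E')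
    (θ : L ⟶ (Scheme.Modules.pushforward φ).obj L')
    {ρ : G → (E ⟶ E)} {α : G → (L ⟶ L)} {ρ' : G → (E' ⟶ E')} {α' : G → (L' ⟶ L')}
    (e : (Scheme.Modules.pullback φ).obj (twist ρ α) ≅ twist ρ' α') : Prop :=
  ∃ κ : tensor E L ⟶ (Scheme.Modules.pushforward φ).obj (tensor E' L'),
    (∀ (U : Y.Opens) (x : Γ(E, U)) (s : Γ(L, U)),
      along κ (tmul x s) = tmul (along η x) (along θ s)) ∧
    unitMap φ (twist ρ α) ≫ (Scheme.Modules.pushforward φ).map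
        (e.hom ≫ invariants.incl (diagonal ρ' α')) =
      invariants.incl (diagonal ρ α) ≫ κ

end BaseChange

end TameTwist

end

open TameTwist

/-!
# Twists of symmetric bundles by tame covers of odd ramification

Let `L = π_* 𝒟^{-1/2}`. The twist of a symmetric bundle by `L` is a symmetric bundle, whose
formation commutes with base change, for the following three reasons.

*The trace form makes `L` a symmetric bundle.* All this is local on `Y`. Since `X` is regular, its
local rings are factorial (`uniqueFactorizationMonoid_of_isRegularRing`), so the divisor `∑ (e_x -
1)/2 x` is, over a neighbourhood of any given point of `Y`, the divisor of one rational function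
`l` (`exists_forall_valuation_eq_exp`). As `π` is finite and flat, it has a basis `β` over a
smaller neighbourhood, and the functions `β i * l` form a frame of `L`. Tameness says that the
inverse different is the sheaf of functions with poles of order at most `e_x - 1`: such functions
have regular traces (`exists_algebraMap_eq_trace`), and conversely an ideal with regular traces
consists of such functions, by independence of the characters `b ↦ g b mod x`, the order of the
inertia group being prime to the residue characteristic (`valuation_le_of_forall_trace`). So `L`
is its own dual for the trace form (`IsTameOddCover.isSymmBundle_traceForm`). The `e_x` are odd
because they are the orders of inertia groups at points of codimension one, which are contained in
inertia groups of closed points (`IsTameOddCover.odd_ramificationIndex`).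

*The trace `π_* 𝒪_X → 𝒪_Y` is surjective.* Otherwise all traces of `B` lie in a prime `p` of `A`,
for a chart `A → B` of `π`; expanding `1` in the dual basis of `β` then shows that the generator
`δ = l⁻²` of the different lies in `p B` (`exists_mem_map_of_forall_trace_mem`). At a point
outside the branch locus this contradicts the vanishing of `δ` at ramified points only. At a point
of the branch locus, pass to an étale neighbourhood where the branch locus is cut out by part `a₁,
…, aₙ` of a regular system of parameters. In the local ring upstairs, which is factorial, the
prime powers in `δ` divide the `aᵢ` with an exponent to spare, so `aᵢ = Qᵢ rᵢ` with nonunits `rᵢ`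
and `δ ∣ Q₁ ⋯ Qₙ` (`exists_factors_of_pow_dvd`). The `aᵢ` remain part of a regular sequence, which
forces `Q₁ ⋯ Qₙ` out of the ideal generated by the maximal ideal downstairs
(`prod_notMem_of_isWeaklyRegular`); thus `δ ∉ p B` (`notMem_map_of_etale`).

*An element of trace one splits the norm.* If `c` is a local function on `X` with trace one, then
`m ↦ ∑ g (c (g⁻¹ m))` is the identity on `L`, and hence on `E ⊗ L` (`SplitsNorm.tensor`). So the
norm maps onto the invariants, and `x ↦ ∑ g (c x)` projects `E ⊗ L` onto them. Invariants are
therefore a vector bundle and commute with base change, and the form `(m, y) ↦ (q ⊗ Tr)(m, y)` for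
`x = ∑ g m` is well defined and nondegenerate on them (`exists_normForm`,
`IsNormForm.isSymmBundle`, `isIso_invariantsBaseChange`). No flatness of the base change is
involved, since everything is expressed in frames.

Sheaves of modules are handled through `IsFrame`, a family of sections over an open set which
restricts to a basis over all smaller ones, and base change through `IsFramed`, a morphism `η : E
→ φ_* E'` which takes frames to frames. The pull-back `φ^* E`, known by its universal property
only, is framed by `IsFrame.pullback`.
-/

namespace TameTwist

/-! ### Sections of modules and gluing -/

section Gluing

variable {X : TopCat.{u}} {C : Type*} [Category.{u} C] {FC : C → C → Type*} {CC : C → Type u}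
  [∀ X Y, FunLike (FC X Y) (CC X) (CC Y)] [ConcreteCategory.{u} C FC]
  [HasLimitsOfSize.{u, u} C] [(CategoryTheory.forget C).ReflectsIsomorphisms]
  [PreservesLimitsOfSize.{u, u} (CategoryTheory.forget C)]

lemma eq_of_locally_eq_of_isSheaf {F : TopCat.Presheaf C X} (hF : F.IsSheaf) {U : Opens X}
    (s t : ToType (F.obj (op U)))
    (h : ∀ y ∈ U, ∃ (V : Opens X) (hV : V ≤ U), y ∈ V ∧
      F.map (homOfLE hV).op s = F.map (homOfLE hV).op t) : s = t := by
  choose V hV hy hs using h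
  refine TopCat.Sheaf.eq_of_locally_eq' ⟨F, hF⟩ (fun y : U => V y.1 y.2) U
    (fun y => homOfLE (hV y.1 y.2)) (fun y hyU => ?_) s t (fun y => hs y.1 y.2)
  exact Opens.mem_iSup.2 ⟨⟨y, hyU⟩, hy y hyU⟩

/-- Gluing of locally existing sections which are locally characterised by a property. -/
lemma exists_section_of_local {F : TopCat.Presheaf C X} (hF : F.IsSheaf) {U : Opens X}
    (P : ∀ V : Opens X, V ≤ U → ToType (F.obj (op V)) → Prop)
    (hres : ∀ (V W : Opens X) (hV : V ≤ U) (h : W ≤ V) (s : ToType (F.obj (op V))),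
      P V hV s → P W (h.trans hV) (F.map (homOfLE h).op s))
    (huniq : ∀ (V : Opens X) (hV : V ≤ U) (s t : ToType (F.obj (op V))),
        P V hV s → P V hV t → s = t)
    (hex : ∀ y ∈ U, ∃ (V : Opens X) (hV : V ≤ U), y ∈ V ∧ ∃ s, P V hV s) :
    ∃ s : ToType (F.obj (op U)), ∀ (V : Opens X) (hV : V ≤ U) (t : ToType (F.obj (op V))),
      P V hV t → F.map (homOfLE hV).op s = t := by
  choose V hV hy s hs using hex
  have hFc : ∀ {A B D : Opens X} (h₁ : A ≤ B) (h₂ : B ≤ D) (x : ToType (F.obj (op D))),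
      F.map (homOfLE h₁).op (F.map (homOfLE h₂).op x) = F.map (homOfLE (h₁.trans h₂)).op x := by
    intro A B D h₁ h₂ x
    rw [← ConcreteCategory.comp_apply, ← F.map_comp]; rfl
  obtain ⟨g, hg, -⟩ := TopCat.Sheaf.existsUnique_gluing' ⟨F, hF⟩ (fun y : U => V y.1 y.2) U
    (fun y => homOfLE (hV y.1 y.2)) (fun y hyU => Opens.mem_iSup.2 ⟨⟨y, hyU⟩, hy y hyU⟩)
    (fun y => s y.1 y.2) (fun i j =>
      huniq _ (inf_le_left.trans (hV i.1 i.2)) _ _ (hres _ _ _ inf_le_left _ (hs i.1 i.2))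
        (hres _ _ _ inf_le_right _ (hs j.1 j.2)))
  refine ⟨g, fun W hW t ht => eq_of_locally_eq_of_isSheaf hF _ _ fun y hyW => ?_⟩
  have hyU := hW hyW
  refine ⟨W ⊓ V y hyU, inf_le_left, ⟨hyW, hy y hyU⟩, ?_⟩
  rw [hFc]
  have : F.map (homOfLE ((inf_le_left : W ⊓ V y hyU ≤ W).trans hW)).op g =
      F.map (homOfLE (inf_le_right : W ⊓ V y hyU ≤ V y hyU)).op (s y hyU) := by
    rw [← hg ⟨y, hyU⟩]
    exact (hFc _ _ _).symm
  rw [this]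
  exact huniq _ ((inf_le_left).trans hW) _ _ (hres _ _ (hV y hyU) inf_le_right _ (hs y hyU))
    (hres _ _ hW inf_le_left _ ht)

end Gluing

section Sections

variable {Y : Scheme.{u}}

/-- Restriction of functions. -/
abbrev rres {U V : Y.Opens} (h : V ≤ U) (r : Γ(Y, U)) : Γ(Y, V) :=
  Y.presheaf.map (homOfLE h).op r

lemma rres_rres {U V W : Y.Opens} (h : V ≤ U) (h' : W ≤ V) (r : Γ(Y, U)) :
    rres h' (rres h r) = rres (h'.trans h) r := by
  rw [rres, rres, ← ConcreteCategory.comp_apply, ← Y.presheaf.map_comp]; rfl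

lemma rres_self {U : Y.Opens} (r : Γ(Y, U)) : rres le_rfl r = r := by
  have : (homOfLE (le_refl U)).op = 𝟙 (op U) := rfl
  rw [rres, this, Y.presheaf.map_id]; rfl

lemma rres_mul {U V : Y.Opens} (h : V ≤ U) (r s : Γ(Y, U)) :
    rres h (r * s) = rres h r * rres h s := map_mul _ _ _

lemma rres_add {U V : Y.Opens} (h : V ≤ U) (r s : Γ(Y, U)) :
    rres h (r + s) = rres h r + rres h s := map_add _ _ _

lemma rres_sum {U V : Y.Opens} (h : V ≤ U) {ι : Type*} (t : Finset ι) (s : ι → Γ(Y, U)) :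
    rres h (∑ i ∈ t, s i) = ∑ i ∈ t, rres h (s i) := map_sum _ _ _

variable (E : Y.Modules)

lemma res_res {U V W : Y.Opens} (h : V ≤ U) (h' : W ≤ V) (s : Γ(E, U)) :
    res E h' (res E h s) = res E (h'.trans h) s := by
  rw [res, res, ← ConcreteCategory.comp_apply, ← E.presheaf.map_comp]; rfl

lemma res_self {U : Y.Opens} (s : Γ(E, U)) : res E le_rfl s = s := by
  have : (homOfLE (le_refl U)).op = 𝟙 (op U) := rfl
  rw [res, this, E.presheaf.map_id]; rfl

lemma res_smul {U V : Y.Opens} (h : V ≤ U) (r : Γ(Y, U)) (s : Γ(E, U)) :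
    res E h (r • s) = rres h r • res E h s :=
  Scheme.Modules.map_smul _ _ _ _

lemma res_add {U V : Y.Opens} (h : V ≤ U) (s t : Γ(E, U)) :
    res E h (s + t) = res E h s + res E h t := map_add _ _ _

lemma res_zero {U V : Y.Opens} (h : V ≤ U) : res E h (0 : Γ(E, U)) = 0 := map_zero _

lemma res_sum {U V : Y.Opens} (h : V ≤ U) {ι : Type*} (t : Finset ι) (s : ι → Γ(E, U)) :
    res E h (∑ i ∈ t, s i) = ∑ i ∈ t, res E h (s i) := map_sum _ _ _

variable {E}

lemma section_ext {U : Y.Opens} (s t : Γ(E, U))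
    (h : ∀ y ∈ U, ∃ (V : Y.Opens) (hV : V ≤ U), y ∈ V ∧ res E hV s = res E hV t) : s = t :=
  eq_of_locally_eq_of_isSheaf E.isSheaf s t h

lemma function_ext {U : Y.Opens} (s t : Γ(Y, U))
    (h : ∀ y ∈ U, ∃ (V : Y.Opens) (hV : V ≤ U), y ∈ V ∧ rres hV s = rres hV t) : s = t :=
  eq_of_locally_eq_of_isSheaf Y.sheaf.property s t h

lemma section_glue {U : Y.Opens} (P : ∀ V : Y.Opens, V ≤ U → Γ(E, V) → Prop)
    (hres : ∀ (V W : Y.Opens) (hV : V ≤ U) (h : W ≤ V) (s : Γ(E, V)),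
      P V hV s → P W (h.trans hV) (res E h s))
    (huniq : ∀ (V : Y.Opens) (hV : V ≤ U) (s t : Γ(E, V)), P V hV s → P V hV t → s = t)
    (hex : ∀ y ∈ U, ∃ (V : Y.Opens) (hV : V ≤ U), y ∈ V ∧ ∃ s, P V hV s) :
    ∃ s : Γ(E, U), ∀ (V : Y.Opens) (hV : V ≤ U) (t : Γ(E, V)), P V hV t → res E hV s = t :=
  exists_section_of_local E.isSheaf P hres huniq hex

lemma function_glue {U : Y.Opens} (P : ∀ V : Y.Opens, V ≤ U → Γ(Y, V) → Prop)
    (hres : ∀ (V W : Y.Opens) (hV : V ≤ U) (h : W ≤ V) (s : Γ(Y, V)),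
      P V hV s → P W (h.trans hV) (rres h s))
    (huniq : ∀ (V : Y.Opens) (hV : V ≤ U) (s t : Γ(Y, V)), P V hV s → P V hV t → s = t)
    (hex : ∀ y ∈ U, ∃ (V : Y.Opens) (hV : V ≤ U), y ∈ V ∧ ∃ s, P V hV s) :
    ∃ s : Γ(Y, U), ∀ (V : Y.Opens) (hV : V ≤ U) (t : Γ(Y, V)), P V hV t → rres hV s = t :=
  exists_section_of_local Y.sheaf.property P hres huniq hex

lemma app_res {E F : Y.Modules} (f : E ⟶ F) {U V : Y.Opens} (h : V ≤ U) (s : Γ(E, U)) :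
    f.app V (res E h s) = res F h (f.app U s) :=
  congr($(f.mapPresheaf.naturality (homOfLE h).op) s)

/-- A morphism of sheaves of modules from compatible linear maps on sections. -/
noncomputable def homMk {E F : Y.Modules} (f : ∀ U : Y.Opens, Γ(E, U) →ₗ[Γ(Y, U)] Γ(F, U))
    (hf : ∀ {U V : Y.Opens} (h : V ≤ U) (s : Γ(E, U)), f V (res E h s) = res F h (f U s)) :
    E ⟶ F :=
  ⟨{ app := fun U => ModuleCat.ofHom (X := E.val.obj U) (Y := F.val.obj U) (f U.unop)
     naturality := fun {U V} i => by
      ext s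
      exact hf i.unop.le s }⟩

/-- A morphism of modules is an isomorphism if it is bijective on the sections over all small open
sets. -/
lemma isIso_of_locally_bijective {E F : Y.Modules} (f : E ⟶ F)
    (h : ∀ y : Y, ∃ U : Y.Opens, y ∈ U ∧ ∀ V ≤ U, Function.Bijective (f.app V)) : IsIso f := by
  rw [Scheme.Modules.Hom.isIso_iff_isIso_app]
  intro U
  rw [ConcreteCategory.isIso_iff_bijective]
  have inj : ∀ (W : Y.Opens), Function.Injective (f.app W) := by
    intro W s t hst
    refine section_ext s t fun y hy => ?_
    obtain ⟨V, hyV, hV⟩ := h y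
    refine ⟨W ⊓ V, inf_le_left, ⟨hy, hyV⟩, (hV _ inf_le_right).1 ?_⟩
    rw [app_res, app_res, hst]
  refine ⟨inj U, fun t => ?_⟩
  obtain ⟨s, hs⟩ := section_glue (E := E) (U := U) (fun V hV s => f.app V s = res F hV t)
    (fun V W hV h s hs => by rw [app_res, hs, res_res])
    (fun V hV s s' hs hs' => inj V (hs.trans hs'.symm))
    (fun y hy => by
      obtain ⟨V, hyV, hV⟩ := h y
      exact ⟨U ⊓ V, inf_le_left, ⟨hy, hyV⟩, (hV _ inf_le_right).2 _⟩)
  refine ⟨s, section_ext _ _ fun y hy => ?_⟩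
  obtain ⟨V, hyV, hV⟩ := h y
  obtain ⟨s', hs'⟩ := (hV (U ⊓ V) inf_le_right).2 (res F inf_le_left t)
  refine ⟨U ⊓ V, inf_le_left, ⟨hy, hyV⟩, ?_⟩
  rw [← app_res, hs _ inf_le_left s' hs', hs']

end Sections

section GlueForms

variable {Y : Scheme.{u}} {E : Y.Modules}

/-- A symmetric bilinear form is determined by a relation `R U x y a`, thought of as "the value of
the form at `(x, y)` is `a`", which is bilinear, symmetric, compatible with restriction, and has
locally exactly one solution `a`. -/
lemma exists_symmForm_of_relation
    (R : ∀ U : Y.Opens, Γ(E, U) → Γ(E, U) → Γ(Y, U) → Prop)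
    (hres : ∀ {U V : Y.Opens} (h : V ≤ U) x y a, R U x y a →
      R V (res E h x) (res E h y) (rres h a))
    (huniq : ∀ U x y a a', R U x y a → R U x y a' → a = a')
    (hex : ∀ (U : Y.Opens) x y, ∀ z ∈ U, ∃ (V : Y.Opens) (hV : V ≤ U), z ∈ V ∧
      ∃ a, R V (res E hV x) (res E hV y) a)
    (hadd : ∀ U x x' y a a', R U x y a → R U x' y a' → R U (x + x') y (a + a'))
    (hsmul : ∀ U (r : Γ(Y, U)) x y a, R U x y a → R U (r • x) y (r * a))
    (hsymm : ∀ U x y a, R U x y a → R U y x a) :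
    ∃ t : SymmForm E, ∀ U x y a, R U x y a → t.form U x y = a := by
  -- glue the local values; `loc` and `val` then translate between the glued value and `R`, and
  -- let every identity be checked locally
  have key : ∀ (U : Y.Opens) (x y : Γ(E, U)), ∃ a : Γ(Y, U), ∀ (V : Y.Opens) (hV : V ≤ U) b,
      R V (res E hV x) (res E hV y) b → rres hV a = b := fun U x y =>
    function_glue (fun V hV b => R V (res E hV x) (res E hV y) b)
      (fun V W hV h b hb => by simpa only [res_res] using hres h _ _ _ hb)
      (fun V hV s t => huniq _ _ _ _ _) (hex U x y)
  choose a ha using key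
  have loc : ∀ (U : Y.Opens) (x y : Γ(E, U)) (b : Γ(Y, U)),
      (∀ z ∈ U, ∃ (V : Y.Opens) (hV : V ≤ U), z ∈ V ∧
        R V (res E hV x) (res E hV y) (rres hV b)) → a U x y = b := by
    intro U x y b h
    refine function_ext _ _ fun z hz => ?_
    obtain ⟨V, hV, hzV, hR⟩ := h z hz
    exact ⟨V, hV, hzV, ha U x y V hV _ hR⟩
  have val : ∀ (U : Y.Opens) (x y : Γ(E, U)), ∀ z ∈ U, ∃ (V : Y.Opens) (hV : V ≤ U), z ∈ V ∧
      R V (res E hV x) (res E hV y) (rres hV (a U x y)) := by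
    intro U x y z hz
    obtain ⟨V, hV, hzV, b, hb⟩ := hex U x y z hz
    exact ⟨V, hV, hzV, by rwa [ha U x y V hV b hb]⟩
  have two : ∀ (U : Y.Opens) (x y x' y' : Γ(E, U)), ∀ z ∈ U, ∃ (V : Y.Opens) (hV : V ≤ U), z ∈ V ∧
      R V (res E hV x) (res E hV y) (rres hV (a U x y)) ∧
      R V (res E hV x') (res E hV y') (rres hV (a U x' y')) := by
    intro U x y x' y' z hz
    obtain ⟨V, hV, hzV, h⟩ := val U x y z hz
    obtain ⟨W, hW, hzW, h'⟩ := val U x' y' z hz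
    refine ⟨V ⊓ W, inf_le_left.trans hV, ⟨hzV, hzW⟩, ?_, ?_⟩
    · simpa only [res_res, rres_rres] using hres (inf_le_left : V ⊓ W ≤ V) _ _ _ h
    · simpa only [res_res, rres_rres] using hres (inf_le_right : V ⊓ W ≤ W) _ _ _ h'
  have symm : ∀ (U : Y.Opens) (x y : Γ(E, U)), a U x y = a U y x := by
    intro U x y
    refine loc U x y _ fun z hz => ?_
    obtain ⟨V, hV, hzV, h⟩ := val U y x z hz
    exact ⟨V, hV, hzV, hsymm _ _ _ _ h⟩
  have add : ∀ (U : Y.Opens) (x x' y : Γ(E, U)), a U (x + x') y = a U x y + a U x' y := by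
    intro U x x' y
    refine loc U _ y _ fun z hz => ?_
    obtain ⟨V, hV, hzV, h, h'⟩ := two U x y x' y z hz
    refine ⟨V, hV, hzV, ?_⟩
    rw [res_add, rres_add]
    exact hadd _ _ _ _ _ _ h h'
  have smul : ∀ (U : Y.Opens) (r : Γ(Y, U)) (x y : Γ(E, U)), a U (r • x) y = r * a U x y := by
    intro U r x y
    refine loc U _ y _ fun z hz => ?_
    obtain ⟨V, hV, hzV, h⟩ := val U x y z hz
    refine ⟨V, hV, hzV, ?_⟩
    rw [res_smul, rres_mul]
    exact hsmul _ _ _ _ _ h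
  refine ⟨{ form := fun U => LinearMap.mk₂ Γ(Y, U) (a U) (add U)
              (fun r x y => smul U r x y) (fun x y y' => by
                rw [symm, add, symm U y, symm U y']) (fun r x y => by
                rw [symm, smul, symm U y]; rfl)
            form_res := ?_
            symm := symm }, ?_⟩
  · intro U V h x y
    refine loc V _ _ _ fun z hz => ?_
    obtain ⟨W, hW, hzW, hR⟩ := val U x y z (h hz)
    refine ⟨V ⊓ W, inf_le_left, ⟨hz, hzW⟩, ?_⟩
    have := hres (inf_le_right : V ⊓ W ≤ W) _ _ _ hR
    simp only [res_res, rres_rres] at this ⊢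
    exact this
  · intro U x y b hb
    refine loc U x y b fun z hz => ⟨U, le_rfl, hz, ?_⟩
    simpa only [res_self, rres_self] using hb

end GlueForms

/-! ### Frames of vector bundles -/

section Frames

variable {Y : Scheme.{u}} {E F : Y.Modules} {U V : Y.Opens} {ι κ : Type*} [Fintype ι]

/-- A frame of `E` over `U`: a finite family of sections in terms of which every section over every
smaller open set has unique coordinates. -/
def IsFrame (E : Y.Modules) (U : Y.Opens) {ι : Type*} [Fintype ι] (b : ι → Γ(E, U)) : Prop :=
  ∀ (V : Y.Opens) (h : V ≤ U) (s : Γ(E, V)), ∃! c : ι → Γ(Y, V), s = ∑ i, c i • res E h (b i)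

lemma isFrame_of_basis {b : ι → Γ(E, U)}
    (H : ∀ (V : Y.Opens) (h : V ≤ U), ∃ B : Module.Basis ι Γ(Y, V) Γ(E, V),
      ∀ i, B i = res E h (b i)) : IsFrame E U b := by
  intro V h s
  obtain ⟨B, hB⟩ := H V h
  refine ⟨B.repr s, ?_, fun c hc => ?_⟩
  · simp only [← hB]
    exact (B.sum_repr s).symm
  · simp only [← hB] at hc
    rw [hc, B.repr_sum_self]

/-- The basis of sections over `V` given by a frame. -/
noncomputable def IsFrame.basis {b : ι → Γ(E, U)} (hb : IsFrame E U b) (h : V ≤ U) :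
    Module.Basis ι Γ(Y, V) Γ(E, V) :=
  Module.Basis.mk (v := fun i => res E h (b i))
    (Fintype.linearIndependent_iff.2 fun g hg => by
      obtain ⟨c, -, hc⟩ := hb V h 0
      have h1 := hc g hg.symm
      have h2 := hc 0 (by simp)
      exact fun i => congrFun (h1.trans h2.symm) i)
    (fun s _ => by
      obtain ⟨c, hc, -⟩ := hb V h s
      rw [hc]
      exact Submodule.sum_mem _ fun i _ => Submodule.smul_mem _ _ (Submodule.subset_span ⟨i, rfl⟩))

@[simp] lemma IsFrame.basis_apply {b : ι → Γ(E, U)} (hb : IsFrame E U b) (h : V ≤ U) (i : ι) :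
    hb.basis h i = res E h (b i) := by
  simp [IsFrame.basis]

lemma IsFrame.restrict {b : ι → Γ(E, U)} (hb : IsFrame E U b) (h : V ≤ U) :
    IsFrame E V fun i => res E h (b i) :=
  isFrame_of_basis fun W hW => ⟨hb.basis (hW.trans h), fun i => by
    rw [hb.basis_apply, res_res]⟩

lemma IsFrame.repr_res {b : ι → Γ(E, U)} (hb : IsFrame E U b) {W : Y.Opens} (h : V ≤ U)
    (h' : W ≤ V) (s : Γ(E, V)) (i : ι) :
    (hb.basis (h'.trans h)).repr (res E h' s) i = rres h' ((hb.basis h).repr s i) := by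
  have h1 : res E h' s = ∑ i, rres h' ((hb.basis h).repr s i) • hb.basis (h'.trans h) i := by
    conv_lhs => rw [← (hb.basis h).sum_repr s]
    rw [res_sum]
    exact Finset.sum_congr rfl fun i _ => by
      rw [res_smul, hb.basis_apply, hb.basis_apply, res_res]
  rw [h1, Module.Basis.repr_sum_self]

lemma IsFrame.reindex [Fintype κ] {b : ι → Γ(E, U)} (hb : IsFrame E U b) (e : κ ≃ ι) :
    IsFrame E U (b ∘ e) :=
  isFrame_of_basis fun _ h => ⟨(hb.basis h).reindex e.symm, fun i => by simp⟩

lemma IsVectorBundle.exists_frame (hE : IsVectorBundle E) (y : Y) :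
    ∃ (U : Y.Opens) (_ : y ∈ U) (n : ℕ) (b : Fin n → Γ(E, U)), IsFrame E U b :=
  hE y

lemma isVectorBundle_of_frames
    (h : ∀ y : Y, ∃ (U : Y.Opens) (_ : y ∈ U) (ι : Type) (_ : Fintype ι) (b : ι → Γ(E, U)),
      IsFrame E U b) : IsVectorBundle E := by
  intro y
  obtain ⟨U, hy, ι, _, b, hb⟩ := h y
  exact ⟨U, hy, Fintype.card ι, _, hb.reindex (Fintype.equivFin ι).symm⟩

lemma res_sum_smul {b : ι → Γ(E, U)} {W : Y.Opens} (h : V ≤ U) (h' : W ≤ V) (c : ι → Γ(Y, V)) :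
    res E h' (∑ i, c i • res E h (b i)) = ∑ i, rres h' (c i) • res E (h'.trans h) (b i) := by
  rw [res_sum]
  exact Finset.sum_congr rfl fun i _ => by rw [res_smul, res_res]

/-- Coordinates may be constructed locally, provided that they are unique. -/
lemma isFrame_of_local {b : ι → Γ(E, U)}
    (uniq : ∀ (V : Y.Opens) (h : V ≤ U) (c c' : ι → Γ(Y, V)),
      ∑ i, c i • res E h (b i) = ∑ i, c' i • res E h (b i) → c = c')
    (ex : ∀ (V : Y.Opens) (h : V ≤ U) (s : Γ(E, V)), ∀ y ∈ V, ∃ (W : Y.Opens) (hW : W ≤ V),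
      y ∈ W ∧ ∃ c : ι → Γ(Y, W), res E hW s = ∑ i, c i • res E (hW.trans h) (b i)) :
    IsFrame E U b := by
  intro V h s
  have key : ∀ i, ∃ c : Γ(Y, V), ∀ (W : Y.Opens) (hW : W ≤ V) (d : Γ(Y, W)),
      (∃ d' : ι → Γ(Y, W), d' i = d ∧ res E hW s = ∑ i, d' i • res E (hW.trans h) (b i)) →
        rres hW c = d := by
    intro i
    refine function_glue (fun W hW d => ∃ d' : ι → Γ(Y, W), d' i = d ∧
      res E hW s = ∑ i, d' i • res E (hW.trans h) (b i)) ?_ ?_ ?_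
    · rintro W W' hW h' d ⟨d', rfl, hd'⟩
      refine ⟨fun i => rres h' (d' i), rfl, ?_⟩
      rw [← res_sum_smul (hW.trans h), ← hd', res_res]
    · rintro W hW d e ⟨d', rfl, hd'⟩ ⟨e', rfl, he'⟩
      rw [uniq W (hW.trans h) d' e' (hd'.symm.trans he')]
    · intro y hy
      obtain ⟨W, hW, hyW, c, hc⟩ := ex V h s y hy
      exact ⟨W, hW, hyW, c i, c, rfl, hc⟩
  choose c hc using key
  have hs : s = ∑ i, c i • res E h (b i) := by
    refine section_ext _ _ fun y hy => ?_
    obtain ⟨W, hW, hyW, d, hd⟩ := ex V h s y hy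
    refine ⟨W, hW, hyW, ?_⟩
    rw [res_sum_smul, hd]
    exact Finset.sum_congr rfl fun i _ => by rw [hc i W hW (d i) ⟨d, rfl, hd⟩]
  exact ⟨c, hs, fun c' hc' => uniq V h c' c (hc'.symm.trans hs)⟩

/-- It suffices to check the frame property on a basis of open sets. -/
lemma isFrame_of_cover {b : ι → Γ(E, U)} (S : Set Y.Opens)
    (hS : ∀ V ≤ U, ∀ y ∈ V, ∃ W ∈ S, y ∈ W ∧ W ≤ V)
    (H : ∀ V ∈ S, ∀ (h : V ≤ U) (s : Γ(E, V)),
      ∃! c : ι → Γ(Y, V), s = ∑ i, c i • res E h (b i)) : IsFrame E U b := by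
  refine isFrame_of_local ?_ ?_
  · intro V h c c' hc
    funext i
    refine function_ext _ _ fun y hy => ?_
    obtain ⟨W, hWS, hyW, hWV⟩ := hS V h y hy
    refine ⟨W, hWV, hyW, ?_⟩
    have h1 := (H W hWS (hWV.trans h) (res E hWV (∑ i, c i • res E h (b i)))).unique
      (y₁ := fun i => rres hWV (c i)) (y₂ := fun i => rres hWV (c' i)) (res_sum_smul h hWV c)
      (by rw [hc]; exact res_sum_smul h hWV c')
    exact congrFun h1 i
  · intro V h s y hy
    obtain ⟨W, hWS, hyW, hWV⟩ := hS V h y hy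
    exact ⟨W, hWV, hyW, (H W hWS (hWV.trans h) (res E hWV s)).exists⟩

lemma IsFrame.bijective_app {b : ι → Γ(E, U)} (hb : IsFrame E U b) {f : E ⟶ F}
    (hf : IsFrame F U fun i => f.app U (b i)) (h : V ≤ U) : Function.Bijective (f.app V) := by
  have hf' : ∀ c : ι → Γ(Y, V), f.app V (∑ i, c i • res E h (b i)) =
      ∑ i, c i • res F h (f.app U (b i)) := by
    intro c
    rw [map_sum]
    exact Finset.sum_congr rfl fun i _ => by rw [Scheme.Modules.Hom.app_smul, app_res]
  constructor
  · intro s t hst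
    obtain ⟨c, rfl, -⟩ := hb V h s
    obtain ⟨d, rfl, -⟩ := hb V h t
    rw [hf', hf'] at hst
    rw [(hf V h _).unique rfl hst]
  · intro t
    obtain ⟨c, rfl, -⟩ := hf V h t
    exact ⟨_, hf' c⟩

lemma isIso_of_frames (f : E ⟶ F)
    (h : ∀ y : Y, ∃ (U : Y.Opens) (_ : y ∈ U) (ι : Type) (_ : Fintype ι) (b : ι → Γ(E, U)),
      IsFrame E U b ∧ IsFrame F U fun i => f.app U (b i)) : IsIso f := by
  refine isIso_of_locally_bijective f fun y => ?_
  obtain ⟨U, hy, ι, _, b, hb, hf⟩ := h y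
  exact ⟨U, hy, fun V hV => hb.bijective_app hf hV⟩

lemma IsFrame.map_isIso {b : ι → Γ(E, U)} (hb : IsFrame E U b) (f : E ⟶ F) [IsIso f] :
    IsFrame F U fun i => f.app U (b i) := by
  intro V h s
  have hbij : Function.Bijective (f.app V) := by
    have := (Scheme.Modules.Hom.isIso_iff_isIso_app (φ := f)).1 inferInstance V
    exact (ConcreteCategory.isIso_iff_bijective _).1 this
  obtain ⟨t, rfl⟩ := hbij.2 s
  have hf' : ∀ c : ι → Γ(Y, V), f.app V (∑ i, c i • res E h (b i)) =
      ∑ i, c i • res F h (f.app U (b i)) := by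
    intro c
    rw [map_sum]
    exact Finset.sum_congr rfl fun i _ => by rw [Scheme.Modules.Hom.app_smul, app_res]
  obtain ⟨c, hc, huniq⟩ := hb V h t
  refine ⟨c, ?_, fun d hd => huniq d (hbij.1 ?_)⟩
  · change f.app V t = _
    rw [← hf', ← hc]
  · rw [hf']
    exact hd

lemma IsFrame.basis_restrict {b : ι → Γ(E, U)} (hb : IsFrame E U b) (h : V ≤ U) :
    (hb.restrict h).basis le_rfl = hb.basis h := by
  ext i
  simp [res_self]

lemma IsFrame.det_res [DecidableEq ι] {b : ι → Γ(E, U)} (hb : IsFrame E U b) {W : Y.Opens}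
    (h : V ≤ U) (h' : W ≤ V) (v : ι → Γ(E, V)) :
    (hb.basis (h'.trans h)).det (fun i => res E h' (v i)) = rres h' ((hb.basis h).det v) := by
  rw [Module.Basis.det_apply, Module.Basis.det_apply]
  change _ = (Y.presheaf.map (homOfLE h').op).hom _
  rw [RingHom.map_det]
  congr 1
  ext i j
  exact hb.repr_res h h' (v j) i

lemma IsFrame.of_isUnit_det [DecidableEq ι] {b : ι → Γ(E, U)} (hb : IsFrame E U b)
    {v : ι → Γ(E, U)} (hv : IsUnit ((hb.basis le_rfl).det v)) : IsFrame E U v := by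
  refine isFrame_of_basis fun V h => ?_
  have h2 : IsUnit ((hb.basis h).det (fun i => res E h (v i))) := by
    rw [hb.det_res le_rfl h]
    exact hv.map (Y.presheaf.map (homOfLE h).op).hom
  obtain ⟨hli, hsp⟩ := (Module.Basis.is_basis_iff_det _).2 h2
  exact ⟨Module.Basis.mk hli hsp.ge, fun i => by simp⟩

/-- A finite family spanning the sections over `U` contains a frame near each point. -/
lemma IsFrame.exists_subframe [DecidableEq ι] {b : ι → Γ(E, U)} (hb : IsFrame E U b)
    (v : κ → Γ(E, U)) (hv : ∀ i, b i ∈ Submodule.span Γ(Y, U) (Set.range v)) {y : Y} (hy : y ∈ U) :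
    ∃ (s : ι → κ) (_ : Function.Injective s) (V : Y.Opens) (h : V ≤ U), y ∈ V ∧
      IsFrame E V fun i => res E h (v (s i)) := by
  let B := hb.basis (le_refl U)
  have hB : ∀ i, B i = b i := fun i => by rw [hb.basis_apply, res_self]
  -- the values at `y` of the given sections span the fibre, so some of them form a basis of it;
  -- their determinant with respect to `b` is then invertible near `y`
  let ev : Γ(Y, U) →+* Y.residueField y := (Y.evaluation U y hy).hom
  let w : κ → ι → Y.residueField y := fun k i => ev (B.repr (v k) i)
  have hw : ⊤ ≤ Submodule.span (Y.residueField y) (Set.range w) := by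
    have key : ∀ z ∈ Submodule.span Γ(Y, U) (Set.range v),
        (fun i => ev (B.repr z i)) ∈ Submodule.span (Y.residueField y) (Set.range w) := by
      intro z hz
      induction hz using Submodule.span_induction with
      | mem z hz =>
        obtain ⟨k, rfl⟩ := hz
        exact Submodule.subset_span ⟨k, rfl⟩
      | zero =>
        convert Submodule.zero_mem (Submodule.span (Y.residueField y) (Set.range w)) using 1
        ext i
        simp
      | add z z' _ _ h h' =>
        convert Submodule.add_mem _ h h' using 1
        ext i
        simp
      | smul r z _ h =>
        convert Submodule.smul_mem _ (ev r) h using 1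
        ext i
        simp
    rw [← (Pi.basisFun (Y.residueField y) ι).span_eq, Submodule.span_le]
    rintro _ ⟨i, rfl⟩
    have := key _ (hv i)
    rw [SetLike.mem_coe]
    convert this using 1
    ext j
    rw [← hB, Module.Basis.repr_self, Pi.basisFun_apply, Finsupp.single_apply, Pi.single_apply]
    by_cases h : i = j
    · simp [h]
    · simp [h, Ne.symm h]
  obtain ⟨κ', a, ha, hspan, hli⟩ := exists_linearIndependent' (Y.residueField y) w
  let B' : Module.Basis κ' (Y.residueField y) (ι → Y.residueField y) :=
    Module.Basis.mk hli (by rw [hspan]; exact hw)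
  let e : ι ≃ κ' := (Pi.basisFun (Y.residueField y) ι).indexEquiv B'
  let d : Γ(Y, U) := B.det fun i => v (a (e i))
  have hd : ev d ≠ 0 := by
    have h1 : ev d = (Pi.basisFun (Y.residueField y) ι).det (B' ∘ e) := by
      simp only [d]
      rw [Module.Basis.det_apply, Module.Basis.det_apply, RingHom.map_det]
      congr 1
      ext i j
      simp [Module.Basis.toMatrix_apply, B', w]
    rw [h1]
    have := ((Pi.basisFun (Y.residueField y) ι).isUnit_det (B'.reindex e.symm)).ne_zero
    convert this using 2
    ext i
    simp
  have hyd : y ∈ Y.basicOpen d :=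
    (Scheme.evaluation_ne_zero_iff_mem_basicOpen Y y hy d).1 hd
  refine ⟨fun i => a (e i), ha.comp e.injective, Y.basicOpen d, Y.basicOpen_le d, hyd, ?_⟩
  refine (hb.restrict (Y.basicOpen_le d)).of_isUnit_det ?_
  rw [hb.basis_restrict, hb.det_res le_rfl]
  exact RingedSpace.isUnit_res_basicOpen Y.toRingedSpace d

end Frames

/-! ### Gram matrices, tensor products of modules -/

section Gram

variable {Y : Scheme.{u}} {E : Y.Modules} {U V : Y.Opens} {ι : Type*}

/-- The Gram matrix of a form with respect to a family of sections. -/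
noncomputable def gram (q : SymmForm E) {ι : Type*} (b : ι → Γ(E, U)) : Matrix ι ι Γ(Y, U) :=
  Matrix.of fun i j => q.form U (b i) (b j)

lemma gram_res (q : SymmForm E) (h : V ≤ U) (b : ι → Γ(E, U)) :
    gram q (fun i => res E h (b i)) = (gram q b).map (Y.presheaf.map (homOfLE h).op).hom := by
  ext i j
  exact q.form_res h _ _

variable [Fintype ι]

/-- The linear form taking the `i`-th coordinate with respect to a frame. -/
noncomputable def IsFrame.dual {b : ι → Γ(E, U)} (hb : IsFrame E U b)
    (i : ι) : DualSection E U where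
  toFun _ h := (hb.basis h).coord i
  toFun_res hV h x := hb.repr_res hV h x i

lemma SymmForm.Nondegenerate.isUnit_gram_det [DecidableEq ι] {q : SymmForm E}
    (hq : q.Nondegenerate) {b : ι → Γ(E, U)} (hb : IsFrame E U b) : IsUnit (gram q b).det := by
  choose x hx using fun i => (hq U (hb.dual i)).exists
  let B := hb.basis (le_refl U)
  have hB : ∀ i, B i = b i := fun i => by rw [hb.basis_apply, res_self]
  have key : (Matrix.of fun i k => B.repr (x i) k) * gram q b = 1 := by
    ext i j
    have h1 := hx i U le_rfl (b j)
    rw [res_self] at h1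
    have h2 : (hb.dual i).toFun U le_rfl (b j) = (1 : Matrix ι ι Γ(Y, U)) i j := by
      change B.repr (b j) i = _
      rw [← hB, B.repr_self, Finsupp.single_apply, Matrix.one_apply]
      simp only [eq_comm]
    rw [← h2, ← h1]
    conv_rhs => rw [← B.sum_repr (x i), map_sum, LinearMap.sum_apply]
    rw [Matrix.mul_apply]
    refine Finset.sum_congr rfl fun k _ => ?_
    rw [map_smul, LinearMap.smul_apply, smul_eq_mul, hB]
    rfl
  exact isUnit_iff_exists_inv'.2 ⟨_, by rw [← Matrix.det_mul, key, Matrix.det_one]⟩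

lemma SymmForm.form_eq_gram (q : SymmForm E) (b : ι → Γ(E, U)) (c : ι → Γ(Y, U)) (j : ι) :
    q.form U (∑ i, c i • b i) (b j) = Matrix.vecMul c (gram q b) j := by
  rw [map_sum, LinearMap.sum_apply]
  refine Finset.sum_congr rfl fun k _ => ?_
  rw [map_smul, LinearMap.smul_apply, smul_eq_mul]
  rfl

lemma SymmForm.existsUnique_of_isUnit_gram [DecidableEq ι] (q : SymmForm E) {b : ι → Γ(E, U)}
    (hb : IsFrame E U b) (hq : IsUnit (gram q b).det) (h : V ≤ U) (c : ι → Γ(Y, V)) :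
    ∃! x : Γ(E, V), ∀ i, q.form V x (res E h (b i)) = c i := by
  have hu : IsUnit (gram q fun i => res E h (b i)).det := by
    rw [gram_res, ← RingHom.mapMatrix_apply, ← RingHom.map_det]
    exact hq.map _
  have hrepr : ∀ x : Γ(E, V), ∃ d : ι → Γ(Y, V), x = ∑ i, d i • res E h (b i) :=
    fun x => (hb V h x).exists
  refine ⟨∑ i, Matrix.vecMul c (gram q fun i => res E h (b i))⁻¹ i • res E h (b i), ?_, ?_⟩
  · intro i
    rw [SymmForm.form_eq_gram q (fun i => res E h (b i)), Matrix.vecMul_vecMul,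
      Matrix.nonsing_inv_mul _ hu, Matrix.vecMul_one]
  · intro x hx
    obtain ⟨d, rfl⟩ := hrepr x
    have : d = Matrix.vecMul c (gram q fun i => res E h (b i))⁻¹ := by
      have h1 : Matrix.vecMul d (gram q fun i => res E h (b i)) = c := funext fun i => by
        rw [← hx i, SymmForm.form_eq_gram q (fun i => res E h (b i))]
      rw [← h1, Matrix.vecMul_vecMul, Matrix.mul_nonsing_inv _ hu, Matrix.vecMul_one]
    rw [← this]

/-- A form is nondegenerate if its Gram determinant is a unit in a frame near each point: the
section which represents a functional is unique, hence can be glued from local ones. -/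
lemma SymmForm.nondegenerate_of_gram (q : SymmForm E)
    (H : ∀ y : Y, ∃ (U : Y.Opens) (_ : y ∈ U) (ι : Type) (_ : Fintype ι) (_ : DecidableEq ι)
      (b : ι → Γ(E, U)), IsFrame E U b ∧ IsUnit (gram q b).det) : q.Nondegenerate := by
  intro U l
  -- local uniqueness
  have uniq : ∀ (V : Y.Opens) (x x' : Γ(E, V)),
      (∀ (W : Y.Opens) (h : W ≤ V) (y : Γ(E, W)),
        q.form W (res E h x) y = q.form W (res E h x') y) → x = x' := by
    intro V x x' hxx
    refine section_ext _ _ fun y hy => ?_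
    obtain ⟨W, hyW, n, _, _, b, hb, hu⟩ := H y
    refine ⟨V ⊓ W, inf_le_left, ⟨hy, hyW⟩, ?_⟩
    exact (q.existsUnique_of_isUnit_gram hb hu inf_le_right
      (fun i => q.form _ (res E inf_le_left x') (res E inf_le_right (b i)))).unique
      (fun i => hxx _ _ _) (fun i => rfl)
  have glue := section_glue (E := E) (U := U) (fun V hV x => ∀ (W : Y.Opens) (h : W ≤ V)
      (y : Γ(E, W)), q.form W (res E h x) y = l.toFun W (h.trans hV) y) ?_ ?_ ?_
  · obtain ⟨x, hx⟩ := glue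
    have hx' : ∀ (V : Y.Opens) (h : V ≤ U) (y : Γ(E, V)),
        q.form V (res E h x) y = l.toFun V h y := by
      intro V h y
      refine function_ext _ _ fun z hz => ?_
      obtain ⟨W, hzW, n, _, _, b, hb, hu⟩ := H z
      obtain ⟨x', hx', -⟩ := q.existsUnique_of_isUnit_gram hb hu
        (inf_le_right : V ⊓ W ≤ W) (fun i => l.toFun _ (inf_le_left.trans h) (res E _ (b i)))
      have hx'' : ∀ (W' : Y.Opens) (h' : W' ≤ V ⊓ W) (y : Γ(E, W')),
          q.form W' (res E h' x') y = l.toFun W' (h'.trans (inf_le_left.trans h)) y := by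
        intro W' h' y
        obtain ⟨c, rfl, -⟩ := hb W' (h'.trans inf_le_right) y
        rw [map_sum, map_sum]
        refine Finset.sum_congr rfl fun i _ => ?_
        rw [map_smul, map_smul, ← res_res E inf_le_right h', q.form_res, hx',
          l.toFun_res (inf_le_left.trans h) h']
      refine ⟨V ⊓ W, inf_le_left, ⟨hz, hzW⟩, ?_⟩
      have h1 := hx (V ⊓ W) (inf_le_left.trans h) x' hx''
      have h2 := hx'' _ le_rfl (res E inf_le_left y)
      rw [res_self, ← h1, ← res_res E h inf_le_left, q.form_res, l.toFun_res h] at h2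
      exact h2
    exact ⟨x, hx', fun x' h => uniq U _ _ fun W hW y => by rw [h, hx']⟩
  · intro V W hV h s hs W' h' y
    rw [res_res, hs]
  · intro V hV s t hs ht
    exact uniq V s t fun W h y => by rw [hs, ht]
  · intro y hy
    obtain ⟨W, hyW, n, _, _, b, hb, hu⟩ := H y
    refine ⟨U ⊓ W, inf_le_left, ⟨hy, hyW⟩, ?_⟩
    obtain ⟨x', hx', -⟩ := q.existsUnique_of_isUnit_gram hb hu
      (inf_le_right : U ⊓ W ≤ W) (fun i => l.toFun _ inf_le_left (res E _ (b i)))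
    refine ⟨x', fun W' h' y => ?_⟩
    obtain ⟨c, rfl, -⟩ := hb W' (h'.trans inf_le_right) y
    rw [map_sum, map_sum]
    refine Finset.sum_congr rfl fun i _ => ?_
    rw [map_smul, map_smul, ← res_res E inf_le_right h', q.form_res, hx',
      l.toFun_res inf_le_left h']

end Gram

section Tensor

variable {Y : Scheme.{u}} (E L : Y.Modules) {U V : Y.Opens}

/-- The canonical map `E(U) ⊗ L(U) → (E ⊗ L)(U)`. -/
noncomputable def tunit (U : Y.Opens) :
    TensorProduct Γ(Y, U) Γ(E, U) Γ(L, U) →ₗ[Γ(Y, U)] Γ(tensor E L, U) where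
  toFun z := (((PresheafOfModules.sheafificationAdjunction (𝟙 Y.ringCatSheaf.obj)).unit.app
    (tensorPresheaf E L)).app (op U)).hom z
  map_add' z w := map_add (((PresheafOfModules.sheafificationAdjunction
    (𝟙 Y.ringCatSheaf.obj)).unit.app (tensorPresheaf E L)).app (op U)).hom z w
  map_smul' r z := (((PresheafOfModules.sheafificationAdjunction
    (𝟙 Y.ringCatSheaf.obj)).unit.app (tensorPresheaf E L)).app (op U)).hom.map_smul' r z

lemma tunit_tmul (a : Γ(E, U)) (b : Γ(L, U)) :
    tunit E L U (TensorProduct.tmul Γ(Y, U) a b) = tmul a b := rfl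

/-- Restriction of sections of the presheaf `U ↦ E(U) ⊗ L(U)`. -/
noncomputable def tres (h : V ≤ U) :
    TensorProduct Γ(Y, U) Γ(E, U) Γ(L, U) →+ TensorProduct Γ(Y, V) Γ(E, V) Γ(L, V) :=
  ((tensorPresheaf E L).presheaf.map (homOfLE h).op).hom

lemma tres_tmul (h : V ≤ U) (a : Γ(E, U)) (b : Γ(L, U)) :
    tres E L h (TensorProduct.tmul Γ(Y, U) a b) =
      TensorProduct.tmul Γ(Y, V) (res E h a) (res L h b) := rfl

lemma tunit_tres (h : V ≤ U) (z : TensorProduct Γ(Y, U) Γ(E, U) Γ(L, U)) :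
    tunit E L V (tres E L h z) = res (tensor E L) h (tunit E L U z) :=
  congr($(((PresheafOfModules.toPresheaf _).map ((PresheafOfModules.sheafificationAdjunction
    (𝟙 Y.ringCatSheaf.obj)).unit.app (tensorPresheaf E L))).naturality (homOfLE h).op) z)

lemma tunit_eq_toSheafify (z : TensorProduct Γ(Y, U) Γ(E, U) Γ(L, U)) :
    tunit E L U z = (CategoryTheory.toSheafify (Opens.grothendieckTopology Y)
      (tensorPresheaf E L).presheaf).app (op U) z := by
  have := PresheafOfModules.toPresheaf_map_sheafificationAdjunction_unit_app
    (𝟙 Y.ringCatSheaf.obj) (tensorPresheaf E L)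
  exact congr(($this).app (op U) z)

lemma tunit_locally_injective (z w : TensorProduct Γ(Y, U) Γ(E, U) Γ(L, U))
    (h : tunit E L U z = tunit E L U w) {y : Y} (hy : y ∈ U) :
    ∃ (V : Y.Opens) (h : V ≤ U), y ∈ V ∧ tres E L h z = tres E L h w := by
  rw [tunit_eq_toSheafify, tunit_eq_toSheafify] at h
  obtain ⟨V, i, hi, hyV⟩ := Presheaf.equalizerSieve_mem (Opens.grothendieckTopology Y)
    (CategoryTheory.toSheafify (Opens.grothendieckTopology Y)
      (tensorPresheaf E L).presheaf) z w h y hy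
  exact ⟨V, i.le, hyV, hi⟩

lemma tunit_locally_surjective (s : Γ(tensor E L, U)) {y : Y} (hy : y ∈ U) :
    ∃ (V : Y.Opens) (h : V ≤ U), y ∈ V ∧ ∃ z, tunit E L V z = res (tensor E L) h s := by
  obtain ⟨V, i, ⟨z, hz⟩, hyV⟩ := Presheaf.imageSieve_mem (Opens.grothendieckTopology Y)
    (CategoryTheory.toSheafify (Opens.grothendieckTopology Y)
      (tensorPresheaf E L).presheaf) s y hy
  exact ⟨V, i.le, hyV, z, (tunit_eq_toSheafify E L z).trans hz⟩

end Tensor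

/-! ### Tensor products of symmetric bundles -/

section TensorProperties

variable {Y : Scheme.{u}} {E L E' L' M : Y.Modules} {U V : Y.Opens}

lemma tmul_add (a : Γ(E, U)) (b b' : Γ(L, U)) :
    (tmul a (b + b') : Γ(tensor E L, U)) = tmul a b + tmul a b' := by
  simp only [← tunit_tmul, TensorProduct.tmul_add, map_add]

lemma add_tmul (a a' : Γ(E, U)) (b : Γ(L, U)) :
    (tmul (a + a') b : Γ(tensor E L, U)) = tmul a b + tmul a' b := by
  simp only [← tunit_tmul, TensorProduct.add_tmul, map_add]

lemma smul_tmul (r : Γ(Y, U)) (a : Γ(E, U)) (b : Γ(L, U)) :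
    (tmul (r • a) b : Γ(tensor E L, U)) = r • tmul a b := by
  simp only [← tunit_tmul, ← TensorProduct.smul_tmul', map_smul]

lemma tmul_smul (r : Γ(Y, U)) (a : Γ(E, U)) (b : Γ(L, U)) :
    (tmul a (r • b) : Γ(tensor E L, U)) = r • tmul a b := by
  simp only [← tunit_tmul, TensorProduct.tmul_smul, map_smul]

lemma tmul_sum {ι : Type*} (t : Finset ι) (a : Γ(E, U)) (b : ι → Γ(L, U)) :
    (tmul a (∑ i ∈ t, b i) : Γ(tensor E L, U)) = ∑ i ∈ t, tmul a (b i) := by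
  simp only [← tunit_tmul, TensorProduct.tmul_sum, map_sum]

lemma res_tmul (h : V ≤ U) (a : Γ(E, U)) (b : Γ(L, U)) :
    res (tensor E L) h (tmul a b) = tmul (res E h a) (res L h b) := by
  rw [← tunit_tmul, ← tunit_tmul, ← tunit_tres, tres_tmul]

/-- A property of sections of `E ⊗ L` which is local and additive holds if it holds for the
sections `a ⊗ b`. -/
lemma tensor_induction {P : ∀ U : Y.Opens, Γ(tensor E L, U) → Prop}
    (local' : ∀ U m, (∀ y ∈ U, ∃ (V : Y.Opens) (h : V ≤ U), y ∈ V ∧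
      P V (res (tensor E L) h m)) → P U m)
    (tmul' : ∀ U a b, P U (tmul a b))
    (add' : ∀ U m m', P U m → P U m' → P U (m + m')) (U : Y.Opens) (m : Γ(tensor E L, U)) :
    P U m := by
  refine local' U m fun y hy => ?_
  obtain ⟨V, h, hyV, z, hz⟩ := tunit_locally_surjective E L m hy
  refine ⟨V, h, hyV, ?_⟩
  rw [← hz]
  induction z using TensorProduct.induction_on with
  | zero => simpa [← tunit_tmul] using tmul' V 0 0
  | tmul a b => exact tmul' V a b
  | add z w hz hw =>
    -- the hypothesis relating `z + w` to `m` plays no role here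
    have H : ∀ z, P V (tunit E L V z) := by
      intro z
      induction z using TensorProduct.induction_on with
      | zero => simpa [← tunit_tmul] using tmul' V 0 0
      | tmul a b => exact tmul' V a b
      | add z w hz hw => rw [map_add]; exact add' _ _ _ hz hw
    exact H _

lemma tensor_induction₂ {P : ∀ U : Y.Opens, Γ(tensor E L, U) → Γ(tensor E L, U) → Prop}
    (local' : ∀ U m n, (∀ y ∈ U, ∃ (V : Y.Opens) (h : V ≤ U), y ∈ V ∧
      P V (res (tensor E L) h m) (res (tensor E L) h n)) → P U m n)
    (tmul' : ∀ U a b a' b', P U (tmul a b) (tmul a' b'))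
    (add_left : ∀ U m m' n, P U m n → P U m' n → P U (m + m') n)
    (add_right : ∀ U m n n', P U m n → P U m n' → P U m (n + n')) (U : Y.Opens)
    (m n : Γ(tensor E L, U)) : P U m n := by
  revert n
  refine tensor_induction (P := fun U m => ∀ n, P U m n) ?_ ?_ ?_ U m
  · intro U m H n
    exact local' U m n fun y hy => by
      obtain ⟨V, h, hyV, hV⟩ := H y hy
      exact ⟨V, h, hyV, hV _⟩
  · intro U a b n
    refine tensor_induction (P := fun U n => ∀ (a : Γ(E, U)) (b : Γ(L, U)), P U (tmul a b) n)
      ?_ ?_ ?_ U n a b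
    · intro V n H a c
      refine local' V _ _ fun y hy => ?_
      obtain ⟨W, h, hyW, hW⟩ := H y hy
      exact ⟨W, h, hyW, by rw [res_tmul]; exact hW _ _⟩
    · exact fun V a' b' a b => tmul' V a b a' b'
    · exact fun V n n' h h' a b => add_right V _ n n' (h a b) (h' a b)
  · exact fun U m m' h h' n => add_left U m m' n (h n) (h' n)

lemma tensor_hom_ext {f g : tensor E L ⟶ M}
    (h : ∀ (U : Y.Opens) (a : Γ(E, U)) (b : Γ(L, U)), f.app U (tmul a b) = g.app U (tmul a b)) :
    f = g := by
  ext U m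
  refine tensor_induction (P := fun U m => f.app U m = g.app U m) ?_ h ?_ U m
  · intro U m H
    refine section_ext _ _ fun y hy => ?_
    obtain ⟨V, h, hyV, hV⟩ := H y hy
    exact ⟨V, h, hyV, by rw [← app_res, hV, app_res]⟩
  · intro U m m' h h'
    rw [map_add, map_add, h, h']

lemma tensorMap_tmul (f : E ⟶ E') (g : L ⟶ L') (a : Γ(E, U)) (b : Γ(L, U)) :
    (tensorMap f g).app U (tmul a b) = tmul (f.app U a) (g.app U b) := by
  have := (PresheafOfModules.sheafificationAdjunction (𝟙 Y.ringCatSheaf.obj)).unit.naturality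
    (PresheafOfModules.Monoidal.tensorHom (R := Y.presheaf) f.val g.val)
  exact congr((($this).app (op U)).hom (TensorProduct.tmul Γ(Y, U) a b)).symm

lemma lift_tres (β : ∀ U : Y.Opens, Γ(E, U) →ₗ[Γ(Y, U)] Γ(L, U) →ₗ[Γ(Y, U)] Γ(M, U))
    (hβ : ∀ {U V : Y.Opens} (h : V ≤ U) a b, β V (res E h a) (res L h b) = res M h (β U a b))
    (h : V ≤ U) (z : TensorProduct Γ(Y, U) Γ(E, U) Γ(L, U)) :
    TensorProduct.lift (β V) (tres E L h z) = res M h (TensorProduct.lift (β U) z) := by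
  induction z using TensorProduct.induction_on with
  | zero => rw [map_zero, map_zero, map_zero, res_zero]
  | tmul a b => exact hβ h a b
  | add z w hz hw => rw [map_add, map_add, map_add, hz, hw, res_add]

/-- The morphism on the presheaf `U ↦ E(U) ⊗ L(U)` defined by a bilinear map. -/
noncomputable def tensorPresheafLift
    (β : ∀ U : Y.Opens, Γ(E, U) →ₗ[Γ(Y, U)] Γ(L, U) →ₗ[Γ(Y, U)] Γ(M, U))
    (hβ : ∀ {U V : Y.Opens} (h : V ≤ U) a b, β V (res E h a) (res L h b) = res M h (β U a b)) :
    tensorPresheaf E L ⟶ (PresheafOfModules.restrictScalars (𝟙 Y.ringCatSheaf.obj)).obj M.val where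
  app U := ModuleCat.ofHom (R := Γ(Y, U.unop))
    (X := TensorProduct Γ(Y, U.unop) Γ(E, U.unop) Γ(L, U.unop)) (Y := Γ(M, U.unop))
    (TensorProduct.lift (β U.unop))
  naturality {U V} i := by
    refine ModuleCat.hom_ext (LinearMap.ext fun z => ?_)
    exact lift_tres β hβ i.unop.le z

/-- The morphism on `E ⊗ L` defined by a bilinear map. -/
noncomputable def tensorLift (β : ∀ U : Y.Opens, Γ(E, U) →ₗ[Γ(Y, U)] Γ(L, U) →ₗ[Γ(Y, U)] Γ(M, U))
    (hβ : ∀ {U V : Y.Opens} (h : V ≤ U) a b, β V (res E h a) (res L h b) = res M h (β U a b)) :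
    tensor E L ⟶ M :=
  ((PresheafOfModules.sheafificationAdjunction (𝟙 Y.ringCatSheaf.obj)).homEquiv
    (tensorPresheaf E L) M).symm (tensorPresheafLift β hβ)

lemma tensorLift_tmul (β : ∀ U : Y.Opens, Γ(E, U) →ₗ[Γ(Y, U)] Γ(L, U) →ₗ[Γ(Y, U)] Γ(M, U))
    (hβ : ∀ {U V : Y.Opens} (h : V ≤ U) a b, β V (res E h a) (res L h b) = res M h (β U a b))
    (a : Γ(E, U)) (b : Γ(L, U)) :
    (tensorLift β hβ).app U (tmul a b) = β U a b := by
  have h1 := ((PresheafOfModules.sheafificationAdjunction (𝟙 Y.ringCatSheaf.obj)).homEquiv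
    (tensorPresheaf E L) M).apply_symm_apply (tensorPresheafLift β hβ)
  have h2 := (PresheafOfModules.sheafificationAdjunction (𝟙 Y.ringCatSheaf.obj)).homEquiv_unit
    (X := tensorPresheaf E L) (Y := M) (f := tensorLift β hβ)
  exact congr((($(h2.symm.trans h1)).app (op U)).hom (TensorProduct.tmul Γ(Y, U) a b))

variable {ι κ : Type*} [Fintype ι] [Fintype κ]

lemma IsFrame.repr_tres {b : ι → Γ(E, U)} {l : κ → Γ(L, U)} (hb : IsFrame E U b)
    (hl : IsFrame L U l) {W : Y.Opens} (h : V ≤ U) (h' : W ≤ V)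
    (z : TensorProduct Γ(Y, V) Γ(E, V) Γ(L, V)) (i : ι × κ) :
    ((hb.basis (h'.trans h)).tensorProduct (hl.basis (h'.trans h))).repr (tres E L h' z) i =
      rres h' (((hb.basis h).tensorProduct (hl.basis h)).repr z i) := by
  induction z using TensorProduct.induction_on with
  | zero => simp
  | tmul a c =>
    obtain ⟨i, j⟩ := i
    rw [tres_tmul, Module.Basis.tensorProduct_repr_tmul_apply,
      Module.Basis.tensorProduct_repr_tmul_apply, hb.repr_res h h', hl.repr_res h h',
      smul_eq_mul, smul_eq_mul, rres_mul]
  | add z w hz hw => simp only [map_add, Finsupp.add_apply, hz, hw]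

lemma IsFrame.tensorFrame {b : ι → Γ(E, U)} {l : κ → Γ(L, U)} (hb : IsFrame E U b)
    (hl : IsFrame L U l) :
    IsFrame (tensor E L) U fun i : ι × κ => tmul (b i.1) (l i.2) := by
  have expand : ∀ (V : Y.Opens) (h : V ≤ U) (c : ι × κ → Γ(Y, V)),
      ∑ i, c i • res (tensor E L) h (tmul (b i.1) (l i.2)) = tunit E L V
        (∑ i, c i • (hb.basis h).tensorProduct (hl.basis h) i) := by
    intro V h c
    rw [map_sum]
    refine Finset.sum_congr rfl fun i _ => ?_
    rw [map_smul, Module.Basis.tensorProduct_apply', hb.basis_apply, hl.basis_apply, tunit_tmul,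
      res_tmul]
  refine isFrame_of_local ?_ ?_
  · intro V h c c' hc
    rw [expand, expand] at hc
    funext i
    refine function_ext _ _ fun y hy => ?_
    obtain ⟨W, hW, hyW, hz⟩ := tunit_locally_injective E L _ _ hc hy
    refine ⟨W, hW, hyW, ?_⟩
    have := congr(((hb.basis (hW.trans h)).tensorProduct (hl.basis (hW.trans h))).repr $hz i)
    rwa [hb.repr_tres hl h hW, hb.repr_tres hl h hW, Module.Basis.repr_sum_self,
      Module.Basis.repr_sum_self] at this
  · intro V h s y hy
    obtain ⟨W, hW, hyW, z, hz⟩ := tunit_locally_surjective E L s hy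
    refine ⟨W, hW, hyW,
      ((hb.basis (hW.trans h)).tensorProduct (hl.basis (hW.trans h))).repr z, ?_⟩
    rw [expand, Module.Basis.sum_repr, hz]

end TensorProperties

section TensorForm

variable {Y : Scheme.{u}} {E L : Y.Modules} {U V : Y.Opens}

lemma SymmForm.ext' {q q' : SymmForm E} (h : ∀ U x y, q.form U x y = q'.form U x y) : q = q' := by
  obtain ⟨f, _, _⟩ := q
  obtain ⟨f', _, _⟩ := q'
  obtain rfl : f = f' := funext fun U => LinearMap.ext₂ (h U)
  rfl

/-- The form `q ⊗ b` on `E(U) ⊗ L(U)`. -/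
noncomputable def tensorSectionForm (q : SymmForm E) (b : SymmForm L) (U : Y.Opens) :
    LinearMap.BilinForm Γ(Y, U) (TensorProduct Γ(Y, U) Γ(E, U) Γ(L, U)) :=
  LinearMap.BilinForm.tmul (q.form U) (b.form U)

lemma tensorSectionForm_tmul (q : SymmForm E) (b : SymmForm L) (x x' : Γ(E, U)) (s s' : Γ(L, U)) :
    tensorSectionForm q b U (TensorProduct.tmul _ x s) (TensorProduct.tmul _ x' s') =
      q.form U x x' * b.form U s s' := by
  simp [tensorSectionForm, mul_comm]

lemma tensorSectionForm_tres (q : SymmForm E) (b : SymmForm L) (h : V ≤ U)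
    (z w : TensorProduct Γ(Y, U) Γ(E, U) Γ(L, U)) :
    tensorSectionForm q b V (tres E L h z) (tres E L h w) =
      rres h (tensorSectionForm q b U z w) := by
  induction z using TensorProduct.induction_on with
  | zero => simp
  | add z z' hz hz' => simp only [map_add, LinearMap.add_apply, hz, hz']
  | tmul x s =>
    induction w using TensorProduct.induction_on with
    | zero => simp
    | add w w' hw hw' => simp only [map_add, hw, hw']
    | tmul x' s' =>
      rw [tres_tmul, tres_tmul, tensorSectionForm_tmul, tensorSectionForm_tmul, q.form_res,
        b.form_res, rres_mul]

lemma tensorSectionForm_symm (q : SymmForm E) (b : SymmForm L)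
    (z w : TensorProduct Γ(Y, U) Γ(E, U) Γ(L, U)) :
    tensorSectionForm q b U z w = tensorSectionForm q b U w z := by
  induction z using TensorProduct.induction_on with
  | zero => simp
  | add z z' hz hz' => simp only [map_add, LinearMap.add_apply, hz, hz']
  | tmul x s =>
    induction w using TensorProduct.induction_on with
    | zero => simp
    | add w w' hw hw' => simp only [map_add, LinearMap.add_apply, hw, hw']
    | tmul x' s' =>
      rw [tensorSectionForm_tmul, tensorSectionForm_tmul, q.symm, b.symm]

lemma tres_tres {W : Y.Opens} (h : W ≤ V) (h' : V ≤ U) (z : TensorProduct Γ(Y, U) Γ(E, U) Γ(L, U)) :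
    tres E L h (tres E L h' z) = tres E L (h.trans h') z := by
  induction z using TensorProduct.induction_on with
  | zero => simp
  | tmul a b => simp only [tres_tmul, res_res]
  | add z w hz hw => simp only [map_add, hz, hw]

lemma tensorSectionForm_congr (q : SymmForm E) (b : SymmForm L)
    {z z' w w' : TensorProduct Γ(Y, U) Γ(E, U) Γ(L, U)} (hz : tunit E L U z = tunit E L U z')
    (hw : tunit E L U w = tunit E L U w') :
    tensorSectionForm q b U z w = tensorSectionForm q b U z' w' := by
  refine function_ext _ _ fun y hy => ?_
  obtain ⟨V, hV, hyV, hz'⟩ := tunit_locally_injective E L _ _ hz hy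
  obtain ⟨W, hW, hyW, hw'⟩ := tunit_locally_injective E L _ _ hw hy
  refine ⟨V ⊓ W, inf_le_left.trans hV, ⟨hyV, hyW⟩, ?_⟩
  rw [← tensorSectionForm_tres, ← tensorSectionForm_tres, ← tres_tres inf_le_left hV z,
    ← tres_tres inf_le_right hW w, hz', hw', tres_tres, tres_tres]

lemma exists_isTensorForm (q : SymmForm E) (b : SymmForm L) :
    ∃ t : SymmForm (tensor E L), IsTensorForm q b t := by
  refine Exists.imp (fun t ht U x x' s s' => ht U _ _ _ ⟨TensorProduct.tmul _ x s,
    TensorProduct.tmul _ x' s', rfl, rfl, tensorSectionForm_tmul q b x x' s s'⟩)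
    (exists_symmForm_of_relation (E := tensor E L)
    (fun U m m' a => ∃ z w, tunit E L U z = m ∧ tunit E L U w = m' ∧
      tensorSectionForm q b U z w = a) ?_ ?_ ?_ ?_ ?_ ?_)
  · rintro U V h _ _ _ ⟨z, w, rfl, rfl, rfl⟩
    exact ⟨tres E L h z, tres E L h w, tunit_tres E L h z, tunit_tres E L h w,
      tensorSectionForm_tres q b h z w⟩
  · rintro U x y _ _ ⟨z, w, rfl, rfl, rfl⟩ ⟨z', w', hz, hw, rfl⟩
    exact tensorSectionForm_congr q b hz.symm hw.symm
  · intro U x y u hu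
    obtain ⟨V, hV, hyV, z, hz⟩ := tunit_locally_surjective E L x hu
    obtain ⟨W, hW, hyW, w, hw⟩ := tunit_locally_surjective E L y hu
    refine ⟨V ⊓ W, inf_le_left.trans hV, ⟨hyV, hyW⟩, _, tres E L inf_le_left z,
      tres E L inf_le_right w, ?_, ?_, rfl⟩
    · rw [tunit_tres, hz, res_res]
    · rw [tunit_tres, hw, res_res]
  · rintro U x x' y _ _ ⟨z, w, rfl, rfl, rfl⟩ ⟨z', w', rfl, hw, rfl⟩
    refine ⟨z + z', w, map_add _ _ _, rfl, ?_⟩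
    rw [map_add, LinearMap.add_apply, tensorSectionForm_congr q b (rfl : tunit E L U z' = _) hw]
  · rintro U r x y _ ⟨z, w, rfl, rfl, rfl⟩
    exact ⟨r • z, w, map_smul _ _ _, rfl, by simp⟩
  · rintro U x y _ ⟨z, w, rfl, rfl, rfl⟩
    exact ⟨w, z, rfl, rfl, tensorSectionForm_symm q b w z⟩

variable {q : SymmForm E} {b : SymmForm L} {t t' : SymmForm (tensor E L)}

/-- Two forms on `E ⊗ L` which agree on sections `a ⊗ b` are equal. -/
lemma IsTensorForm.unique (ht : IsTensorForm q b t) (ht' : IsTensorForm q b t') : t = t' := by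
  refine SymmForm.ext' (tensor_induction₂ ?_ ?_ ?_ ?_)
  · intro U m n H
    refine function_ext _ _ fun y hy => ?_
    obtain ⟨V, h, hyV, hV⟩ := H y hy
    exact ⟨V, h, hyV, by rwa [t.form_res, t'.form_res] at hV⟩
  · intro U a c a' c'
    rw [ht, ht']
  · intro U m m' n h h'
    rw [map_add, map_add, LinearMap.add_apply, LinearMap.add_apply, h, h']
  · intro U m n n' h h'
    rw [map_add, map_add, h, h']

lemma gram_tensor (ht : IsTensorForm q b t) {ι κ : Type*} (x : ι → Γ(E, U)) (l : κ → Γ(L, U)) :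
    gram t (fun i : ι × κ => tmul (x i.1) (l i.2)) =
      Matrix.kroneckerMap (· * ·) (gram q x) (gram b l) := by
  ext i j
  exact ht U _ _ _ _

/-- The tensor product of two symmetric bundles is a symmetric bundle. -/
lemma IsTensorForm.isSymmBundle (ht : IsTensorForm q b t) (hE : IsSymmBundle E q)
    (hL : IsSymmBundle L b) : IsSymmBundle (tensor E L) t := by
  have key : ∀ y : Y, ∃ (U : Y.Opens) (_ : y ∈ U) (ι : Type) (_ : Fintype ι) (_ : DecidableEq ι)
      (f : ι → Γ(tensor E L, U)), IsFrame (tensor E L) U f ∧ IsUnit (gram t f).det := by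
    intro y
    obtain ⟨U, hyU, n, x, hx⟩ := hE.isVectorBundle.exists_frame y
    obtain ⟨V, hyV, m, l, hl⟩ := hL.isVectorBundle.exists_frame y
    have hx' := hx.restrict (inf_le_left : U ⊓ V ≤ U)
    have hl' := hl.restrict (inf_le_right : U ⊓ V ≤ V)
    refine ⟨U ⊓ V, ⟨hyU, hyV⟩, Fin n × Fin m, inferInstance, inferInstance, _,
      hx'.tensorFrame hl', ?_⟩
    rw [gram_tensor ht (fun i => res E inf_le_left (x i)) (fun i => res L inf_le_right (l i)),
      Matrix.det_kronecker]
    exact ((hE.nondegenerate.isUnit_gram_det hx').pow _).mul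
      ((hL.nondegenerate.isUnit_gram_det hl').pow _)
  exact ⟨isVectorBundle_of_frames fun y => by
      obtain ⟨U, hy, ι, _, _, f, hf, -⟩ := key y
      exact ⟨U, hy, ι, inferInstance, f, hf⟩, SymmForm.nondegenerate_of_gram t key⟩

end TensorForm

/-! ### Invariants of a group action -/

section Invariants

variable {Y : Scheme.{u}} {T : Y.Modules} {G : Type v} [Finite G] (a : G → (T ⟶ T))

/-- Sections over an open set, as a functor to abelian groups. -/
noncomputable abbrev sectionsFunctor (V : Y.Opens) : Y.Modules ⥤ Ab.{u} :=
  Scheme.Modules.toPresheaf Y ⋙ (CategoryTheory.evaluation _ _).obj (op V)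

noncomputable instance (V : Y.Opens) : PreservesLimitsOfSize.{u, u} (sectionsFunctor V) :=
  have : PreservesLimitsOfSize.{u, u}
      ((CategoryTheory.evaluation Y.Opensᵒᵖ Ab.{u}).obj (op V)) :=
    ⟨evaluation_preservesLimitsOfShape _⟩
  comp_preservesLimits _ _

noncomputable instance (V : Y.Opens) : PreservesFiniteProducts (sectionsFunctor V) := by
  have : PreservesFiniteLimits (sectionsFunctor V) := PreservesLimitsOfSize.preservesFiniteLimits _
  infer_instance

instance (V : Y.Opens) : (sectionsFunctor V).Additive where
  map_add := rfl

lemma invariants.incl_comp (g : G) : invariants.incl a ≫ a g = invariants.incl a := by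
  have h := kernel.condition (Pi.lift fun g => a g - 𝟙 T) =≫ Pi.π _ g
  rw [Category.assoc, Pi.lift_π, zero_comp, Preadditive.comp_sub, Category.comp_id,
      sub_eq_zero] at h
  exact h

lemma invariants.app_incl (g : G) {V : Y.Opens} (x : Γ(invariants a, V)) :
    (a g).app V ((invariants.incl a).app V x) = (invariants.incl a).app V x :=
  congr(($(invariants.incl_comp a g)).app V x)

lemma invariants.incl_injective (V : Y.Opens) : Function.Injective ((invariants.incl a).app V) := by
  have : Mono ((sectionsFunctor V).map (invariants.incl a)) := by
    have : Mono (invariants.incl a) := inferInstanceAs (Mono (equalizer.ι _ _))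
    infer_instance
  exact (AddCommGrpCat.mono_iff_injective _).1 this

lemma invariants.exists_of_invariant {V : Y.Opens} {m : Γ(T, V)} (hm : ∀ g, (a g).app V m = m) :
    ∃ x : Γ(invariants a, V), (invariants.incl a).app V x = m := by
  let f := Pi.lift fun g => a g - 𝟙 T
  have hf : f.app V m = 0 := by
    refine Concrete.isLimit_ext _ (isLimitOfPreserves (sectionsFunctor V)
      (limit.isLimit (Discrete.functor fun _ : G => T))) _ _ fun ⟨g⟩ => ?_
    have h : f ≫ Pi.π _ g = a g - 𝟙 T := Pi.lift_π _ _
    have h2 := congr(($h).app V m)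
    refine h2.trans ?_
    rw [Scheme.Modules.Hom.sub_app]
    refine Eq.trans (b := (0 : Γ(T, V))) ?_ (map_zero (Scheme.Modules.Hom.app (Pi.π
        (fun _ : G => T) g) V).hom).symm
    change (a g).app V m - m = 0
    rw [hm, sub_self]
  have hk := (KernelFork.isLimitMapConeEquiv _ (sectionsFunctor V)) (isLimitOfPreserves
      (sectionsFunctor V) (kernelIsKernel f))
  have hex := ShortComplex.exact_of_f_is_kernel (ShortComplex.mk ((sectionsFunctor V).map
      (kernel.ι f)) ((sectionsFunctor V).map f) (by rw [← Functor.map_comp, kernel.condition,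
          Functor.map_zero])) hk
  exact (ShortComplex.ab_exact_iff _).1 hex m hf

end Invariants

/-! ### The norm form on the invariants -/

section Endo

variable {Y : Scheme.{u}} {T : Y.Modules} {U V : Y.Opens} {ι : Type*} [Fintype ι]
  {b : ι → Γ(T, U)}

/-- The endomorphism, over the open subsets of `U`, which sends a given frame `b` to given
sections. -/
noncomputable def IsFrame.endo (hb : IsFrame T U b) (v : ι → Γ(T, U)) (h : V ≤ U) :
    Γ(T, V) →ₗ[Γ(Y, V)] Γ(T, V) :=
  (hb.basis h).constr Γ(Y, V) fun i => res T h (v i)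

lemma IsFrame.endo_apply (hb : IsFrame T U b) (v : ι → Γ(T, U)) (h : V ≤ U) (s : Γ(T, V)) :
    hb.endo v h s = ∑ i, (hb.basis h).repr s i • res T h (v i) := by
  rw [endo, Module.Basis.constr_apply_fintype]
  rfl

lemma IsFrame.endo_frame (hb : IsFrame T U b) (v : ι → Γ(T, U)) (h : V ≤ U) (i : ι) :
    hb.endo v h (res T h (b i)) = res T h (v i) := by
  rw [endo, ← hb.basis_apply h, Module.Basis.constr_basis]

lemma IsFrame.endo_res (hb : IsFrame T U b) (v : ι → Γ(T, U)) {W : Y.Opens} (h : V ≤ U)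
    (h' : W ≤ V) (s : Γ(T, V)) :
    hb.endo v (h'.trans h) (res T h' s) = res T h' (hb.endo v h s) := by
  rw [endo_apply, endo_apply, res_sum_smul]
  simp only [hb.repr_res h h']

/-- The linear map on sections given by a morphism. -/
noncomputable def appL {E F : Y.Modules} (f : E ⟶ F)
    (V : Y.Opens) : Γ(E, V) →ₗ[Γ(Y, V)] Γ(F, V) where
  toFun := f.app V
  map_add' := map_add _
  map_smul' := Scheme.Modules.Hom.app_smul f

end Endo

section NormForm

lemma SymmForm.rres_form {Y : Scheme.{u}} {E : Y.Modules} {U V : Y.Opens} (q : SymmForm E)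
    (h : V ≤ U) (x y : Γ(E, U)) :
    rres h (q.form U x y) = q.form V (res E h x) (res E h y) :=
  (q.form_res h x y).symm

lemma DualSection.rres_toFun {Y : Scheme.{u}} {E : Y.Modules} {U V W : Y.Opens}
    (l : DualSection E U) (hV : V ≤ U) (h : W ≤ V) (x : Γ(E, V)) :
    rres h (l.toFun V hV x) = l.toFun W (h.trans hV) (res E h x) :=
  (l.toFun_res hV h x).symm

variable {Y : Scheme.{u}} {T : Y.Modules} {G : Type v} [Fintype G] (a : G → (T ⟶ T))
  {U V : Y.Opens}

/-- The norm `m ↦ ∑_g g m`. -/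
noncomputable def norm (V : Y.Opens) : Γ(T, V) →ₗ[Γ(Y, V)] Γ(T, V) := ∑ g, appL (a g) V

lemma norm_apply (m : Γ(T, V)) : norm a V m = ∑ g, (a g).app V m := by
  rw [norm, LinearMap.sum_apply]
  rfl

lemma norm_res (h : V ≤ U) (m : Γ(T, U)) : norm a V (res T h m) = res T h (norm a U m) := by
  rw [norm_apply, norm_apply, res_sum]
  exact Finset.sum_congr rfl fun g _ => app_res _ _ _

variable [Group G]

/-- Over `U` there is an endomorphism `γ` of `T`, given by the images `v` of the sections in a frame
`b`, such that `∑_g g γ g⁻¹ = 1`. -/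
def SplitsNorm {ι : Type*} [Fintype ι] (b v : ι → Γ(T, U)) : Prop :=
  ∃ hb : IsFrame T U b, ∀ i, ∑ g, (a g).app U (hb.endo v le_rfl ((a g⁻¹).app U (b i))) = b i

variable {a}

lemma SplitsNorm.sum_eq {ι : Type*} [Fintype ι] {b v : ι → Γ(T, U)} (H : SplitsNorm a b v)
    (h : V ≤ U) (x : Γ(T, V)) :
    ∑ g, (a g).app V (H.choose.endo v h ((a g⁻¹).app V x)) = x := by
  have key : ∑ g, appL (a g) V ∘ₗ H.choose.endo v h ∘ₗ appL (a g⁻¹) V = LinearMap.id := by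
    refine (H.choose.basis h).ext fun i => ?_
    rw [LinearMap.sum_apply, IsFrame.basis_apply, LinearMap.id_apply]
    conv_rhs => rw [← H.choose_spec i, res_sum]
    refine Finset.sum_congr rfl fun g _ => ?_
    rw [← app_res, ← IsFrame.endo_res, ← app_res]
    rfl
  have := congr($key x)
  rw [LinearMap.sum_apply] at this
  exact this

lemma SplitsNorm.restrict {ι : Type*} [Fintype ι] {b v : ι → Γ(T, U)} (H : SplitsNorm a b v)
    (h : V ≤ U) : SplitsNorm a (fun i => res T h (b i)) (fun i => res T h (v i)) := by
  refine ⟨H.choose.restrict h, fun i => ?_⟩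
  refine Eq.trans ?_ (H.sum_eq h (res T h (b i)))
  refine Finset.sum_congr rfl fun g _ => congrArg _ ?_
  rw [IsFrame.endo_apply, IsFrame.endo_apply, H.choose.basis_restrict h]
  simp only [res_self]

lemma SplitsNorm.norm_eq {ι : Type*} [Fintype ι] {b v : ι → Γ(T, U)} (H : SplitsNorm a b v)
    (h : V ≤ U) {x : Γ(T, V)} (hx : ∀ g, (a g).app V x = x) :
    norm a V (H.choose.endo v h x) = x := by
  conv_rhs => rw [← H.sum_eq h x]
  rw [norm_apply]
  simp only [hx]

lemma app_norm (hmul : ∀ g h, a (g * h) = a h ≫ a g) (g : G) (m : Γ(T, V)) :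
    (a g).app V (norm a V m) = norm a V m := by
  rw [norm_apply, map_sum]
  refine Fintype.sum_equiv (Equiv.mulLeft g) _ _ fun h => ?_
  rw [Equiv.coe_mulLeft, hmul]
  rfl

lemma norm_app (hmul : ∀ g h, a (g * h) = a h ≫ a g) (g : G) (m : Γ(T, V)) :
    norm a V ((a g).app V m) = norm a V m := by
  rw [norm_apply, norm_apply]
  refine Fintype.sum_equiv (Equiv.mulRight g) _ _ fun h => ?_
  rw [Equiv.coe_mulRight, hmul]
  rfl

/-- The norm, as a map to the invariants. -/
noncomputable def normLift (hmul : ∀ g h, a (g * h) = a h ≫ a g) (V : Y.Opens) :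
    Γ(T, V) →ₗ[Γ(Y, V)] Γ(invariants a, V) :=
  have hinj : Function.Injective (appL (invariants.incl a) V) := invariants.incl_injective a V
  (LinearEquiv.ofInjective _ hinj).symm.toLinearMap ∘ₗ (norm a V).codRestrict _ fun m =>
    invariants.exists_of_invariant a fun g => app_norm hmul g m

lemma incl_normLift (hmul : ∀ g h, a (g * h) = a h ≫ a g) (m : Γ(T, V)) :
    (invariants.incl a).app V (normLift hmul V m) = norm a V m := by
  have hinj : Function.Injective (appL (invariants.incl a) V) := invariants.incl_injective a V
  exact congr(($((LinearEquiv.ofInjective _ hinj).apply_symm_apply ⟨norm a V m,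
    invariants.exists_of_invariant a fun g => app_norm hmul g m⟩)).1)

lemma normLift_res (hmul : ∀ g h, a (g * h) = a h ≫ a g) (h : V ≤ U) (m : Γ(T, U)) :
    normLift hmul V (res T h m) = res _ h (normLift hmul U m) := by
  refine invariants.incl_injective a V ?_
  rw [incl_normLift, app_res, incl_normLift, norm_res]

/-- Near each point there is a frame of `T` which consists of a frame of the invariants and of
sections in the kernel of the projector `∑_g g γ` onto the invariants. -/
lemma exists_adapted_frame (hmul : ∀ g h, a (g * h) = a h ≫ a g) {n : ℕ} {b v : Fin n → Γ(T, U)}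
    (H : SplitsNorm a b v) {y : Y} (hy : y ∈ U) :
    ∃ (V : Y.Opens) (h : V ≤ U) (_ : y ∈ V) (I J : Type) (_ : Fintype I) (_ : Fintype J)
      (w : I → Γ(invariants a, V)) (z : J → Γ(T, V)),
      IsFrame T V (Sum.elim (fun i => (invariants.incl a).app V (w i)) z) ∧
      ∀ j, norm a V (H.choose.endo v h (z j)) = 0 := by
  classical
  set γ := H.choose.endo v (le_refl U) with hγ
  -- each `b i` is the sum of its image under the projector `∑_g g γ` and of a section in the
  -- kernel; by Nakayama some of these sections form a frame near `y`
  obtain ⟨s, hs, V, h, hyV, hf⟩ := H.choose.exists_subframe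
    (Sum.elim (fun i => norm a U (γ (b i))) fun i => b i - norm a U (γ (b i))) (fun i => by
      have h1 := Submodule.subset_span (R := Γ(Y, U)) (Set.mem_range_self (f := Sum.elim
        (fun i => norm a U (γ (b i))) fun i => b i - norm a U (γ (b i))) (Sum.inl i))
      have h2 := Submodule.subset_span (R := Γ(Y, U)) (Set.mem_range_self (f := Sum.elim
        (fun i => norm a U (γ (b i))) fun i => b i - norm a U (γ (b i))) (Sum.inr i))
      have := Submodule.add_mem _ h1 h2
      rwa [Sum.elim_inl, Sum.elim_inr, add_sub_cancel] at this) hy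
  -- separate the invariant sections of the frame from those in the kernel
  let I := {i : Fin n // ∃ k, s i = Sum.inl k}
  let J := {i : Fin n // ¬ ∃ k, s i = Sum.inl k}
  have hI : ∀ i : I, ∃ k, s i.1 = Sum.inl k := fun i => i.2
  have hJ : ∀ j : J, ∃ k, s j.1 = Sum.inr k := fun j => by
    rcases h : s j.1 with k | k
    · exact absurd ⟨k, h⟩ j.2
    · exact ⟨k, rfl⟩
  choose kI hkI using hI
  choose kJ hkJ using hJ
  refine ⟨V, h, hyV, I, J, inferInstance, inferInstance,
    fun i => res _ h (normLift hmul U (γ (b (kI i)))),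
    fun j => res T h (b (kJ j) - norm a U (γ (b (kJ j)))), ?_, fun j => ?_⟩
  · convert hf.reindex (Equiv.sumCompl fun i => ∃ k, s i = Sum.inl k) using 1
    funext i
    rcases i with i | j
    · change _ = res T h (Sum.elim _ _ (s i.1))
      rw [hkI, Sum.elim_inl, Sum.elim_inl, app_res, incl_normLift]
    · change _ = res T h (Sum.elim _ _ (s j.1))
      rw [hkJ]
      rfl
  · rw [H.choose.endo_res v le_rfl h, norm_res, map_sub, map_sub,
      H.norm_eq le_rfl fun g => app_norm hmul g _, sub_self, res_zero]

/-- The sections of an adapted frame which are invariant form a frame of the invariants. -/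
lemma isFrame_invariants {ι : Type*} [Fintype ι]
    {b v : ι → Γ(T, U)} (H : SplitsNorm a b v) (h : V ≤ U) {I J : Type*} [Fintype I] [Fintype J]
    {w : I → Γ(invariants a, V)} {z : J → Γ(T, V)}
    (hf : IsFrame T V (Sum.elim (fun i => (invariants.incl a).app V (w i)) z))
    (hz : ∀ j, norm a V (H.choose.endo v h (z j)) = 0) : IsFrame (invariants a) V w := by
  have expand : ∀ (W : Y.Opens) (hW : W ≤ V) (c : I → Γ(Y, W)),
      (invariants.incl a).app W (∑ i, c i • res _ hW (w i)) =
        ∑ i, c i • res T hW ((invariants.incl a).app V (w i)) := by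
    intro W hW c
    rw [map_sum]
    exact Finset.sum_congr rfl fun i _ => by rw [Scheme.Modules.Hom.app_smul, app_res]
  intro W hW x
  obtain ⟨c, hc, -⟩ := hf W hW ((invariants.incl a).app W x)
  refine ⟨fun i => c (Sum.inl i), invariants.incl_injective a W ?_, fun c' hc' => ?_⟩
  · rw [expand, ← H.norm_eq (hW.trans h) fun g => invariants.app_incl a g x, hc,
      Fintype.sum_sum_type, map_add, map_add, map_sum, map_sum, map_sum, map_sum]
    conv_rhs => rw [← add_zero (∑ i, _)]
    congr 1
    · refine Finset.sum_congr rfl fun i _ => ?_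
      rw [map_smul, map_smul, Sum.elim_inl, H.choose.endo_res v h hW, norm_res,
        H.norm_eq h fun g => invariants.app_incl a g _]
    · refine Finset.sum_eq_zero fun j _ => ?_
      rw [map_smul, map_smul, Sum.elim_inr, H.choose.endo_res v h hW, norm_res, hz, res_zero,
        smul_zero]
  · have := (hf W hW ((invariants.incl a).app W x)).unique hc
      (y₂ := Sum.elim c' 0) (by
        rw [hc', expand, Fintype.sum_sum_type]
        simp)
    rw [this]
    rfl

section Form

variable {t : SymmForm T}

lemma form_norm_left (hmul : ∀ g h, a (g * h) = a h ≫ a g) (hone : a 1 = 𝟙 T)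
    (ht : ∀ g (U : Y.Opens) (x y : Γ(T, U)), t.form U ((a g).app U x)
        ((a g).app U y) = t.form U x y)
    (m n : Γ(T, V)) : t.form V (norm a V m) n = t.form V m (norm a V n) := by
  rw [norm_apply, norm_apply, map_sum, map_sum, LinearMap.sum_apply]
  refine Fintype.sum_equiv (Equiv.inv G) _ _ fun g => ?_
  rw [← ht g⁻¹ V _ n]
  congr 2
  have : a g ≫ a g⁻¹ = 𝟙 T := by rw [← hmul, inv_mul_cancel, hone]
  exact congr(($this).app V m)

/-- The norm form on the invariants: its value at `(x, y)` is `t(m, y)` if `x = ∑_g g m`. -/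
def IsNormForm (a : G → (T ⟶ T)) (t : SymmForm T) (qX : SymmForm (invariants a)) : Prop :=
  ∀ (U : Y.Opens) (x y : Γ(invariants a, U)) (m : Γ(T, U)),
    (invariants.incl a).app U x = norm a U m →
      qX.form U x y = t.form U m ((invariants.incl a).app U y)

lemma exists_normForm (hmul : ∀ g h, a (g * h) = a h ≫ a g) (hone : a 1 = 𝟙 T)
    (ht : ∀ g (U : Y.Opens) (x y : Γ(T, U)), t.form U ((a g).app U x)
        ((a g).app U y) = t.form U x y)
    (H : ∀ y : Y, ∃ (U : Y.Opens) (_ : y ∈ U) (n : ℕ) (b v : Fin n → Γ(T, U)), SplitsNorm a b v) :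
    ∃ qX : SymmForm (invariants a), IsNormForm a t qX := by
  have loc : ∀ (U : Y.Opens) (x : Γ(invariants a, U)), ∀ z ∈ U, ∃ (V : Y.Opens) (h : V ≤ U),
      z ∈ V ∧ ∃ m, (invariants.incl a).app V (res _ h x) = norm a V m := by
    intro U x z hz
    obtain ⟨V, hzV, n, b, v, hbv⟩ := H z
    exact ⟨U ⊓ V, inf_le_left, ⟨hz, hzV⟩, _, (hbv.norm_eq inf_le_right fun g =>
      invariants.app_incl a g _).symm⟩
  have swap := fun {V : Y.Opens} => form_norm_left (V := V) hmul hone ht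
  refine Exists.imp (fun qX hq U x y m hm => ?_) (exists_symmForm_of_relation (E := invariants a)
    (fun U x y c => ∃ m n, (invariants.incl a).app U x = norm a U m ∧
      (invariants.incl a).app U y = norm a U n ∧
      c = t.form U m ((invariants.incl a).app U y)) ?_ ?_ ?_ ?_ ?_ ?_)
  · refine function_ext _ _ fun z hz => ?_
    obtain ⟨V, h, hzV, n, hn⟩ := loc U y z hz
    refine ⟨V, h, hzV, ?_⟩
    have := hq V (res _ h x) (res _ h y) _ ⟨res T h m, n, by rw [app_res, hm, norm_res], hn, rfl⟩
    rwa [qX.form_res, app_res, t.form_res] at this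
  · rintro U V h x y _ ⟨m, n, hm, hn, rfl⟩
    refine ⟨res T h m, res T h n, ?_, ?_, ?_⟩
    · rw [app_res, hm, norm_res]
    · rw [app_res, hn, norm_res]
    · rw [app_res, t.form_res]
  · rintro U x y _ _ ⟨m, n, hm, hn, rfl⟩ ⟨m', n', hm', hn', rfl⟩
    rw [hn, ← swap, ← swap, ← hm, ← hm']
  · intro U x y z hz
    obtain ⟨V, hV, hzV, m, hm⟩ := loc U x z hz
    obtain ⟨W, hW, hzW, n, hn⟩ := loc U y z hz
    refine ⟨V ⊓ W, inf_le_left.trans hV, ⟨hzV, hzW⟩, _, res T inf_le_left m, res T inf_le_right n,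
      ?_, ?_, rfl⟩
    · rw [norm_res, ← hm, ← app_res, res_res]
    · rw [norm_res, ← hn, ← app_res, res_res]
  · rintro U x x' y _ _ ⟨m, n, hm, hn, rfl⟩ ⟨m', n', hm', hn', rfl⟩
    exact ⟨m + m', n, by rw [map_add, map_add, hm, hm'], hn, by
      rw [map_add, LinearMap.add_apply]⟩
  · rintro U r x y _ ⟨m, n, hm, hn, rfl⟩
    exact ⟨r • m, n, by rw [Scheme.Modules.Hom.app_smul, hm, map_smul], hn, by
      rw [map_smul, LinearMap.smul_apply, smul_eq_mul]⟩
  · rintro U x y _ ⟨m, n, hm, hn, rfl⟩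
    exact ⟨n, m, hn, hm, by rw [hn, hm, ← swap, t.symm]⟩

lemma IsNormForm.unique {q₁ q₂ : SymmForm (invariants a)} (h₁ : IsNormForm a t q₁)
    (h₂ : IsNormForm a t q₂)
    (H : ∀ y : Y, ∃ (U : Y.Opens) (_ : y ∈ U) (n : ℕ) (b v : Fin n → Γ(T, U)), SplitsNorm a b v) :
    q₁ = q₂ := by
  refine SymmForm.ext' fun U x y => function_ext _ _ fun z hz => ?_
  obtain ⟨V, hzV, n, b, v, hbv⟩ := H z
  refine ⟨U ⊓ V, inf_le_left, ⟨hz, hzV⟩, ?_⟩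
  have := (hbv.norm_eq inf_le_right fun g =>
    invariants.app_incl a g (res _ (inf_le_left : U ⊓ V ≤ U) x)).symm
  rw [q₁.rres_form, q₂.rres_form, h₁ _ _ _ _ this, h₂ _ _ _ _ this]

lemma IsNormForm.isSymmBundle {qX : SymmForm (invariants a)} (hq : IsNormForm a t qX)
    (hT : t.Nondegenerate) (hmul : ∀ g h, a (g * h) = a h ≫ a g) (hone : a 1 = 𝟙 T)
    (ht : ∀ g (U : Y.Opens) (x y : Γ(T, U)), t.form U ((a g).app U x)
        ((a g).app U y) = t.form U x y)
    (H : ∀ y : Y, ∃ (U : Y.Opens) (_ : y ∈ U) (n : ℕ) (b v : Fin n → Γ(T, U)), SplitsNorm a b v) :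
    IsSymmBundle (invariants a) qX := by
  refine ⟨isVectorBundle_of_frames fun y => ?_, fun U l => ?_⟩
  · obtain ⟨U, hy, n, b, v, hbv⟩ := H y
    obtain ⟨V, h, hyV, I, J, _, _, w, z, hf, hz⟩ := exists_adapted_frame hmul hbv hy
    exact ⟨V, hyV, I, inferInstance, w, isFrame_invariants hbv h hf hz⟩
  · let l' : DualSection T U := ⟨fun V h => l.toFun V h ∘ₗ normLift hmul V, fun hV h x => by
      rw [LinearMap.comp_apply, LinearMap.comp_apply, normLift_res, l.toFun_res]⟩
    obtain ⟨u, hu, huniq⟩ := hT U l'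
    have hinv : ∀ g, (a g).app U u = u := fun g => huniq _ fun V h m => by
      rw [← app_res, ← ht g⁻¹]
      have h1 : a g ≫ a g⁻¹ = 𝟙 T := by rw [← hmul, inv_mul_cancel, hone]
      have h2 : (a g⁻¹).app V ((a g).app V (res T h u)) = res T h u :=
        congr(($h1).app V (res T h u))
      rw [h2, hu]
      change l.toFun V h (normLift hmul V _) = l.toFun V h (normLift hmul V _)
      congr 1
      refine invariants.incl_injective a V ?_
      rw [incl_normLift, incl_normLift, norm_app hmul]
    obtain ⟨x, hx⟩ := invariants.exists_of_invariant a hinv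
    refine ⟨x, fun V h y => ?_, fun x' hx' => invariants.incl_injective a U ?_⟩
    · refine function_ext _ _ fun z hz => ?_
      obtain ⟨W, hzW, n, b, v, hbv⟩ := H z
      have hy := (hbv.norm_eq inf_le_right fun g =>
        invariants.app_incl a g (res _ (inf_le_left : V ⊓ W ≤ V) y)).symm
      set m := hbv.choose.endo v (inf_le_right : V ⊓ W ≤ W)
        ((invariants.incl a).app (V ⊓ W) (res _ (inf_le_left : V ⊓ W ≤ V) y))
      refine ⟨V ⊓ W, inf_le_left, ⟨hz, hzW⟩, ?_⟩
      rw [qX.rres_form, l.rres_toFun h, res_res, qX.symm, hq _ _ _ _ hy, app_res, hx, t.symm,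
        hu]
      change l.toFun _ _ (normLift hmul _ m) = _
      congr 1
      refine invariants.incl_injective a _ ?_
      rw [incl_normLift, hy]
    · rw [hx]
      refine huniq _ fun V h m => ?_
      rw [← app_res, t.symm, ← hq V (normLift hmul V m) _ m (incl_normLift hmul m), qX.symm, hx']
      rfl

end Form

end NormForm

/-! ### Frames of pull-backs -/

section OpenPush

variable {Y : Scheme.{u}} (U : Y.Opens)

/-- The sheaf `j_* j^* F`, where `j` is the inclusion of the open subset `U`; its sections over `W`
are those of `F` over `U ∩ W`. -/
noncomputable def openPush (F : Y.Modules) : Y.Modules :=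
  (Scheme.Modules.restrictFunctor U.ι ⋙ Scheme.Modules.pushforward U.ι).obj F

/-- The intersection `U ∩ W`, in the form in which it occurs in `openPush`. -/
noncomputable abbrev openInter (W : Y.Opens) : Y.Opens := U.ι ''ᵁ U.ι ⁻¹ᵁ W

lemma openInter_eq (W : Y.Opens) : openInter U W = U ⊓ W := by
  simp [openInter, Scheme.Hom.image_preimage_eq_opensRange_inf]

lemma openInter_le (W : Y.Opens) : openInter U W ≤ W := by
  rw [openInter_eq]; exact inf_le_right

lemma openInter_le' (W : Y.Opens) : openInter U W ≤ U := by
  rw [openInter_eq]; exact inf_le_left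

lemma openInter_mono {W W' : Y.Opens} (h : W ≤ W') : openInter U W ≤ openInter U W' := by
  rw [openInter_eq, openInter_eq]; exact inf_le_inf_left _ h

/-- A section of `F` over `U ∩ W`, as a section of `openPush U F` over `W`. -/
def toPush {F : Y.Modules} {W : Y.Opens} (s : Γ(F, openInter U W)) : Γ(openPush U F, W) := s

lemma res_toPush {F : Y.Modules} {W W' : Y.Opens} (h : W' ≤ W) (s : Γ(F, openInter U W)) :
    res (openPush U F) h (toPush U s) = toPush U (res F (openInter_mono U h) s) := rfl

lemma smul_toPush {F : Y.Modules} {W : Y.Opens} (r : Γ(Y, W)) (s : Γ(F, openInter U W)) :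
    r • (toPush U s) = toPush U (rres (openInter_le U W) r • s) := by
  have : U.ι.app W = Y.presheaf.map (homOfLE (openInter_le U W)).op := Scheme.Opens.ι_app U W
  change (show Γ(Y, openInter U W) from (U.ι.appIso _).inv (U.ι.app W r)) • s =
    rres (openInter_le U W) r • s
  rw [this, Scheme.Opens.ι_appIso]
  rfl

/-- The structure sheaf as a sheaf of modules. -/
noncomputable def structureModule (Y : Scheme.{u}) : Y.Modules := SheafOfModules.unit Y.ringCatSheaf

/-- A function, as a section of the structure sheaf. -/
def toStructure {W : Y.Opens} (s : Γ(Y, W)) : Γ(structureModule Y, W) := s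

/-- A section of the structure sheaf, as a function. -/
def ofStructure {W : Y.Opens} (s : Γ(structureModule Y, W)) : Γ(Y, W) := s

lemma res_toStructure {W W' : Y.Opens} (h : W' ≤ W) (s : Γ(Y, W)) :
    res (structureModule Y) h (toStructure s) = toStructure (rres h s) := rfl

lemma smul_toStructure {W : Y.Opens} (r s : Γ(Y, W)) :
    r • toStructure s = toStructure (r * s) := rfl

end OpenPush

section Pullback

variable {Y Z : Scheme.{u}} {φ : Z ⟶ Y} {E : Y.Modules} {M : Z.Modules} {U V : Y.Opens}

/-- A morphism to a direct image from compatible maps on sections. -/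
noncomputable def pushMk (f : ∀ V : Y.Opens, Γ(E, V) →+ Γ(M, φ ⁻¹ᵁ V))
    (hsmul : ∀ V (r : Γ(Y, V)) (s : Γ(E, V)), f V (r • s) = φ.app V r • f V s)
    (hf : ∀ {U V : Y.Opens} (h : V ≤ U) (s : Γ(E, U)),
      f V (res E h s) = res M (φ.preimage_mono h) (f U s)) :
    E ⟶ (Scheme.Modules.pushforward φ).obj M :=
  homMk (fun V => { toFun := f V, map_add' := map_add (f V), map_smul' := hsmul V }) hf

variable (η : E ⟶ (Scheme.Modules.pushforward φ).obj M)

lemma along_res (h : V ≤ U) (s : Γ(E, U)) :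
    along η (res E h s) = res M (φ.preimage_mono h) (along η s) :=
  app_res η h s

lemma along_smul (r : Γ(Y, V)) (s : Γ(E, V)) : along η (r • s) = φ.app V r • along η s :=
  Scheme.Modules.Hom.app_smul η r s

lemma along_add (s t : Γ(E, V)) : along η (s + t) = along η s + along η t :=
  map_add (η.app V).hom s t

lemma along_sum {ι : Type*} (t : Finset ι) (s : ι → Γ(E, V)) :
    along η (∑ i ∈ t, s i) = ∑ i ∈ t, along η (s i) :=
  map_sum (η.app V).hom s t

/-- The morphism `φ^* E → M` adjoint to `E → φ_* M`. -/
noncomputable def pullbackDesc : (Scheme.Modules.pullback φ).obj E ⟶ M :=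
  ((Scheme.Modules.pullbackPushforwardAdjunction φ).homEquiv E M).symm η

lemma unitMap_pullbackDesc :
    unitMap φ E ≫ (Scheme.Modules.pushforward φ).map (pullbackDesc η) = η := by
  have h1 := ((Scheme.Modules.pullbackPushforwardAdjunction φ).homEquiv E M).apply_symm_apply η
  rwa [Adjunction.homEquiv_unit] at h1

lemma pullbackDesc_along (s : Γ(E, V)) :
    (pullbackDesc η).app (φ ⁻¹ᵁ V) (along (unitMap φ E) s) = along η s :=
  congr(($(unitMap_pullbackDesc η)).app V s)

lemma pullback_hom_ext {f g : (Scheme.Modules.pullback φ).obj E ⟶ M}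
    (h : ∀ (V : Y.Opens) (s : Γ(E, V)), f.app (φ ⁻¹ᵁ V) (along (unitMap φ E) s) =
      g.app (φ ⁻¹ᵁ V) (along (unitMap φ E) s)) : f = g := by
  refine ((Scheme.Modules.pullbackPushforwardAdjunction φ).homEquiv E M).injective ?_
  rw [Adjunction.homEquiv_unit, Adjunction.homEquiv_unit]
  ext V s
  exact h V s

lemma app_rres (h : V ≤ U) (r : Γ(Y, U)) :
    φ.app V (rres h r) = rres (φ.preimage_mono h) (φ.app U r) :=
  congr(($(φ.naturality (homOfLE h).op)).hom r)

variable {ι : Type*} [Fintype ι]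

/-- The coordinate `φ^* E → j_* 𝒪`, over the inverse image of `U`, given by a frame of `E`. -/
noncomputable def IsFrame.pullbackCoord {b : ι → Γ(E, U)} (hb : IsFrame E U b) (φ : Z ⟶ Y) (i : ι) :
    (Scheme.Modules.pullback φ).obj E ⟶ openPush (φ ⁻¹ᵁ U) (structureModule Z) :=
  have hle : ∀ V : Y.Opens, openInter (φ ⁻¹ᵁ U) (φ ⁻¹ᵁ V) ≤ φ ⁻¹ᵁ (U ⊓ V) := fun V =>
    (openInter_eq _ _).le
  pullbackDesc (pushMk (fun V =>
    { toFun := fun s => toPush (φ ⁻¹ᵁ U) (toStructure (rres (hle V) (φ.app _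
        ((hb.basis (inf_le_left : U ⊓ V ≤ U)).repr (res E inf_le_right s) i))))
      map_zero' := by
        simp only [map_zero, Finsupp.zero_apply]; rfl
      map_add' := fun s t => by
        rw [res_add, map_add, Finsupp.add_apply, map_add, rres_add]; rfl })
    (fun V r s => by
      simp only [AddMonoidHom.coe_mk, ZeroHom.coe_mk]
      rw [smul_toPush, smul_toStructure, res_smul, map_smul, Finsupp.smul_apply, smul_eq_mul,
        map_mul, rres_mul, app_rres, rres_rres])
    (fun {A B} h s => by
      simp only [AddMonoidHom.coe_mk, ZeroHom.coe_mk]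
      rw [res_toPush, res_toStructure, res_res, ← res_res E inf_le_right
        (inf_le_inf_left U h : U ⊓ B ≤ U ⊓ A), hb.repr_res inf_le_left (inf_le_inf_left U h),
        app_rres, rres_rres, rres_rres]))

/-- The coordinates, over the inverse image of `U`, of a section of `φ^* E`. -/
noncomputable def IsFrame.pullbackCoordFun {b : ι → Γ(E, U)} (hb : IsFrame E U b) (φ : Z ⟶ Y)
    (i : ι) {W : Z.Opens} (x : Γ((Scheme.Modules.pullback φ).obj E, W)) :
    Γ(Z, openInter (φ ⁻¹ᵁ U) W) :=
  ofStructure ((hb.pullbackCoord φ i).app W x : Γ(openPush (φ ⁻¹ᵁ U) (structureModule Z), W))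

lemma IsFrame.pullbackCoordFun_along {b : ι → Γ(E, U)} (hb : IsFrame E U b) (i : ι)
    (s : Γ(E, V)) :
    hb.pullbackCoordFun φ i (along (unitMap φ E) s) =
      rres (V := openInter (φ ⁻¹ᵁ U) (φ ⁻¹ᵁ V)) (U := φ ⁻¹ᵁ (U ⊓ V)) (openInter_eq _ _).le
        (φ.app _ ((hb.basis (inf_le_left : U ⊓ V ≤ U)).repr (res E inf_le_right s) i)) :=
  pullbackDesc_along _ s

lemma IsFrame.pullbackCoordFun_add {b : ι → Γ(E, U)} (hb : IsFrame E U b) (i : ι) {W : Z.Opens}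
    (x y : Γ((Scheme.Modules.pullback φ).obj E, W)) :
    hb.pullbackCoordFun φ i (x + y) = hb.pullbackCoordFun φ i x + hb.pullbackCoordFun φ i y :=
  map_add ((hb.pullbackCoord φ i).app W).hom x y

lemma IsFrame.pullbackCoordFun_smul {b : ι → Γ(E, U)} (hb : IsFrame E U b) (i : ι) {W : Z.Opens}
    (r : Γ(Z, W)) (x : Γ((Scheme.Modules.pullback φ).obj E, W)) :
    hb.pullbackCoordFun φ i (r • x) =
      rres (openInter_le _ W) r * hb.pullbackCoordFun φ i x :=
  (Scheme.Modules.Hom.app_smul (hb.pullbackCoord φ i) r x).trans (smul_toPush _ r _)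

lemma IsFrame.pullbackCoordFun_res {b : ι → Γ(E, U)} (hb : IsFrame E U b) (i : ι) {W W' : Z.Opens}
    (h : W' ≤ W) (x : Γ((Scheme.Modules.pullback φ).obj E, W)) :
    hb.pullbackCoordFun φ i (res _ h x) =
      rres (openInter_mono _ h) (hb.pullbackCoordFun φ i x) :=
  app_res (hb.pullbackCoord φ i) h x

/-- A section of `φ^* E` is the combination of the inverse images of the sections in a frame of `E`
with the coordinates given by `IsFrame.pullbackCoordFun`: both sides are morphisms on `φ^* E`, and
they agree on inverse images of sections. -/
lemma IsFrame.sum_pullbackCoordFun {b : ι → Γ(E, U)} (hb : IsFrame E U b) {W : Z.Opens}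
    (x : Γ((Scheme.Modules.pullback φ).obj E, W)) :
    ∑ i, hb.pullbackCoordFun φ i x • res _ (openInter_le' _ W) (along (unitMap φ E) (b i)) =
      res _ (openInter_le (φ ⁻¹ᵁ U) W) x := by
  let F := (Scheme.Modules.pullback φ).obj E
  let U' := φ ⁻¹ᵁ U
  let d : F ⟶ openPush U' F := homMk (fun W =>
    { toFun := fun x => toPush U' (∑ i, hb.pullbackCoordFun φ i x •
        res F (openInter_le' U' W) (along (unitMap φ E) (b i)))
      map_add' := fun x y => by
        simp only [hb.pullbackCoordFun_add, add_smul, Finset.sum_add_distrib]; rfl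
      map_smul' := fun r x => by
        rw [RingHom.id_apply, smul_toPush, Finset.smul_sum]
        simp only [hb.pullbackCoordFun_smul, mul_smul] })
    (fun {A B} h x => by
      simp only [LinearMap.coe_mk, AddHom.coe_mk]
      rw [res_toPush, res_sum]
      refine congrArg (toPush U') (Finset.sum_congr rfl fun i _ => ?_)
      rw [res_smul, res_res]
      exact congrArg (· • _) (hb.pullbackCoordFun_res i h x))
  let r : F ⟶ openPush U' F := homMk (fun W =>
    { toFun := fun x => toPush U' (res F (openInter_le U' W) x)
      map_add' := fun x y => by rw [res_add]; rfl
      map_smul' := fun r x => by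
        rw [RingHom.id_apply, smul_toPush, res_smul] })
    (fun {A B} h x => by
      simp only [LinearMap.coe_mk, AddHom.coe_mk]
      rw [res_toPush, res_res, res_res])
  have hdr : d = r := by
    refine pullback_hom_ext fun V s => ?_
    change toPush U' (∑ i, hb.pullbackCoordFun φ i (along (unitMap φ E) s) •
      res F (openInter_le' U' _) (along (unitMap φ E) (b i))) =
        toPush U' (res F (openInter_le U' _) (along (unitMap φ E) s))
    congr 1
    have hle : openInter U' (φ ⁻¹ᵁ V) ≤ φ ⁻¹ᵁ (U ⊓ V) := (openInter_eq _ _).le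
    have h1 : res F (openInter_le U' _) (along (unitMap φ E) s) =
        res F hle (along (unitMap φ E) (res E (inf_le_right : U ⊓ V ≤ V) s)) := by
      rw [along_res, res_res]
    rw [h1]
    conv_rhs =>
      rw [← (hb.basis (inf_le_left : U ⊓ V ≤ U)).sum_repr (res E inf_le_right s)]
    rw [along_sum, res_sum]
    refine Finset.sum_congr rfl fun i _ => ?_
    rw [along_smul, res_smul, hb.basis_apply, along_res, res_res, hb.pullbackCoordFun_along]
  exact congr(($hdr).app W x)

/-- The inverse images of the sections in a frame form a frame. -/
lemma IsFrame.pullback {b : ι → Γ(E, U)} (hb : IsFrame E U b) (φ : Z ⟶ Y) :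
    IsFrame ((Scheme.Modules.pullback φ).obj E) (φ ⁻¹ᵁ U)
      fun i => along (unitMap φ E) (b i) := by
  classical
  let F := (Scheme.Modules.pullback φ).obj E
  intro W h x
  have hW : W ≤ openInter (φ ⁻¹ᵁ U) W := by rw [openInter_eq]; exact le_inf h le_rfl
  have hone : ∀ i j, rres hW (hb.pullbackCoordFun φ i (res F h (along (unitMap φ E) (b j)))) =
      if i = j then 1 else 0 := by
    intro i j
    have h1 : (hb.basis (inf_le_left : U ⊓ U ≤ U)).repr (res E inf_le_right (b j)) i =
        if i = j then 1 else 0 := by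
      rw [← hb.basis_apply (inf_le_left : U ⊓ U ≤ U), Module.Basis.repr_self,
        Finsupp.single_apply]
      simp only [eq_comm]
    rw [hb.pullbackCoordFun_res, hb.pullbackCoordFun_along, h1]
    split_ifs
    · simp only [map_one]
    · simp only [map_zero]
  refine ⟨fun i => rres hW (hb.pullbackCoordFun φ i x), ?_, fun c hc => ?_⟩
  · have := congr(res F hW $(hb.sum_pullbackCoordFun x))
    rw [res_res, res_self, res_sum] at this
    refine this.symm.trans (Finset.sum_congr rfl fun i _ => ?_)
    rw [res_smul, res_res]
  · funext i
    have hsum : hb.pullbackCoordFun φ i x =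
        ∑ j, rres (openInter_le _ W) (c j) *
          hb.pullbackCoordFun φ i (res F h (along (unitMap φ E) (b j))) := by
      rw [hc]
      simp only [← hb.pullbackCoordFun_smul]
      exact map_sum (⟨⟨fun x => hb.pullbackCoordFun φ i x, map_zero
        ((hb.pullbackCoord φ i).app W).hom⟩, hb.pullbackCoordFun_add i⟩ : _ →+ _) _ _
    rw [hsum, rres_sum]
    simp only [rres_mul, hone, rres_rres, mul_ite, mul_one, mul_zero]
    rw [Finset.sum_ite_eq, if_pos (Finset.mem_univ i), rres_self]

end Pullback

/-! ### Base change of modules and forms -/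

section Framed

variable {Y Z : Scheme.{u}} {φ : Z ⟶ Y} {E L : Y.Modules} {E' L' M : Z.Modules} {U V : Y.Opens}

/-- A morphism `η : E → φ_* E'` which, near each point of `Y`, takes some frame of `E` to a frame
of `E'`. Equivalently, `E` is a vector bundle and the adjoint `φ^* E → E'` is an isomorphism. -/
def IsFramed (η : E ⟶ (Scheme.Modules.pushforward φ).obj E') : Prop :=
  ∀ y : Y, ∃ (U : Y.Opens) (_ : y ∈ U) (n : ℕ) (b : Fin n → Γ(E, U)),
    IsFrame E U b ∧ IsFrame E' (φ ⁻¹ᵁ U) fun i => along η (b i)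

lemma isFramed_unitMap (hE : IsVectorBundle E) (φ : Z ⟶ Y) : IsFramed (unitMap φ E) := by
  intro y
  obtain ⟨U, hy, n, b, hb⟩ := hE.exists_frame y
  exact ⟨U, hy, n, b, hb, hb.pullback φ⟩

variable {η : E ⟶ (Scheme.Modules.pushforward φ).obj E'}

lemma IsFramed.isIso (hη : IsFramed η) : IsIso (pullbackDesc η) := by
  refine isIso_of_frames _ fun z => ?_
  obtain ⟨U, hU, n, b, hb, hb'⟩ := hη (φ z)
  refine ⟨φ ⁻¹ᵁ U, hU, Fin n, inferInstance, _, hb.pullback φ, ?_⟩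
  simpa only [pullbackDesc_along] using hb'

/-- A framed morphism takes every frame to a frame. -/
lemma IsFramed.isFrame (hη : IsFramed η) {ι : Type*} [Fintype ι] {b : ι → Γ(E, U)}
    (hb : IsFrame E U b) : IsFrame E' (φ ⁻¹ᵁ U) fun i => along η (b i) := by
  have := hη.isIso
  simpa only [pullbackDesc_along] using (hb.pullback φ).map_isIso (pullbackDesc η)

lemma IsFramed.isVectorBundle (hη : IsFramed η) : IsVectorBundle E' :=
  isVectorBundle_of_frames fun z => by
    obtain ⟨U, hU, n, b, hb, hb'⟩ := hη (φ z)
    exact ⟨φ ⁻¹ᵁ U, hU, Fin n, inferInstance, _, hb'⟩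

lemma IsFramed.hom_ext (hη : IsFramed η) {f g : E' ⟶ M}
    (h : ∀ (V : Y.Opens) (s : Γ(E, V)), f.app (φ ⁻¹ᵁ V) (along η s) =
      g.app (φ ⁻¹ᵁ V) (along η s)) : f = g := by
  have := hη.isIso
  rw [← cancel_epi (pullbackDesc η)]
  refine pullback_hom_ext fun V s => ?_
  have := h V s
  rwa [← pullbackDesc_along] at this

/-- A morphism `E → φ_* M` factors through a framed morphism `E → φ_* E'`. -/
lemma IsFramed.exists_lift (hη : IsFramed η) (ψ : E ⟶ (Scheme.Modules.pushforward φ).obj M) :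
    ∃ f : E' ⟶ M, η ≫ (Scheme.Modules.pushforward φ).map f = ψ := by
  have := hη.isIso
  refine ⟨inv (pullbackDesc η) ≫ pullbackDesc ψ, ?_⟩
  have h := unitMap_pullbackDesc η =≫
    (Scheme.Modules.pushforward φ).map (inv (pullbackDesc η) ≫ pullbackDesc ψ)
  rwa [Category.assoc, ← Functor.map_comp, IsIso.hom_inv_id_assoc, unitMap_pullbackDesc,
    eq_comm] at h

lemma along_of_comp {f : E ⟶ L} {f' : E' ⟶ L'} {θ : L ⟶ (Scheme.Modules.pushforward φ).obj L'}
    (h : η ≫ (Scheme.Modules.pushforward φ).map f' = f ≫ θ) (s : Γ(E, V)) :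
    f'.app (φ ⁻¹ᵁ V) (along η s) = along θ (f.app V s) :=
  congr(($h).app V s)

lemma unitMap_naturality (f : E ⟶ L) :
    unitMap φ E ≫ (Scheme.Modules.pushforward φ).map ((Scheme.Modules.pullback φ).map f) =
      f ≫ unitMap φ L :=
  ((Scheme.Modules.pullbackPushforwardAdjunction φ).unit.naturality f).symm

section Tensor

variable {θ : L ⟶ (Scheme.Modules.pushforward φ).obj L'}

/-- The bilinear map `(a, b) ↦ η a ⊗ θ b`. -/
noncomputable def tensorAlongBilin (η : E ⟶ (Scheme.Modules.pushforward φ).obj E')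
    (θ : L ⟶ (Scheme.Modules.pushforward φ).obj L') (U : Y.Opens) :
    Γ(E, U) →ₗ[Γ(Y, U)] Γ(L, U) →ₗ[Γ(Y, U)]
      Γ((Scheme.Modules.pushforward φ).obj (tensor E' L'), U) :=
  LinearMap.mk₂ Γ(Y, U)
    (fun a b => (show Γ((Scheme.Modules.pushforward φ).obj (tensor E' L'), U) from
      tmul (along η a) (along θ b)))
    (fun a a' b => by rw [along_add, add_tmul]; rfl)
    (fun r a b => by rw [along_smul, smul_tmul]; rfl)
    (fun a b b' => by rw [along_add, tmul_add]; rfl)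
    (fun r a b => by rw [along_smul, tmul_smul]; rfl)

lemma tensorAlongBilin_res (h : V ≤ U) (a : Γ(E, U)) (b : Γ(L, U)) :
    tensorAlongBilin η θ V (res E h a) (res L h b) = res _ h (tensorAlongBilin η θ U a b) := by
  rw [tensorAlongBilin, tensorAlongBilin, LinearMap.mk₂_apply, LinearMap.mk₂_apply, along_res,
    along_res]
  exact (res_tmul _ _ _).symm

/-- The morphism `E ⊗ L → φ_* (E' ⊗ L')` given by `η : E → φ_* E'` and `θ : L → φ_* L'`. -/
noncomputable def tensorAlong (η : E ⟶ (Scheme.Modules.pushforward φ).obj E')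
    (θ : L ⟶ (Scheme.Modules.pushforward φ).obj L') :
    tensor E L ⟶ (Scheme.Modules.pushforward φ).obj (tensor E' L') :=
  tensorLift (tensorAlongBilin η θ) tensorAlongBilin_res

lemma tensorAlong_tmul (a : Γ(E, U)) (b : Γ(L, U)) :
    along (tensorAlong η θ) (tmul a b) = tmul (along η a) (along θ b) :=
  tensorLift_tmul (tensorAlongBilin η θ) tensorAlongBilin_res a b

lemma IsFramed.tensorAlong (hη : IsFramed η) (hθ : IsFramed θ) :
    IsFramed (tensorAlong η θ) := by
  intro y
  obtain ⟨U, hyU, n, b, hb, -⟩ := hη y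
  obtain ⟨V, hyV, m, l, hl, -⟩ := hθ y
  have hb' := hb.restrict (inf_le_left : U ⊓ V ≤ U)
  have hl' := hl.restrict (inf_le_right : U ⊓ V ≤ V)
  have e := (Fintype.equivFin (Fin n × Fin m)).symm
  refine ⟨U ⊓ V, ⟨hyU, hyV⟩, _, _, (hb'.tensorFrame hl').reindex e, ?_⟩
  have := ((hη.isFrame hb').tensorFrame (hθ.isFrame hl')).reindex e
  convert this using 1
  funext i
  exact tensorAlong_tmul _ _

end Tensor

section Forms

variable {q : SymmForm E} {q' q₁ q₂ : SymmForm E'}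

lemma IsCompatibleForm.unique (hη : IsFramed η) (h₁ : IsCompatibleForm η q q₁)
    (h₂ : IsCompatibleForm η q q₂) : q₁ = q₂ := by
  refine SymmForm.ext' fun W x y => function_ext _ _ fun z hz => ?_
  obtain ⟨U, hU, n, b, hb, hb'⟩ := hη (φ z)
  refine ⟨W ⊓ φ ⁻¹ᵁ U, inf_le_left, ⟨hz, hU⟩, ?_⟩
  rw [SymmForm.rres_form, SymmForm.rres_form]
  obtain ⟨c, hc, -⟩ := hb' (W ⊓ φ ⁻¹ᵁ U) inf_le_right (res E' inf_le_left x)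
  obtain ⟨d, hd, -⟩ := hb' (W ⊓ φ ⁻¹ᵁ U) inf_le_right (res E' inf_le_left y)
  rw [hc, hd]
  simp only [map_sum, LinearMap.sum_apply, map_smul, LinearMap.smul_apply, ← SymmForm.rres_form]
  simp only [h₁ U, h₂ U]

/-- A form on `E` extends to the base change `E'`. -/
lemma IsFramed.exists_isCompatibleForm (hη : IsFramed η) (q : SymmForm E) :
    ∃ q' : SymmForm E', IsCompatibleForm η q q' := by
  -- the form as a morphism `E ⊗ E → φ_* 𝒪_Z`, which extends along `E ⊗ E → φ_* (E' ⊗ E')`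
  let B₀ : tensor E E ⟶ (Scheme.Modules.pushforward φ).obj (structureModule Z) :=
    tensorLift (fun U => LinearMap.mk₂ Γ(Y, U)
      (fun a b => (show Γ((Scheme.Modules.pushforward φ).obj (structureModule Z), U) from
        toStructure (φ.app U (q.form U a b))))
      (fun a a' b => by rw [map_add, LinearMap.add_apply, map_add]; rfl)
      (fun r a b => by rw [map_smul, LinearMap.smul_apply, smul_eq_mul, map_mul]; rfl)
      (fun a b b' => by rw [map_add, map_add]; rfl)
      (fun r a b => by rw [map_smul, smul_eq_mul, map_mul]; rfl))
    (fun {U V} h a b => by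
      rw [LinearMap.mk₂_apply, LinearMap.mk₂_apply, q.form_res]
      exact congrArg toStructure (app_rres h _))
  obtain ⟨B, hB⟩ := (hη.tensorAlong hη).exists_lift B₀
  have hB' : ∀ (U : Y.Opens) (a b : Γ(E, U)),
      B.app (φ ⁻¹ᵁ U) (tmul (along η a) (along η b)) = toStructure (φ.app U (q.form U a b)) := by
    intro U a b
    rw [← tensorAlong_tmul]
    refine (congr(($hB).app U (tmul a b))).trans ?_
    exact tensorLift_tmul _ _ a b
  let f : ∀ W : Z.Opens, Γ(E', W) → Γ(E', W) → Γ(Z, W) := fun W x y =>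
    ofStructure (B.app W (tmul x y))
  have f_add : ∀ W x x' y, f W (x + x') y = f W x y + f W x' y := fun W x x' y => by
    simp only [f, add_tmul, map_add]; rfl
  have f_smul : ∀ W (r : Γ(Z, W)) x y, f W (r • x) y = r * f W x y := fun W r x y => by
    simp only [f, smul_tmul, Scheme.Modules.Hom.app_smul]; rfl
  have add_f : ∀ W x y y', f W x (y + y') = f W x y + f W x y' := fun W x y y' => by
    simp only [f, tmul_add, map_add]; rfl
  have smul_f : ∀ W (r : Γ(Z, W)) x y, f W x (r • y) = r * f W x y := fun W r x y => by
    simp only [f, tmul_smul, Scheme.Modules.Hom.app_smul]; rfl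
  have f_res : ∀ {W W' : Z.Opens} (h : W' ≤ W) x y,
      f W' (res E' h x) (res E' h y) = rres h (f W x y) := fun h x y => by
    simp only [f, ← res_tmul]
    exact congrArg ofStructure (app_res B h _)
  let F : ∀ W : Z.Opens, Γ(E', W) →ₗ[Γ(Z, W)] Γ(E', W) →ₗ[Γ(Z, W)] Γ(Z, W) := fun W =>
    LinearMap.mk₂ _ (f W) (f_add W) (f_smul W) (add_f W) (smul_f W)
  -- symmetry can be checked on a frame of the form `along η (b i)`
  have F_symm : ∀ W x y, F W x y = F W y x := by
    refine fun W x y => function_ext _ _ fun z hz => ?_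
    obtain ⟨U, hU, n, b, hb, hb'⟩ := hη (φ z)
    refine ⟨W ⊓ φ ⁻¹ᵁ U, inf_le_left, ⟨hz, hU⟩, ?_⟩
    obtain ⟨c, hc, -⟩ := hb' (W ⊓ φ ⁻¹ᵁ U) inf_le_right (res E' inf_le_left x)
    obtain ⟨d, hd, -⟩ := hb' (W ⊓ φ ⁻¹ᵁ U) inf_le_right (res E' inf_le_left y)
    have hF : ∀ x y, rres inf_le_left (F W x y) = F (W ⊓ φ ⁻¹ᵁ U) (res E' inf_le_left x)
      (res E' inf_le_left y) := fun x y => (f_res inf_le_left x y).symm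
    have hsw : ∀ i j, F (W ⊓ φ ⁻¹ᵁ U) (res E' inf_le_right (along η (b i)))
        (res E' inf_le_right (along η (b j))) = F (W ⊓ φ ⁻¹ᵁ U)
        (res E' inf_le_right (along η (b j))) (res E' inf_le_right (along η (b i))) := by
      intro i j
      refine (f_res inf_le_right _ _).trans (Eq.trans ?_ (f_res inf_le_right _ _).symm)
      congr 1
      exact congrArg ofStructure (by rw [hB', hB', q.symm])
    rw [hF, hF, hc, hd]
    simp only [map_sum, LinearMap.sum_apply, map_smul, LinearMap.smul_apply, smul_eq_mul,
      Finset.mul_sum]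
    rw [Finset.sum_comm]
    refine Finset.sum_congr rfl fun i _ => Finset.sum_congr rfl fun j _ => ?_
    rw [hsw]
    ring
  exact ⟨⟨F, f_res, F_symm⟩, fun U x y => congrArg ofStructure (hB' U x y)⟩

/-- The pull-back of a form along a morphism. -/
noncomputable def SymmForm.comap (q : SymmForm E) (f : L ⟶ E) : SymmForm L where
  form U := (q.form U).compl₁₂ (appL f U) (appL f U)
  form_res h x y := by
    simp only [LinearMap.compl₁₂_apply, appL, LinearMap.coe_mk, AddHom.coe_mk]
    rw [app_res, app_res, q.form_res]
  symm U x y := q.symm U _ _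

/-- Extensions of isometries are isometries. -/
lemma IsCompatibleForm.isometry (hη : IsFramed η) (hq : IsCompatibleForm η q q') {f : E ⟶ E}
    {f' : E' ⟶ E'} (hff' : η ≫ (Scheme.Modules.pushforward φ).map f' = f ≫ η)
    (hf : ∀ U x y, q.form U (f.app U x) (f.app U y) = q.form U x y) (W : Z.Opens)
    (x y : Γ(E', W)) : q'.form W (f'.app W x) (f'.app W y) = q'.form W x y := by
  have h : IsCompatibleForm η q (q'.comap f') := fun U x y => by
    refine Eq.trans ?_ ((hq U (f.app U x) (f.app U y)).trans (by rw [hf]))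
    rw [← along_of_comp hff', ← along_of_comp hff']
    rfl
  conv_rhs => rw [← h.unique hη hq]
  rfl

lemma IsCompatibleForm.isSymmBundle (hη : IsFramed η) (hq : IsCompatibleForm η q q')
    (hE : IsSymmBundle E q) : IsSymmBundle E' q' := by
  refine ⟨hη.isVectorBundle, SymmForm.nondegenerate_of_gram _ fun z => ?_⟩
  obtain ⟨U, hU, n, b, hb, hb'⟩ := hη (φ z)
  refine ⟨φ ⁻¹ᵁ U, hU, Fin n, inferInstance, inferInstance, _, hb', ?_⟩
  have h1 : gram q' (fun i => along η (b i)) = (gram q b).map (φ.app U).hom := by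
    ext i j
    exact hq U _ _
  rw [h1, ← RingHom.mapMatrix_apply, ← RingHom.map_det]
  exact (hE.nondegenerate.isUnit_gram_det hb).map _

end Forms

end Framed

/-! ### Base change of invariants -/

section BaseChangeInvariants

variable {Y Z : Scheme.{u}} {φ : Z ⟶ Y} {T : Y.Modules} {T' : Z.Modules} {U V : Y.Opens}
  {κ : T ⟶ (Scheme.Modules.pushforward φ).obj T'} {G : Type v} [Fintype G] {a : G → (T ⟶ T)}
  {a' : G → (T' ⟶ T')}

lemma along_endo {ι : Type*} [Fintype ι] {b : ι → Γ(T, U)} (hb : IsFrame T U b)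
    (hb' : IsFrame T' (φ ⁻¹ᵁ U) fun i => along κ (b i)) (v : ι → Γ(T, U)) (h : V ≤ U)
    (x : Γ(T, V)) :
    hb'.endo (fun i => along κ (v i)) (φ.preimage_mono h) (along κ x) = along κ
        (hb.endo v h x) := by
  rw [hb.endo_apply]
  conv_lhs => rw [← (hb.basis h).sum_repr x]
  rw [along_sum, along_sum, map_sum]
  refine Finset.sum_congr rfl fun i _ => ?_
  rw [along_smul, along_smul, map_smul, hb.basis_apply, along_res, along_res]
  congr 1
  exact hb'.endo_frame _ _ i

lemma along_norm (ha : ∀ g, κ ≫ (Scheme.Modules.pushforward φ).map (a' g) = a g ≫ κ)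
    (m : Γ(T, V)) : norm a' (φ ⁻¹ᵁ V) (along κ m) = along κ (norm a V m) := by
  rw [norm_apply, norm_apply, along_sum]
  exact Finset.sum_congr rfl fun g _ => along_of_comp (ha g) m

/-- The canonical morphism `φ^* (T^G) → T'^G`. -/
noncomputable def invariantsBaseChange
    (ha : ∀ g, κ ≫ (Scheme.Modules.pushforward φ).map (a' g) = a g ≫ κ) :
    (Scheme.Modules.pullback φ).obj (invariants a) ⟶ invariants a' :=
  kernel.lift _ (pullbackDesc (invariants.incl a ≫ κ)) (by
    refine Pi.hom_ext _ _ fun g => ?_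
    rw [Category.assoc, Pi.lift_π, zero_comp, Preadditive.comp_sub, Category.comp_id, sub_eq_zero]
    refine pullback_hom_ext fun V s => ?_
    rw [Scheme.Modules.Hom.comp_app, ConcreteCategory.comp_apply, pullbackDesc_along]
    change (a' g).app _ (along κ ((invariants.incl a).app V s)) =
      along κ ((invariants.incl a).app V s)
    rw [along_of_comp (ha g), invariants.app_incl])

lemma invariantsBaseChange_incl
    (ha : ∀ g, κ ≫ (Scheme.Modules.pushforward φ).map (a' g) = a g ≫ κ) :
    invariantsBaseChange ha ≫ invariants.incl a' = pullbackDesc (invariants.incl a ≫ κ) :=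
  kernel.lift_ι _ _ _

lemma incl_invariantsBaseChange
    (ha : ∀ g, κ ≫ (Scheme.Modules.pushforward φ).map (a' g) = a g ≫ κ) (x : Γ(invariants a, V)) :
    (invariants.incl a').app (φ ⁻¹ᵁ V) ((invariantsBaseChange ha).app (φ ⁻¹ᵁ V)
      (along (unitMap φ _) x)) = along κ ((invariants.incl a).app V x) := by
  refine (congr(($(invariantsBaseChange_incl ha)).app (φ ⁻¹ᵁ V)
    (along (unitMap φ _) x))).trans ?_
  exact pullbackDesc_along _ _

variable [Group G]

lemma SplitsNorm.along (hκ : IsFramed κ)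
    (ha : ∀ g, κ ≫ (Scheme.Modules.pushforward φ).map (a' g) = a g ≫ κ) {ι : Type*} [Fintype ι]
    {b v : ι → Γ(T, U)} (H : SplitsNorm a b v) :
    SplitsNorm a' (fun i => along κ (b i)) (fun i => along κ (v i)) := by
  refine ⟨hκ.isFrame H.choose, fun i => ?_⟩
  refine Eq.trans ?_ (congrArg (TameTwist.along κ) (H.choose_spec i))
  rw [along_sum]
  refine Finset.sum_congr rfl fun g _ => ?_
  rw [along_of_comp (ha g⁻¹)]
  refine (congrArg _ (along_endo H.choose (hκ.isFrame H.choose) v le_rfl _)).trans ?_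
  exact along_of_comp (ha g) _

lemma isIso_invariantsBaseChange (hκ : IsFramed κ)
    (ha : ∀ g, κ ≫ (Scheme.Modules.pushforward φ).map (a' g) = a g ≫ κ)
    (hmul : ∀ g h, a (g * h) = a h ≫ a g)
    (H : ∀ y : Y, ∃ (U : Y.Opens) (_ : y ∈ U) (n : ℕ) (b v : Fin n → Γ(T, U)), SplitsNorm a b v) :
    IsIso (invariantsBaseChange ha) := by
  refine isIso_of_frames _ fun z => ?_
  obtain ⟨U, hy, n, b, v, hbv⟩ := H (φ z)
  obtain ⟨V, h, hyV, I, J, _, _, w, s, hf, hs⟩ := exists_adapted_frame hmul hbv hy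
  refine ⟨φ ⁻¹ᵁ V, hyV, I, inferInstance, _, (isFrame_invariants hbv h hf hs).pullback φ, ?_⟩
  have hbv' := hbv.along hκ ha
  refine isFrame_invariants hbv' (φ.preimage_mono h) (z := fun j => TameTwist.along κ (s j)) ?_
    fun j => ?_
  · convert hκ.isFrame hf using 1
    funext i
    rcases i with i | j
    · exact incl_invariantsBaseChange ha (w i)
    · rfl
  · have h1 := along_endo hbv.choose hbv'.choose v h (s j)
    refine (congrArg (norm a' _) h1).trans ?_
    rw [along_norm ha, hs]
    exact map_zero (κ.app V).hom

/-- The canonical morphism `φ^* (T^G) → T'^G` is compatible with the norm forms. -/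
lemma IsNormForm.isCompatibleForm
    (ha : ∀ g, κ ≫ (Scheme.Modules.pushforward φ).map (a' g) = a g ≫ κ)
    (H : ∀ y : Y, ∃ (U : Y.Opens) (_ : y ∈ U) (n : ℕ) (b v : Fin n → Γ(T, U)), SplitsNorm a b v)
    {t : SymmForm T} {t' : SymmForm T'} (ht : IsCompatibleForm κ t t')
    {qX : SymmForm (invariants a)} {qZ : SymmForm (invariants a')} (hq : IsNormForm a t qX)
    (hq' : IsNormForm a' t' qZ) :
    IsCompatibleForm (unitMap φ _ ≫ (Scheme.Modules.pushforward φ).map (invariantsBaseChange ha))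
      qX qZ := by
  set θ := unitMap φ _ ≫ (Scheme.Modules.pushforward φ).map (invariantsBaseChange ha)
  have hθ : ∀ {V : Y.Opens} (x : Γ(invariants a, V)),
      (invariants.incl a').app (φ ⁻¹ᵁ V) (TameTwist.along θ x) =
        TameTwist.along κ ((invariants.incl a).app V x) := fun x =>
    incl_invariantsBaseChange ha x
  intro U x y
  refine function_ext _ _ fun z hz => ?_
  obtain ⟨V, hzV, n, b, v, hbv⟩ := H (φ z)
  refine ⟨φ ⁻¹ᵁ (U ⊓ V), φ.preimage_mono inf_le_left, ⟨hz, hzV⟩, ?_⟩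
  have hm := (hbv.norm_eq (inf_le_right : U ⊓ V ≤ V) fun g =>
    invariants.app_incl a g (res _ (inf_le_left : U ⊓ V ≤ U) x)).symm
  rw [← app_rres, SymmForm.rres_form, SymmForm.rres_form,
    ← along_res θ (inf_le_left : U ⊓ V ≤ U) x, ← along_res θ (inf_le_left : U ⊓ V ≤ U) y,
    hq _ _ _ _ hm, ← ht, ← hθ]
  refine hq' _ _ _ _ ?_
  rw [hθ, along_norm ha, ← hm]

end BaseChangeInvariants

/-! ### Twists of symmetric bundles -/

section TensorSplits

variable {Y : Scheme.{u}} {E L : Y.Modules} {U : Y.Opens} {G : Type v} [Group G] [Fintype G]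
  {ρ : G → (E ⟶ E)} {α : G → (L ⟶ L)}

lemma endo_tmul {ι κ : Type*} [Fintype ι] [Fintype κ] {b : ι → Γ(E, U)} {l : κ → Γ(L, U)}
    (hb : IsFrame E U b) (hl : IsFrame L U l)
    (hbl : IsFrame (tensor E L) U fun i : ι × κ => tmul (b i.1) (l i.2)) (v : κ → Γ(L, U))
    (x : Γ(E, U)) (s : Γ(L, U)) :
    hbl.endo (fun i : ι × κ => tmul (b i.1) (v i.2)) le_rfl (tmul x s) =
      tmul x (hl.endo v le_rfl s) := by
  let τ : Γ(E, U) →ₗ[Γ(Y, U)] Γ(L, U) →ₗ[Γ(Y, U)] Γ(tensor E L, U) :=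
    (TensorProduct.mk Γ(Y, U) Γ(E, U) Γ(L, U)).compr₂ (tunit E L U)
  suffices h : τ.compr₂ (hbl.endo (fun i : ι × κ => tmul (b i.1) (v i.2)) le_rfl) =
      τ.compl₂ (hl.endo v le_rfl) from congr($h x s)
  refine LinearMap.ext_basis (hb.basis le_rfl) (hl.basis le_rfl) fun i j => ?_
  rw [hb.basis_apply, hl.basis_apply, LinearMap.compr₂_apply, LinearMap.compl₂_apply,
    hl.endo_frame]
  have := hbl.endo_frame (fun i : ι × κ => tmul (b i.1) (v i.2)) le_rfl (i, j)
  rw [res_tmul, res_tmul] at this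
  exact this

/-- If the norm of `L` splits locally then so does that of `E ⊗ L`, by means of `1 ⊗ γ`. -/
lemma SplitsNorm.tensor (hρmul : ∀ g h, ρ (g * h) = ρ h ≫ ρ g) (hρone : ρ 1 = 𝟙 E)
    {ι κ : Type*} [Fintype ι] [Fintype κ] {b : ι → Γ(E, U)} {l v : κ → Γ(L, U)}
    (hb : IsFrame E U b) (H : SplitsNorm α l v) :
    SplitsNorm (diagonal ρ α) (fun i : ι × κ => tmul (b i.1) (l i.2))
      (fun i : ι × κ => tmul (b i.1) (v i.2)) := by
  refine ⟨hb.tensorFrame H.choose, fun i => ?_⟩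
  refine Eq.trans ?_ (congrArg (tmul (b i.1)) (H.choose_spec i.2))
  rw [tmul_sum]
  refine Finset.sum_congr rfl fun g _ => ?_
  have h1 : ρ g⁻¹ ≫ ρ g = 𝟙 E := by rw [← hρmul, mul_inv_cancel, hρone]
  have h2 : (ρ g).app U ((ρ g⁻¹).app U (b i.1)) = b i.1 := congr(($h1).app U (b i.1))
  rw [diagonal, diagonal, tensorMap_tmul, endo_tmul hb H.choose, tensorMap_tmul, h2]

lemma SplitsNorm.reindex {T : Y.Modules} {a : G → (T ⟶ T)} {ι κ : Type*} [Fintype ι] [Fintype κ]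
    {b v : ι → Γ(T, U)} (H : SplitsNorm a b v) (e : κ ≃ ι) : SplitsNorm a (b ∘ e) (v ∘ e) := by
  have hb := H.choose.reindex e
  have h : ∀ x, hb.endo (v ∘ e) le_rfl x = H.choose.endo v le_rfl x := by
    intro x
    suffices h : hb.endo (v ∘ e) le_rfl = H.choose.endo v le_rfl from congr($h x)
    refine (hb.basis le_rfl).ext fun i => ?_
    rw [hb.basis_apply, hb.endo_frame]
    exact (H.choose.endo_frame v le_rfl (e i)).symm
  refine ⟨hb, fun i => ?_⟩
  simp only [h]
  exact H.choose_spec (e i)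

lemma diagonal_mul (hρ : ∀ g h, ρ (g * h) = ρ h ≫ ρ g) (hα : ∀ g h, α (g * h) = α h ≫ α g)
    (g h : G) : diagonal ρ α (g * h) = diagonal ρ α h ≫ diagonal ρ α g := by
  refine tensor_hom_ext fun U a b => ?_
  rw [Scheme.Modules.Hom.comp_app, ConcreteCategory.comp_apply]
  simp only [diagonal, tensorMap_tmul, hρ, hα]
  rfl

lemma diagonal_one (hρ : ρ 1 = 𝟙 E) (hα : α 1 = 𝟙 L) : diagonal ρ α 1 = 𝟙 _ := by
  refine tensor_hom_ext fun U a b => ?_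
  rw [diagonal, tensorMap_tmul, hρ, hα]
  rfl

lemma IsTensorForm.comap {q : SymmForm E} {b : SymmForm L} {t : SymmForm (TameTwist.tensor E L)}
    (ht : IsTensorForm q b t) {f : E ⟶ E} {g : L ⟶ L}
    (hf : ∀ U x y, q.form U (f.app U x) (f.app U y) = q.form U x y)
    (hg : ∀ U x y, b.form U (g.app U x) (g.app U y) = b.form U x y) (U : Y.Opens)
    (x y : Γ(TameTwist.tensor E L, U)) :
    t.form U ((tensorMap f g).app U x) ((tensorMap f g).app U y) = t.form U x y := by
  have h : IsTensorForm q b (t.comap (tensorMap f g)) := fun U x x' s s' => by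
    refine Eq.trans (b := t.form U ((tensorMap f g).app U (tmul x s))
      ((tensorMap f g).app U (tmul x' s'))) rfl ?_
    rw [tensorMap_tmul, tensorMap_tmul, ht, hf, hg]
  conv_rhs => rw [ht.unique h]
  rfl

lemma isTwistForm_iff {q : SymmForm E} {b : SymmForm L} {t : SymmForm (TameTwist.tensor E L)}
    (ht : IsTensorForm q b t) (qX : SymmForm (twist ρ α)) :
    IsTwistForm ρ α q b qX ↔ IsNormForm (diagonal ρ α) t qX := by
  have hfin : ∀ (U : Y.Opens) (m : Γ(TameTwist.tensor E L, U)),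
      ∑ᶠ g : G, (diagonal ρ α g).app U m = norm (diagonal ρ α) U m := fun U m => by
    rw [finsum_eq_sum_of_fintype, norm_apply]
  constructor
  · rintro ⟨t', ht', h⟩ U x y m hm
    rw [ht.unique ht']
    exact h U x y m (hm.trans (hfin U m).symm)
  · intro h
    exact ⟨t, ht, fun U x y m hm => h U x y m (hm.trans (hfin U m))⟩

/-- The twist of a symmetric bundle `(E, q)` by a symmetric bundle `(L, b)` with an action of `G`
whose norm splits locally is a symmetric bundle. -/
theorem exists_twistForm {q : SymmForm E} {b : SymmForm L} (hE : IsSymmBundle E q)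
    (hL : IsSymmBundle L b) (hρmul : ∀ g h, ρ (g * h) = ρ h ≫ ρ g) (hρone : ρ 1 = 𝟙 E)
    (hρ : ∀ g U x y, q.form U ((ρ g).app U x) ((ρ g).app U y) = q.form U x y)
    (hαmul : ∀ g h, α (g * h) = α h ≫ α g) (hαone : α 1 = 𝟙 L)
    (hα : ∀ g U x y, b.form U ((α g).app U x) ((α g).app U y) = b.form U x y)
    (H : ∀ y : Y, ∃ (U : Y.Opens) (_ : y ∈ U) (n : ℕ) (l v : Fin n → Γ(L, U)), SplitsNorm α l v) :
    ∃ (t : SymmForm (TameTwist.tensor E L)) (qX : SymmForm (twist ρ α)),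
      IsTensorForm q b t ∧ IsNormForm (diagonal ρ α) t qX ∧
      (∀ q₁, IsTwistForm ρ α q b q₁ ↔ q₁ = qX) ∧ IsSymmBundle (twist ρ α) qX ∧
      ∀ y : Y, ∃ (U : Y.Opens) (_ : y ∈ U) (n : ℕ) (c v : Fin n → Γ(TameTwist.tensor E L, U)),
        SplitsNorm (diagonal ρ α) c v := by
  obtain ⟨t, ht⟩ := exists_isTensorForm q b
  have hmul := diagonal_mul hρmul hαmul
  have hone := diagonal_one hρone hαone
  have hiso : ∀ g (U : Y.Opens) (x y : Γ(TameTwist.tensor E L, U)),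
      t.form U ((diagonal ρ α g).app U x) ((diagonal ρ α g).app U y) = t.form U x y :=
    fun g => ht.comap (hρ g) (hα g)
  have hsplit : ∀ y : Y, ∃ (U : Y.Opens) (_ : y ∈ U) (n : ℕ)
      (c v : Fin n → Γ(TameTwist.tensor E L, U)), SplitsNorm (diagonal ρ α) c v := by
    intro y
    obtain ⟨U, hU, n, c, hc⟩ := hE.isVectorBundle.exists_frame y
    obtain ⟨V, hV, m, l, v, hlv⟩ := H y
    have := (hlv.restrict (inf_le_right : U ⊓ V ≤ V)).tensor hρmul hρone
      (hc.restrict (inf_le_left : U ⊓ V ≤ U))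
    exact ⟨U ⊓ V, ⟨hU, hV⟩, _, _, _, this.reindex (Fintype.equivFin (Fin n × Fin m)).symm⟩
  obtain ⟨qX, hqX⟩ := exists_normForm hmul hone hiso hsplit
  refine ⟨t, qX, ht, hqX, fun q₁ => ?_, hqX.isSymmBundle (ht.isSymmBundle hE hL).nondegenerate
    hmul hone hiso hsplit, hsplit⟩
  rw [isTwistForm_iff ht]
  exact ⟨fun h => h.unique hqX hsplit, fun h => h ▸ hqX⟩

/-- The formation of the twist commutes with base change. -/
theorem exists_twistForm_baseChange {q : SymmForm E} {b : SymmForm L} (hE : IsSymmBundle E q)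
    (hL : IsSymmBundle L b) (hρmul : ∀ g h, ρ (g * h) = ρ h ≫ ρ g) (hρone : ρ 1 = 𝟙 E)
    (hρ : ∀ g U x y, q.form U ((ρ g).app U x) ((ρ g).app U y) = q.form U x y)
    (hαmul : ∀ g h, α (g * h) = α h ≫ α g) (hαone : α 1 = 𝟙 L)
    (hα : ∀ g U x y, b.form U ((α g).app U x) ((α g).app U y) = b.form U x y)
    (H : ∀ y : Y, ∃ (U : Y.Opens) (_ : y ∈ U) (n : ℕ) (l v : Fin n → Γ(L, U)), SplitsNorm α l v) :
    ∃ qX : SymmForm (twist ρ α), (∀ q₁, IsTwistForm ρ α q b q₁ ↔ q₁ = qX) ∧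
      IsSymmBundle (twist ρ α) qX ∧
      ∀ (Z : Scheme.{u}) (φ : Z ⟶ Y) (L' : Z.Modules)
        (θ : L ⟶ (Scheme.Modules.pushforward φ).obj L'), IsFramed θ →
        ∃ (α' : G → (L' ⟶ L')) (b' : SymmForm L') (q' : SymmForm
            ((Scheme.Modules.pullback φ).obj E)),
          (∀ g, θ ≫ (Scheme.Modules.pushforward φ).map (α' g) = α g ≫ θ) ∧
          IsCompatibleForm θ b b' ∧ IsCompatibleForm (unitMap φ E) q q' ∧
          ∃ qZ : SymmForm (twist (fun g => (Scheme.Modules.pullback φ).map (ρ g)) α'),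
            (∀ q₁, IsTwistForm (fun g => (Scheme.Modules.pullback φ).map (ρ g)) α' q' b' q₁ ↔
              q₁ = qZ) ∧
            IsSymmBundle _ qZ ∧
            ∃ e : (Scheme.Modules.pullback φ).obj (twist ρ α) ≅
                twist (fun g => (Scheme.Modules.pullback φ).map (ρ g)) α',
              IsCanonicalIso (unitMap φ E) θ e ∧
              IsCompatibleForm (unitMap φ _ ≫ (Scheme.Modules.pushforward φ).map e.hom) qX qZ := by
  obtain ⟨t, qX, ht, hqX, huniq, hX, hsplit⟩ :=
    exists_twistForm hE hL hρmul hρone hρ hαmul hαone hα H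
  refine ⟨qX, huniq, hX, fun Z φ L' θ hθ => ?_⟩
  -- the base change of the actions and of the forms; each is determined on inverse images of
  -- sections, so the hypotheses on it follow from those over `Y`
  have hη : IsFramed (unitMap φ E) := isFramed_unitMap hE.isVectorBundle φ
  choose α' hα' using fun g => hθ.exists_lift (α g ≫ θ)
  obtain ⟨b', hb'⟩ := hθ.exists_isCompatibleForm b
  obtain ⟨q', hq'⟩ := hη.exists_isCompatibleForm q
  have hρ' : ∀ g, unitMap φ E ≫ (Scheme.Modules.pushforward φ).map
      ((Scheme.Modules.pullback φ).map (ρ g)) = ρ g ≫ unitMap φ E :=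
    fun g => unitMap_naturality (ρ g)
  obtain ⟨t', qZ, ht', hqZ, huniq', hZ, -⟩ := exists_twistForm
    (ρ := fun g => (Scheme.Modules.pullback φ).map (ρ g)) (α := α') (q := q') (b := b')
    (hq'.isSymmBundle hη hE) (hb'.isSymmBundle hθ hL)
    (fun g h => by rw [hρmul, Functor.map_comp])
    (by rw [hρone]; exact CategoryTheory.Functor.map_id _ _)
    (fun g => hq'.isometry hη (hρ' g) (hρ g))
    (fun g h => hθ.hom_ext fun V s => by
      rw [along_of_comp (hα' _), hαmul, Scheme.Modules.Hom.comp_app, ConcreteCategory.comp_apply,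
        Scheme.Modules.Hom.comp_app, ConcreteCategory.comp_apply, along_of_comp (hα' _),
        along_of_comp (hα' _)])
    (hθ.hom_ext fun V s => by
      rw [along_of_comp (hα' _), hαone]
      rfl)
    (fun g => hb'.isometry hθ (hα' g) (hα g))
    (fun z => by
      obtain ⟨U, hU, n, l, v, hlv⟩ := H (φ z)
      exact ⟨φ ⁻¹ᵁ U, hU, n, _, _, hlv.along hθ hα'⟩)
  refine ⟨α', b', q', hα', hb', hq', qZ, huniq', hZ, ?_⟩
  -- the map `E ⊗ L → φ_* (φ^* E ⊗ L')` is equivariant, so it induces one on invariants, which is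
  -- the canonical isomorphism
  have hκ := hη.tensorAlong hθ
  have ha : ∀ g, tensorAlong (unitMap φ E) θ ≫ (Scheme.Modules.pushforward φ).map
      (diagonal (fun g => (Scheme.Modules.pullback φ).map (ρ g)) α' g) =
      diagonal ρ α g ≫ tensorAlong (unitMap φ E) θ := by
    intro g
    refine tensor_hom_ext fun U x s => ?_
    change (diagonal (fun g => (Scheme.Modules.pullback φ).map (ρ g)) α' g).app (φ ⁻¹ᵁ U)
      (along (tensorAlong (unitMap φ E) θ) (tmul x s)) =
      along (tensorAlong (unitMap φ E) θ) ((diagonal ρ α g).app U (tmul x s))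
    rw [tensorAlong_tmul, diagonal, diagonal, tensorMap_tmul, tensorMap_tmul, tensorAlong_tmul,
      along_of_comp (hρ' g), along_of_comp (hα' g)]
  have hiso := isIso_invariantsBaseChange hκ ha (diagonal_mul hρmul hαmul) hsplit
  refine ⟨asIso (invariantsBaseChange ha), ⟨_, fun U x s => tensorAlong_tmul x s, ?_⟩, ?_⟩
  · rw [asIso_hom, invariantsBaseChange_incl, unitMap_pullbackDesc]
  · refine IsNormForm.isCompatibleForm ha hsplit (t := t) (t' := t') ?_ hqX hqZ
    refine tensor_induction₂ ?_ ?_ ?_ ?_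
    · intro U m n h
      refine function_ext _ _ fun z hz => ?_
      obtain ⟨V, hV, hzV, h⟩ := h (φ z) hz
      refine ⟨φ ⁻¹ᵁ V, φ.preimage_mono hV, hzV, ?_⟩
      rwa [SymmForm.rres_form, ← along_res, ← along_res, ← app_rres, SymmForm.rres_form]
    · intro U x s x' s'
      rw [tensorAlong_tmul, tensorAlong_tmul, ht', ht, map_mul, ← hq', ← hb']
    · intro U m m' n h h'
      rw [along_add, map_add, map_add, LinearMap.add_apply, LinearMap.add_apply, map_add, h, h']
    · intro U m n n' h h'
      rw [along_add, map_add, map_add, map_add, h, h']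

end TensorSplits

/-! ### Regular local rings -/

section RegularLocal

open IsLocalRing RingTheory.Sequence

lemma natCast_le_of_add_one_le {n : ℕ} {e : WithBot ℕ∞}
    (h : (n : WithBot ℕ∞) + 1 ≤ e + 1) : (n : WithBot ℕ∞) ≤ e := by
  induction e with
  | bot => simp at h
  | coe e =>
    have : ((n + 1 : ℕ∞) : WithBot ℕ∞) ≤ ((e + 1 : ℕ∞) : WithBot ℕ∞) := by exact_mod_cast h
    have := WithBot.coe_le_coe.1 this
    exact_mod_cast (ENat.add_le_add_iff_right ENat.one_ne_top).1 this

lemma eq_of_add_one_eq {n : ℕ} {e : WithBot ℕ∞} (h : e + 1 = n + 1) : e = n := by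
  refine le_antisymm ?_ (natCast_le_of_add_one_le h.ge)
  induction e with
  | bot => exact bot_le
  | coe e =>
    have : ((e + 1 : ℕ∞) : WithBot ℕ∞) = ((n + 1 : ℕ∞) : WithBot ℕ∞) := by exact_mod_cast h
    have := (WithBot.coe_inj.1 this).le
    exact_mod_cast (ENat.add_le_add_iff_right ENat.one_ne_top).1 this

/-- Elements of the maximal ideal with linearly independent classes in the cotangent space can be
completed to a minimal system of generators. -/
lemma exists_list_extend {R : Type u} [CommRing R] [IsLocalRing R] [IsNoetherianRing R] {ι : Type*}
    (v : ι → maximalIdeal R)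
    (hv : LinearIndependent (ResidueField R) fun i => (maximalIdeal R).toCotangent (v i)) :
    ∃ l : List (maximalIdeal R), Submodule.span R (Set.range v ∪ {x | x ∈ l}) = ⊤ ∧
      Nat.card ι + l.length = Module.finrank (ResidueField R) (CotangentSpace R) := by
  classical
  let B := Module.Basis.sumExtend hv
  have hB : ∀ i, B (Sum.inl i) = (maximalIdeal R).toCotangent (v i) := by
    intro i
    simp [B, Module.Basis.sumExtend]
    rfl
  have hfin : Finite (ι ⊕ Module.Basis.sumExtendIndex hv) := Module.Finite.finite_basis B
  have : Finite ι := Finite.sum_left (Module.Basis.sumExtendIndex hv)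
  have : Finite (Module.Basis.sumExtendIndex hv) := Finite.sum_right ι
  let _ := Fintype.ofFinite (Module.Basis.sumExtendIndex hv)
  choose w hw using fun j => (maximalIdeal R).toCotangent_surjective (B (Sum.inr j))
  refine ⟨Finset.univ.toList.map w, ?_, ?_⟩
  · rw [← CotangentSpace.span_image_eq_top_iff, eq_top_iff, ← B.span_eq]
    refine Submodule.span_mono ?_
    rintro _ ⟨i | j, rfl⟩
    · exact ⟨v i, Or.inl ⟨i, rfl⟩, (hB i).symm⟩
    · exact ⟨w j, Or.inr (List.mem_map.2 ⟨j, Finset.mem_toList.2 (Finset.mem_univ _), rfl⟩), hw j⟩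
  · rw [Module.finrank_eq_nat_card_basis B, Nat.card_sum]
    simp [Nat.card_eq_fintype_card]

/-- A regular local ring of dimension `n + 1` modulo an element of `𝔪 ∖ 𝔪²` is regular of
dimension `n`. -/
lemma IsRegularLocalRing.quotient {R : Type u} [CommRing R] [IsRegularLocalRing R] {x : R}
    (hx : x ∈ maximalIdeal R) (hx2 : x ∉ maximalIdeal R ^ 2) :
    IsRegularLocalRing (R ⧸ Ideal.span {x}) ∧
      ringKrullDim (R ⧸ Ideal.span {x}) + 1 = ringKrullDim R := by
  have hne : Ideal.span {x} ≠ ⊤ := fun h => by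
    rw [Ideal.span_singleton_eq_top] at h
    exact (mem_maximalIdeal x).1 hx h
  have : Nontrivial (R ⧸ Ideal.span {x}) := Ideal.Quotient.nontrivial_iff.2 hne
  have hmk : Function.Surjective (Ideal.Quotient.mk (Ideal.span {x})) :=
    Ideal.Quotient.mk_surjective
  have : IsLocalRing (R ⧸ Ideal.span {x}) := IsLocalRing.of_surjective' _ hmk
  have hm : maximalIdeal (R ⧸ Ideal.span {x}) =
      (maximalIdeal R).map (Ideal.Quotient.mk (Ideal.span {x})) :=
    ((Ideal.map_eq_top_or_isMaximal_of_surjective _ hmk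
      (maximalIdeal.isMaximal R)).resolve_left (fun h => by
        have h1 : (Ideal.comap (Ideal.Quotient.mk (Ideal.span {x})) ((maximalIdeal R).map
          (Ideal.Quotient.mk (Ideal.span {x})))) = ⊤ := by rw [h]; rfl
        rw [Ideal.comap_map_of_surjective _ hmk, ← RingHom.ker_eq_comap_bot, Ideal.mk_ker,
          sup_eq_left.2 ((Ideal.span_singleton_le_iff_mem _).2 hx)] at h1
        exact (maximalIdeal.isMaximal R).ne_top h1)) |> (eq_maximalIdeal · |>.symm)
  -- complete `x` to a minimal system of generators of the maximal ideal; the other generators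
  -- generate the maximal ideal of the quotient
  obtain ⟨l, hl, hcard⟩ := exists_list_extend (fun _ : Unit => (⟨x, hx⟩ : maximalIdeal R))
    (LinearIndependent.of_subsingleton () (fun h => hx2 ((Ideal.toCotangent_eq_zero _ _).1 h)))
  have hdim : ringKrullDim R = (l.length : WithBot ℕ∞) + 1 := by
    rw [← (IsRegularLocalRing.iff_finrank_cotangentSpace R).1 ‹_›, ← hcard]
    simp [add_comm]
  have hle : (l.length : WithBot ℕ∞) + 1 ≤ ringKrullDim (R ⧸ Ideal.span {x}) + 1 := by
    have := ringKrullDim_le_ringKrullDim_quotient_add_card ({x} : Finset R) (by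
      simpa [IsLocalRing.ringJacobson_eq_maximalIdeal] using hx)
    rw [hdim] at this
    rw [Finset.coe_singleton, Finset.card_singleton] at this
    exact_mod_cast this
  have hle' := natCast_le_of_add_one_le hle
  have hgen : maximalIdeal (R ⧸ Ideal.span {x}) =
      Ideal.span ((fun y : maximalIdeal R => Ideal.Quotient.mk (Ideal.span {x}) y) ''
        {y | y ∈ l}) := by
    have h1 := congrArg (Submodule.map (maximalIdeal R).subtype) hl
    rw [Submodule.map_top, Submodule.range_subtype, Submodule.map_span] at h1
    rw [hm]
    refine (congrArg (Ideal.map _) h1.symm).trans ((Ideal.map_span _ _).trans ?_)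
    refine (le_antisymm (Ideal.span_le.2 ?_) (Ideal.span_le.2 ?_))
    · rintro _ ⟨_, ⟨y, hy | hy, rfl⟩, rfl⟩
      · obtain ⟨_, rfl⟩ := hy
        simp [Ideal.Quotient.eq_zero_iff_mem.2 (Ideal.mem_span_singleton_self x)]
      · exact Ideal.subset_span ⟨y, hy, rfl⟩
    · rintro _ ⟨y, hy, rfl⟩
      exact Ideal.subset_span ⟨y, ⟨y, Or.inr hy, rfl⟩, rfl⟩
  have hsp : (maximalIdeal (R ⧸ Ideal.span {x})).spanFinrank ≤ l.length := by
    classical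
    have hf : {y | y ∈ l}.Finite := l.finite_toSet
    rw [hgen]
    refine (Submodule.spanFinrank_span_le_ncard_of_finite (hf.image _)).trans
      ((Set.ncard_image_le hf).trans ?_)
    rw [show {y | y ∈ l} = (l.toFinset : Set (maximalIdeal R)) by ext; simp,
      Set.ncard_coe_finset]
    exact l.toFinset_card_le
  have hreg := IsRegularLocalRing.of_spanFinrank_maximalIdeal_le (R ⧸ Ideal.span {x})
    ((Nat.cast_le.2 hsp).trans hle')
  refine ⟨hreg, ?_⟩
  rw [hdim]
  congr 1
  refine le_antisymm ?_ hle'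
  rw [← (isRegularLocalRing_iff _).1 hreg]
  exact Nat.cast_le.2 hsp

/-- Prime avoidance in a regular local ring of positive dimension: some element of `𝔪 ∖ 𝔪²` avoids
given finitely many primes other than `𝔪`. -/
lemma exists_mem_of_ringKrullDim_eq {R : Type u} [CommRing R] [IsRegularLocalRing R] {n : ℕ}
    (h : ringKrullDim R = (n + 1 : ℕ)) (S : Set (Ideal R)) (hS : S.Finite)
    (hp : ∀ p ∈ S, p.IsPrime ∧ p ≠ maximalIdeal R) :
    ∃ x ∈ maximalIdeal R, x ∉ maximalIdeal R ^ 2 ∧ ∀ p ∈ S, x ∉ p := by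
  classical
  by_contra! hcon
  have hsub : (maximalIdeal R : Set R) ⊆
      ⋃ i ∈ ((insert (maximalIdeal R ^ 2) hS.toFinset : Finset (Ideal R)) : Set (Ideal R)), i := by
    intro x hx
    by_cases hx2 : x ∈ maximalIdeal R ^ 2
    · exact Set.mem_biUnion (Finset.mem_coe.2 (Finset.mem_insert_self _ _)) hx2
    · obtain ⟨p, hpS, hxp⟩ := hcon x hx hx2
      exact Set.mem_biUnion (Finset.mem_coe.2 (Finset.mem_insert_of_mem (hS.mem_toFinset.2 hpS)))
        hxp
  obtain ⟨p, hpS, hle⟩ := (Ideal.subset_union_prime (f := fun i => i) (maximalIdeal R ^ 2)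
    (maximalIdeal R ^ 2) (fun i hi h _ => (hp i (hS.mem_toFinset.1
      ((Finset.mem_insert.1 hi).resolve_left h))).1)).1 hsub
  rcases Finset.mem_insert.1 hpS with rfl | hpS
  · have hbot : maximalIdeal R = ⊥ :=
      Submodule.eq_bot_of_le_smul_of_le_jacobson_bot (maximalIdeal R) _
        (IsNoetherian.noetherian _) (by rwa [smul_eq_mul, ← pow_two])
        (by rw [IsLocalRing.jacobson_eq_maximalIdeal _ bot_ne_top])
    have := (finrank_cotangentSpace_eq_zero_iff (R := R)).2
      (IsLocalRing.isField_iff_maximalIdeal_eq.2 hbot)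
    have h0 := (IsRegularLocalRing.iff_finrank_cotangentSpace R).1 ‹_›
    rw [this, h] at h0
    norm_cast at h0
  · obtain ⟨hpp, hne⟩ := hp p (hS.mem_toFinset.1 hpS)
    exact hne ((IsLocalRing.le_maximalIdeal hpp.ne_top).antisymm hle)

/-- Regular local rings are domains. -/
theorem IsRegularLocalRing.isDomain {R : Type u} [CommRing R] [IsRegularLocalRing R] :
    IsDomain R := by
  obtain ⟨n, hn⟩ : ∃ n : ℕ, ringKrullDim R = n := ⟨_, ((isRegularLocalRing_iff R).1 ‹_›).symm⟩
  induction n generalizing R with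
  | zero =>
    have h0 := (IsRegularLocalRing.iff_finrank_cotangentSpace R).1 ‹_›
    rw [hn] at h0
    have h0' : Module.finrank (ResidueField R) (CotangentSpace R) = 0 := by exact_mod_cast h0
    rw [finrank_cotangentSpace_eq_zero_iff] at h0'
    exact h0'.isDomain
  | succ n ih =>
    have hfin := minimalPrimes.finite_of_isNoetherianRing R
    -- choose `x` in `𝔪 ∖ 𝔪²` outside the minimal primes; by induction `(x)` is prime. A minimal
    -- prime `p` in `(x)` satisfies `p = x p`, so it vanishes by Nakayama
    obtain ⟨x, hx, hx2, hxp⟩ := exists_mem_of_ringKrullDim_eq hn (minimalPrimes R) hfin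
      (fun p hp => ⟨hp.1.1, fun h => by
        have h1 : (maximalIdeal R).height = 0 := by
          rw [Ideal.height_eq_zero_iff]; exact h ▸ hp
        have h2 := IsLocalRing.maximalIdeal_height_eq_ringKrullDim (R := R)
        rw [h1, hn] at h2
        norm_cast at h2⟩)
    obtain ⟨hq, hqd⟩ := IsRegularLocalRing.quotient hx hx2
    have hdom : IsDomain (R ⧸ Ideal.span {x}) := by
      refine ih ?_
      rw [hn] at hqd
      exact eq_of_add_one_eq (hqd.trans (by push_cast; rfl))
    have hprime : (Ideal.span {x}).IsPrime := (Ideal.Quotient.isDomain_iff_prime _).1 hdom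
    obtain ⟨p, hp, hpx⟩ := Ideal.exists_minimalPrimes_le (bot_le : (⊥ : Ideal R) ≤ Ideal.span {x})
    have hpp : p.IsPrime := hp.1.1
    have hbot : p = ⊥ := by
      refine Submodule.eq_bot_of_le_smul_of_le_jacobson_bot (Ideal.span {x}) p
        (IsNoetherian.noetherian p) ?_ ?_
      · intro y hy
        obtain ⟨z, rfl⟩ := Ideal.mem_span_singleton'.1 (hpx hy)
        have hz : z ∈ p := (hpp.mem_or_mem hy).resolve_right (hxp p hp)
        rw [mul_comm]
        exact Submodule.smul_mem_smul (Ideal.mem_span_singleton_self x) hz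
      · rw [IsLocalRing.jacobson_eq_maximalIdeal _ bot_ne_top, Ideal.span_singleton_le_iff_mem]
        exact hx
    have : (⊥ : Ideal R).IsPrime := hbot ▸ hpp
    exact IsDomain.of_bot_isPrime R

/-- A system of `dim R` generators of the maximal ideal of a regular local ring is a regular
sequence. -/
lemma IsRegularLocalRing.isWeaklyRegular_of_ofList_eq {n : ℕ} {R : Type u} [CommRing R]
    [IsRegularLocalRing R] (l : List R) (hl : Ideal.ofList l = maximalIdeal R)
    (hlen : ringKrullDim R = l.length) (hn : l.length = n) :
    IsWeaklyRegular R l := by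
  induction n generalizing R with
  | zero =>
    rw [List.length_eq_zero_iff.1 hn]
    simp
  | succ n ih =>
    obtain ⟨x, l, rfl⟩ := List.exists_cons_of_length_eq_add_one hn
    have hxm : x ∈ maximalIdeal R := hl ▸ Ideal.subset_span List.mem_cons_self
    have := IsRegularLocalRing.isDomain (R := R)
    have hx2 : x ∉ maximalIdeal R ^ 2 := by
      intro hx2
      have h1 : maximalIdeal R ≤ Ideal.ofList l := by
        refine Submodule.le_of_le_smul_of_le_jacobson_bot (I := maximalIdeal R)
          (IsNoetherian.noetherian _)
          (by rw [IsLocalRing.jacobson_eq_maximalIdeal _ bot_ne_top]) ?_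
        conv_lhs => rw [← hl, Ideal.ofList_cons]
        refine sup_le ?_ le_sup_left
        rw [Ideal.span_singleton_le_iff_mem]
        exact Ideal.mem_sup_right (by rwa [smul_eq_mul, ← pow_two])
      have h2 : (maximalIdeal R).spanFinrank ≤ l.length := by
        classical
        rw [le_antisymm h1 (hl ▸ (by rw [Ideal.ofList_cons]; exact le_sup_right))]
        refine (Submodule.spanFinrank_span_le_ncard_of_finite l.finite_toSet).trans ?_
        rw [show {y | y ∈ l} = (l.toFinset : Set R) by ext; simp, Set.ncard_coe_finset]
        exact l.toFinset_card_le
      have h3 := (isRegularLocalRing_iff R).1 ‹_›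
      rw [hlen] at h3
      have h4 : (maximalIdeal R).spanFinrank = (x :: l).length := by exact_mod_cast h3
      rw [h4, List.length_cons] at h2
      omega
    obtain ⟨hq, hqd⟩ := IsRegularLocalRing.quotient hxm hx2
    have hx0 : x ≠ 0 := by
      rintro rfl
      exact hx2 (zero_mem _)
    have hm : maximalIdeal (R ⧸ Ideal.span {x}) = Ideal.ofList (l.map
        (algebraMap R (R ⧸ Ideal.span {x}))) := by
      have : Function.Surjective (algebraMap R (R ⧸ Ideal.span {x})) :=
        Ideal.Quotient.mk_surjective
      have hloc : IsLocalHom (algebraMap R (R ⧸ Ideal.span {x})) := .of_surjective _ this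
      have h1 := IsLocalRing.map_maximalIdeal_of_surjective (algebraMap R (R ⧸ Ideal.span {x})) this
      rw [← h1, ← hl, Ideal.map_ofList, List.map_cons, Ideal.ofList_cons,
        show algebraMap R (R ⧸ Ideal.span {x}) x = 0 from
          Ideal.Quotient.eq_zero_iff_mem.2 (Ideal.mem_span_singleton_self x)]
      simp
    have h := ih (R := R ⧸ Ideal.span {x}) (l.map (algebraMap R (R ⧸ Ideal.span {x}))) hm.symm
      (by
        rw [hlen] at hqd
        rw [List.length_map]
        exact eq_of_add_one_eq (hqd.trans (by rw [List.length_cons]; push_cast; rfl)))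
      (by simpa using hn)
    rw [isWeaklyRegular_map_algebraMap_iff] at h
    refine IsWeaklyRegular.cons ?_ ?_
    · exact (IsSMulRegular.of_ne_zero hx0)
    · refine (LinearEquiv.isWeaklyRegular_congr (Submodule.quotEquivOfEq _ _ ?_) l).1 h
      rw [← Ideal.mul_top (Ideal.span {x}), ← smul_eq_mul, Submodule.ideal_span_singleton_smul]

/-- If `Q₁ r₁, …, Qₖ rₖ, c₁, …, cₘ` is a regular sequence in a Noetherian local ring and the `rᵢ`
are not units, then `Q₁ ⋯ Qₖ` does not lie in the ideal generated by the sequence. -/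
lemma prod_notMem_of_isWeaklyRegular {R : Type u} [CommRing R] [IsLocalRing R] [IsNoetherianRing R]
    (l : List (R × R)) (cs : List R) (hr : ∀ p ∈ l, p.2 ∈ maximalIdeal R)
    (hc : ∀ c ∈ cs, c ∈ maximalIdeal R)
    (h : IsWeaklyRegular R (l.map (fun p => p.1 * p.2) ++ cs)) :
    (l.map Prod.fst).prod ∉ Ideal.ofList (l.map (fun p => p.1 * p.2) ++ cs) := by
  induction l generalizing cs with
  | nil =>
    intro h1
    refine (maximalIdeal.isMaximal R).ne_top ((Ideal.eq_top_iff_one _).2 ?_)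
    have : Ideal.ofList cs ≤ maximalIdeal R := Ideal.span_le.2 hc
    exact this (by simpa using h1)
  | cons p l ih =>
    intro hmem
    have hlm : ∀ c ∈ l.map (fun p => p.1 * p.2) ++ cs, c ∈ maximalIdeal R := by
      intro c hcm
      rcases List.mem_append.1 hcm with hcm | hcm
      · obtain ⟨p', hp', rfl⟩ := List.mem_map.1 hcm
        exact Ideal.mul_mem_left _ _ (hr p' (List.mem_cons_of_mem _ hp'))
      · exact hc c hcm
    -- regular sequences in a local ring can be permuted: move `Q r` to the end, where both `Q`
    -- and `r` are regular modulo the other elements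
    have h1 : IsWeaklyRegular R ((l.map (fun p => p.1 * p.2) ++ cs) ++ [p.1 * p.2]) := by
      refine IsLocalRing.isWeaklyRegular_of_perm_of_subset_maximalIdeal h ?_ ?_
      · exact (List.perm_append_singleton _ _).symm
      · intro c hcm
        rcases List.mem_cons.1 hcm with rfl | hcm
        · exact Ideal.mul_mem_left _ _ (hr p List.mem_cons_self)
        · exact hlm c hcm
    rw [isWeaklyRegular_append_iff, isWeaklyRegular_singleton_iff] at h1
    have hr2 : IsSMulRegular _ p.2 := IsSMulRegular.of_mul h1.2
    have hr1 : IsSMulRegular _ p.1 := IsSMulRegular.of_mul ((mul_comm p.1 p.2) ▸ h1.2)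
    have hp2 := hr p List.mem_cons_self
    -- cancel `Q` from the relation and replace `Q r` by `r` in the sequence
    refine ih (p.2 :: cs) (fun p' hp' => hr p' (List.mem_cons_of_mem _ hp'))
      (fun c hcm => by
        rcases List.mem_cons.1 hcm with rfl | hcm
        · exact hp2
        · exact hc c hcm) ?_ ?_
    · refine IsLocalRing.isWeaklyRegular_of_perm_of_subset_maximalIdeal
        ((isWeaklyRegular_append_iff R _ [p.2]).2 ⟨h1.1, (isWeaklyRegular_singleton_iff _ _).2 hr2⟩)
        ?_ ?_
      · exact (List.perm_append_singleton _ _).trans List.perm_middle.symm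
      · intro c hcm
        rcases List.mem_append.1 hcm with hcm | hcm
        · exact hlm c hcm
        · rw [List.mem_singleton.1 hcm]; exact hp2
    · rw [List.map_cons, List.cons_append, Ideal.ofList_cons, Submodule.mem_sup] at hmem
      obtain ⟨y, hy, z, hz, hyz⟩ := hmem
      obtain ⟨t, rfl⟩ := Ideal.mem_span_singleton'.1 hy
      rw [List.map_cons, List.prod_cons] at hyz
      have h2 : p.1 * ((l.map Prod.fst).prod - t * p.2) ∈
          Ideal.ofList (l.map (fun p => p.1 * p.2) ++ cs) := by
        convert hz using 1
        linear_combination -hyz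
      have h3 : (l.map Prod.fst).prod - t * p.2 ∈
          (Ideal.ofList (l.map (fun p => p.1 * p.2) ++ cs) • ⊤ : Submodule R R) := by
        rw [← Submodule.Quotient.mk_eq_zero]
        refine hr1 ?_
        change p.1 • _ = p.1 • (0 : _)
        rw [smul_zero, ← Submodule.Quotient.mk_smul, Submodule.Quotient.mk_eq_zero]
        simpa using h2
      have h4 : (l.map Prod.fst).prod - t * p.2 ∈
          Ideal.ofList (l.map (fun p => p.1 * p.2) ++ cs) := by simpa using h3
      have h5 : Ideal.ofList (l.map (fun p => p.1 * p.2) ++ p.2 :: cs) =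
          Ideal.span {p.2} ⊔ Ideal.ofList (l.map (fun p => p.1 * p.2) ++ cs) := by
        rw [Ideal.ofList_append, Ideal.ofList_cons, Ideal.ofList_append, sup_left_comm]
      rw [h5, ← sub_add_cancel ((l.map Prod.fst).prod) (t * p.2)]
      exact add_mem (Ideal.mem_sup_right h4)
        (Ideal.mem_sup_left (Ideal.mem_span_singleton'.2 ⟨t, rfl⟩))

end RegularLocal

/-! ### Finite free resolutions -/

section FreeResolution

open IsLocalRing

/-- `M` has a resolution by finite free modules of length less than `n`. -/
def HasFFR (R : Type u) [CommRing R] : ℕ → ∀ (M : Type u) [AddCommGroup M] [Module R M], Prop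
  | 0, M, _, _ => Subsingleton M
  | n + 1, M, _, _ => ∃ (k : ℕ) (f : (Fin k → R) →ₗ[R] M), Function.Surjective f ∧
      HasFFR R n (LinearMap.ker f)

lemma HasFFR.of_equiv {R : Type u} [CommRing R] {n : ℕ} {M N : Type u} [AddCommGroup M]
    [Module R M] [AddCommGroup N] [Module R N] (e : M ≃ₗ[R] N) (h : HasFFR R n M) :
    HasFFR R n N := by
  cases n with
  | zero => exact e.symm.toEquiv.subsingleton_congr.2 h
  | succ n =>
    obtain ⟨k, f, hf, hk⟩ := h
    refine ⟨k, e.toLinearMap ∘ₗ f, e.surjective.comp hf, ?_⟩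
    rwa [LinearEquiv.ker_comp]

/-- Lifting of free resolutions along `R → R/x`, for a module on which `x` is regular. -/
lemma HasFFR.of_quotient {R S : Type u} [CommRing R] [IsLocalRing R] [IsNoetherianRing R]
    [CommRing S] [Algebra R S] {x : R} (hx : x ∈ maximalIdeal R) (hreg : IsSMulRegular R x)
    (hS : Function.Surjective (algebraMap R S)) (hker : RingHom.ker (algebraMap R S) = Ideal.span
        {x})
    {n : ℕ} {N N' : Type u} [AddCommGroup N] [Module R N] [Module.Finite R N]
    [AddCommGroup N'] [Module R N'] [Module S N'] [IsScalarTower R S N'] (hN : IsSMulRegular N x)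
    (p : N →ₗ[R] N') (hp : Function.Surjective p) (hpx : ∀ a, p a = 0 → ∃ b, a = x • b)
    (h : HasFFR S n N') : HasFFR R n N := by
  have hjac : Ideal.span {x} ≤ (⊥ : Ideal R).jacobson := by
    rw [IsLocalRing.jacobson_eq_maximalIdeal _ bot_ne_top, Ideal.span_singleton_le_iff_mem]
    exact hx
  have hxS : algebraMap R S x = 0 := by
    rw [← RingHom.mem_ker, hker]; exact Ideal.mem_span_singleton_self x
  have hx0 : ∀ b : N', x • b = 0 := fun b => by
    rw [← algebraMap_smul S, hxS, zero_smul]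
  induction n generalizing N N' with
  | zero =>
    have : Subsingleton N' := h
    change Subsingleton N
    have htop : (⊤ : Submodule R N) = ⊥ := by
      refine Submodule.eq_bot_of_le_smul_of_le_jacobson_bot (Ideal.span {x}) ⊤
        Module.Finite.fg_top ?_ hjac
      intro a _
      obtain ⟨b, rfl⟩ := hpx a (Subsingleton.elim _ _)
      exact Submodule.smul_mem_smul (Ideal.mem_span_singleton_self x) trivial
    exact (Submodule.subsingleton_iff R).1 (subsingleton_of_bot_eq_top htop.symm)
  | succ n ih =>
    obtain ⟨k, f, hf, hk⟩ := h
    -- lift the images of the basis vectors; `F` is surjective by Nakayama and, as `x` is regular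
    -- on `N`, the kernel of `f` is the reduction of the kernel of `F`
    choose w hw using fun i : Fin k => hp (f (Pi.single i 1))
    let F : (Fin k → R) →ₗ[R] N := Fintype.linearCombination R w
    let P : (Fin k → R) →ₗ[R] (Fin k → S) :=
      LinearMap.pi fun i => Algebra.linearMap R S ∘ₗ LinearMap.proj i
    have hPapp : ∀ v i, P v i = algebraMap R S (v i) := fun v i => rfl
    have hF : ∀ v, p (F v) = f (P v) := by
      intro v
      have h1 : P v = ∑ i, v i • Pi.single i (1 : S) := by
        ext j
        simp [hPapp, Finset.sum_apply, Pi.single_apply, Algebra.algebraMap_eq_smul_one]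
      rw [h1, map_sum, Fintype.linearCombination_apply, map_sum]
      refine Finset.sum_congr rfl fun i _ => ?_
      rw [map_smul, hw]
      exact (LinearMap.map_smul_of_tower f (v i) _).symm
    have hP : Function.Surjective P := by
      intro v
      choose v' hv' using fun i => hS (v i)
      exact ⟨v', funext hv'⟩
    have hPx : ∀ v, P v = 0 → ∃ b, v = x • b := by
      intro v hv
      have h1 : ∀ i, ∃ b, v i = x * b := fun i => by
        have h2 : v i ∈ RingHom.ker (algebraMap R S) := congrFun hv i
        rw [hker] at h2
        obtain ⟨b, hb⟩ := Ideal.mem_span_singleton.1 h2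
        exact ⟨b, hb⟩
      choose b hb using h1
      exact ⟨b, funext hb⟩
    have hFs : Function.Surjective F := by
      rw [← LinearMap.range_eq_top, eq_top_iff]
      refine Submodule.le_of_le_smul_of_le_jacobson_bot (I := Ideal.span {x})
        Module.Finite.fg_top hjac ?_
      intro a _
      obtain ⟨v, hv⟩ := hf (p a)
      obtain ⟨v, rfl⟩ := hP v
      obtain ⟨b, hb⟩ := hpx (a - F v) (by rw [map_sub, hF, hv, sub_self])
      rw [eq_add_of_sub_eq' hb]
      exact add_mem (Submodule.mem_sup_left ⟨v, rfl⟩) (Submodule.mem_sup_right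
        (Submodule.smul_mem_smul (Ideal.mem_span_singleton_self x) trivial))
    refine ⟨k, F, hFs, ?_⟩
    refine ih (N := LinearMap.ker F) (N' := LinearMap.ker f) ?_
      (LinearMap.codRestrict ((LinearMap.ker f).restrictScalars R) (P ∘ₗ (LinearMap.ker F).subtype)
        fun v => ?_) ?_ ?_ hk ?_
    · intro v v' hvv
      refine Subtype.ext (funext fun i => hreg ?_)
      exact congrFun (congrArg Subtype.val hvv) i
    · change f (P v.1) = 0
      rw [← hF, show F v.1 = 0 from v.2, map_zero]
    · rintro ⟨v', hv'⟩
      obtain ⟨v, rfl⟩ := hP v'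
      obtain ⟨b, hb⟩ := hpx (F v) (by rw [hF]; exact hv')
      obtain ⟨w', rfl⟩ := hFs b
      refine ⟨⟨v - x • w', by rw [LinearMap.mem_ker, map_sub, map_smul, hb, sub_self]⟩, ?_⟩
      refine Subtype.ext (funext fun i => ?_)
      change algebraMap R S (v i - x * w' i) = algebraMap R S (v i)
      rw [map_sub, map_mul, hxS, zero_mul, sub_zero]
    · rintro ⟨v, hv⟩ hv0
      obtain ⟨b, rfl⟩ := hPx v (congrArg Subtype.val hv0)
      refine ⟨⟨b, ?_⟩, rfl⟩
      rw [LinearMap.mem_ker, map_smul] at hv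
      exact hN (hv.trans (smul_zero x).symm)
    · intro b
      refine Subtype.ext (funext fun i => ?_)
      change x • (b.1 i) = 0
      rw [Algebra.smul_def, hxS, zero_mul]

/-- Over a regular local ring of dimension `n`, every finite module has a free resolution of length
at most `n`. -/
theorem IsRegularLocalRing.hasFFR {n : ℕ} {R : Type u} [CommRing R] [IsRegularLocalRing R]
    (hn : ringKrullDim R = n) (M : Type u) [AddCommGroup M] [Module R M] [Module.Finite R M] :
    HasFFR R (n + 1) M := by
  induction n generalizing R M with
  | zero =>
    have h0 := (IsRegularLocalRing.iff_finrank_cotangentSpace R).1 ‹_›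
    rw [hn] at h0
    have h0' : Module.finrank (ResidueField R) (CotangentSpace R) = 0 := by exact_mod_cast h0
    rw [finrank_cotangentSpace_eq_zero_iff] at h0'
    let _ : Field R := h0'.toField
    let e := (Module.finBasis R M).equivFun
    refine ⟨_, e.symm.toLinearMap, e.symm.surjective, ?_⟩
    rw [LinearEquiv.ker]
    exact inferInstanceAs (Subsingleton (⊥ : Submodule R _))
  | succ n ih =>
    obtain ⟨x, hx, hx2, -⟩ := exists_mem_of_ringKrullDim_eq hn ∅ Set.finite_empty (by simp)
    obtain ⟨hq, hqd⟩ := IsRegularLocalRing.quotient hx hx2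
    have := IsRegularLocalRing.isDomain (R := R)
    have hx0 : x ≠ 0 := by
      rintro rfl
      exact hx2 (zero_mem _)
    -- `M` itself may have `x`-torsion, but its first syzygy has none, so the resolution modulo
    -- `x` lifts
    obtain ⟨k, f, hf⟩ := Module.Finite.exists_fin' R M
    refine ⟨k, f, hf, ?_⟩
    have hreg : IsSMulRegular (LinearMap.ker f) x := by
      intro v v' hvv
      refine Subtype.ext (funext fun i => mul_left_cancel₀ hx0 ?_)
      exact congrFun (congrArg Subtype.val hvv) i
    have hd : ringKrullDim (R ⧸ Ideal.span {x}) = n := by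
      rw [hn] at hqd
      exact eq_of_add_one_eq (hqd.trans (by push_cast; rfl))
    refine HasFFR.of_quotient (S := R ⧸ Ideal.span {x})
      (N' := LinearMap.ker f ⧸ (Ideal.span {x} • ⊤ : Submodule R (LinearMap.ker f)))
      hx (IsSMulRegular.of_ne_zero hx0)
      Ideal.Quotient.mk_surjective Ideal.mk_ker hreg (Submodule.mkQ _) (Submodule.mkQ_surjective _)
      ?_ (ih hd _)
    intro a ha
    rw [Submodule.mkQ_apply, Submodule.Quotient.mk_eq_zero,
        Submodule.ideal_span_singleton_smul] at ha
    obtain ⟨b, -, hb⟩ := ha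
    exact ⟨b, hb.symm⟩

lemma HasFFR.isStablyFree {R : Type u} [CommRing R] {n : ℕ} {M : Type u} [AddCommGroup M]
    [Module R M] [Module.Projective R M] (h : HasFFR R n M) : Module.IsStablyFree R M := by
  induction n generalizing M with
  | zero =>
    have : Subsingleton M := h
    infer_instance
  | succ n ih =>
    obtain ⟨k, f, hf, hk⟩ := h
    obtain ⟨s, hs⟩ := Module.projective_lifting_property f LinearMap.id hf
    have hs' : ∀ m, f (s m) = m := fun m => LinearMap.congr_fun hs m
    let P : (Fin k → R) →ₗ[R] LinearMap.ker f :=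
      LinearMap.codRestrict _ (LinearMap.id - s ∘ₗ f) fun v => by simp [hs']
    let e : (Fin k → R) ≃ₗ[R] M × LinearMap.ker f :=
      LinearEquiv.ofLinearMap (f.prod P)
        (s.coprod (LinearMap.ker f).subtype)
        (by
          refine LinearMap.ext fun ⟨m, v, hv⟩ => Prod.ext ?_ (Subtype.ext ?_)
          · simp [hs', LinearMap.mem_ker.1 hv]
          · simp [P, hs', LinearMap.mem_ker.1 hv])
        (by ext; simp [P])
    have hproj : Module.Projective R (LinearMap.ker f) :=
      Module.Projective.of_split (LinearMap.ker f).subtype P (by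
        refine LinearMap.ext fun ⟨v, hv⟩ => Subtype.ext ?_
        simp [P, LinearMap.mem_ker.1 hv])
    have hfin : Module.Finite R (LinearMap.ker f) :=
      Module.Finite.of_surjective P fun v => ⟨v.1, Subtype.ext (by
        simp [P])⟩
    have := ih hk
    obtain ⟨N, _, _, _, _, _⟩ := Module.IsStablyFree.exist_free_prod R (LinearMap.ker f)
    have : Module.Free R (M × (LinearMap.ker f × N)) :=
      Module.Free.of_equiv ((e.prodCongr (LinearEquiv.refl R N)).trans
        (LinearEquiv.prodAssoc R M (LinearMap.ker f) N))
    exact Module.IsStablyFree.of_free_prod R M (LinearMap.ker f × N)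

lemma HasFFR.localization {R Rₛ : Type u} [CommRing R] [CommRing Rₛ] [Algebra R Rₛ]
    (S : Submonoid R) [IsLocalization S Rₛ] {n : ℕ} {M M' : Type u} [AddCommGroup M]
    [Module R M] [AddCommGroup M'] [Module R M'] [Module Rₛ M'] [IsScalarTower R Rₛ M']
    (g : M →ₗ[R] M') [IsLocalizedModule S g] (h : HasFFR R n M) : HasFFR Rₛ n M' := by
  induction n generalizing M M' with
  | zero =>
    have : Subsingleton M := h
    exact IsLocalizedModule.subsingleton_of_subsingleton S g
  | succ n ih =>
    obtain ⟨k, f, hf, hk⟩ := h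
    let P : (Fin k → R) →ₗ[R] (Fin k → Rₛ) :=
      LinearMap.pi fun i => Algebra.linearMap R Rₛ ∘ₗ LinearMap.proj i
    have hP : IsLocalizedModule S P := IsLocalizedModule.pi S fun _ => Algebra.linearMap R Rₛ
    let F := (IsLocalizedModule.map S P g f).extendScalarsOfIsLocalization S Rₛ
    refine ⟨k, F, IsLocalizedModule.map_surjective S P g f hf, ?_⟩
    let t : LinearMap.ker f →ₗ[R] LinearMap.ker F := LinearMap.toKerIsLocalized S P g f
    have : IsLocalizedModule S t := LinearMap.toKerLocalized_isLocalizedModule Rₛ S P g f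
    exact ih t hk

end FreeResolution

/-! ### Factoriality of regular local rings -/

section Factorial

open IsLocalRing

lemma IsRegularRing.of_isLocalization {R S : Type*} [CommRing R] [CommRing S] [Algebra R S]
    (M : Submonoid R) [IsLocalization M S] [IsRegularRing R] : IsRegularRing S := by
  have := IsLocalization.isNoetherianRing M S inferInstance
  rw [isRegularRing_iff]
  intro p hp
  have := IsLocalization.isLocalization_isLocalization_atPrime_isLocalization M
    (Localization.AtPrime p) p
  exact IsRegularLocalRing.of_ringEquiv (IsLocalization.algEquiv (p.comap
      (algebraMap R S)).primeCompl
    (Localization.AtPrime (p.comap (algebraMap R S))) (Localization.AtPrime p)).toRingEquiv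

lemma exists_notMem_forall_smul_mem {R M : Type*} [CommRing R] [AddCommGroup M] [Module R M]
    {N N' : Submodule R M} (hN : N.FG) (p : Ideal R) [p.IsPrime]
    (h : ∀ a ∈ N, ∃ s ∉ p, s • a ∈ N') : ∃ s ∉ p, ∀ a ∈ N, s • a ∈ N' := by
  classical
  obtain ⟨T, rfl⟩ := hN
  choose! s hs hsa using h
  refine ⟨∏ a ∈ T, s a, ?_, fun a ha => ?_⟩
  · rw [Ideal.IsPrime.prod_mem_iff]
    rintro ⟨a, ha, h⟩
    exact hs a (Submodule.subset_span ha) h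
  · induction ha using Submodule.span_induction with
    | mem a ha =>
      rw [← Finset.prod_erase_mul T s ha, mul_smul]
      exact N'.smul_mem _ (hsa a (Submodule.subset_span ha))
    | zero => simp
    | add a b _ _ iha ihb => rw [smul_add]; exact add_mem iha ihb
    | smul r a _ iha => rw [smul_comm]; exact N'.smul_mem _ iha

/-- A nonzero finitely generated ideal of a domain which is locally principal is an invertible
module. -/
lemma exists_units_of_locally_principal {R : Type u} [CommRing R] [IsDomain R] (I : Ideal R)
    (hI : I ≠ ⊥)
    (h : ∀ m : Ideal R, m.IsMaximal → ∃ t ∈ I, ∃ s ∉ m, ∀ a ∈ I, t ∣ s * a) :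
    ∃ J : (Submodule R (FractionRing R))ˣ, J = IsLocalization.coeSubmodule (FractionRing R) I := by
  obtain ⟨a, ha, ha0⟩ := Submodule.exists_mem_ne_zero_of_ne_bot hI
  have hmul : I * (Submodule.colon (Ideal.span {a}) (I : Set R)) = Ideal.span {a} := by
    refine le_antisymm ?_ ?_
    · rw [Ideal.mul_le]
      intro r hr s hs
      rw [mul_comm]
      exact Submodule.mem_colon.1 hs r hr
    · rw [Ideal.span_singleton_le_iff_mem]
      by_contra hcon
      -- the ideal `D` of those `d` with `d a ∈ I (a : I)` is not contained in any maximal ideal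
      let D : Ideal R := Submodule.colon (I * (Submodule.colon (Ideal.span {a}) (I : Set R))) {a}
      have hD : D ≠ ⊤ := fun h => by
        refine hcon ?_
        have h1 : (1 : R) ∈ D := h ▸ trivial
        simpa using Submodule.mem_colon.1 h1 a rfl
      obtain ⟨m, hm, hle⟩ := Ideal.exists_le_maximal D hD
      obtain ⟨t, ht, s, hs, hst⟩ := h m hm
      obtain ⟨w, hw⟩ := hst a ha
      have hws : s * w ∈ Submodule.colon (Ideal.span {a}) (I : Set R) := by
        refine Submodule.mem_colon.2 fun p hp => ?_
        obtain ⟨c, hc⟩ := hst p hp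
        refine Ideal.mem_span_singleton'.2 ⟨s * c, ?_⟩
        rw [smul_eq_mul]
        linear_combination c * hw - w * hc
      have : s * s ∈ D := by
        refine Submodule.mem_colon.2 fun p hp => ?_
        rw [Set.mem_singleton_iff.1 hp, smul_eq_mul]
        have := Ideal.mul_mem_mul ht hws
        convert this using 1
        linear_combination s * hw
      exact hs ((hm.isPrime.mem_or_mem (hle this)).elim id id)
  have ha0' : algebraMap R (FractionRing R) a ≠ 0 := by
    rwa [Ne, FaithfulSMul.algebraMap_eq_zero_iff]
  have key : IsLocalization.coeSubmodule (FractionRing R) I *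
      (IsLocalization.coeSubmodule (FractionRing R) (Submodule.colon (Ideal.span {a}) (I : Set R)) *
        Submodule.span R {(algebraMap R (FractionRing R) a)⁻¹}) = 1 := by
    rw [← mul_assoc, ← IsLocalization.coeSubmodule_mul, hmul,
      IsLocalization.coeSubmodule_span_singleton, Submodule.span_mul_span,
      Set.singleton_mul_singleton, mul_inv_cancel₀ ha0', Submodule.one_eq_span]
  exact ⟨Units.mkOfMulEqOne _ _ key, rfl⟩

lemma isPrincipal_of_free {R : Type u} [CommRing R] [IsDomain R] (I : Ideal R)
    [Module.Free R I] : I.IsPrincipal := by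
  let b := Module.Free.chooseBasis R I
  have hs : Subsingleton (Module.Free.ChooseBasisIndex R I) := by
    refine ⟨fun i j => ?_⟩
    by_contra hij
    have h := b.linearIndependent
    rw [linearIndependent_iff'] at h
    have h1 := h {i, j} (fun k => if k = i then (b j : R) else -(b i : R)) (by
      rw [Finset.sum_pair hij]
      refine Subtype.ext ?_
      simp [Ne.symm hij, mul_comm]) j (by simp)
    simp only [Ne.symm hij, if_false, neg_eq_zero] at h1
    exact b.ne_zero i (Subtype.ext h1)
  cases isEmpty_or_nonempty (Module.Free.ChooseBasisIndex R I) with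
  | inl h =>
    have : Subsingleton I := b.repr.toEquiv.subsingleton
    exact ⟨0, by rw [Submodule.subsingleton_iff_eq_bot.1 this]; simp⟩
  | inr h =>
    obtain ⟨i⟩ := h
    refine ⟨(b i : R), le_antisymm (fun x hx => ?_) ?_⟩
    · have h1 := b.mem_span ⟨x, hx⟩
      rw [show Set.range b = {b i} from Set.eq_singleton_iff_unique_mem.2
        ⟨⟨i, rfl⟩, by rintro _ ⟨j, rfl⟩; rw [Subsingleton.elim j i]⟩] at h1
      obtain ⟨c, hc⟩ := Submodule.mem_span_singleton.1 h1
      exact Submodule.mem_span_singleton.2 ⟨c, congrArg Subtype.val hc⟩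
    · rw [Submodule.span_le, Set.singleton_subset_iff]
      exact (b i).2

/-- Auslander–Buchsbaum: regular local rings are factorial. -/
theorem uniqueFactorizationMonoid_of_isRegularRing {n : ℕ} {R : Type u} [CommRing R]
    [IsLocalRing R] [IsRegularRing R] (hn : ringKrullDim R = n) : UniqueFactorizationMonoid R := by
  induction n using Nat.strong_induction_on generalizing R with
  | _ n ih =>
  have hreg := IsRegularLocalRing.of_isRegularRing_of_isLocalRing (R := R)
  have hdom := IsRegularLocalRing.isDomain (R := R)
  obtain _ | n := n
  · have h0 := (IsRegularLocalRing.iff_finrank_cotangentSpace R).1 ‹_›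
    rw [hn] at h0
    have h0' : Module.finrank (ResidueField R) (CotangentSpace R) = 0 := by exact_mod_cast h0
    rw [finrank_cotangentSpace_eq_zero_iff] at h0'
    let _ : Field R := h0'.toField
    infer_instance
  obtain ⟨x, hx, hx2, -⟩ := exists_mem_of_ringKrullDim_eq hn ∅ Set.finite_empty (by simp)
  obtain ⟨hq, hqd⟩ := IsRegularLocalRing.quotient hx hx2
  have hx0 : x ≠ 0 := by
    rintro rfl
    exact hx2 (zero_mem _)
  have hxp : Prime x := by
    rw [← Ideal.span_singleton_prime hx0, ← Ideal.Quotient.isDomain_iff_prime]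
    exact IsRegularLocalRing.isDomain
  -- by Nagata's criterion it suffices to treat `R[1/x]`
  rw [UniqueFactorizationMonoid.iff_localizationAway_of_prime hxp]
  let Rx := Localization.Away x
  have hdomx : IsDomain Rx := IsLocalization.Away.isDomain Rx hx0
  have hregx : IsRegularRing Rx := IsRegularRing.of_isLocalization (.powers x)
  refine UniqueFactorizationMonoid.of_forall_isPrincipal_of_height_eq_one fun P _ hP => ?_
  -- a prime `P` of height one of `R[1/x]` is locally principal, as the local rings of `R[1/x]`
  -- are regular of smaller dimension
  have hloc : ∀ m : Ideal Rx, m.IsMaximal → ∃ t ∈ P, ∃ s ∉ m, ∀ a ∈ P, t ∣ s * a := by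
    intro m hm
    by_cases hPm : P ≤ m
    · let L := Localization.AtPrime m
      have hL : IsRegularRing L := IsRegularRing.of_isLocalization m.primeCompl
      have hLreg := IsRegularLocalRing.of_isRegularRing_of_isLocalRing (R := L)
      have hdis : Disjoint (m.primeCompl : Set Rx) P := by
        rw [Set.disjoint_left]
        exact fun a ha ha' => ha (hPm ha')
      have hPL : (P.map (algebraMap Rx L)).IsPrime :=
        IsLocalization.isPrime_of_isPrime_disjoint m.primeCompl L P inferInstance hdis
      have hk : ((maximalIdeal L).spanFinrank : WithBot ℕ∞) = ringKrullDim L :=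
        (isRegularLocalRing_iff L).1 hLreg
      have hlt : (maximalIdeal L).spanFinrank < n + 1 := by
        have h1 : m.comap (algebraMap R Rx) < maximalIdeal R := by
          refine lt_of_le_of_ne (IsLocalRing.le_maximalIdeal (Ideal.IsPrime.ne_top inferInstance))
            fun h => hm.ne_top ?_
          have h2 : x ∈ m.comap (algebraMap R Rx) := h ▸ hx
          exact Ideal.eq_top_of_isUnit_mem _ h2 (IsLocalization.Away.algebraMap_isUnit x)
        have h2 := Ideal.height_strict_mono_of_isPrime_of_isPrime h1
        rw [IsLocalization.height_under (.powers x)] at h2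
        have h3 := IsLocalRing.maximalIdeal_height_eq_ringKrullDim (R := R)
        rw [IsLocalization.AtPrime.ringKrullDim_eq_height m L] at hk
        rw [hn] at h3
        have h4 : (maximalIdeal R).height = (n + 1 : ℕ) := by exact_mod_cast h3
        have h5 : ((maximalIdeal L).spanFinrank : ℕ∞) = m.height := by exact_mod_cast hk
        rw [h4, ← h5] at h2
        exact_mod_cast h2
      have hufd : UniqueFactorizationMonoid L := ih _ hlt hk.symm
      have hLdom := IsRegularLocalRing.isDomain (R := L)
      obtain ⟨g, hg⟩ := UniqueFactorizationMonoid.isPrincipal_of_height_eq_one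
        (p := P.map (algebraMap Rx L))
        ((IsLocalization.height_map_of_disjoint m.primeCompl P hdis).trans hP)
      have hgm : g ∈ P.map (algebraMap Rx L) := hg ▸ Ideal.mem_span_singleton_self g
      obtain ⟨⟨t, s⟩, hts⟩ := (IsLocalization.mem_map_algebraMap_iff m.primeCompl L).1 hgm
      have hpt : ∀ a ∈ P, ∃ r ∉ m, r • a ∈ Ideal.span {(t : Rx)} := by
        intro a ha
        have h1 : algebraMap Rx L a ∈ P.map (algebraMap Rx L) := Ideal.mem_map_of_mem _ ha
        rw [hg] at h1
        obtain ⟨c, hc⟩ := Ideal.mem_span_singleton.1 h1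
        obtain ⟨⟨c', s'⟩, hc'⟩ := IsLocalization.surj m.primeCompl c
        have h2 : algebraMap Rx L (s * s' * a) = algebraMap Rx L (t * c') := by
          simp only [map_mul] at hts hc' ⊢
          rw [hc, ← hts, ← hc']
          ring
        obtain ⟨w, hw⟩ := IsLocalization.exists_of_eq (M := m.primeCompl) h2
        refine ⟨w * (s * s'), (w * (s * s')).2, Ideal.mem_span_singleton'.2 ⟨w * c', ?_⟩⟩
        rw [smul_eq_mul]
        linear_combination -hw
      obtain ⟨s, hs, hsa⟩ := exists_notMem_forall_smul_mem (IsNoetherian.noetherian P) m hpt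
      exact ⟨t, t.2, s, hs, fun a ha => Ideal.mem_span_singleton.1 (hsa a ha)⟩
    · obtain ⟨t, ht, htm⟩ := SetLike.not_le_iff_exists.1 hPm
      exact ⟨t, ht, t, htm, fun a _ => dvd_mul_right _ _⟩
  -- thus `P` is invertible; it has a finite free resolution since its contraction to `R` has one,
  -- so it is stably free, hence free
  obtain ⟨J, hJ⟩ := exists_units_of_locally_principal P (P.ne_bot_of_height_eq_one hP) hloc
  let e : P ≃ₗ[Rx] (J : Submodule Rx (FractionRing Rx)) :=
    (Submodule.equivMapOfInjective (Algebra.linearMap Rx (FractionRing Rx))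
      (IsFractionRing.injective Rx (FractionRing Rx)) P).trans (LinearEquiv.ofEq _ _ hJ.symm)
  have hFFR : HasFFR Rx (n + 1 + 1) P := by
    have h1 := IsRegularLocalRing.hasFFR hn (P.comap (algebraMap R Rx))
    have h2 := HasFFR.localization (Rₛ := Rx) (.powers x)
      (Algebra.idealMap Rx (P.comap (algebraMap R Rx))) h1
    exact HasFFR.of_equiv (LinearEquiv.ofEq _ _
      (IsLocalization.map_under (.powers x) Rx P)) h2
  have hproj : Module.Projective Rx P := Module.Projective.of_equiv e.symm
  have hst : Module.IsStablyFree Rx (J : Submodule Rx (FractionRing Rx)) :=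
    hFFR.isStablyFree.equiv e
  have := Module.free_of_isStablyFree_of_invertible Rx (J : Submodule Rx (FractionRing Rx))
  have : Module.Free Rx P := Module.Free.of_equiv e.symm
  exact isPrincipal_of_free P

end Factorial

/-! ### Étale algebras and factorizations -/

section Etale

open IsLocalRing

/-- An étale algebra over a regular ring is regular. -/
lemma isRegularRing_of_etale {B C : Type u} [CommRing B] [CommRing C] [Algebra B C]
    [Algebra.Etale B C] [IsRegularRing B] : IsRegularRing C := by
  have : IsNoetherianRing C := Algebra.FiniteType.isNoetherianRing B C
  rw [isRegularRing_iff]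
  intro Q _
  refine IsRegularLocalRing.of_spanFinrank_maximalIdeal_le _ ?_
  let q := Q.under B
  let _ := Localization.AtPrime.algebraOfLiesOver q Q
  -- the maximal ideal at `Q` is generated by that at `q`, and `height q ≤ height Q` by going down
  have h1 := ((Algebra.isUnramifiedAt_iff_map_eq B q Q).1 inferInstance).2
  have h2 : q.map (algebraMap B (Localization.AtPrime Q)) =
      (maximalIdeal (Localization.AtPrime q)).map
        (algebraMap (Localization.AtPrime q) (Localization.AtPrime Q)) := by
    rw [← Localization.AtPrime.map_eq_maximalIdeal, Ideal.map_map,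
      ← IsScalarTower.algebraMap_eq]
  have h3 := Ideal.height_eq_height_add_of_liesOver_of_hasGoingDown q Q
  rw [← h1, h2, IsLocalization.AtPrime.ringKrullDim_eq_height Q]
  refine (Nat.cast_le.2 (Ideal.spanFinrank_map_le_of_fg _ (IsNoetherian.noetherian _))).trans ?_
  rw [(isRegularLocalRing_iff (Localization.AtPrime q)).1 inferInstance,
    IsLocalization.AtPrime.ringKrullDim_eq_height q]
  exact_mod_cast h3 ▸ le_self_add

/-- In a factorial domain let `δ` be such that for each prime power `P ^ m` dividing `δ`, with
`m > 0`, the power `P ^ (m + 1)` divides one of the `aᵢ`. Then `aᵢ = Qᵢ rᵢ` where the product of the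
`Qᵢ` is divisible by `δ` and `rᵢ` is a unit only if `aᵢ` is one. -/
lemma exists_factors_of_pow_dvd {R ι : Type*} [CommRing R] [IsDomain R]
    [UniqueFactorizationMonoid R] [Fintype ι] [DecidableEq ι] (a : ι → R) (ha : ∀ i, ¬ IsUnit (a i))
    (ha0 : ∀ i, a i ≠ 0)
    (δ : R) (hδ : δ ≠ 0)
    (h : ∀ p : R, Prime p → ∀ m : ℕ, 0 < m → p ^ m ∣ δ → ∃ i, p ^ (m + 1) ∣ a i) :
    ∃ Q r : ι → R, (∀ i, a i = Q i * r i) ∧ (∀ i, ¬ IsUnit (r i)) ∧ δ ∣ ∏ i, Q i := by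
  -- construct prime factors `s i` of `r i` whenever `Q i` is not a unit, together with the `Q i`,
  -- by induction on the prime power factors of `δ`
  suffices H : ∃ Q s : ι → R, (∀ i, Q i * s i ∣ a i) ∧ (∀ i, IsUnit (s i) → IsUnit (Q i)) ∧
      δ ∣ ∏ i, Q i ∧ ∀ i p, Prime p → p ∣ Q i * s i → p ∣ δ by
    obtain ⟨Q, s, h1, h2, h3, -⟩ := H
    choose t ht using h1
    refine ⟨Q, fun i => s i * t i, fun i => by rw [ht]; ring, fun i hu => ha i ?_, h3⟩
    have hs := isUnit_of_mul_isUnit_left hu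
    rw [ht, mul_assoc]
    exact (h2 i hs).mul hu
  revert hδ h
  refine UniqueFactorizationMonoid.induction_on_coprime δ ?_ ?_ ?_ ?_
  · intro h; exact absurd rfl h
  · intro x hx _ _
    exact ⟨1, 1, by simp, by simp, by simpa using hx.dvd, by
      intro i p hp hd
      rw [Pi.one_apply, mul_one] at hd
      exact absurd (isUnit_of_dvd_one hd) hp.not_isUnit⟩
  · intro p m hp _ h
    obtain rfl | hm := Nat.eq_zero_or_pos m
    · exact ⟨1, 1, by simp, by simp, by simp, by
        intro i p hp hd
        rw [Pi.one_apply, mul_one] at hd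
        exact absurd (isUnit_of_dvd_one hd) hp.not_isUnit⟩
    · obtain ⟨i, hi⟩ := h p hp m hm dvd_rfl
      refine ⟨Pi.mulSingle i (p ^ m), Pi.mulSingle i p, fun j => ?_, fun j hj => ?_, ?_, ?_⟩
      · by_cases hji : j = i
        · subst hji; simpa [← pow_succ] using hi
        · simp [hji]
      · by_cases hji : j = i
        · subst hji
          rw [Pi.mulSingle_eq_same] at hj
          exact absurd hj hp.not_isUnit
        · simp [hji]
      · rw [Finset.prod_pi_mulSingle']
        simp
      · intro j p' hp' hd
        by_cases hji : j = i
        · subst hji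
          rw [Pi.mulSingle_eq_same, Pi.mulSingle_eq_same, ← pow_succ] at hd
          exact (hp'.dvd_of_dvd_pow hd).trans (dvd_pow_self p hm.ne')
        · simp only [ne_eq, hji, not_false_eq_true, Pi.mulSingle_eq_of_ne, mul_one] at hd
          exact absurd (isUnit_of_dvd_one hd) hp'.not_isUnit
  · intro x y hxy hx hy h0 h
    have hx0 : x ≠ 0 := left_ne_zero_of_mul h0
    have hy0 : y ≠ 0 := right_ne_zero_of_mul h0
    obtain ⟨Q, s, h1, h2, h3, h4⟩ := hx hx0 fun p hp m hm hd => h p hp m hm (hd.mul_right _)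
    obtain ⟨Q', s', h1', h2', h3', h4'⟩ := hy hy0 fun p hp m hm hd => h p hp m hm (hd.mul_left _)
    refine ⟨Q * Q', s * s', fun i => ?_, fun i hi => ?_, ?_, fun i p hp hd => ?_⟩
    · have hrel : IsRelPrime (Q i * s i) (Q' i * s' i) := by
        intro d hd hd'
        by_contra hu
        have hd0 : d ≠ 0 := ne_zero_of_dvd_ne_zero (ha0 i) (hd.trans (h1 i))
        obtain ⟨p, hp, hpd⟩ := WfDvdMonoid.exists_irreducible_factor hu hd0
        exact hp.not_isUnit (hxy (h4 i p hp.prime (hpd.trans hd)) (h4' i p hp.prime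
            (hpd.trans hd')))
      have := hrel.mul_dvd (h1 i) (h1' i)
      convert this using 1
      simp only [Pi.mul_apply]; ring
    · rw [Pi.mul_apply] at hi ⊢
      exact (h2 i (isUnit_of_mul_isUnit_left hi)).mul (h2' i (isUnit_of_mul_isUnit_right hi))
    · simp only [Pi.mul_apply, Finset.prod_mul_distrib]
      exact mul_dvd_mul h3 h3'
    · have : p ∣ (Q i * s i) * (Q' i * s' i) := by
        convert hd using 1
        simp only [Pi.mul_apply]; ring
      rcases hp.dvd_or_dvd this with h | h
      · exact (h4 i p hp h).mul_right _
      · exact (h4' i p hp h).mul_left _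

end Etale

/-! ### The different at a normal crossing -/

section EtaleLocal

open IsLocalRing RingTheory.Sequence

lemma exists_notMem_mul_mem_map_of_mem {A B : Type*} [CommRing A] [CommRing B] [Algebra A B]
    [Algebra.EssFiniteType A B] (Q : Ideal B) [Q.IsPrime] [Algebra.IsUnramifiedAt A Q] {a : B}
    (ha : a ∈ Q) : ∃ s ∉ Q, s * a ∈ (Q.under A).map (algebraMap A B) := by
  let q := Q.under A
  let _ := Localization.AtPrime.algebraOfLiesOver q Q
  have h1 := ((Algebra.isUnramifiedAt_iff_map_eq A q Q).1 inferInstance).2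
  have h2 : algebraMap B (Localization.AtPrime Q) a ∈
      (q.map (algebraMap A B)).map (algebraMap B (Localization.AtPrime Q)) := by
    rw [Ideal.map_map, ← IsScalarTower.algebraMap_eq, h1,
        ← Localization.AtPrime.map_eq_maximalIdeal]
    exact Ideal.mem_map_of_mem _ ha
  obtain ⟨s, hs, h3⟩ := (IsLocalization.algebraMap_mem_map_algebraMap_iff Q.primeCompl
    (Localization.AtPrime Q) _ _).1 h2
  exact ⟨s, hs, h3⟩

lemma exists_notMem_mul_mem_of_mem_map {B R : Type*} [CommRing B] [CommRing R] [Algebra B R]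
    [Module.Flat B R] (P : Ideal R) [P.IsPrime] (I : Ideal B) {b : B} {s : R} (hs : s ∉ P)
    (h : s * algebraMap B R b ∈ I.map (algebraMap B R)) : ∃ c ∉ P.under B, c * b ∈ I := by
  let q := P.under B
  let _ := Localization.AtPrime.algebraOfLiesOver q P
  have hfl : Module.Flat (Localization.AtPrime q) (Localization.AtPrime P) := by
    have : Module.Flat B (Localization.AtPrime P) := Module.Flat.trans B R _
    exact (Module.flat_iff_of_isLocalization (Localization.AtPrime q) q.primeCompl
      (M := Localization.AtPrime P)).2 this
  have : Module.FaithfullyFlat (Localization.AtPrime q) (Localization.AtPrime P) :=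
    Module.FaithfullyFlat.of_flat_of_isLocalHom
  have h1 : algebraMap B (Localization.AtPrime q) b ∈ I.map (algebraMap B
      (Localization.AtPrime q)) := by
    rw [← Ideal.comap_map_eq_self_of_faithfullyFlat (B := Localization.AtPrime P)
      (I.map (algebraMap B (Localization.AtPrime q))), Ideal.mem_comap, Ideal.map_map,
      ← IsScalarTower.algebraMap_eq, ← IsScalarTower.algebraMap_apply,
      IsScalarTower.algebraMap_eq B R, RingHom.comp_apply, ← Ideal.map_map]
    exact (IsLocalization.algebraMap_mem_map_algebraMap_iff P.primeCompl _ _ _).2 ⟨s, hs, h⟩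
  obtain ⟨s, hs, h3⟩ := (IsLocalization.algebraMap_mem_map_algebraMap_iff q.primeCompl
    (Localization.AtPrime q) _ _).1 h1
  exact ⟨s, hs, h3⟩

/-- Let `A → A'` be étale, with local parameters `aᵢ` at a prime `u` of `A'` which define the branch
locus of `A → B` near `u`, and let `δ` be a generator of the different of `B` over `A`, the
ramification being tame. Then `δ` does not lie in `𝔭 B`, where `𝔭` is the prime of `A` below `u`. In
the local ring `R` of a point of `Spec (A' ⊗ B)` above `u` the element `δ` divides a product of
proper divisors `Qᵢ` of the `aᵢ`, and the `aᵢ` are part of a regular sequence which generates the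
ideal of `u`. -/
theorem notMem_map_of_etale {A A' B R : Type u} [CommRing A] [CommRing A'] [CommRing B] [CommRing R]
    [Algebra A A'] [Algebra A B] [Algebra A R] [Algebra A' R] [Algebra B R] [IsScalarTower A A' R]
    [IsScalarTower A B R] [Algebra.Etale A A'] [IsDomain B] [IsNoetherianRing B] [IsLocalRing R]
        [IsRegularRing R]
    [Module.Flat A' R] [Module.Flat B R] [Algebra.FormallyUnramified B R]
    [Algebra.EssFiniteType B R] (u : Ideal A') [u.IsPrime] [(maximalIdeal R).LiesOver u]
    (hu : IsRegularLocalRing (Localization.AtPrime u)) {ι : Type*} [Finite ι]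
    (a : ι → A') (hau : ∀ i, algebraMap A' (Localization.AtPrime u) (a i) ∈
      maximalIdeal (Localization.AtPrime u))
    (hli : LinearIndependent (ResidueField (Localization.AtPrime u))
      fun i => (maximalIdeal (Localization.AtPrime u)).toCotangent ⟨_, hau i⟩)
    (e : Ideal B → ℕ) (δ : B) (hδ0 : δ ≠ 0)
    (h1 : ∀ x : Ideal B, x.IsPrime → x.height = 1 → δ ∈ x → ∀ c ∉ x, c * δ ∉ x ^ e x)
    (h2 : ∀ x : Ideal B, x.IsPrime → x.height = 1 → δ ∈ x → ∀ r ∈ x.under A,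
      ∃ c ∉ x, c * algebraMap A B r ∈ x ^ e x)
    (h3 : ∀ x : Ideal B, x.IsPrime → x.height = 1 → δ ∈ x → ∀ u' : Ideal A', u'.IsPrime → u' ≤ u →
      u'.under A = x.under A → ∃ i, a i ∈ u') :
    δ ∉ (u.under A).map (algebraMap A B) := by
  classical
  have := Fintype.ofFinite ι
  let L := Localization.AtPrime u
  have hreg := IsRegularLocalRing.of_isRegularRing_of_isLocalRing (R := R)
  have hdom := IsRegularLocalRing.isDomain (R := R)
  have hufd : UniqueFactorizationMonoid R :=
    uniqueFactorizationMonoid_of_isRegularRing ((isRegularLocalRing_iff R).1 hreg).symm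
  let _ : Algebra L R := (IsLocalization.lift (M := u.primeCompl) (g := algebraMap A' R) (by
    rintro ⟨s, hs⟩
    by_contra hn
    have : s ∈ (maximalIdeal R).under A' := (mem_maximalIdeal _).2 hn
    rw [← (maximalIdeal R).over_def u] at this
    exact hs this)).toAlgebra
  have : IsScalarTower A' L R := .of_algebraMap_eq fun x => (IsLocalization.lift_eq _ x).symm
  have hflL : Module.Flat L R := (Module.flat_iff_of_isLocalization L u.primeCompl (M := R)).2 ‹_›
  have hmap : ∀ y ∈ u, algebraMap A' R y ∈ maximalIdeal R := fun y hy => by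
    rw [(maximalIdeal R).over_def u] at hy
    exact hy
  have hmapL : (maximalIdeal L).map (algebraMap L R) ≤ maximalIdeal R := by
    rw [← Localization.AtPrime.map_eq_maximalIdeal, Ideal.map_map, ← IsScalarTower.algebraMap_eq]
    exact Ideal.map_le_iff_le_comap.2 hmap
  have hloc : IsLocalHom (algebraMap L R) :=
    ((IsLocalRing.local_hom_TFAE (algebraMap L R)).out 2 0).1 hmapL
  have hffL : Module.FaithfullyFlat L R := Module.FaithfullyFlat.of_flat_of_isLocalHom
  have hLR : Function.Injective (algebraMap L R) := FaithfulSMul.algebraMap_injective L R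
  have hBR : Function.Injective (algebraMap B R) := FaithfulSMul.algebraMap_injective B R
  obtain ⟨l, hl, hcard⟩ := exists_list_extend _ hli
  -- `W` is a regular system of parameters of `L` that starts with the `aᵢ`; it stays a regular
  -- sequence in the flat `L`-algebra `R`
  let W : List L := Finset.univ.toList.map (fun i => algebraMap A' L (a i)) ++ l.map Subtype.val
  have hW : Ideal.ofList W = maximalIdeal L := by
    have h := congrArg (Submodule.map (maximalIdeal L).subtype) hl
    rw [Submodule.map_span, Submodule.map_subtype_top] at h
    refine Eq.trans ?_ h
    refine congrArg _ (Set.ext fun x => ?_)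
    simp [W, or_and_right, exists_or, eq_comm, L]
  have hlen : W.length = Module.finrank (ResidueField L) (CotangentSpace L) := by
    refine Eq.trans ?_ hcard
    simp [W, Nat.card_eq_fintype_card]
  have hreg' : IsWeaklyRegular L W :=
    IsRegularLocalRing.isWeaklyRegular_of_ofList_eq (n := W.length) W hW (by
      rw [hlen, (IsRegularLocalRing.iff_finrank_cotangentSpace L).1 hu]) rfl
  have hregR := hreg'.of_flat (S := R)
  have hαm : ∀ i, algebraMap A' R (a i) ∈ maximalIdeal R := fun i => by
    rw [IsScalarTower.algebraMap_apply A' L R]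
    exact hmapL (Ideal.mem_map_of_mem _ (hau i))
  have hδR : algebraMap B R δ ≠ 0 := fun h => hδ0 (hBR (h.trans (map_zero _).symm))
  obtain ⟨Q, r, hQ, hr, hdvd⟩ := exists_factors_of_pow_dvd (fun i => algebraMap A' R (a i))
    (fun i => (mem_maximalIdeal _).1 (hαm i))
    (fun i h0 => by
      rw [IsScalarTower.algebraMap_apply A' L R, map_eq_zero_iff _ hLR] at h0
      refine hli.ne_zero i ?_
      rw [← map_zero (maximalIdeal L).toCotangent]
      exact congrArg _ (Subtype.ext h0)) (algebraMap B R δ) hδR (by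
    intro P hP m hm hPm
    have hPp : (Ideal.span {P}).IsPrime := (Ideal.span_singleton_prime hP.ne_zero).2 hP
    have hdvd_iff : ∀ y, y ∈ Ideal.span {P} ↔ P ∣ y := fun y => Ideal.mem_span_singleton
    -- the prime `x` of `B` below `(P)` has height one, as it contains `δ ≠ 0` and `B → R`
    -- satisfies going down
    let x : Ideal B := (Ideal.span {P}).under B
    have hδx : δ ∈ x := (hdvd_iff _).2 ((dvd_pow_self P hm.ne').trans hPm)
    have hx1 : x.height = 1 := by
      refine le_antisymm ?_ (Order.one_le_iff_ne_zero.2 fun h0 => hδ0 ?_)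
      · refine le_trans ?_ (Ideal.height_le_one_of_isPrincipal_of_mem_minimalPrimes
          (Ideal.span {P}) (Ideal.span {P}) ⟨⟨hPp, le_rfl⟩, fun _ h _ => h.2⟩)
        rw [Ideal.height_eq_height_add_of_liesOver_of_hasGoingDown x (Ideal.span {P})]
        exact le_self_add
      · rw [Ideal.height_eq_zero_iff, IsDomain.minimalPrimes_eq_singleton_bot] at h0
        have h0' : x = ⊥ := h0
        rw [h0'] at hδx
        exact hδx
    have hpow : (x ^ e x).map (algebraMap B R) ≤ Ideal.span {P ^ e x} := by
      rw [Ideal.map_pow, ← Ideal.span_singleton_pow]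
      exact Ideal.pow_right_mono Ideal.map_comap_le _
    -- the exponent of `P` in `δ` is smaller than `e x`, as `P` generates `x R` near `(P)`
    have hme : m + 1 ≤ e x := by
      by_contra! hlt
      obtain ⟨s, hs, hsP⟩ := exists_notMem_mul_mem_map_of_mem (A := B) (Ideal.span {P})
        (Ideal.mem_span_singleton_self P)
      obtain ⟨d, hd⟩ := (pow_dvd_pow P (Nat.le_of_lt_succ hlt)).trans hPm
      obtain ⟨c, hc, hcδ⟩ := exists_notMem_mul_mem_of_mem_map (Ideal.span {P}) (x ^ e x) (b := δ)
        (s := s ^ e x) (fun h => hs (hPp.mem_of_pow_mem _ h)) (by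
          rw [hd, ← mul_assoc, ← mul_pow, Ideal.map_pow]
          exact Ideal.mul_mem_right _ _ (Ideal.pow_mem_pow hsP _))
      exact h1 x inferInstance hx1 hδx c hc hcδ
    -- `x` lies over the branch locus, so some `aᵢ` lies in `(P)`; the prime of `A` below
    -- generates locally that of `A'` and is contained in `xᵉ`, whence `P ^ e ∣ aᵢ`
    have hle : (Ideal.span {P}).under A' ≤ u := by
      rw [(maximalIdeal R).over_def u]
      exact Ideal.comap_mono (le_maximalIdeal hPp.ne_top)
    obtain ⟨i, hi⟩ := h3 x inferInstance hx1 hδx ((Ideal.span {P}).under A') inferInstance hle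
      (by rw [Ideal.under_under, Ideal.under_under])
    refine ⟨i, ?_⟩
    obtain ⟨s, hs, hsa⟩ := exists_notMem_mul_mem_map_of_mem (A := A) ((Ideal.span {P}).under A') hi
    have hA : (x.under A).map (algebraMap A R) ≤ Ideal.span {P ^ e x} := by
      refine Ideal.map_le_iff_le_comap.2 fun y hy => ?_
      obtain ⟨c, hc, hcy⟩ := h2 x inferInstance hx1 hδx y hy
      have h := hpow (Ideal.mem_map_of_mem (algebraMap B R) hcy)
      rw [map_mul, Ideal.mem_span_singleton, ← IsScalarTower.algebraMap_apply] at h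
      exact Ideal.mem_span_singleton.2 (hP.pow_dvd_of_dvd_mul_left _
        (fun h => hc ((hdvd_iff _).2 h)) h)
    have hsR : algebraMap A' R (s * a i) ∈ Ideal.span {P ^ e x} := by
      refine hA ?_
      have h := Ideal.mem_map_of_mem (algebraMap A' R) hsa
      rwa [Ideal.map_map, ← IsScalarTower.algebraMap_eq, Ideal.under_under,
        ← Ideal.under_under (B := B)] at h
    rw [map_mul, Ideal.mem_span_singleton] at hsR
    exact (pow_dvd_pow P hme).trans (hP.pow_dvd_of_dvd_mul_left _
      (fun h => hs ((hdvd_iff _).2 h)) hsR))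
  intro hmem
  refine prod_notMem_of_isWeaklyRegular (Finset.univ.toList.map fun i => (Q i, r i))
    ((l.map Subtype.val).map (algebraMap L R)) ?_ ?_ ?_ ?_
  · intro p hp
    obtain ⟨i, -, rfl⟩ := List.mem_map.1 hp
    exact (mem_maximalIdeal _).2 (hr i)
  · intro c hc
    obtain ⟨c, h, rfl⟩ := List.mem_map.1 hc
    obtain ⟨c, -, rfl⟩ := List.mem_map.1 h
    exact hmapL (Ideal.mem_map_of_mem _ c.2)
  · convert hregR using 1
    simp only [W, List.map_append, List.map_map]
    congr 1
    refine List.map_congr_left fun i _ => ?_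
    simp only [Function.comp_apply]
    rw [← hQ, ← IsScalarTower.algebraMap_apply]
  · have hlist : (Finset.univ.toList.map fun i => (Q i, r i)).map (fun p => p.1 * p.2) =
        (Finset.univ.toList.map fun i => algebraMap A' L (a i)).map (algebraMap L R) := by
      rw [List.map_map, List.map_map]
      refine List.map_congr_left fun i _ => ?_
      simp only [Function.comp_apply]
      rw [← hQ, ← IsScalarTower.algebraMap_apply]
    rw [hlist, ← List.map_append, ← Ideal.map_ofList, hW]
    have h : algebraMap B R δ ∈ (maximalIdeal L).map (algebraMap L R) := by
      have h := Ideal.mem_map_of_mem (algebraMap B R) hmem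
      rw [Ideal.map_map, ← IsScalarTower.algebraMap_eq, IsScalarTower.algebraMap_eq A A',
        ← Ideal.map_map] at h
      have h' := Ideal.map_mono (f := algebraMap A' R) Ideal.map_comap_le h
      rwa [IsScalarTower.algebraMap_eq A' L, ← Ideal.map_map,
        Localization.AtPrime.map_eq_maximalIdeal] at h'
    refine Ideal.mem_of_dvd _ ?_ h
    simpa [List.map_map, Function.comp_def, Finset.prod_toList] using hdvd

attribute [local instance] Algebra.TensorProduct.rightAlgebra in
open TensorProduct in
/-- The case of `notMem_map_of_etale` in which `R` is a local ring of `B ⊗ A'`. -/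
theorem notMem_map_of_etale_of_faithfullyFlat {A A' B : Type u} [CommRing A] [CommRing A']
    [CommRing B] [Algebra A A'] [Algebra A B] [Algebra.Etale A A'] [IsDomain B] [IsRegularRing B]
    [Module.FaithfullyFlat A B] (u : Ideal A') [u.IsPrime]
    (hu : IsRegularLocalRing (Localization.AtPrime u)) {ι : Type*} [Finite ι]
    (a : ι → A') (hau : ∀ i, algebraMap A' (Localization.AtPrime u) (a i) ∈
      maximalIdeal (Localization.AtPrime u))
    (hli : LinearIndependent (ResidueField (Localization.AtPrime u))
      fun i => (maximalIdeal (Localization.AtPrime u)).toCotangent ⟨_, hau i⟩)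
    (e : Ideal B → ℕ) (δ : B) (hδ0 : δ ≠ 0)
    (h1 : ∀ x : Ideal B, x.IsPrime → x.height = 1 → δ ∈ x → ∀ c ∉ x, c * δ ∉ x ^ e x)
    (h2 : ∀ x : Ideal B, x.IsPrime → x.height = 1 → δ ∈ x → ∀ r ∈ x.under A,
      ∃ c ∉ x, c * algebraMap A B r ∈ x ^ e x)
    (h3 : ∀ x : Ideal B, x.IsPrime → x.height = 1 → δ ∈ x → ∀ u' : Ideal A', u'.IsPrime → u' ≤ u →
      u'.under A = x.under A → ∃ i, a i ∈ u') :
    δ ∉ (u.under A).map (algebraMap A B) := by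
  let C := B ⊗[A] A'
  have hff : Module.FaithfullyFlat A' C := Module.FaithfullyFlat.of_linearEquiv A' (A' ⊗[A] B)
    { (TensorProduct.comm A B A').toAddEquiv with
      map_smul' := fun r x => by
        change TensorProduct.comm A B A' (Algebra.TensorProduct.includeRight r * x) =
          r • TensorProduct.comm A B A' x
        refine TensorProduct.induction_on x (by simp) (fun b y => ?_) fun x y hx hy => by
          rw [mul_add, map_add, hx, hy, map_add, smul_add]
        rw [Algebra.TensorProduct.includeRight_apply, Algebra.TensorProduct.tmul_mul_tmul, one_mul]
        rfl }
  obtain ⟨Q, hQ⟩ := PrimeSpectrum.comap_surjective_of_faithfullyFlat (A := A') (B := C) ⟨u, ‹_›⟩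
  have hQu : Q.asIdeal.under A' = u := congrArg PrimeSpectrum.asIdeal hQ
  have hreg : IsRegularRing C := isRegularRing_of_etale (B := B)
  let R := Localization.AtPrime Q.asIdeal
  have : IsRegularRing R := IsRegularRing.of_isLocalization Q.asIdeal.primeCompl
  have : (maximalIdeal R).LiesOver u := ⟨by
    rw [← hQu, ← Ideal.under_under (B := C) (maximalIdeal R),
        Localization.AtPrime.under_maximalIdeal]⟩
  have : Module.Flat A' R := Module.Flat.trans A' C R
  have : Module.Flat B R := Module.Flat.trans B C R
  have : IsScalarTower A A' R := .to₁₂₄ A A' C R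
  have : IsScalarTower A B R := .to₁₂₄ A B C R
  have : Algebra.FormallyUnramified B R := inferInstance
  have : Algebra.EssFiniteType B R := Algebra.EssFiniteType.comp B C R
  exact notMem_map_of_etale (R := R) u hu a hau hli e δ hδ0 h1 h2 h3

end EtaleLocal

/-! ### Valuations at primes of height one -/

section AdicValuation

open IsLocalRing WithZero

lemma lt_exp_add_one_iff {a : WithZero (Multiplicative ℤ)} {n : ℤ} :
    a < exp (n + 1) ↔ a ≤ exp n := by
  obtain rfl | ha := eq_or_ne a 0
  · simp
  · rw [← log_lt_iff_lt_exp ha, ← log_le_iff_le_exp ha, Int.lt_add_one_iff]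

lemma lt_one_iff_le_exp {a : WithZero (Multiplicative ℤ)} : a < 1 ↔ a ≤ exp (-1) := by
  rw [← lt_exp_add_one_iff]; rfl

/-- The valuation `v` on the fraction field `K` of `B` is the normalized discrete valuation whose
ring is the localization of `B` at `x`. -/
structure IsAdicValuation {B K : Type*} [CommRing B] [Field K] [Algebra B K] (x : Ideal B)
    (v : Valuation K (WithZero (Multiplicative ℤ))) : Prop where
  le_one_iff : ∀ s : K, v s ≤ 1 ↔ ∃ c ∉ x, ∃ b, algebraMap B K c * s = algebraMap B K b
  exists_eq : ∃ t : B, v (algebraMap B K t) = exp (-1)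

namespace IsAdicValuation

variable {B K : Type*} [CommRing B] [Field K] [Algebra B K] [FaithfulSMul B K] {x : Ideal B}
  [x.IsPrime] {v : Valuation K (WithZero (Multiplicative ℤ))}

lemma le_one (hv : IsAdicValuation x v) (b : B) : v (algebraMap B K b) ≤ 1 :=
  (hv.le_one_iff _).2 ⟨1, (Ideal.ne_top_iff_one x).1 Ideal.IsPrime.ne_top', b, by simp⟩

lemma lt_one_iff_mem (hv : IsAdicValuation x v) {b : B} : v (algebraMap B K b) < 1 ↔ b ∈ x := by
  have hinj := FaithfulSMul.algebraMap_injective B K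
  obtain rfl | hb0 := eq_or_ne b 0
  · simp
  have hb0' : algebraMap B K b ≠ 0 := (map_ne_zero_iff _ hinj).2 hb0
  constructor
  · intro h
    by_contra hb
    have h1 : v (algebraMap B K b)⁻¹ ≤ 1 :=
      (hv.le_one_iff _).2 ⟨b, hb, 1, by rw [mul_inv_cancel₀ hb0', map_one]⟩
    rw [map_inv₀] at h1
    exact (one_lt_inv₀ (zero_lt_iff.2 ((Valuation.ne_zero_iff v).2 hb0'))).2 h |>.not_ge h1
  · intro hb
    refine lt_of_le_of_ne (hv.le_one b) fun h => ?_
    have h1 : v (algebraMap B K b)⁻¹ ≤ 1 := by rw [map_inv₀, h, inv_one]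
    obtain ⟨c, hc, d, h2⟩ := (hv.le_one_iff _).1 h1
    rw [← div_eq_mul_inv, div_eq_iff hb0', ← map_mul] at h2
    exact hc (hinj h2 ▸ Ideal.mul_mem_left _ _ hb)

lemma eq_one_iff_notMem (hv : IsAdicValuation x v) {b : B} : v (algebraMap B K b) = 1 ↔ b ∉ x := by
  rw [← hv.lt_one_iff_mem, not_lt, le_antisymm_iff, and_iff_right (hv.le_one b)]

lemma lt_one_iff (hv : IsAdicValuation x v) {s : K} :
    v s < 1 ↔ ∃ c ∉ x, ∃ b ∈ x, algebraMap B K c * s = algebraMap B K b := by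
  constructor
  · intro h
    obtain ⟨c, hc, b, hb⟩ := (hv.le_one_iff _).1 h.le
    refine ⟨c, hc, b, hv.lt_one_iff_mem.1 ?_, hb⟩
    rwa [← hb, map_mul, hv.eq_one_iff_notMem.2 hc, one_mul]
  · rintro ⟨c, hc, b, hb, h⟩
    have := hv.lt_one_iff_mem.2 hb
    rwa [← h, map_mul, hv.eq_one_iff_notMem.2 hc, one_mul] at this

lemma le_exp_of_mem_pow (hv : IsAdicValuation x v) {n : ℕ} {b : B} (hb : b ∈ x ^ n) :
    v (algebraMap B K b) ≤ exp (-(n : ℤ)) := by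
  induction n generalizing b with
  | zero => exact hv.le_one b
  | succ n ih =>
    rw [pow_succ] at hb
    refine Submodule.mul_induction_on hb (fun b hb c hc => ?_) fun b c hb hc => ?_
    · rw [map_mul, map_mul, Nat.cast_succ, neg_add, exp_add]
      exact mul_le_mul' (ih hb) (lt_one_iff_le_exp.1 (hv.lt_one_iff_mem.2 hc))
    · rw [map_add]
      exact v.map_add_le hb hc

lemma exists_mul_mem_pow (hv : IsAdicValuation x v) {n : ℕ} {b : B}
    (hb : v (algebraMap B K b) ≤ exp (-(n : ℤ))) :
    ∃ c ∉ x, c * b ∈ x ^ n := by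
  have hinj := FaithfulSMul.algebraMap_injective B K
  obtain ⟨t, ht⟩ := hv.exists_eq
  have ht0 : algebraMap B K t ≠ 0 := fun h => exp_ne_zero (ht.symm.trans (by rw [h, map_zero]))
  have htx : t ∈ x := hv.lt_one_iff_mem.1 (by rw [ht]; exact lt_one_iff_le_exp.2 le_rfl)
  have h1 : v (algebraMap B K b / algebraMap B K t ^ n) ≤ 1 := by
    rw [map_div₀, map_pow, ht, ← exp_nsmul]
    refine div_le_one_of_le₀ (hb.trans_eq ?_) zero_le
    simp
  obtain ⟨c, hc, d, h⟩ := (hv.le_one_iff _).1 h1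
  refine ⟨c, hc, ?_⟩
  rw [mul_div_assoc', div_eq_iff (pow_ne_zero _ ht0), ← map_mul, ← map_pow, ← map_mul] at h
  rw [hinj h]
  exact Ideal.mul_mem_left _ _ (Ideal.pow_mem_pow htx n)

end IsAdicValuation

lemma exists_isAdicValuation_of_isPrincipal {B K : Type*} [CommRing B] [IsDomain B]
    [IsNoetherianRing B] [Field K] [Algebra B K] [IsFractionRing B K] (x : Ideal B) [x.IsPrime]
    (hx : x ≠ ⊥) (h : (maximalIdeal (Localization.AtPrime x)).IsPrincipal) :
    ∃ v : Valuation K (WithZero (Multiplicative ℤ)), IsAdicValuation x v := by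
  let S := Localization.AtPrime x
  have hinj := FaithfulSMul.algebraMap_injective B K
  let _ : Algebra S K := (IsLocalization.lift (M := x.primeCompl) (g := algebraMap B K)
    fun s => IsUnit.mk0 _ ((map_ne_zero_iff _ hinj).2 fun h => s.2 (h ▸ x.zero_mem))).toAlgebra
  have : IsScalarTower B S K := .of_algebraMap_eq fun y => (IsLocalization.lift_eq _ y).symm
  have : IsFractionRing S K :=
    IsFractionRing.isFractionRing_of_isDomain_of_isLocalization x.primeCompl S K
  have hN : IsNoetherianRing S := IsLocalization.isNoetherianRing x.primeCompl S inferInstance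
  have hD : IsDomain S := IsLocalization.isDomain_of_atPrime S x
  have hded : IsDedekindDomain S :=
    ((tfae_of_isNoetherianRing_of_isLocalRing_of_isDomain S).out 4 2).1 h
  have hbot : maximalIdeal S ≠ ⊥ := fun h0 => hx (by
    rw [← Localization.AtPrime.under_maximalIdeal (I := x), h0]
    exact Ideal.comap_bot_of_injective _ (FaithfulSMul.algebraMap_injective B S))
  -- the localization at `x` is a discrete valuation ring
  let w : IsDedekindDomain.HeightOneSpectrum S := ⟨maximalIdeal S, inferInstance, hbot⟩
  have hw1 : ∀ c ∉ x, w.valuation K (algebraMap B K c) = 1 := fun c hc => by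
    rw [IsScalarTower.algebraMap_apply B S K,
      IsDedekindDomain.HeightOneSpectrum.valuation_eq_one_iff_notMem]
    exact fun h => hc (by rwa [← Localization.AtPrime.under_maximalIdeal (I := x)])
  have hle : ∀ s : K, w.valuation K s ≤ 1 ↔
      ∃ c ∉ x, ∃ b, algebraMap B K c * s = algebraMap B K b := by
    intro s
    constructor
    · intro hs
      obtain ⟨n, d, hnd⟩ := w.exists_primeCompl_mul_eq_of_integer s hs
      have hd : IsUnit (d : S) := not_not.1 fun h => d.2 ((mem_maximalIdeal _).2 h)
      obtain ⟨⟨b, c⟩, hbc⟩ := IsLocalization.surj x.primeCompl (n * (hd.unit⁻¹ : Sˣ))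
      refine ⟨c, c.2, b, ?_⟩
      rw [IsScalarTower.algebraMap_apply B S K b, ← hbc, map_mul, map_mul, ← hnd, mul_assoc s,
        ← map_mul, hd.mul_val_inv, map_one, mul_one, mul_comm,
        ← IsScalarTower.algebraMap_apply]
    · rintro ⟨c, hc, b, h⟩
      have h1 := congrArg (w.valuation K) h
      rw [map_mul, hw1 c hc, one_mul] at h1
      rw [h1, IsScalarTower.algebraMap_apply B S K]
      exact w.valuation_le_one _
  refine ⟨w.valuation K, hle, ?_⟩
  obtain ⟨p, hp⟩ := w.valuation_exists_uniformizer K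
  obtain ⟨c, hc, b, h⟩ := (hle p).1 (by rw [hp]; exact (lt_one_iff_le_exp.2 le_rfl).le)
  refine ⟨b, ?_⟩
  rw [← h, map_mul, hw1 c hc, one_mul, hp]

lemma uniqueFactorizationMonoid_localization {B : Type u} [CommRing B] [IsRegularRing B]
    (q : Ideal B) [q.IsPrime] :
    UniqueFactorizationMonoid (Localization.AtPrime q) := by
  have : IsRegularRing (Localization.AtPrime q) := IsRegularRing.of_isLocalization q.primeCompl
  have hreg := IsRegularLocalRing.of_isRegularRing_of_isLocalRing (R := Localization.AtPrime q)
  exact uniqueFactorizationMonoid_of_isRegularRing ((isRegularLocalRing_iff _).1 hreg).symm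

lemma exists_isAdicValuation {B : Type u} [CommRing B] [IsDomain B] [IsRegularRing B] (K : Type*)
    [Field K] [Algebra B K] [IsFractionRing B K] (x : Ideal B)
    [x.IsPrime] (hx : x.height = 1) :
    ∃ v : Valuation K (WithZero (Multiplicative ℤ)), IsAdicValuation x v := by
  have := uniqueFactorizationMonoid_localization x
  have := IsLocalization.isDomain_of_atPrime (Localization.AtPrime x) x
  refine exists_isAdicValuation_of_isPrincipal x (Ideal.ne_bot_of_height_eq_one hx) ?_
  refine UniqueFactorizationMonoid.isPrincipal_of_height_eq_one ?_
  have h1 := IsLocalization.AtPrime.ringKrullDim_eq_height x (Localization.AtPrime x)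
  rw [← IsLocalRing.maximalIdeal_height_eq_ringKrullDim, hx] at h1
  exact_mod_cast h1

/-- A regular domain is the intersection of its localizations at the primes of height one. -/
lemma exists_eq_algebraMap_of_forall_le_one {B : Type u} [CommRing B] [IsDomain B] [IsRegularRing B]
    {K : Type*} [Field K] [Algebra B K] [IsFractionRing B K]
    {v : Ideal B → Valuation K (WithZero (Multiplicative ℤ))}
    (hv : ∀ x : Ideal B, x.IsPrime → x.height = 1 → IsAdicValuation x (v x)) {s : K}
    (hs : ∀ x : Ideal B, x.IsPrime → x.height = 1 → v x s ≤ 1) : ∃ b, algebraMap B K b = s := by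
  -- the ideal of denominators of `s` is not contained in any maximal ideal
  let J : Ideal B :=
    { carrier := {c | ∃ b, algebraMap B K c * s = algebraMap B K b}
      add_mem' := by
        rintro c c' ⟨b, hb⟩ ⟨b', hb'⟩
        exact ⟨b + b', by rw [map_add, map_add, add_mul, hb, hb']⟩
      zero_mem' := ⟨0, by simp⟩
      smul_mem' := by
        rintro r c ⟨b, hb⟩
        exact ⟨r * b, by rw [smul_eq_mul, map_mul, map_mul, mul_assoc, hb]⟩ }
  suffices hJ : J = ⊤ by
    obtain ⟨b, hb⟩ : (1 : B) ∈ J := hJ ▸ Submodule.mem_top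
    exact ⟨b, by rw [← hb, map_one, one_mul]⟩
  by_contra hJ
  obtain ⟨q, hq, hJq⟩ := Ideal.exists_le_maximal J hJ
  let S := Localization.AtPrime q
  have := uniqueFactorizationMonoid_localization q
  have hD : IsDomain S := IsLocalization.isDomain_of_atPrime S q
  have hinj := FaithfulSMul.algebraMap_injective B K
  let _ : Algebra S K := (IsLocalization.lift (M := q.primeCompl) (g := algebraMap B K)
    fun s => IsUnit.mk0 _ ((map_ne_zero_iff _ hinj).2 fun h => s.2 (h ▸ q.zero_mem))).toAlgebra
  have : IsScalarTower B S K := .of_algebraMap_eq fun y => (IsLocalization.lift_eq _ y).symm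
  have : IsFractionRing S K :=
    IsFractionRing.isFractionRing_of_isDomain_of_isLocalization q.primeCompl S K
  have hinjS := FaithfulSMul.algebraMap_injective S K
  -- `B_q` is factorial: a prime factor `p` of the reduced denominator of `s` would give a prime
  -- of height one at which `s` has a pole
  obtain ⟨n, d, hnd, rfl⟩ := IsFractionRing.exists_reduced_fraction (A := S) s
  have hd0 : (d : S) ≠ 0 := nonZeroDivisors.ne_zero d.2
  have hd0' : algebraMap S K d ≠ 0 := (map_ne_zero_iff _ hinjS).2 hd0
  have hmk : IsLocalization.mk' K n d = algebraMap S K n / algebraMap S K d :=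
    IsFractionRing.mk'_eq_div _
  by_cases hu : IsUnit (d : S)
  · obtain ⟨⟨b, c⟩, hbc⟩ := IsLocalization.surj q.primeCompl (n * (hu.unit⁻¹ : Sˣ))
    refine c.2 (hJq ⟨b, ?_⟩)
    rw [IsScalarTower.algebraMap_apply B S K b, ← hbc, IsScalarTower.algebraMap_apply B S K,
      hmk, ← mul_div_assoc, div_eq_iff hd0', ← map_mul, ← map_mul]
    congr 1
    linear_combination (-(n * algebraMap B S c)) * hu.val_inv_mul
  · obtain ⟨p, hp, hpd⟩ := WfDvdMonoid.exists_irreducible_factor hu hd0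
    have hpp := hp.prime
    have : (Ideal.span {p}).IsPrime := (Ideal.span_singleton_prime hpp.ne_zero).2 hpp
    let x : Ideal B := (Ideal.span {p}).under B
    have hht : x.height = 1 := by
      rw [IsLocalization.height_under q.primeCompl]
      refine le_antisymm (Ideal.height_le_one_of_isPrincipal_of_mem_minimalPrimes
          (Ideal.span {p}) (Ideal.span {p}) ⟨⟨this, le_rfl⟩, fun _ h _ => h.2⟩)
          (Order.one_le_iff_ne_zero.2 fun h0 => ?_)
      rw [Ideal.height_eq_zero_iff, IsDomain.minimalPrimes_eq_singleton_bot] at h0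
      exact hpp.ne_zero (Ideal.span_singleton_eq_bot.1 h0)
    have hvx := hv x inferInstance hht
    have hmem : ∀ z : S, v x (algebraMap S K z) ≤ 1 ∧
        (v x (algebraMap S K z) < 1 ↔ p ∣ z) := by
      intro z
      obtain ⟨⟨b, c⟩, hbc⟩ := IsLocalization.surj q.primeCompl z
      have hcu : IsUnit (algebraMap B S c) := IsLocalization.map_units S c
      have hcx : (c : B) ∉ x := fun h => this.ne_top (Ideal.eq_top_of_isUnit_mem _ h hcu)
      have h1 : v x (algebraMap S K z) = v x (algebraMap B K b) := by
        rw [IsScalarTower.algebraMap_apply B S K b, ← hbc, map_mul, map_mul,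
          ← IsScalarTower.algebraMap_apply, hvx.eq_one_iff_notMem.2 hcx, mul_one]
      rw [h1, hvx.lt_one_iff_mem, ← Ideal.mem_span_singleton]
      refine ⟨hvx.le_one b, ?_⟩
      change algebraMap B S b ∈ Ideal.span {p} ↔ _
      rw [← hbc]
      exact Ideal.mul_unit_mem_iff_mem _ hcu
    have h1 := hs x inferInstance hht
    have h2 := (hmem d).2.2 hpd
    have h3 : v x (algebraMap S K n) = 1 := le_antisymm (hmem n).1 (not_lt.1 fun h =>
      hpp.not_isUnit (hnd ((hmem n).2.1 h) hpd))
    rw [hmk, map_div₀, h3, one_div] at h1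
    exact h1.not_gt ((one_lt_inv₀ (zero_lt_iff.2 ((Valuation.ne_zero_iff _).2 hd0'))).2 h2)

end AdicValuation

/-! ### Divisors on regular domains -/

section DivisorialIdeals

open IsLocalRing WithZero nonZeroDivisors

/-- A prime of height one of a regular domain is invertible. -/
lemma coeIdeal_mul_inv_of_height_eq_one {B : Type u} [CommRing B] [IsDomain B] [IsRegularRing B]
    {K : Type*} [Field K] [Algebra B K] [IsFractionRing B K] (x : Ideal B) [x.IsPrime]
    (hx : x.height = 1) :
    (x : FractionalIdeal B⁰ K) * (x : FractionalIdeal B⁰ K)⁻¹ = 1 := by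
  have hinj := FaithfulSMul.algebraMap_injective B K
  have hx0 : (x : FractionalIdeal B⁰ K) ≠ 0 :=
    FractionalIdeal.coeIdeal_ne_zero.2 (Ideal.ne_bot_of_height_eq_one hx)
  have hle : (x : FractionalIdeal B⁰ K) * (x : FractionalIdeal B⁰ K)⁻¹ ≤ 1 := by
    refine FractionalIdeal.mul_le.2 fun i hi j hj => ?_
    rw [mul_comm]
    exact (FractionalIdeal.mem_inv_iff hx0).1 hj i hi
  obtain ⟨J, hJ⟩ := FractionalIdeal.le_one_iff_exists_coeIdeal.1 hle
  have hmemJ : ∀ b, b ∈ J ↔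
      algebraMap B K b ∈ (x : FractionalIdeal B⁰ K) * (x : FractionalIdeal B⁰ K)⁻¹ := fun b => by
    rw [← hJ, FractionalIdeal.mem_coeIdeal]
    exact ⟨fun h => ⟨b, h, rfl⟩, fun ⟨c, hc, h⟩ => hinj h ▸ hc⟩
  rw [← hJ]
  suffices hT : J = ⊤ by rw [hT, FractionalIdeal.coeIdeal_top]
  by_contra hne
  -- if the product were contained in a maximal ideal `q ⊇ x`, a generator `d` of `x B_q` would
  -- give a contradiction
  obtain ⟨q, hq, hJq⟩ := Ideal.exists_le_maximal J hne
  by_cases hxq : x ≤ q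
  · let S := Localization.AtPrime q
    have := uniqueFactorizationMonoid_localization q
    have hD : IsDomain S := IsLocalization.isDomain_of_atPrime S q
    have hdisj : Disjoint (q.primeCompl : Set B) (x : Set B) :=
      Set.disjoint_left.2 fun a ha hax => ha (hxq hax)
    have hxS : (x.map (algebraMap B S)).IsPrime :=
      IsLocalization.isPrime_of_isPrime_disjoint q.primeCompl S x ‹_› hdisj
    have hcom : (x.map (algebraMap B S)).under B = x :=
      IsLocalization.under_map_of_isPrime_disjoint q.primeCompl S ‹_› hdisj
    have hht : (x.map (algebraMap B S)).height = 1 := by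
      rw [← IsLocalization.height_under q.primeCompl, hcom, hx]
    obtain ⟨g, hg⟩ := (UniqueFactorizationMonoid.isPrincipal_of_height_eq_one hht).principal
    obtain ⟨⟨d, c⟩, hdc⟩ := IsLocalization.surj q.primeCompl g
    have hcu : IsUnit (algebraMap B S c) := IsLocalization.map_units S c
    have hspan : x.map (algebraMap B S) = Ideal.span {algebraMap B S d} := by
      change _ = Ideal.span {g} at hg
      rw [hg, ← hdc, Ideal.span_singleton_mul_right_unit hcu]
    have hdx : d ∈ x := by
      rw [← hcom, Ideal.under, Ideal.mem_comap, hspan]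
      exact Ideal.mem_span_singleton_self _
    have hd0 : d ≠ 0 := by
      rintro rfl
      rw [map_zero, Ideal.span_singleton_eq_bot.2 rfl] at hspan
      rw [hspan] at hcom
      refine Ideal.ne_bot_of_height_eq_one hx (hcom.symm.trans ?_)
      exact Ideal.comap_bot_of_injective _ (FaithfulSMul.algebraMap_injective B S)
    obtain ⟨c, hc, hcx⟩ := exists_notMem_forall_smul_mem (N := x) (N' := Ideal.span {d})
      (IsNoetherian.noetherian x) q fun a ha => by
        refine (IsLocalization.algebraMap_mem_map_algebraMap_iff q.primeCompl S _ _).1 ?_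
        rw [Ideal.map_span, Set.image_singleton, ← hspan]
        exact Ideal.mem_map_of_mem _ ha
    have hd0' : algebraMap B K d ≠ 0 := (map_ne_zero_iff _ hinj).2 hd0
    refine hc (hJq ((hmemJ c).2 ?_))
    rw [show algebraMap B K c = algebraMap B K d * (algebraMap B K c / algebraMap B K d) by
      field_simp]
    refine FractionalIdeal.mul_mem_mul (FractionalIdeal.mem_coeIdeal_of_mem _ hdx)
      ((FractionalIdeal.mem_inv_iff hx0).2 fun y hy => ?_)
    obtain ⟨y, hyx, rfl⟩ := (FractionalIdeal.mem_coeIdeal _).1 hy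
    obtain ⟨z, hz⟩ := Ideal.mem_span_singleton.1 (hcx y hyx)
    refine (FractionalIdeal.mem_one_iff _).2 ⟨z, ?_⟩
    rw [div_mul_eq_mul_div, eq_div_iff hd0', ← map_mul, ← map_mul, mul_comm z, ← hz, smul_eq_mul]
  · obtain ⟨b, hbx, hbq⟩ := SetLike.not_le_iff_exists.1 hxq
    refine hbq (hJq ((hmemJ b).2 ?_))
    rw [← mul_one (algebraMap B K b)]
    refine FractionalIdeal.mul_mem_mul (FractionalIdeal.mem_coeIdeal_of_mem _ hbx)
      ((FractionalIdeal.mem_inv_iff hx0).2 fun y hy => ?_)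
    rw [one_mul]
    exact FractionalIdeal.coeIdeal_le_one hy

/-- Given finitely many incomparable primes, an invertible fractional ideal `I` has an element
which generates it locally at each of them. -/
lemma exists_mem_forall_mul_eq_algebraMap {B : Type*} [CommRing B] [IsDomain B] {K : Type*}
    [Field K]
    [Algebra B K] [IsFractionRing B K] {I I' : FractionalIdeal B⁰ K} (hI : I * I' = 1)
    (T : Finset (Ideal B)) (hT : ∀ q ∈ T, q.IsPrime) (hT' : ∀ q ∈ T, ∀ q' ∈ T, q' ≤ q → q' = q) :
    ∃ δ ∈ I, ∀ q ∈ T, ∃ i ∈ I', ∃ u ∉ q, δ * i = algebraMap B K u := by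
  classical
  have hinj := FaithfulSMul.algebraMap_injective B K
  have h1 : ∀ q ∈ T, ∃ j ∈ I, ∃ i ∈ I', ∃ u ∉ q, j * i = algebraMap B K u := by
    intro q hq
    by_contra! h
    have hle : I * I' ≤ (q : FractionalIdeal B⁰ K) := FractionalIdeal.mul_le.2 fun j hj i hi => by
      have h2 : j * i ∈ I * I' := FractionalIdeal.mul_mem_mul hj hi
      rw [hI] at h2
      obtain ⟨u, hu⟩ := (FractionalIdeal.mem_one_iff _).1 h2
      refine (FractionalIdeal.mem_coeIdeal _).2 ⟨u, ?_, hu⟩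
      by_contra huq
      exact h j hj i hi u huq hu.symm
    rw [hI] at hle
    obtain ⟨u, huq, hu⟩ := (FractionalIdeal.mem_coeIdeal _).1 (hle (FractionalIdeal.one_mem_one _))
    rw [← map_one (algebraMap B K)] at hu
    exact (hT q hq).ne_top ((Ideal.eq_top_iff_one q).2 (hinj hu ▸ huq))
  choose! j hj i hi u hu hji using h1
  -- patch the local generators `j q` by coefficients `c q` that vanish at the other primes
  have h2 : ∀ q ∈ T, ∃ c ∉ q, ∀ q' ∈ T, q' ≠ q → c ∈ q' := by
    intro q hq
    have h3 : ∀ q' ∈ T.erase q, ∃ a ∈ q', a ∉ q := fun q' hq' =>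
      SetLike.not_le_iff_exists.1 fun h =>
        Finset.ne_of_mem_erase hq' (hT' q hq q' (Finset.mem_of_mem_erase hq') h)
    choose! a ha ha' using h3
    have := hT q hq
    refine ⟨∏ q' ∈ T.erase q, a q', fun h => ?_, fun q' hq' hne => ?_⟩
    · obtain ⟨q', hq', h⟩ := Ideal.IsPrime.prod_mem_iff.1 h
      exact ha' q' hq' h
    · have hm := Finset.mem_erase.2 ⟨hne, hq'⟩
      exact Ideal.mem_of_dvd _ (Finset.dvd_prod_of_mem a hm) (ha q' hm)
  choose! c hc hc' using h2
  refine ⟨∑ q ∈ T, algebraMap B K (c q) * j q, ?_, fun q hq => ?_⟩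
  · refine Submodule.sum_mem (I : Submodule B K) fun q hq => ?_
    rw [← Algebra.smul_def]
    exact Submodule.smul_mem _ _ (hj q hq)
  · have h4 : ∀ q' ∈ T, ∃ w, algebraMap B K w = j q' * i q := fun q' hq' => by
      have h2 : j q' * i q ∈ I * I' := FractionalIdeal.mul_mem_mul (hj q' hq') (hi q hq)
      rw [hI] at h2
      exact (FractionalIdeal.mem_one_iff _).1 h2
    choose! w hw using h4
    have := hT q hq
    refine ⟨i q, hi q hq, ∑ q' ∈ T, c q' * w q', fun h => ?_, ?_⟩
    · rw [← Finset.add_sum_erase T _ hq] at h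
      have h5 : ∑ q' ∈ T.erase q, c q' * w q' ∈ q := Ideal.sum_mem _ fun q' hq' =>
        Ideal.mul_mem_right _ _ (hc' q' (Finset.mem_of_mem_erase hq') q hq
          (Finset.ne_of_mem_erase hq').symm)
      have h6 : w q = u q := hinj ((hw q hq).trans (hji q hq))
      rcases ‹q.IsPrime›.mem_or_mem ((Ideal.add_mem_iff_left _ h5).1 h) with h | h
      · exact hc q hq h
      · exact hu q hq (h6 ▸ h)
    · rw [Finset.sum_mul, map_sum]
      refine Finset.sum_congr rfl fun q' hq' => ?_
      rw [map_mul, hw q' hq', mul_assoc]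

section

variable {B : Type u} [CommRing B] [IsDomain B] [IsRegularRing B]
  {K : Type*} [Field K] [Algebra B K] [IsFractionRing B K]
  {v : Ideal B → Valuation K (WithZero (Multiplicative ℤ))}

lemma eq_of_le_of_height_eq_one {x y : Ideal B} [x.IsPrime] [y.IsPrime] (hx : x.height = 1)
    (hy : y.height = 1) (h : x ≤ y) : x = y := by
  by_contra hne
  have := Ideal.height_strict_mono_of_isPrime_of_isPrime (lt_of_le_of_ne h hne)
  rw [hx, hy] at this
  exact lt_irrefl _ this

lemma valuation_le_of_mem_mul {w : Valuation K (WithZero (Multiplicative ℤ))}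
    {I J : FractionalIdeal B⁰ K} {m n : ℤ} (hI : ∀ j ∈ I, w j ≤ exp m) (hJ : ∀ j ∈ J, w j ≤ exp n) :
    ∀ j ∈ I * J, w j ≤ exp (m + n) := fun j hj => by
  refine FractionalIdeal.mul_induction_on hj (fun a ha b hb => ?_) fun a b ha hb => ?_
  · rw [map_mul, exp_add]
    exact mul_le_mul' (hI a ha) (hJ b hb)
  · exact w.map_add_le ha hb

lemma valuation_le_of_mem_pow {w : Valuation K (WithZero (Multiplicative ℤ))}
    (hw : ∀ b : B, w (algebraMap B K b) ≤ 1)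
    {I : FractionalIdeal B⁰ K} {m : ℤ} (hI : ∀ j ∈ I, w j ≤ exp m) (n : ℕ) :
    ∀ j ∈ I ^ n, w j ≤ exp (n * m) := by
  induction n with
  | zero =>
    intro j hj
    obtain ⟨b, rfl⟩ := (FractionalIdeal.mem_one_iff B⁰).1 (by rwa [pow_zero] at hj)
    simpa using hw b
  | succ n ih =>
    have h := valuation_le_of_mem_mul ih hI
    rwa [← pow_succ, show n * m + m = ((n + 1 : ℕ) : ℤ) * m by push_cast; ring] at h

/-- The invertible fractional ideal of a divisor. -/
lemma exists_fractionalIdeal_of_finite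
    (hv : ∀ x : Ideal B, x.IsPrime → x.height = 1 → IsAdicValuation x (v x))
    (k : Ideal B → ℕ) (T : Finset (Ideal B)) (hT : ∀ x ∈ T, x.IsPrime ∧ x.height = 1) :
    ∃ I I' : FractionalIdeal B⁰ K, I * I' = 1 ∧ ∀ x : Ideal B, x.IsPrime → x.height = 1 →
      (∀ j ∈ I, v x j ≤ exp (if x ∈ T then (k x : ℤ) else 0)) ∧
      ∀ j ∈ I', v x j ≤ exp (-if x ∈ T then (k x : ℤ) else 0) := by
  classical
  induction T using Finset.induction_on with
  | empty =>
    refine ⟨1, 1, mul_one 1, fun x hx hx1 => ?_⟩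
    have h : ∀ j ∈ (1 : FractionalIdeal B⁰ K), v x j ≤ 1 := fun j hj => by
      obtain ⟨b, rfl⟩ := (FractionalIdeal.mem_one_iff _).1 hj
      exact (hv x hx hx1).le_one b
    simpa using h
  | insert x₀ T hxT ih =>
    obtain ⟨I, I', hI, hb⟩ := ih fun x hx => hT x (Finset.mem_insert_of_mem hx)
    obtain ⟨hp₀, hx₀⟩ := hT x₀ (Finset.mem_insert_self _ _)
    have hu := coeIdeal_mul_inv_of_height_eq_one (K := K) x₀ hx₀
    have hne : (x₀ : FractionalIdeal B⁰ K) ≠ 0 :=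
      FractionalIdeal.coeIdeal_ne_zero.2 (Ideal.ne_bot_of_height_eq_one hx₀)
    refine ⟨(x₀ : FractionalIdeal B⁰ K)⁻¹ ^ k x₀ * I, (x₀ : FractionalIdeal B⁰ K) ^ k x₀ * I', ?_,
      fun x hx hx1 => ?_⟩
    · rw [mul_mul_mul_comm, ← mul_pow, mul_comm _⁻¹, hu, one_pow, one_mul, hI]
    · have hvx := hv x hx hx1
      have hxx : x ≠ x₀ → ∃ b ∈ x₀, b ∉ x := fun h => SetLike.not_le_iff_exists.1 fun hle =>
        h (eq_of_le_of_height_eq_one hx₀ hx1 hle).symm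
      have h1 : (∀ j ∈ (x₀ : FractionalIdeal B⁰ K), v x j ≤ exp (-if x = x₀ then 1 else 0)) := by
        intro j hj
        obtain ⟨b, hb, rfl⟩ := (FractionalIdeal.mem_coeIdeal _).1 hj
        split_ifs with h
        · exact lt_one_iff_le_exp.1 (hvx.lt_one_iff_mem.2 (h ▸ hb))
        · exact hvx.le_one b
      have h2 : (∀ j ∈ (x₀ : FractionalIdeal B⁰ K)⁻¹, v x j ≤ exp (if x = x₀ then 1 else 0)) := by
        intro j hj
        have h3 : ∀ b ∈ x₀, v x j * v x (algebraMap B K b) ≤ 1 := fun b hb => by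
          obtain ⟨c, hc⟩ := (FractionalIdeal.mem_one_iff _).1
            ((FractionalIdeal.mem_inv_iff hne).1 hj _ (FractionalIdeal.mem_coeIdeal_of_mem _ hb))
          rw [← map_mul, ← hc]
          exact hvx.le_one c
        split_ifs with h
        · obtain ⟨t, ht⟩ := hvx.exists_eq
          have h4 := h3 t (h ▸ hvx.lt_one_iff_mem.1 (by rw [ht]; exact lt_one_iff_le_exp.2 le_rfl))
          rw [ht, exp_neg] at h4
          rwa [← div_eq_mul_inv, div_le_one₀ exp_pos] at h4
        · obtain ⟨b, hb, hbx⟩ := hxx h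
          simpa [hvx.eq_one_iff_notMem.2 hbx] using h3 b hb
      have h1' := valuation_le_of_mem_mul (valuation_le_of_mem_pow hvx.le_one h1 (k x₀))
        (hb x hx hx1).2
      have h2' := valuation_le_of_mem_mul (valuation_le_of_mem_pow hvx.le_one h2 (k x₀))
        (hb x hx hx1).1
      have h5 : (k x₀ * (if x = x₀ then 1 else 0) + if x ∈ T then (k x : ℤ) else 0) =
          if x ∈ insert x₀ T then (k x : ℤ) else 0 := by
        by_cases h : x = x₀
        · subst h; simp [hxT]
        · simp [h]
      rw [h5] at h2'
      rw [mul_neg, ← neg_add, h5] at h1'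
      exact ⟨h2', h1'⟩

lemma finite_setOf_height_eq_one_mem {b : B} (hb : b ≠ 0) :
    {x : Ideal B | x.IsPrime ∧ x.height = 1 ∧ b ∈ x}.Finite := by
  refine (Ideal.finite_minimalPrimes_of_isNoetherianRing B (Ideal.span {b})).subset ?_
  rintro x ⟨hx, hx1, hbx⟩
  obtain ⟨y, hy, hyx⟩ := Ideal.exists_minimalPrimes_le ((Ideal.span_singleton_le_iff_mem x).2 hbx)
  have hyp : y.IsPrime := hy.1.1
  have hy0 : y.height ≠ 0 := fun h0 => by
    rw [Ideal.height_eq_zero_iff, IsDomain.minimalPrimes_eq_singleton_bot] at h0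
    have h1 : y = ⊥ := h0
    have h2 := hy.1.2 (Ideal.mem_span_singleton_self b)
    rw [h1] at h2
    exact hb h2
  have hy1 : y.height = 1 := le_antisymm
    (Ideal.height_le_one_of_isPrincipal_of_mem_minimalPrimes _ _ hy)
    (Order.one_le_iff_ne_zero.2 hy0)
  rwa [← eq_of_le_of_height_eq_one hy1 hx1 hyx]

/-- Locally on the base, the divisor `∑ k x • x` is the divisor of a rational function. -/
theorem exists_forall_valuation_eq_exp {A : Type*} [CommRing A] [Algebra A B] [Module.Finite A B]
    [FaithfulSMul A B]
    (hv : ∀ x : Ideal B, x.IsPrime → x.height = 1 → IsAdicValuation x (v x))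
    (k : Ideal B → ℕ) {a₀ : B} (ha₀ : a₀ ≠ 0)
    (hk : ∀ x : Ideal B, x.IsPrime → x.height = 1 → k x ≠ 0 → a₀ ∈ x) (p : Ideal A) [p.IsPrime] :
    ∃ l : K, l ≠ 0 ∧ ∃ f ∉ p, ∀ x : Ideal B, x.IsPrime → x.height = 1 → algebraMap A B f ∉ x →
      v x l = exp (k x : ℤ) := by
  classical
  have hS := finite_setOf_height_eq_one_mem ha₀
  obtain ⟨I, I', hI, hb⟩ := exists_fractionalIdeal_of_finite hv k hS.toFinset
    fun x hx => ⟨(hS.mem_toFinset.1 hx).1, (hS.mem_toFinset.1 hx).2.1⟩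
  have hkT : ∀ x : Ideal B, x.IsPrime → x.height = 1 →
      (if x ∈ hS.toFinset then (k x : ℤ) else 0) = k x := fun x hx hx1 => by
    split_ifs with h
    · rfl
    · by_contra hne
      exact h (hS.mem_toFinset.2 ⟨hx, hx1, hk x hx hx1 fun h0 => hne (by simp [h0])⟩)
  have hP : (p.primesOver B).Finite := Algebra.QuasiFinite.finite_primesOver p
  obtain ⟨l, hl, hlq⟩ := exists_mem_forall_mul_eq_algebraMap hI hP.toFinset
    (fun q hq => (hP.mem_toFinset.1 hq).1) fun q hq q' hq' hle => by
      obtain ⟨hqp, hqo⟩ := hP.mem_toFinset.1 hq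
      obtain ⟨hqp', hqo'⟩ := hP.mem_toFinset.1 hq'
      by_contra hne
      refine (Ideal.IsIntegral.comap_lt_comap (R := A) (lt_of_le_of_ne hle hne)).ne ?_
      exact hqo'.over.symm.trans hqo.over
  -- `l` generates `I` at the primes over `p`, so it has the right valuation at all `x` contained
  -- in one of them
  have hlx : ∀ q ∈ p.primesOver B, ∀ x : Ideal B, x.IsPrime → x.height = 1 → x ≤ q →
      v x l = exp (k x : ℤ) := by
    intro q hq x hx hx1 hxq
    obtain ⟨i, hi, u, hu, h⟩ := hlq q (hP.mem_toFinset.2 hq)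
    have h1 := (hb x hx hx1).1 l hl
    have h2 := (hb x hx hx1).2 i hi
    rw [hkT x hx hx1] at h1 h2
    have h3 : v x l * v x i = 1 := by
      rw [← map_mul, h, (hv x hx hx1).eq_one_iff_notMem]
      exact fun hux => hu (hxq hux)
    refine le_antisymm h1 ?_
    rw [eq_inv_of_mul_eq_one_left h3, ← inv_inv (exp (k x : ℤ)), ← exp_neg]
    exact inv_anti₀ (zero_lt_iff.2 (right_ne_zero_of_mul_eq_one h3)) h2
  have hinj := FaithfulSMul.algebraMap_injective A B
  have hl0 : l ≠ 0 := by
    obtain ⟨q, -, hq, hqp⟩ := Ideal.exists_ideal_over_prime_of_isIntegral p (⊥ : Ideal B) (by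
      rw [Ideal.comap_bot_of_injective _ hinj]; exact bot_le)
    obtain ⟨i, hi, u, hu, h⟩ := hlq q (hP.mem_toFinset.2 ⟨hq, ⟨hqp.symm⟩⟩)
    rintro rfl
    rw [zero_mul, eq_comm, map_eq_zero_iff _ (FaithfulSMul.algebraMap_injective B K)] at h
    exact hu (h ▸ q.zero_mem)
  refine ⟨l, hl0, ?_⟩
  obtain ⟨n, d, hd, rfl⟩ := IsFractionRing.div_surjective (A := B) l
  have hd0 : d ≠ 0 := nonZeroDivisors.ne_zero hd
  have hn0 : n ≠ 0 := by rintro rfl; simp at hl0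
  set l := algebraMap B K n / algebraMap B K d
  -- there are finitely many other `x` at which the valuation of `l` is wrong; `f` is chosen to
  -- vanish at these
  have hbad : {x : Ideal B | x.IsPrime ∧ x.height = 1 ∧ v x l ≠ exp (k x : ℤ)}.Finite := by
    refine (finite_setOf_height_eq_one_mem (mul_ne_zero ha₀ (mul_ne_zero hn0 hd0))).subset ?_
    rintro x ⟨hx, hx1, hne⟩
    refine ⟨hx, hx1, ?_⟩
    by_contra h
    rw [hx.mul_mem_iff_mem_or_mem, hx.mul_mem_iff_mem_or_mem, not_or, not_or] at h
    have hvx := hv x hx hx1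
    refine hne ?_
    have hk0 : k x = 0 := by
      by_contra h0
      exact h.1 (hk x hx hx1 h0)
    rw [map_div₀, hvx.eq_one_iff_notMem.2 h.2.1, hvx.eq_one_iff_notMem.2 h.2.2, hk0]
    simp
  have hf : ∀ x ∈ hbad.toFinset, ∃ f ∉ p, algebraMap A B f ∈ x := by
    intro x hx
    obtain ⟨hx, hx1, hne⟩ := hbad.mem_toFinset.1 hx
    by_contra! h
    obtain ⟨q, hxq, hq, hqp⟩ := Ideal.exists_ideal_over_prime_of_isIntegral p x fun f hf => by
      by_contra hfp
      exact h f hfp hf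
    exact hne (hlx q ⟨hq, ⟨hqp.symm⟩⟩ x hx hx1 hxq)
  choose! f hfp hfx using hf
  refine ⟨∏ x ∈ hbad.toFinset, f x, fun h => ?_, fun x hx hx1 hfx' => ?_⟩
  · obtain ⟨x, hx, h⟩ := Ideal.IsPrime.prod_mem_iff.1 h
    exact hfp x hx h
  · by_contra hne
    have hm := hbad.mem_toFinset.2 ⟨hx, hx1, hne⟩
    rw [map_prod] at hfx'
    exact hfx' (Ideal.mem_of_dvd _ (Finset.dvd_prod_of_mem (fun y => algebraMap A B (f y)) hm)
      (hfx x hm))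

end

end DivisorialIdeals

/-! ### The inverse different of a tame extension -/

section GaloisTrace

open WithZero Pointwise

lemma algebraMap_trace_eq_sum (F : Type*) {K G : Type*} [Field F] [Field K] [Algebra F K] [Group G]
    [Fintype G] [MulSemiringAction G K] [IsGaloisGroup G F K] (s : K) :
    algebraMap F K (Algebra.trace F K s) = ∑ g : G, g • s := by
  have := IsGaloisGroup.isGalois G F K
  have := IsGaloisGroup.finiteDimensional G F K
  rw [trace_eq_sum_automorphisms]
  refine (Equiv.sum_comp (IsGaloisGroup.mulEquivAlgEquiv G F K).toEquiv fun σ => σ s).symm.trans ?_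
  exact Finset.sum_congr rfl fun g _ => rfl

/-- The ramification of `B` over `A` at the primes of height one is tame: `e x` is the ramification
index at `x` and the order of the inertia group of `x` is prime to the residue characteristic. -/
structure IsTameRamification (A G : Type*) {B K : Type*} [CommRing A] [CommRing B] [Field K]
    [Algebra A B] [Algebra B K] [Group G] [MulSemiringAction G B]
    (v : Ideal B → Valuation K (WithZero (Multiplicative ℤ))) (e : Ideal B → ℕ) : Prop where
  isAdic : ∀ x : Ideal B, x.IsPrime → x.height = 1 → IsAdicValuation x (v x)
  le_exp : ∀ x : Ideal B, x.IsPrime → x.height = 1 → ∀ r ∈ x.under A,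
    v x (algebraMap B K (algebraMap A B r)) ≤ exp (-(e x : ℤ))
  exists_eq : ∀ x : Ideal B, x.IsPrime → x.height = 1 → ∃ r ∈ x.under A,
    v x (algebraMap B K (algebraMap A B r)) = exp (-(e x : ℤ))
  card_ne_zero : ∀ x : Ideal B, x.IsPrime → x.height = 1 →
    (Nat.card {g : G // ∀ b : B, g • b - b ∈ x} : B ⧸ x) ≠ 0

variable {A B : Type u} {F K G : Type*} [CommRing A] [CommRing B] [IsDomain B] [IsRegularRing B]
  [Algebra A B] [Field F] [Field K] [Algebra A F] [IsFractionRing A F] [Algebra B K]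
  [IsFractionRing B K] [Algebra F K] [Algebra A K] [IsScalarTower A B K] [IsScalarTower A F K]
  [Group G] [Finite G] [MulSemiringAction G B] [IsGaloisGroup G A B] [MulSemiringAction G K]
  [SMulDistribClass G B K] {v : Ideal B → Valuation K (WithZero (Multiplicative ℤ))}
  {e : Ideal B → ℕ}

/-- An element of `B` which is a quotient of elements of `A` lies in `A`. -/
lemma exists_algebraMap_eq_of_algebraMap_eq [IsGaloisGroup G F K] {b : B} {a : F}
    (h : algebraMap B K b = algebraMap F K a) : ∃ r : A, algebraMap A F r = a := by
  have hinj := FaithfulSMul.algebraMap_injective B K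
  obtain ⟨r, hr⟩ := (IsGaloisGroup.isInvariant (G := G) (A := A) (B := B)).isInvariant b fun g =>
    hinj (by
      have := IsGaloisGroup.commutes (G := G) (A := F) (B := K)
      rw [algebraMap.smul', h, smul_algebraMap])
  refine ⟨r, FaithfulSMul.algebraMap_injective F K ?_⟩
  rw [← h, ← hr, ← IsScalarTower.algebraMap_apply, ← IsScalarTower.algebraMap_apply]

/-- A quotient of elements of `A` which is regular at a prime `x` of `B` is regular at the prime of
`A` below `x`. -/
lemma exists_mul_eq_algebraMap_of_le_one [IsGaloisGroup G F K]
    {x : Ideal B} [x.IsPrime] {w : Valuation K (WithZero (Multiplicative ℤ))}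
    (hw : IsAdicValuation x w) {a : F} (ha : w (algebraMap F K a) ≤ 1) :
    ∃ f ∉ x.under A, ∃ r : A, algebraMap A F f * a = algebraMap A F r := by
  have hc := IsGaloisGroup.commutes (G := G) (A := A) (B := B)
  have hi := IsGaloisGroup.isInvariant (G := G) (A := A) (B := B)
  have hcF := IsGaloisGroup.commutes (G := G) (A := F) (B := K)
  have hint : Algebra.IsIntegral A B := hi.isIntegral
  -- the ideal of denominators of `a` is stable under `G`, so if it were contained in a prime over
  -- that of `A` below `x`, all of which are conjugate, it would be contained in `x`
  let J : Ideal B :=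
    { carrier := {c | ∃ b, algebraMap B K c * algebraMap F K a = algebraMap B K b}
      add_mem' := by
        rintro c c' ⟨b, hb⟩ ⟨b', hb'⟩
        exact ⟨b + b', by rw [map_add, map_add, add_mul, hb, hb']⟩
      zero_mem' := ⟨0, by simp⟩
      smul_mem' := by
        rintro r c ⟨b, hb⟩
        exact ⟨r * b, by rw [smul_eq_mul, map_mul, map_mul, mul_assoc, hb]⟩ }
  have hJ : ∀ (g : G) (c : B), c ∈ J → g • c ∈ J := by
    rintro g c ⟨b, hb⟩
    refine ⟨g • b, ?_⟩
    rw [algebraMap.smul', algebraMap.smul', ← hb, smul_mul', smul_algebraMap g a]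
  by_contra! h
  obtain ⟨Q, hJQ, hQ, hQx⟩ := Ideal.exists_ideal_over_prime_of_isIntegral (x.under A) J
    fun f ⟨b, hb⟩ => by
      by_contra hf
      rw [← IsScalarTower.algebraMap_apply, IsScalarTower.algebraMap_apply A F K, ← map_mul] at hb
      obtain ⟨r, hr⟩ := exists_algebraMap_eq_of_algebraMap_eq (A := A) (G := G) hb.symm
      exact h f hf r hr.symm
  obtain ⟨g, hg⟩ := Algebra.IsInvariant.exists_smul_of_under_eq A B G x Q hQx.symm
  obtain ⟨c, hcx, b, hb⟩ := (hw.le_one_iff _).1 ha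
  have h1 : g • c ∈ Q := hJQ (hJ g c ⟨b, hb⟩)
  rw [hg, Ideal.smul_mem_pointwise_smul_iff] at h1
  exact hcx h1

/-- The trace of an element of the inverse different is regular. -/
theorem exists_algebraMap_eq_trace [IsGaloisGroup G F K] (ht : IsTameRamification A G v e) {s : K}
    (hs : ∀ x : Ideal B, x.IsPrime → x.height = 1 → v x s ≤ exp ((e x : ℤ) - 1)) :
    ∃ r : A, algebraMap A F r = Algebra.trace F K s := by
  cases nonempty_fintype G
  have hc := IsGaloisGroup.commutes (G := G) (A := A) (B := B)
  suffices h : ∀ x : Ideal B, x.IsPrime → x.height = 1 →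
      v x (algebraMap F K (Algebra.trace F K s)) ≤ 1 by
    obtain ⟨b, hb⟩ := exists_eq_algebraMap_of_forall_le_one ht.isAdic h
    exact exists_algebraMap_eq_of_algebraMap_eq (G := G) hb
  intro x hx hx1
  have hvx := ht.isAdic x hx hx1
  obtain ⟨τ, hτx, hτ⟩ := ht.exists_eq x hx hx1
  set a := Algebra.trace F K s with ha
  -- `τ s` vanishes at all the conjugates of `x`, so its trace `τ a` vanishes at `x`; being a
  -- function on the base, `τ a` then vanishes to order `e x`, the order of `τ`
  have h1 : v x (algebraMap F K (algebraMap A F τ * a)) < 1 := by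
    rw [map_mul, ha, algebraMap_trace_eq_sum F (G := G), Finset.mul_sum,
      ← IsScalarTower.algebraMap_apply, IsScalarTower.algebraMap_apply A B K]
    refine (v x).map_sum_lt one_ne_zero fun g _ => ?_
    let x' : Ideal B := x.comap (MulSemiringAction.toRingEquiv G B g)
    have hx' : x'.IsPrime := Ideal.comap_isPrime _ _
    have hx1' : x'.height = 1 := (RingEquiv.height_comap _ _).trans hx1
    have h2 : v x' (algebraMap B K (algebraMap A B τ) * s) < 1 := by
      rw [map_mul, lt_one_iff_le_exp]
      refine (mul_le_mul' (ht.le_exp x' hx' hx1' τ ?_) (hs x' hx' hx1')).trans_eq ?_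
      · change g • algebraMap A B τ ∈ x
        rwa [smul_algebraMap]
      · rw [← exp_add]; congr 1; ring
    obtain ⟨c, hc, b, hb, h3⟩ := (ht.isAdic x' hx' hx1').lt_one_iff.1 h2
    refine hvx.lt_one_iff.2 ⟨g • c, hc, g • b, hb, ?_⟩
    rw [algebraMap.smul', algebraMap.smul', ← h3, smul_mul', smul_mul', ← algebraMap.smul' g
        (algebraMap A B τ) K,
      smul_algebraMap g τ]
  obtain ⟨f, hf, r, hr⟩ := exists_mul_eq_algebraMap_of_le_one (A := A) (G := G) hvx h1.le
  have hf1 : v x (algebraMap F K (algebraMap A F f)) = 1 := by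
    rw [← IsScalarTower.algebraMap_apply, IsScalarTower.algebraMap_apply A B K,
      hvx.eq_one_iff_notMem]
    exact hf
  have h2 : v x (algebraMap B K (algebraMap A B r)) = v x (algebraMap F K
      (algebraMap A F τ * a)) := by
    rw [← IsScalarTower.algebraMap_apply, IsScalarTower.algebraMap_apply A F K, ← hr, map_mul,
      map_mul, hf1, one_mul]
  have h3 := ht.le_exp x hx hx1 r (hvx.lt_one_iff_mem.1 (h2 ▸ h1))
  rw [h2, map_mul, map_mul, ← IsScalarTower.algebraMap_apply, IsScalarTower.algebraMap_apply A B K,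
    hτ] at h3
  exact le_of_mul_le_mul_left (h3.trans_eq (mul_one _).symm) exp_pos

/-- The fractional ideals with integral traces are contained in the inverse different. -/
theorem valuation_le_of_forall_trace [IsGaloisGroup G F K] (ht : IsTameRamification A G v e) {s : K}
    (hs : ∀ b : B, ∃ r : A, algebraMap A F r = Algebra.trace F K (s * algebraMap B K b))
    (x : Ideal B) (hx : x.IsPrime) (hx1 : x.height = 1) : v x s ≤ exp ((e x : ℤ) - 1) := by
  classical
  cases nonempty_fintype G
  have hvx := ht.isAdic x hx hx1
  have hinj := FaithfulSMul.algebraMap_injective B K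
  obtain ⟨τ, hτx, hτ⟩ := ht.exists_eq x hx hx1
  by_contra! hlt
  -- if `s` has a pole of order at least `e x`, write `(τ s)⁻¹ = b / w` with `w ∉ x`
  rw [← not_le, ← lt_exp_add_one_iff, sub_add_cancel, not_lt] at hlt
  have hs0 : s ≠ 0 := by
    rintro rfl
    rw [map_zero] at hlt
    exact hlt.not_gt exp_pos
  have hτ0 : algebraMap B K (algebraMap A B τ) ≠ 0 := fun h => by
    rw [h, map_zero] at hτ
    exact exp_ne_zero hτ.symm
  have h1 : v x (algebraMap B K (algebraMap A B τ) * s)⁻¹ ≤ 1 := by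
    rw [map_inv₀, map_mul, hτ]
    refine inv_le_one_of_one_le₀ ?_
    calc (1 : WithZero (Multiplicative ℤ)) = exp (-(e x : ℤ)) * exp (e x : ℤ) := by
          rw [← exp_add, neg_add_cancel]; rfl
      _ ≤ _ := mul_le_mul' le_rfl hlt
  obtain ⟨w, hw, b, hb⟩ := (hvx.le_one_iff _).1 h1
  have hwb : algebraMap B K w = algebraMap B K (algebraMap A B τ) * (s * algebraMap B K b) := by
    rw [← hb]; field_simp
  -- `w` has traces in `x`
  have h2 : ∀ b', ∑ g : G, g • (w * b') ∈ x := fun b' => by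
    obtain ⟨r, hr⟩ := hs (b * b')
    have h3 : algebraMap B K (∑ g : G, g • (w * b')) =
        algebraMap B K (algebraMap A B τ * algebraMap A B r) := by
      rw [map_sum]
      simp_rw [algebraMap.smul']
      rw [← algebraMap_trace_eq_sum F, map_mul, hwb, mul_assoc, mul_assoc, ← map_mul,
        ← IsScalarTower.algebraMap_apply, IsScalarTower.algebraMap_apply A F K, ← Algebra.smul_def,
        map_smul, ← hr, smul_eq_mul, map_mul, map_mul, ← IsScalarTower.algebraMap_apply,
        ← IsScalarTower.algebraMap_apply, ← IsScalarTower.algebraMap_apply,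
        ← IsScalarTower.algebraMap_apply]
    rw [hinj h3]
    exact Ideal.mul_mem_right _ _ hτx
  -- the characters `b ↦ g • b mod x`
  let χ : G → (B →* B ⧸ x) := fun g =>
    ((Ideal.Quotient.mk x).comp (MulSemiringAction.toRingHom G B g) : B →* B ⧸ x)
  have hχ : ∀ g b', χ g b' = Ideal.Quotient.mk x (g • b') := fun g b' => rfl
  have hli := linearIndependent_monoidHom B (B ⧸ x)
  have h3 : ∑ φ ∈ Finset.univ.image χ, (∑ g with χ g = φ, χ g w) • (φ : B → B ⧸ x) = 0 := by
    funext b'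
    simp only [Finset.sum_apply, Pi.smul_apply, smul_eq_mul, Pi.zero_apply]
    rw [← (Ideal.Quotient.eq_zero_iff_mem.2 (h2 b')), map_sum,
      ← Finset.sum_fiberwise_of_maps_to (t := Finset.univ.image χ) (g := χ)
        (fun g _ => Finset.mem_image_of_mem χ (Finset.mem_univ g))]
    refine Finset.sum_congr rfl fun φ _ => ?_
    rw [Finset.sum_mul]
    refine Finset.sum_congr rfl fun g hg => ?_
    rw [← (Finset.mem_filter.1 hg).2, ← map_mul, hχ]
  -- by independence of characters the coefficient of the trivial one vanishes; it is the order of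
  -- the inertia group times the class of `w`
  have h4 := linearIndependent_iff'.1 hli _ _ h3 (χ 1) (Finset.mem_image_of_mem χ
      (Finset.mem_univ 1))
  have hmem : ∀ g, χ g = χ 1 ↔ ∀ b : B, g • b - b ∈ x := fun g => by
    rw [DFunLike.ext_iff]
    refine forall_congr' fun b => ?_
    rw [hχ, hχ, one_smul, Ideal.Quotient.eq]
  have h5 : ∑ g with χ g = χ 1, χ g w =
      (Nat.card {g : G // ∀ b : B, g • b - b ∈ x} : B ⧸ x) * Ideal.Quotient.mk x w := by
    rw [Finset.sum_congr rfl fun g hg => by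
      rw [(Finset.mem_filter.1 hg).2, hχ, one_smul], Finset.sum_const, nsmul_eq_mul]
    congr 2
    rw [Nat.card_eq_fintype_card, Fintype.card_subtype]
    exact congrArg _ (Finset.filter_congr fun g _ => hmem g)
  rw [h5] at h4
  rcases mul_eq_zero.1 h4 with h | h
  · exact ht.card_ne_zero x hx hx1 h
  · exact hw (Ideal.Quotient.eq_zero_iff_mem.1 h)

end GaloisTrace

/-! ### Surjectivity of the trace -/

section HalfCodifferentAlgebra

open WithZero Module

variable {A B : Type u} {F K G : Type*} [CommRing A] [CommRing B] [IsDomain B] [IsRegularRing B]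
  [Algebra A B] [Field F] [Field K] [Algebra A F] [IsFractionRing A F] [Algebra B K]
  [IsFractionRing B K] [Algebra F K] [Algebra A K] [IsScalarTower A B K] [IsScalarTower A F K]
  [Group G] [Finite G] [MulSemiringAction G B] [IsGaloisGroup G A B] [MulSemiringAction G K]
  [SMulDistribClass G B K] [IsGaloisGroup G F K]
  {v : Ideal B → Valuation K (WithZero (Multiplicative ℤ))} {e k : Ideal B → ℕ} {l : K}

/-- If `l` generates the square root of the inverse different, then the dual of `l B` for the trace
form is contained in `l B`. -/
lemma exists_eq_mul_of_forall_trace (ht : IsTameRamification A G v e)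
    (hl : ∀ x : Ideal B, x.IsPrime → x.height = 1 → v x l = exp (k x : ℤ))
    (he : ∀ x : Ideal B, x.IsPrime → x.height = 1 → e x = 2 * k x + 1) (hl0 : l ≠ 0) {s : K}
    (hs : ∀ b : B, ∃ r : A, algebraMap A F r = Algebra.trace F K (s * (l * algebraMap B K b))) :
    ∃ b, s = algebraMap B K b * l := by
  obtain ⟨b, hb⟩ := exists_eq_algebraMap_of_forall_le_one (K := K) ht.isAdic (s := s / l)
    fun x hx hx1 => by
      have h := valuation_le_of_forall_trace (s := s * l) ht
        (fun b => by rw [mul_assoc]; exact hs b) x hx hx1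
      rw [map_mul, hl x hx hx1, he x hx hx1] at h
      rw [map_div₀, hl x hx hx1, div_le_one₀ exp_pos]
      refine le_of_mul_le_mul_right (h.trans_eq ?_) (exp_pos (a := (k x : ℤ)))
      rw [← exp_add]; congr 1; push_cast; ring
  exact ⟨b, by rw [hb, div_mul_cancel₀ _ hl0]⟩

/-- A basis of `B` over `A` as a basis of fraction fields. -/
lemma exists_basis_fractionField (G : Type*) [Group G] [Finite G] [MulSemiringAction G B]
    [IsGaloisGroup G A B] [MulSemiringAction G K] [IsGaloisGroup G F K] {ι : Type*} [Fintype ι]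
    (β : Basis ι A B) :
    ∃ c : Basis ι F K, ∀ i, c i = algebraMap B K (β i) := by
  have hfin : Module.Finite A B := Module.Finite.of_basis β
  have hfr : Module.Free A B := Module.Free.of_basis β
  have hdom : IsDomain A := (IsFractionRing.injective A F).isDomain _
  have := IsGaloisGroup.finiteDimensional G F K
  have hinj := FaithfulSMul.algebraMap_injective B K
  let f : B →ₗ[A] K := (IsScalarTower.toAlgHom A B K).toLinearMap
  have hli : LinearIndependent A (fun i => algebraMap B K (β i)) :=
    β.linearIndependent.map' f (LinearMap.ker_eq_bot.2 hinj)
  have hli' : LinearIndependent F (fun i => algebraMap B K (β i)) := hli.localization F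
      (nonZeroDivisors A)
  have hcard : Fintype.card ι = finrank F K := by
    rw [← IsGaloisGroup.card_eq_finrank G F K, IsGaloisGroup.card_eq_finrank' (A := A) (B := B) G,
      Module.finrank_eq_card_basis β]
  cases isEmpty_or_nonempty ι
  · have := Module.finrank_pos (R := F) (M := K)
    rw [← hcard, Fintype.card_eq_zero] at this
    exact absurd this (lt_irrefl _)
  · exact ⟨basisOfLinearIndependentOfCardEqFinrank hli' hcard, fun i => by simp⟩

/-- If all traces of elements of `B` lie in `p`, then so does, in `p B`, the generator of the
different. -/
lemma exists_mem_map_of_forall_trace_mem (ht : IsTameRamification A G v e)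
    (hl : ∀ x : Ideal B, x.IsPrime → x.height = 1 → v x l = exp (k x : ℤ))
    (he : ∀ x : Ideal B, x.IsPrime → x.height = 1 → e x = 2 * k x + 1)
    {ι : Type*} [Fintype ι] (β : Basis ι A B) (p : Ideal A)
    (hp : ∀ (b : B) (r : A), algebraMap A F r = Algebra.trace F K (algebraMap B K b) → r ∈ p) :
    ∃ δ ∈ p.map (algebraMap A B), algebraMap B K δ = (l ^ 2)⁻¹ := by
  classical
  have := IsGaloisGroup.isGalois G F K
  have := IsGaloisGroup.finiteDimensional G F K
  obtain ⟨c, hc⟩ := exists_basis_fractionField (F := F) (K := K) G β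
  -- the dual basis `d i` lies in the inverse different, and `1 = ∑ tr (β i) d i` has coefficients
  -- in `p`; multiply by the generator `l⁻²` of the different
  have hnd := traceForm_nondegenerate F K
  let d := LinearMap.BilinForm.dualBasis (Algebra.traceForm F K) hnd c
  have hd : ∀ i j, Algebra.trace F K (d i * c j) = if j = i then 1 else 0 := fun i j =>
    LinearMap.BilinForm.apply_dualBasis_left hnd c i j
  have htr : ∀ i (b : B), algebraMap A F (β.repr b i) = Algebra.trace F K
      (d i * algebraMap B K b) := by
    intro i b
    conv_rhs => rw [← β.sum_repr b, map_sum, Finset.mul_sum, map_sum]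
    have hsm : ∀ j, Algebra.trace F K (d i * algebraMap B K (β.repr b j • β j)) =
        algebraMap A F (β.repr b j) * if j = i then 1 else 0 := fun j => by
      have : d i * algebraMap B K (β.repr b j • β j) =
          algebraMap A F (β.repr b j) • (d i * c j) := by
        rw [Algebra.smul_def, Algebra.smul_def, map_mul (algebraMap B K), hc,
          ← IsScalarTower.algebraMap_apply, ← IsScalarTower.algebraMap_apply]
        ring
      rw [this, map_smul, hd, smul_eq_mul]
    rw [Finset.sum_eq_single i]
    · rw [hsm, if_pos rfl, mul_one]
    · intro j _ hj
      rw [hsm, if_neg hj, mul_zero]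
    · intro h; exact absurd (Finset.mem_univ i) h
  have hmem : ∀ i, ∃ b, algebraMap B K b = (l ^ 2)⁻¹ * d i := fun i =>
    exists_eq_algebraMap_of_forall_le_one ht.isAdic fun x hx hx1 => by
      have h := valuation_le_of_forall_trace ht (fun b => ⟨_, htr i b⟩) x hx hx1
      rw [map_mul, map_inv₀, map_pow, hl x hx hx1, ← exp_nsmul, ← exp_neg]
      refine (mul_le_mul' le_rfl h).trans_eq ?_
      rw [he x hx hx1, ← exp_add, ← exp_zero]; congr 1; push_cast; simp
  choose b hb using hmem
  have htrB : ∀ b : B, ∃ r : A, algebraMap A F r = Algebra.trace F K (algebraMap B K b) := fun b =>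
    exists_algebraMap_eq_trace ht fun x hx hx1 => by
      refine ((ht.isAdic x hx hx1).le_one b).trans ?_
      rw [← exp_zero, exp_le_exp, he x hx hx1]; push_cast; simp
  choose r hr using fun i => htrB (β i)
  refine ⟨∑ i, algebraMap A B (r i) * b i,
    Ideal.sum_mem _ fun i _ => Ideal.mul_mem_right _ _ (Ideal.mem_map_of_mem _ (hp _ _ (hr i))), ?_⟩
  have h1 : (1 : K) = ∑ i, algebraMap F K (algebraMap A F (r i)) * d i := by
    conv_lhs => rw [← d.sum_repr 1]
    refine Finset.sum_congr rfl fun i _ => ?_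
    rw [LinearMap.BilinForm.dualBasis_repr_apply, Algebra.smul_def, Algebra.traceForm_apply,
        one_mul,
      hc, hr]
  rw [map_sum, ← mul_one (l ^ 2)⁻¹, h1, Finset.mul_sum]
  refine Finset.sum_congr rfl fun i _ => ?_
  rw [map_mul, hb, ← IsScalarTower.algebraMap_apply, ← IsScalarTower.algebraMap_apply]
  ring

/-- Unramified case of the surjectivity of the trace. -/
theorem exists_trace_notMem_of_unramified (ht : IsTameRamification A G v e)
    (hl : ∀ x : Ideal B, x.IsPrime → x.height = 1 → v x l = exp (k x : ℤ))
    (he : ∀ x : Ideal B, x.IsPrime → x.height = 1 → e x = 2 * k x + 1) (hl0 : l ≠ 0)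
    {ι : Type*} [Fintype ι] (β : Basis ι A B) (p : Ideal A) [p.IsPrime]
    (hp : ∀ x : Ideal B, x.IsPrime → x.height = 1 → x.under A ≤ p → e x = 1) :
    ∃ (b : B) (r : A), algebraMap A F r = Algebra.trace F K (algebraMap B K b) ∧ r ∉ p := by
  by_contra! h
  obtain ⟨δ, hδ, hδl⟩ := exists_mem_map_of_forall_trace_mem ht hl he β p h
  have hinj := FaithfulSMul.algebraMap_injective B K
  have hc := IsGaloisGroup.isInvariant (G := G) (A := A) (B := B)
  have hint : Algebra.IsIntegral A B := hc.isIntegral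
  obtain ⟨q, -, hq, hqp⟩ := Ideal.exists_ideal_over_prime_of_isIntegral p (⊥ : Ideal B) (by
    rw [Ideal.comap_bot_of_injective]
    · exact bot_le
    · intro a a' haa
      refine IsFractionRing.injective A F (FaithfulSMul.algebraMap_injective F K ?_)
      rw [← IsScalarTower.algebraMap_apply, ← IsScalarTower.algebraMap_apply,
        IsScalarTower.algebraMap_apply A B K, haa, ← IsScalarTower.algebraMap_apply])
  have hδq : δ ∈ q := (Ideal.map_le_iff_le_comap.2 hqp.ge) hδ
  -- the generator `δ` of the different vanishes at a prime of height one over a prime contained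
  -- in `p`, where the extension is ramified
  obtain ⟨x, hx, hxq⟩ := Ideal.exists_minimalPrimes_le ((Ideal.span_singleton_le_iff_mem q).2 hδq)
  have hxp : x.IsPrime := hx.1.1
  have hδx : δ ∈ x := hx.1.2 (Ideal.mem_span_singleton_self δ)
  have hδ0 : δ ≠ 0 := by
    rintro rfl
    rw [map_zero, eq_comm, inv_eq_zero] at hδl
    exact pow_ne_zero 2 hl0 hδl
  have hx1 : x.height = 1 := by
    refine le_antisymm (Ideal.height_le_one_of_isPrincipal_of_mem_minimalPrimes _ _ hx)
      (Order.one_le_iff_ne_zero.2 fun h0 => ?_)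
    rw [Ideal.height_eq_zero_iff, IsDomain.minimalPrimes_eq_singleton_bot] at h0
    have h1 : x = ⊥ := h0
    rw [h1] at hδx
    exact hδ0 hδx
  have h1 := hp x hxp hx1 ((Ideal.comap_mono hxq).trans hqp.le)
  have h2 := (ht.isAdic x hxp hx1).lt_one_iff_mem.2 hδx
  have hk : k x = 0 := by have := he x hxp hx1; omega
  rw [hδl, map_inv₀, map_pow, hl x hxp hx1, hk] at h2
  simp at h2

/-- The trace of a tamely ramified extension is locally surjective: the case of a point of the
branch locus, which is a divisor with normal crossings in an étale neighbourhood `A'`. -/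
theorem exists_trace_notMem_of_etale (ht : IsTameRamification A G v e)
    (hl : ∀ x : Ideal B, x.IsPrime → x.height = 1 → v x l = exp (k x : ℤ))
    (he : ∀ x : Ideal B, x.IsPrime → x.height = 1 → e x = 2 * k x + 1) (hl0 : l ≠ 0)
    {ι : Type*} [Fintype ι] (β : Basis ι A B) {A' : Type u} [CommRing A'] [Algebra A A']
    [Algebra.Etale A A'] (u : Ideal A') [u.IsPrime]
    (hu : IsRegularLocalRing (Localization.AtPrime u)) {κ : Type*} [Finite κ]
    (a : κ → A') (hau : ∀ i, algebraMap A' (Localization.AtPrime u) (a i) ∈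
      IsLocalRing.maximalIdeal (Localization.AtPrime u))
    (hli : LinearIndependent (IsLocalRing.ResidueField (Localization.AtPrime u))
      fun i => (IsLocalRing.maximalIdeal (Localization.AtPrime u)).toCotangent ⟨_, hau i⟩)
    (hb : ∀ x : Ideal B, x.IsPrime → x.height = 1 → e x ≠ 1 → ∀ u' : Ideal A', u'.IsPrime →
      u' ≤ u → u'.under A = x.under A → ∃ i, a i ∈ u') :
    ∃ (b : B) (r : A), algebraMap A F r = Algebra.trace F K (algebraMap B K b) ∧ r ∉ u.under A := by
  by_contra! h
  obtain ⟨δ, hδ, hδl⟩ := exists_mem_map_of_forall_trace_mem ht hl he β _ h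
  have hδ0 : δ ≠ 0 := by
    rintro rfl
    rw [map_zero, eq_comm, inv_eq_zero] at hδl
    exact pow_ne_zero 2 hl0 hδl
  have hvδ : ∀ x : Ideal B, x.IsPrime → x.height = 1 →
      v x (algebraMap B K δ) = exp (-(2 * k x : ℤ)) := fun x hx hx1 => by
    rw [hδl, map_inv₀, map_pow, hl x hx hx1, ← exp_nsmul, ← exp_neg, nsmul_eq_mul]; norm_cast
  have hfr : Module.Free A B := Module.Free.of_basis β
  have hfl : Module.FaithfullyFlat A B := by
    have : Nonempty ι := by
      by_contra hne
      rw [not_nonempty_iff] at hne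
      exact not_subsingleton B β.repr.toEquiv.subsingleton
    have : Nontrivial B := inferInstance
    exact Module.FaithfullyFlat.of_linearEquiv _ _ β.repr
  -- `δ` vanishes at `x` to order `2 k = e - 1 < e`
  refine notMem_map_of_etale_of_faithfullyFlat u hu a hau hli e δ hδ0 ?_ ?_ ?_ hδ
  · intro x hx hx1 hδx c hc h
    have h1 := (ht.isAdic x hx hx1).le_exp_of_mem_pow h
    rw [map_mul, map_mul, (ht.isAdic x hx hx1).eq_one_iff_notMem.2 hc, one_mul, hvδ x hx hx1,
      exp_le_exp, he x hx hx1] at h1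
    push_cast at h1
    omega
  · intro x hx hx1 hδx r hr
    exact (ht.isAdic x hx hx1).exists_mul_mem_pow (ht.le_exp x hx hx1 r hr)
  · intro x hx hx1 hδx
    refine hb x hx hx1 fun h1 => ?_
    have h2 := (ht.isAdic x hx hx1).lt_one_iff_mem.2 hδx
    have hk : k x = 0 := by have := he x hx hx1; omega
    rw [hvδ x hx hx1, hk] at h2
    simp at h2

end HalfCodifferentAlgebra

/-! ### Inertia groups and ramification indices -/

section InertiaOrder

open Ideal Algebra

variable {R S G : Type*} [CommRing R] [CommRing S] [Algebra R S] [Group G]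
  [MulSemiringAction G S] [IsGaloisGroup G R S] [Finite G]

open scoped Pointwise

attribute [local instance] Ideal.Quotient.field in
/-- The order of the decomposition group, for a separable residue field extension. -/
theorem card_stabilizer_eq_card_inertia_mul_inertiaDeg (p : Ideal R) [p.IsPrime]
    (P : Ideal S) [P.LiesOver p] [P.IsPrime]
    (hsep : letI := Localization.AtPrime.algebraOfLiesOver p P
      Algebra.IsSeparable p.ResidueField P.ResidueField) :
    Nat.card (MulAction.stabilizer G P) = Nat.card (P.inertia G) * P.inertiaDeg R := by
  let := Localization.AtPrime.algebraOfLiesOver p P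
  have heq : (algebraMap (S ⧸ P) P.ResidueField).comp (algebraMap (R ⧸ p) (S ⧸ P)) =
      (algebraMap p.ResidueField P.ResidueField).comp (algebraMap (R ⧸ p) p.ResidueField) := by
    ext
    simp [← IsScalarTower.algebraMap_apply]
  let := ((algebraMap (S ⧸ P) P.ResidueField).comp (algebraMap (R ⧸ p) (S ⧸ P))).toAlgebra
  have : IsScalarTower (R ⧸ p) (S ⧸ P) P.ResidueField := .of_algebraMap_eq' rfl
  have : IsScalarTower (R ⧸ p) p.ResidueField P.ResidueField := .of_algebraMap_eq' heq
  have : IsGalois p.ResidueField P.ResidueField :=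
    { __ := Ideal.IsFractionRing.normal G p P p.ResidueField P.ResidueField
      to_isSeparable := hsep }
  have : Module.Finite p.ResidueField P.ResidueField :=
    Ideal.IsFractionRing.finite_of_isInvariant G p P p.ResidueField P.ResidueField
  have : Subgroup.index _ = _ := Nat.card_congr
    (IsFractionRing.stabilizerQuotientInertiaEquiv G p P p.ResidueField P.ResidueField).toEquiv
  rw [inertiaDeg_eq p P, ← IsGalois.card_aut_eq_finrank p.ResidueField P.ResidueField, ← this,
    ← ((P.inertia G).subgroupOf (MulAction.stabilizer G P)).card_mul_index,
    Nat.card_congr (Subgroup.subgroupOfEquivOfLe (inertia_le_stabilizer (M := G) P)).toEquiv,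
    AddSubgroup.subgroupOf_inertia]

/-- The order of the inertia group is the ramification index, for a separable residue field
extension. -/
lemma card_inertia_eq_ramificationIdx [IsDomain R] [IsDomain S] [Module.Finite R S]
    [Module.Flat R S] (p : Ideal R) (P : Ideal S) [P.LiesOver p] [p.IsPrime] [P.IsPrime]
    (hsep : letI := Localization.AtPrime.algebraOfLiesOver p P
      Algebra.IsSeparable p.ResidueField P.ResidueField) :
    Nat.card (P.inertia G) = P.ramificationIdx R := by
  have H : (p.primesOver S).ncard * Nat.card (P.inertia G) * P.inertiaDeg R = Nat.card G := by
    rw [mul_assoc, ← card_stabilizer_eq_card_inertia_mul_inertiaDeg p P hsep,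
      ← IsInvariant.orbit_eq_primesOver R S G p P]
    simpa using Nat.card_congr (MulAction.orbitProdStabilizerEquivGroup G P)
  rw [← inertiaDegIn_eq_inertiaDeg p P G] at H
  rw [← ramificationIdxIn_eq_ramificationIdx p P G]
  have h1 : (p.primesOver S).ncard ≠ 0 := by grind [Nat.card_pos]
  have h2 : p.inertiaDegIn S ≠ 0 := by grind [Nat.card_pos]
  rwa [← ncard_primesOver_mul_ramificationIdxIn_mul_inertiaDegIn p S G,
    mul_assoc, mul_right_inj' h1, mul_left_inj' h2] at H

end InertiaOrder

section LocalRingAtPrime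

open WithZero IsLocalRing

lemma injective_algebraMap_of_isLocalization_atPrime (B : Type*) {K O : Type*} [CommRing B]
    [Field K]
    [Algebra B K] [FaithfulSMul B K] (x : Ideal B) [x.IsPrime] [CommRing O] [Algebra B O]
    [Algebra O K] [IsScalarTower B O K] [IsLocalization.AtPrime O x] :
    Function.Injective (algebraMap O K) := by
  refine (injective_iff_map_eq_zero _).2 fun a ha => ?_
  obtain ⟨⟨b, d⟩, h⟩ := IsLocalization.surj x.primeCompl a
  have hb : algebraMap B K b = 0 := by
    rw [IsScalarTower.algebraMap_apply B O K, ← h, map_mul, ha, zero_mul]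
  rw [(map_eq_zero_iff _ (FaithfulSMul.algebraMap_injective B K)).1 hb, map_zero] at h
  exact (IsLocalization.map_units O d).mul_left_eq_zero.1 h

namespace IsAdicValuation

variable {B K O : Type*} [CommRing B] [Field K] [Algebra B K] [FaithfulSMul B K] {x : Ideal B}
    [x.IsPrime] {v : Valuation K (WithZero (Multiplicative ℤ))} [CommRing O]
    [Algebra B O] [Algebra O K] [IsScalarTower B O K] [IsLocalization.AtPrime O x]

lemma le_one_iff_mem_range (hv : IsAdicValuation x v) {s : K} :
    v s ≤ 1 ↔ ∃ c : O, s = algebraMap O K c := by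
  rw [hv.le_one_iff]
  have hinj := FaithfulSMul.algebraMap_injective B K
  have hne : ∀ c ∉ x, algebraMap B K c ≠ 0 := fun c hc h =>
    hc ((map_eq_zero_iff _ hinj).1 h ▸ x.zero_mem)
  constructor
  · rintro ⟨c, hc, b, h⟩
    refine ⟨IsLocalization.mk' O b (⟨c, hc⟩ : x.primeCompl), mul_left_cancel₀ (hne c hc) ?_⟩
    rw [h, IsScalarTower.algebraMap_apply B O K c, ← map_mul,
      IsLocalization.mk'_spec' O b (⟨c, hc⟩ : x.primeCompl), ← IsScalarTower.algebraMap_apply]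
  · rintro ⟨c, rfl⟩
    obtain ⟨⟨b, d⟩, h⟩ := IsLocalization.surj x.primeCompl c
    exact ⟨d.1, d.2, b, by
      rw [IsScalarTower.algebraMap_apply B O K, IsScalarTower.algebraMap_apply B O K, ← h, map_mul,
        mul_comm]⟩

lemma mem_maximalIdeal_iff [IsLocalRing O] (hv : IsAdicValuation x v) {c : O} :
    c ∈ maximalIdeal O ↔ v (algebraMap O K c) < 1 := by
  obtain ⟨⟨b, d⟩, h⟩ := IsLocalization.surj x.primeCompl c
  have h1 : v (algebraMap O K c) = v (algebraMap B K b) := by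
    rw [IsScalarTower.algebraMap_apply B O K, ← h, map_mul, map_mul,
      ← IsScalarTower.algebraMap_apply, hv.eq_one_iff_notMem.2 d.2, mul_one]
  rw [h1, hv.lt_one_iff_mem, ← IsLocalization.AtPrime.to_map_mem_maximal_iff O x, ← h,
    Ideal.mul_unit_mem_iff_mem]
  exact IsLocalization.map_units O d

lemma mem_maximalIdeal_pow_iff [IsLocalRing O] (hv : IsAdicValuation x v) {n : ℕ} {c : O} :
    c ∈ maximalIdeal O ^ n ↔ v (algebraMap O K c) ≤ exp (-(n : ℤ)) := by
  constructor
  · intro h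
    induction n generalizing c with
    | zero => exact (hv.le_one_iff_mem_range (O := O)).2 ⟨c, rfl⟩
    | succ n ih =>
      rw [pow_succ] at h
      refine Submodule.mul_induction_on h (fun b hb c hc => ?_) fun b c hb hc => ?_
      · rw [map_mul, map_mul, Nat.cast_succ, neg_add, exp_add]
        exact mul_le_mul' (ih hb) (lt_one_iff_le_exp.1 (hv.mem_maximalIdeal_iff.1 hc))
      · rw [map_add]
        exact (v.map_add _ _).trans (max_le hb hc)
  · intro h
    obtain ⟨t, ht⟩ := hv.exists_eq
    have ht0 : algebraMap B K t ≠ 0 := fun h => exp_ne_zero (ht.symm.trans (by rw [h, map_zero]))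
    have hinj : Function.Injective (algebraMap O K) :=
      injective_algebraMap_of_isLocalization_atPrime B x
    obtain ⟨d, hd⟩ := (hv.le_one_iff_mem_range (O := O)
      (s := algebraMap O K c / algebraMap B K t ^ n)).1 (by
        rw [map_div₀, map_pow, ht, ← exp_nsmul, div_le_one₀ exp_pos]
        simpa using h)
    have hc : c = d * algebraMap B O t ^ n := hinj (by
      rw [map_mul, ← hd, map_pow, ← IsScalarTower.algebraMap_apply,
        div_mul_cancel₀ _ (pow_ne_zero n ht0)])
    rw [hc]
    refine Ideal.mul_mem_left _ _ (Ideal.pow_mem_pow ?_ n)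
    rw [hv.mem_maximalIdeal_iff, ← IsScalarTower.algebraMap_apply, ht]
    exact lt_one_iff_le_exp.2 le_rfl

/-- The pole order of a rational function in terms of the valuation. -/
lemma forall_mem_pow_iff [IsLocalRing O] (hv : IsAdicValuation x v) {k : ℕ} {s : K} :
    (∀ a ∈ maximalIdeal O ^ k, ∃ c : O, s * algebraMap O K a = algebraMap O K c) ↔
      v s ≤ exp (k : ℤ) := by
  simp_rw [← hv.le_one_iff_mem_range, map_mul]
  constructor
  · intro h
    obtain ⟨t, ht⟩ := hv.exists_eq
    have ht' : v (algebraMap O K (algebraMap B O t ^ k)) = exp (-(k : ℤ)) := by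
      rw [map_pow, ← IsScalarTower.algebraMap_apply, map_pow, ht, ← exp_nsmul]; simp
    have h1 := h (algebraMap B O t ^ k) (hv.mem_maximalIdeal_pow_iff.2 ht'.le)
    rw [ht'] at h1
    refine le_of_mul_le_mul_right (h1.trans_eq ?_) (exp_pos (a := (-(k : ℤ))))
    rw [← exp_add]; simp
  · intro h a ha
    refine (mul_le_mul' h (hv.mem_maximalIdeal_pow_iff.1 ha)).trans_eq ?_
    rw [← exp_add]; simp

end IsAdicValuation

section Ramification

variable {A B K R O : Type*} [CommRing A] [CommRing B] [Algebra A B] [Field K] [Algebra B K]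
  [FaithfulSMul B K] {x : Ideal B} [x.IsPrime] {v : Valuation K (WithZero (Multiplicative ℤ))}
  [CommRing O] [IsLocalRing O] [Algebra B O] [Algebra O K] [IsScalarTower B O K]
  [IsLocalization.AtPrime O x] [CommRing R] [IsLocalRing R] [Algebra A R]
  [IsLocalization.AtPrime R (x.under A)] [Algebra R O] [Algebra A O] [IsScalarTower A B O]
  [IsScalarTower A R O]

lemma maximalIdeal_map_le_pow_iff (hv : IsAdicValuation x v) {n : ℕ} :
    (maximalIdeal R).map (algebraMap R O) ≤ maximalIdeal O ^ n ↔
      ∀ r ∈ x.under A, v (algebraMap B K (algebraMap A B r)) ≤ exp (-(n : ℤ)) := by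
  rw [← IsLocalization.AtPrime.map_eq_maximalIdeal (x.under A) R, Ideal.map_map,
    ← IsScalarTower.algebraMap_eq, Ideal.map_le_iff_le_comap]
  refine forall₂_congr fun r _ => ?_
  rw [Ideal.mem_comap, hv.mem_maximalIdeal_pow_iff, IsScalarTower.algebraMap_apply A B O,
    ← IsScalarTower.algebraMap_apply B O K]

/-- The ramification index in terms of the valuation. -/
lemma ramificationIdx'_maximalIdeal_spec (hv : IsAdicValuation x v)
    (h0 : ∃ r ∈ x.under A, algebraMap B K (algebraMap A B r) ≠ 0) :
    (∀ r ∈ x.under A, v (algebraMap B K (algebraMap A B r)) ≤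
      exp (-((maximalIdeal R).ramificationIdx' (maximalIdeal O) : ℤ))) ∧
    (∃ r ∈ x.under A, v (algebraMap B K (algebraMap A B r)) =
      exp (-((maximalIdeal R).ramificationIdx' (maximalIdeal O) : ℤ))) := by
  obtain ⟨r₀, hr₀, hr₀'⟩ := h0
  have hbdd : BddAbove {n | (maximalIdeal R).map (algebraMap R O) ≤ maximalIdeal O ^ n} := by
    obtain ⟨m, hm⟩ : ∃ m : ℤ, v (algebraMap B K (algebraMap A B r₀)) = exp m :=
      ⟨_, (exp_log ((Valuation.ne_zero_iff v).2 hr₀')).symm⟩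
    refine ⟨(-m).toNat, fun n hn => ?_⟩
    have := (maximalIdeal_map_le_pow_iff hv).1 hn r₀ hr₀
    rw [hm, exp_le_exp] at this
    omega
  have hmem : (maximalIdeal R).ramificationIdx' (maximalIdeal O) ∈
      {n | (maximalIdeal R).map (algebraMap R O) ≤ maximalIdeal O ^ n} :=
    Nat.sSup_mem ⟨0, by simp⟩ hbdd
  have h1 := (maximalIdeal_map_le_pow_iff (A := A) hv).1 hmem
  refine ⟨h1, ?_⟩
  by_contra! hne
  have h2 : (maximalIdeal R).ramificationIdx' (maximalIdeal O) + 1 ∈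
      {n | (maximalIdeal R).map (algebraMap R O) ≤ maximalIdeal O ^ n} := by
    refine (maximalIdeal_map_le_pow_iff (A := A) hv).2 fun r hr => ?_
    rw [← lt_exp_add_one_iff]
    refine lt_of_le_of_ne ((h1 r hr).trans_eq (by congr 1; push_cast; ring)) fun h => hne r hr ?_
    rw [h]; congr 1; push_cast; ring
  exact absurd (le_csSup hbdd h2) (by
    change ¬ (maximalIdeal R).ramificationIdx' (maximalIdeal O) + 1 ≤
      (maximalIdeal R).ramificationIdx' (maximalIdeal O)
    omega)

variable (K O) in
lemma IsAdicValuation.isDiscreteValuationRing [IsDomain O] [IsNoetherianRing B]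
    (hv : IsAdicValuation x v) : IsDiscreteValuationRing O := by
  have := IsLocalization.isNoetherianRing x.primeCompl O inferInstance
  obtain ⟨t, ht⟩ := hv.exists_eq
  have hinj : Function.Injective (algebraMap O K) :=
    injective_algebraMap_of_isLocalization_atPrime B x
  have ht' : v (algebraMap O K (algebraMap B O t)) = exp (-1) := by
    rw [← IsScalarTower.algebraMap_apply, ht]
  have ht0 : algebraMap O K (algebraMap B O t) ≠ 0 := fun h =>
    exp_ne_zero (ht'.symm.trans (by rw [h, map_zero]))
  have htm : algebraMap B O t ∈ maximalIdeal O :=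
    hv.mem_maximalIdeal_iff.2 (ht' ▸ lt_one_iff_le_exp.2 le_rfl)
  have hm : maximalIdeal O = Ideal.span {algebraMap B O t} := by
    refine le_antisymm (fun c hc => ?_) ((Ideal.span_singleton_le_iff_mem _).2 htm)
    obtain ⟨d, hd⟩ := (hv.le_one_iff_mem_range (O := O)
      (s := algebraMap O K c / algebraMap O K (algebraMap B O t))).1 (by
        rw [map_div₀, ht', div_le_one₀ exp_pos]
        exact lt_one_iff_le_exp.1 (hv.mem_maximalIdeal_iff.1 hc))
    refine Ideal.mem_span_singleton'.2 ⟨d, hinj ?_⟩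
    rw [map_mul, ← hd, div_mul_cancel₀ _ ht0]
  have hf : ¬ IsField O := fun hf => ht0 (by
    rw [isField_iff_maximalIdeal_eq.1 hf] at htm
    rw [(Ideal.mem_bot).1 htm, map_zero])
  have hp : (maximalIdeal O).IsPrincipal := ⟨⟨_, hm⟩⟩
  exact ((IsDiscreteValuationRing.TFAE O hf).out 0 4).2 hp

variable (K R O) in
lemma ramificationIdx_eq_ramificationIdx' [IsDomain B] [IsNoetherianRing B]
    (hv : IsAdicValuation x v) (h0 : ∃ r ∈ x.under A, algebraMap B K (algebraMap A B r) ≠ 0) :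
    x.ramificationIdx A = (maximalIdeal R).ramificationIdx' (maximalIdeal O) := by
  let S := Localization.AtPrime x
  have hinj := FaithfulSMul.algebraMap_injective B K
  let _ : Algebra S K := (IsLocalization.lift (M := x.primeCompl) (g := algebraMap B K)
    fun s => IsUnit.mk0 _ ((map_ne_zero_iff _ hinj).2 fun h => s.2 (h ▸ x.zero_mem))).toAlgebra
  have : IsScalarTower B S K := .of_algebraMap_eq fun b => (IsLocalization.lift_eq _ b).symm
  have := IsLocalization.isDomain_of_atPrime S x
  have := hv.isDiscreteValuationRing K S
  obtain ⟨h1, r, hr, hr1⟩ := ramificationIdx'_maximalIdeal_spec (R := R) (O := O) hv h0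
  set e := (maximalIdeal R).ramificationIdx' (maximalIdeal O)
  have hmap : (x.under A).map (algebraMap A S) = maximalIdeal S ^ e := by
    refine le_antisymm (Ideal.map_le_iff_le_comap.2 fun r hr => ?_) fun c hc => ?_
    · rw [Ideal.mem_comap, hv.mem_maximalIdeal_pow_iff, IsScalarTower.algebraMap_apply A B S,
        ← IsScalarTower.algebraMap_apply B S K]
      exact h1 r hr
    · rw [hv.mem_maximalIdeal_pow_iff] at hc
      have hr1' : v (algebraMap S K (algebraMap A S r)) = exp (-(e : ℤ)) := by
        rw [IsScalarTower.algebraMap_apply A B S, ← IsScalarTower.algebraMap_apply B S K, hr1]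
      have hr0 : algebraMap S K (algebraMap A S r) ≠ 0 := fun h =>
        exp_ne_zero (hr1'.symm.trans (by rw [h, map_zero]))
      obtain ⟨d, hd⟩ := (hv.le_one_iff_mem_range (O := S)
        (s := algebraMap S K c / algebraMap S K (algebraMap A S r))).1 (by
          rw [map_div₀, hr1', div_le_one₀ exp_pos]
          exact hc)
      have hinjS : Function.Injective (algebraMap S K) :=
        injective_algebraMap_of_isLocalization_atPrime B x
      rw [show c = d * algebraMap A S r from hinjS (by
        rw [map_mul, ← hd, div_mul_cancel₀ _ hr0])]
      exact Ideal.mul_mem_left _ _ (Ideal.mem_map_of_mem _ hr)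
  rw [Ideal.ramificationIdx_def, hmap, IsDiscreteValuationRing.length_quotient_pow_maximalIdeal]
  simp

variable (R O) in
lemma isSeparable_residueField_of_isLocalization [IsLocalHom (algebraMap R O)]
    (h : Algebra.IsSeparable (ResidueField R) (ResidueField O)) :
    letI := Localization.AtPrime.algebraOfLiesOver (x.under A) x
    Algebra.IsSeparable (x.under A).ResidueField x.ResidueField := by
  let := Localization.AtPrime.algebraOfLiesOver (x.under A) x
  let e₁ : R ≃ₐ[A] Localization.AtPrime (x.under A) :=
    IsLocalization.algEquiv (x.under A).primeCompl R _
  let e₂ : O ≃ₐ[B] Localization.AtPrime x := IsLocalization.algEquiv x.primeCompl O _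
  refine Algebra.IsSeparable.of_equiv_equiv (ResidueField.mapEquiv e₁.toRingEquiv)
    (ResidueField.mapEquiv e₂.toRingEquiv) ?_
  have h1 : (algebraMap (Localization.AtPrime (x.under A)) (Localization.AtPrime x)).comp
      (e₁ : R →+* Localization.AtPrime (x.under A)) =
        (e₂ : O →+* Localization.AtPrime x).comp (algebraMap R O) := by
    refine IsLocalization.ringHom_ext (x.under A).primeCompl (RingHom.ext fun a => ?_)
    simp only [RingHom.comp_apply, RingHom.coe_coe]
    rw [AlgEquiv.commutes, ← IsScalarTower.algebraMap_apply A R O,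
      IsScalarTower.algebraMap_apply A B O, AlgEquiv.commutes, ← IsScalarTower.algebraMap_apply,
      ← IsScalarTower.algebraMap_apply]
  refine RingHom.ext fun a => ?_
  obtain ⟨a, rfl⟩ := residue_surjective a
  exact congrArg (residue _) (RingHom.congr_fun h1 a)

end Ramification

end LocalRingAtPrime

/-! ### Rings of sections and points -/

section SectionRings

open WithZero IsLocalRing

variable {X Y : Scheme.{u}}

lemma isRegularRing_section (hX : ∀ x : X, IsRegularLocalRing (X.presheaf.stalk x))
    [IsLocallyNoetherian X] {W : X.Opens} (hW : IsAffineOpen W) : IsRegularRing Γ(X, W) := by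
  have := IsLocallyNoetherian.component_noetherian ⟨W, hW⟩
  refine isRegularRing_iff.2 fun P hP => ?_
  have hy : hW.fromSpec ⟨P, hP⟩ ∈ W := (hW.isoSpec.inv ⟨P, hP⟩).2
  let _ := TopCat.Presheaf.algebra_section_stalk X.presheaf ⟨hW.fromSpec ⟨P, hP⟩, hy⟩
  have hl : IsLocalization.AtPrime (X.presheaf.stalk (hW.fromSpec ⟨P, hP⟩)) P :=
    hW.isLocalization_stalk' ⟨P, hP⟩ hy
  have := hX (hW.fromSpec ⟨P, hP⟩)
  exact IsRegularLocalRing.of_ringEquiv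
    (IsLocalization.algEquiv P.primeCompl (X.presheaf.stalk (hW.fromSpec ⟨P, hP⟩))
      (Localization.AtPrime P)).toRingEquiv

/-- The prime ideal of `Γ(X, W)` which corresponds to the point `x` of the affine open subset `W`.
-/
noncomputable abbrev pointIdeal {W : X.Opens} (hW : IsAffineOpen W) (x : X) (hx : x ∈ W) :
    Ideal Γ(X, W) :=
  (hW.primeIdealOf ⟨x, hx⟩).asIdeal

lemma exists_pointIdeal_eq {W : X.Opens} (hW : IsAffineOpen W) (P : Ideal Γ(X, W))
    (hP : P.IsPrime) : ∃ (x : X) (hx : x ∈ W), pointIdeal hW x hx = P := by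
  let y := hW.isoSpec.inv ⟨P, hP⟩
  refine ⟨y.1, y.2, ?_⟩
  have : hW.primeIdealOf y = ⟨P, hP⟩ := by
    change (hW.isoSpec.inv ≫ hW.isoSpec.hom) ⟨P, hP⟩ = _
    rw [Iso.inv_hom_id]
    rfl
  exact congrArg PrimeSpectrum.asIdeal this

variable {W : X.Opens} (hW : IsAffineOpen W) {x : X} (hx : x ∈ W)

lemma isLocalization_stalk_pointIdeal :
    letI := (X.presheaf.germ W x hx).hom.toAlgebra
    IsLocalization.AtPrime (X.presheaf.stalk x) (pointIdeal hW x hx) :=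
  hW.isLocalization_stalk ⟨x, hx⟩

lemma mem_pointIdeal_iff {s : Γ(X, W)} :
    s ∈ pointIdeal hW x hx ↔ X.presheaf.germ W x hx s ∈ maximalIdeal (X.presheaf.stalk x) := by
  let _ := (X.presheaf.germ W x hx).hom.toAlgebra
  have := isLocalization_stalk_pointIdeal hW hx
  exact (IsLocalization.AtPrime.to_map_mem_maximal_iff _ (pointIdeal hW x hx) s).symm

lemma height_pointIdeal :
    ((pointIdeal hW x hx).height : WithBot ℕ∞) = ringKrullDim (X.presheaf.stalk x) := by
  let _ := (X.presheaf.germ W x hx).hom.toAlgebra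
  have := isLocalization_stalk_pointIdeal hW hx
  exact (IsLocalization.AtPrime.ringKrullDim_eq_height _ _).symm

variable [IsIntegral X]

lemma isScalarTower_section_stalk [Nonempty W] :
    letI := (X.presheaf.germ W x hx).hom.toAlgebra
    IsScalarTower Γ(X, W) (X.presheaf.stalk x) X.functionField :=
  functionField_isScalarTower X W ⟨x, hx⟩

lemma hasPoleOrderLE_iff [Nonempty W] {v : Valuation X.functionField (WithZero (Multiplicative ℤ))}
    (hv : IsAdicValuation (pointIdeal hW x hx) v) (k : ℕ) (f : X.functionField) :
    HasPoleOrderLE x k f ↔ v f ≤ exp (k : ℤ) := by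
  let _ := (X.presheaf.germ W x hx).hom.toAlgebra
  have := isLocalization_stalk_pointIdeal hW hx
  have := isScalarTower_section_stalk hx
  have := functionField_isFractionRing_of_isAffineOpen X W hW
  exact hv.forall_mem_pow_iff (O := X.presheaf.stalk x)

end SectionRings

section ChartRamification

open WithZero IsLocalRing

variable {X Y : Scheme.{u}} (π : X ⟶ Y) {V : Y.Opens}
  (hW : IsAffineOpen (π ⁻¹ᵁ V)) {x : X} (hx : x ∈ π ⁻¹ᵁ V)

lemma under_pointIdeal (hV : IsAffineOpen V) :
    letI := (π.app V).hom.toAlgebra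
    (pointIdeal hW x hx).under Γ(Y, V) = pointIdeal hV (π x) hx := by
  let _ := (π.app V).hom.toAlgebra
  have h := IsAffineOpen.comap_primeIdealOf_appLE V hV (π ⁻¹ᵁ V) hW le_rfl hx
  rw [Scheme.Hom.appLE_eq_app] at h
  exact congrArg PrimeSpectrum.asIdeal h

lemma isLocalization_stalk_under_pointIdeal (hV : IsAffineOpen V) :
    letI := (π.app V).hom.toAlgebra
    letI := (Y.presheaf.germ V (π x) hx).hom.toAlgebra
    IsLocalization.AtPrime (Y.presheaf.stalk (π x)) ((pointIdeal hW x hx).under Γ(Y, V)) := by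
  have key : ∀ (I J : Ideal Γ(Y, V)) [I.IsPrime] [J.IsPrime], I = J →
      letI := (Y.presheaf.germ V (π x) hx).hom.toAlgebra
      IsLocalization.AtPrime (Y.presheaf.stalk (π x)) I →
        IsLocalization.AtPrime (Y.presheaf.stalk (π x)) J := by
    rintro I J _ _ rfl h
    exact h
  let _ := (π.app V).hom.toAlgebra
  exact key _ _ (under_pointIdeal π hW hx hV).symm (isLocalization_stalk_pointIdeal hV hx)

lemma isSeparable_residueField_pointIdeal (hV : IsAffineOpen V)
    (h : letI := (π.residueFieldMap x).hom.toAlgebra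
      Algebra.IsSeparable (Y.residueField (π x)) (X.residueField x)) :
    letI := (π.app V).hom.toAlgebra
    letI := Localization.AtPrime.algebraOfLiesOver ((pointIdeal hW x hx).under Γ(Y, V))
      (pointIdeal hW x hx)
    Algebra.IsSeparable ((pointIdeal hW x hx).under Γ(Y, V)).ResidueField
      (pointIdeal hW x hx).ResidueField := by
  let _ := (π.app V).hom.toAlgebra
  let _ := (X.presheaf.germ (π ⁻¹ᵁ V) x hx).hom.toAlgebra
  let _ := (Y.presheaf.germ V (π x) hx).hom.toAlgebra
  let _ := (π.stalkMap x).hom.toAlgebra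
  let _ := ((π.app V) ≫ X.presheaf.germ (π ⁻¹ᵁ V) x hx).hom.toAlgebra
  have := isLocalization_stalk_pointIdeal hW hx
  have := isLocalization_stalk_under_pointIdeal π hW hx hV
  have : IsScalarTower Γ(Y, V) Γ(X, π ⁻¹ᵁ V) (X.presheaf.stalk x) := .of_algebraMap_eq' rfl
  have : IsScalarTower Γ(Y, V) (Y.presheaf.stalk (π x)) (X.presheaf.stalk x) :=
    .of_algebraMap_eq' (congrArg CommRingCat.Hom.hom (Scheme.Hom.germ_stalkMap π V x hx).symm)
  have : IsLocalHom (algebraMap (Y.presheaf.stalk (π x)) (X.presheaf.stalk x)) :=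
    inferInstanceAs (IsLocalHom (π.stalkMap x).hom)
  refine isSeparable_residueField_of_isLocalization (Y.presheaf.stalk (π x))
    (X.presheaf.stalk x) ?_
  convert! h
  refine Algebra.algebra_ext _ _ fun x ↦ ?_
  obtain ⟨x, rfl⟩ := IsLocalRing.residue_surjective x
  rfl

variable [IsIntegral X] [Nonempty (π ⁻¹ᵁ V)]

/-- The ramification index of a point of codimension one in terms of its valuation. -/
lemma ramificationIndex_spec (hV : IsAffineOpen V)
    {v : Valuation X.functionField (WithZero (Multiplicative ℤ))}
    (hv : IsAdicValuation (pointIdeal hW x hx) v)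
    (h0 : letI := (π.app V).hom.toAlgebra; ∃ r ∈ (pointIdeal hW x hx).under Γ(Y, V),
      algebraMap Γ(X, π ⁻¹ᵁ V) X.functionField (algebraMap Γ(Y, V) Γ(X, π ⁻¹ᵁ V) r) ≠ 0) :
    letI := (π.app V).hom.toAlgebra
    (∀ r ∈ (pointIdeal hW x hx).under Γ(Y, V), v (algebraMap Γ(X, π ⁻¹ᵁ V) X.functionField
      (algebraMap Γ(Y, V) Γ(X, π ⁻¹ᵁ V) r)) ≤ exp (-(ramificationIndex π x : ℤ))) ∧
    (∃ r ∈ (pointIdeal hW x hx).under Γ(Y, V), v (algebraMap Γ(X, π ⁻¹ᵁ V) X.functionField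
      (algebraMap Γ(Y, V) Γ(X, π ⁻¹ᵁ V) r)) = exp (-(ramificationIndex π x : ℤ))) ∧
    (IsNoetherianRing Γ(X, π ⁻¹ᵁ V) →
      (pointIdeal hW x hx).ramificationIdx Γ(Y, V) = ramificationIndex π x) := by
  let _ := (π.app V).hom.toAlgebra
  let _ := (X.presheaf.germ (π ⁻¹ᵁ V) x hx).hom.toAlgebra
  let _ := (Y.presheaf.germ V (π x) hx).hom.toAlgebra
  let _ := (π.stalkMap x).hom.toAlgebra
  let _ := ((π.app V) ≫ X.presheaf.germ (π ⁻¹ᵁ V) x hx).hom.toAlgebra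
  have := isLocalization_stalk_pointIdeal hW hx
  have := isLocalization_stalk_under_pointIdeal π hW hx hV
  have := isScalarTower_section_stalk hx
  have := functionField_isFractionRing_of_isAffineOpen X (π ⁻¹ᵁ V) hW
  have : IsScalarTower Γ(Y, V) Γ(X, π ⁻¹ᵁ V) (X.presheaf.stalk x) := .of_algebraMap_eq' rfl
  have : IsScalarTower Γ(Y, V) (Y.presheaf.stalk (π x)) (X.presheaf.stalk x) :=
    .of_algebraMap_eq' (congrArg CommRingCat.Hom.hom (Scheme.Hom.germ_stalkMap π V x hx).symm)
  have h2 := ramificationIdx'_maximalIdeal_spec (R := Y.presheaf.stalk (π x))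
    (O := X.presheaf.stalk x) hv h0
  refine ⟨h2.1, h2.2, fun hn => ?_⟩
  exact ramificationIdx_eq_ramificationIdx' X.functionField (Y.presheaf.stalk (π x))
    (X.presheaf.stalk x) hv h0

end ChartRamification

/-! ### The unramified locus and the generic point -/

section Unramified

open IsLocalRing

lemma ramificationIdx'_eq_one_of_formallyUnramified {R O : Type*} [CommRing R] [CommRing O]
    [IsLocalRing R] [IsLocalRing O] [Algebra R O] [IsLocalHom (algebraMap R O)]
    [Algebra.FormallyUnramified R O] [Algebra.EssFiniteType R O] [IsNoetherianRing O]
    (hO : ringKrullDim O = 1) : (maximalIdeal R).ramificationIdx' (maximalIdeal O) = 1 := by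
  have h := Algebra.FormallyUnramified.map_maximalIdeal (R := R) (S := O)
  refine Ideal.ramificationIdx'_spec (by rw [h, pow_one]) fun hle => ?_
  rw [h, show 1 + 1 = 2 from rfl, pow_two] at hle
  have h0 : maximalIdeal O = ⊥ :=
    Submodule.eq_bot_of_le_smul_of_le_jacobson_bot _ _ (IsNoetherian.noetherian _) hle
      (maximalIdeal_le_jacobson _)
  have := (isField_iff_maximalIdeal_eq.2 h0)
  let _ := this.toField
  rw [ringKrullDim_eq_zero_of_field] at hO
  exact zero_ne_one hO

variable {X Y : Scheme.{u}} (π : X ⟶ Y)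

lemma formallyUnramified_stalkMap_of_etale_restrict {U : Y.Opens} (h : Etale (π ∣_ U)) {x : X}
    (hx : π x ∈ U) : (π.stalkMap x).hom.FormallyUnramified :=
  (RingHom.FormallyUnramified.respectsIso.arrow_mk_iso_iff
    (morphismRestrictStalkMap π U ⟨x, hx⟩)).1
      (FormallyUnramified.stalkMap (π ∣_ U) ⟨x, hx⟩)

variable {π} {x : X}

lemma ramificationIndex_eq_one [LocallyOfFiniteType π]
    (h : (π.stalkMap x).hom.FormallyUnramified)
    [IsNoetherianRing (X.presheaf.stalk x)] (hO : ringKrullDim (X.presheaf.stalk x) = 1) :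
    ramificationIndex π x = 1 := by
  algebraize [(π.stalkMap x).hom]
  have : IsLocalHom (algebraMap (Y.presheaf.stalk (π x)) (X.presheaf.stalk x)) :=
    inferInstanceAs <| IsLocalHom (π.stalkMap x).hom
  have : Algebra.EssFiniteType (Y.presheaf.stalk (π x)) (X.presheaf.stalk x) := by
    rw [← RingHom.essFiniteType_algebraMap, RingHom.algebraMap_toAlgebra]
    exact LocallyOfFiniteType.stalkMap π x
  exact ramificationIdx'_eq_one_of_formallyUnramified hO

lemma isSeparable_residueFieldMap [LocallyOfFiniteType π]
    (h : (π.stalkMap x).hom.FormallyUnramified) :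
    letI := (π.residueFieldMap x).hom.toAlgebra
    Algebra.IsSeparable (Y.residueField (π x)) (X.residueField x) := by
  algebraize [(π.stalkMap x).hom]
  have : IsLocalHom (algebraMap (Y.presheaf.stalk (π x)) (X.presheaf.stalk x)) :=
    inferInstanceAs <| IsLocalHom (π.stalkMap x).hom
  suffices h : Algebra.IsSeparable
      (IsLocalRing.ResidueField <| Y.presheaf.stalk (π x))
      (IsLocalRing.ResidueField <| X.presheaf.stalk x) by
    convert! h
    refine Algebra.algebra_ext _ _ fun x ↦ ?_
    obtain ⟨x, rfl⟩ := IsLocalRing.residue_surjective x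
    rfl
  have : Algebra.EssFiniteType (Y.presheaf.stalk (π x)) (X.presheaf.stalk x) := by
    rw [← RingHom.essFiniteType_algebraMap, RingHom.algebraMap_toAlgebra]
    exact LocallyOfFiniteType.stalkMap π x
  infer_instance

end Unramified

section GenericPoint

open IsLocalRing

variable {X Y : Scheme.{u}}

lemma HasNormalCrossings.genericPoint_notMem [IsIntegral Y] {b : Closeds Y}
    (hb : HasNormalCrossings b) : genericPoint Y ∉ b := by
  intro hy
  obtain ⟨U, f, hf, ⟨u, hu⟩, n, a, hab, hreg⟩ := hb _ hy
  obtain ⟨i, hi⟩ := (hab u).1 (hu ▸ hy)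
  have hfield : IsField (Y.presheaf.stalk (f u)) := by
    rw [hu]
    exact Field.toIsField Y.functionField
  have hunr : (f.stalkMap u).hom.FormallyUnramified := FormallyUnramified.stalkMap f u
  algebraize [(f.stalkMap u).hom]
  have : IsLocalHom (algebraMap (Y.presheaf.stalk (f u)) (U.presheaf.stalk u)) :=
    inferInstanceAs <| IsLocalHom (f.stalkMap u).hom
  have : Algebra.EssFiniteType (Y.presheaf.stalk (f u)) (U.presheaf.stalk u) := by
    rw [← RingHom.essFiniteType_algebraMap, RingHom.algebraMap_toAlgebra]
    exact LocallyOfFiniteType.stalkMap f u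
  have h := Algebra.FormallyUnramified.map_maximalIdeal (R := Y.presheaf.stalk (f u))
    (S := U.presheaf.stalk u)
  rw [isField_iff_maximalIdeal_eq.1 hfield, Ideal.map_bot] at h
  have h0 : U.presheaf.germ ⊤ u trivial (a i) = 0 := by
    rw [← h] at hi
    exact hi
  refine (hreg u).2.ne_zero ⟨i, hi⟩ ?_
  have h1 : (⟨U.presheaf.germ ⊤ u trivial (a i), hi⟩ : maximalIdeal (U.presheaf.stalk u)) = 0 :=
    Subtype.ext h0
  change (maximalIdeal (U.presheaf.stalk u)).toCotangent ⟨_, hi⟩ = 0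
  rw [h1, map_zero]

variable [IsIntegral X] {G : Type v} [Group G] [Finite G] {act : G →* Aut X} {π : X ⟶ Y}

instance isIso_hom_of_aut (σ : Aut X) : IsIso σ.hom := Iso.isIso_hom (show X ≅ X from σ)

lemma fromSpecStalk_genericPoint_comp (f : X ⟶ X) [IsDominant f]
    (hf : functionFieldMap f = RingHom.id X.functionField) :
    X.fromSpecStalk (genericPoint X) ≫ f = X.fromSpecStalk (genericPoint X) := by
  have h1 : X.presheaf.stalkSpecializes (specializes_of_eq (map_genericPoint f)) ≫
      f.stalkMap (genericPoint X) = 𝟙 _ := CommRingCat.hom_ext hf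
  rw [← Scheme.SpecMap_stalkMap_fromSpecStalk f, ← Scheme.SpecMap_stalkSpecializes_fromSpecStalk
      (specializes_of_eq (map_genericPoint f)), ← Category.assoc, ← Spec.map_comp, h1,
      Spec.map_id, Category.id_comp]

/-- An automorphism in `G` which is trivial at the generic point is trivial, since `G` acts freely
over the nonempty open subset where `π` is a torsor. -/
lemma eq_one_of_functionFieldMap_eq {hinv : ∀ g, (act g).hom ≫ π = π} {U : Y.Opens}
    (hU : IsTorsorOver act π hinv U) (hξ : π (genericPoint X) ∈ U) {g : G}
    (hg : functionFieldMap (act g).hom = RingHom.id X.functionField) : g = 1 := by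
  have h1 := fromSpecStalk_genericPoint_comp (act g).hom hg
  set i := X.fromSpecStalk (genericPoint X) with hi
  let p : Spec (X.presheaf.stalk (genericPoint X)) := closedPoint _
  have hp : i p = genericPoint X := Scheme.fromSpecStalk_closedPoint
  let ι : G → (X ⟶ ∐ fun _ : G => X) := fun g => Sigma.ι (fun _ : G => X) g
  have hι : ∀ g, ι g ≫ shear act π hinv =
      pullback.lift (act g).hom (𝟙 X) (by rw [hinv g, Category.id_comp]) := fun g =>
    Sigma.ι_desc _ _
  have hone : (act 1).hom = 𝟙 X := by rw [map_one]; rfl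
  -- the shear map sends the generic points of the components of index `g` and `1` to the same
  -- point of `X ×_Y X`; it is injective over `U`
  have h2 : i ≫ ι g ≫ shear act π hinv = i ≫ ι 1 ≫ shear act π hinv := by
    rw [hι, hι]
    apply pullback.hom_ext
    · simp only [Category.assoc, pullback.lift_fst]
      rw [h1, hone, Category.comp_id]
    · simp only [Category.assoc, pullback.lift_snd]
  have h3 : shear act π hinv (ι g (i p)) = shear act π hinv (ι 1 (i p)) := by
    have := congrArg (fun f => f p) h2
    simpa only [Scheme.Hom.comp_apply] using this
  have hiso := hU.2.2
  set P := (pullback.fst π π ≫ π) ⁻¹ᵁ U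
  have hmem : ∀ g, shear act π hinv (ι g (i p)) ∈ P := fun g => by
    change (pullback.fst π π ≫ π) (shear act π hinv (ι g (i p))) ∈ U
    have h4 : ι g ≫ shear act π hinv ≫ pullback.fst π π ≫ π = π := by
      rw [← Category.assoc, hι, pullback.lift_fst_assoc, hinv]
    rw [← Scheme.Hom.comp_apply, ← Scheme.Hom.comp_apply, h4, hp]
    exact hξ
  have hinj : Function.Injective (shear act π hinv ∣_ P) :=
    (shear act π hinv ∣_ P).homeomorph.injective
  have h5 : (⟨ι g (i p), hmem g⟩ : ↥(shear act π hinv ⁻¹ᵁ P)) = ⟨ι 1 (i p), hmem 1⟩ := by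
    refine hinj (Subtype.ext ?_)
    exact (morphismRestrict_base_coe _ P ⟨_, hmem g⟩).trans
      (h3.trans (morphismRestrict_base_coe _ P ⟨_, hmem 1⟩).symm)
  have h6 : ι g (i p) = ι 1 (i p) := congrArg Subtype.val h5
  have h7 := (sigmaι_eq_iff (fun _ : G => X) g 1 (i p) (i p)).1 h6
  exact congrArg Sigma.fst h7

end GenericPoint

/-! ### The Galois group of the function field -/

section FunctionFieldMap

variable {X Y Z : Scheme.{u}} [IsIntegral X] [IsIntegral Y] [IsIntegral Z]

lemma stalkToFunctionField_germ {U : X.Opens} [Nonempty U] {x : X} (hx : x ∈ U) (r : Γ(X, U)) :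
    stalkToFunctionField x (X.presheaf.germ U x hx r) = algebraMap Γ(X, U) X.functionField r :=
  X.algebraMap_germ_eq_germToFunctionField hx r

lemma toFunctionField_eq_algebraMap {U : X.Opens} [Nonempty U] (x : U) (r : Γ(X, U)) :
    toFunctionField U x r = algebraMap Γ(X, U) X.functionField r :=
  stalkToFunctionField_germ x.2 r

lemma functionFieldMap_algebraMap (f : X ⟶ Y) [IsDominant f] (V : Y.Opens) [Nonempty V]
    [Nonempty (f ⁻¹ᵁ V)] (r : Γ(Y, V)) :
    functionFieldMap f (algebraMap Γ(Y, V) Y.functionField r) =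
      algebraMap Γ(X, f ⁻¹ᵁ V) X.functionField (f.app V r) := by
  obtain ⟨x⟩ := (inferInstance : Nonempty (f ⁻¹ᵁ V))
  have h := functionFieldMap_stalk f x.1 (Y.presheaf.germ V (f x.1) x.2 r)
  exact ((congrArg (functionFieldMap f) (stalkToFunctionField_germ (X := Y) x.2 r)).symm.trans
    h).trans ((congrArg _ (Scheme.Hom.germ_stalkMap_apply f V x.1 x.2 r)).trans
    (stalkToFunctionField_germ x.2 _))

lemma algebraMap_rres {U V : X.Opens} [Nonempty U] [Nonempty V] (h : V ≤ U) (r : Γ(X, U)) :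
    algebraMap Γ(X, V) X.functionField (X.presheaf.map (homOfLE h).op r) =
      algebraMap Γ(X, U) X.functionField r :=
  X.presheaf.germ_res_apply (homOfLE h) (genericPoint X)
    (((genericPoint_spec X).mem_open_set_iff V.isOpen).2 (by simpa using ‹Nonempty V›)) r

lemma functionFieldMap_appLE (f : X ⟶ Y) [IsDominant f] (V : Y.Opens) [Nonempty V]
    (W : X.Opens) [Nonempty W] (h : W ≤ f ⁻¹ᵁ V) (r : Γ(Y, V)) :
    functionFieldMap f (algebraMap Γ(Y, V) Y.functionField r) =
      algebraMap Γ(X, W) X.functionField (f.appLE V W h r) := by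
  have : Nonempty (f ⁻¹ᵁ V) := ⟨⟨_, h (Classical.arbitrary W).2⟩⟩
  rw [functionFieldMap_algebraMap, Scheme.Hom.appLE, ConcreteCategory.comp_apply]
  exact (algebraMap_rres h _).symm

lemma functionField_ringHom_ext {L : Type*} [Field L] (x : X) {f g : X.functionField →+* L}
    (h : ∀ a, f (stalkToFunctionField x a) = g (stalkToFunctionField x a)) : f = g :=
  IsLocalization.ringHom_ext (nonZeroDivisors (X.presheaf.stalk x)) (RingHom.ext h)

lemma functionFieldMap_comp (f : X ⟶ Y) (g : Y ⟶ Z) [IsDominant f] [IsDominant g] :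
    functionFieldMap (f ≫ g) = (functionFieldMap f).comp (functionFieldMap g) := by
  refine functionField_ringHom_ext (g (f (genericPoint X))) fun a => ?_
  rw [RingHom.comp_apply, functionFieldMap_stalk, functionFieldMap_stalk]
  refine (functionFieldMap_stalk (f ≫ g) (genericPoint X) a).trans ?_
  rw [Scheme.Hom.stalkMap_comp]
  rfl

lemma functionFieldMap_id : functionFieldMap (𝟙 X) = RingHom.id X.functionField := by
  refine functionField_ringHom_ext (genericPoint X) fun a => ?_
  refine (functionFieldMap_stalk (𝟙 X) (genericPoint X) a).trans ?_
  rw [Scheme.Hom.stalkMap_id]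
  rfl

lemma functionFieldMap_congr {f g : X ⟶ Y} [IsDominant f] [IsDominant g] (h : f = g) :
    functionFieldMap f = functionFieldMap g := by
  subst h
  rfl

end FunctionFieldMap

section GaloisGroup

variable {X Y : Scheme.{u}} {G : Type v} [Group G] (act : G →* Aut X) {π : X ⟶ Y}

lemma act_mul_hom (g h : G) : (act (g * h)).hom = (act h).hom ≫ (act g).hom := by
  rw [map_mul]; rfl

lemma act_one_hom : (act 1).hom = 𝟙 X := by rw [map_one]; rfl

lemma preimage_le_preimage_of_comp_eq {σ : X ⟶ X} (h : σ ≫ π = π) (V : Y.Opens) :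
    π ⁻¹ᵁ V ≤ σ ⁻¹ᵁ (π ⁻¹ᵁ V) := fun _ hx => apply_mem_preimage π σ h hx

lemma appLE_preimage_comp {σ τ : X ⟶ X} (hσ : σ ≫ π = π) (hτ : τ ≫ π = π) (V : Y.Opens)
    (hστ : (σ ≫ τ) ≫ π = π) (b : Γ(X, π ⁻¹ᵁ V)) :
    (σ ≫ τ).appLE _ _ (preimage_le_preimage_of_comp_eq hστ V) b =
      σ.appLE _ _ (preimage_le_preimage_of_comp_eq hσ V)
        (τ.appLE _ _ (preimage_le_preimage_of_comp_eq hτ V) b) := by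
  rw [← ConcreteCategory.comp_apply, Scheme.Hom.appLE_comp_appLE]

/-- The left action of `G` on the functions on `π⁻¹ V`: the element `g` acts by `(g⁻¹)^*`. -/
noncomputable abbrev sectionAction (hinv : ∀ g, (act g).hom ≫ π = π) (V : Y.Opens) :
    MulSemiringAction G Γ(X, π ⁻¹ᵁ V) where
  smul g b := (act g⁻¹).hom.appLE _ _ (preimage_le_preimage_of_comp_eq (hinv g⁻¹) V) b
  one_smul b := by
    change (act 1⁻¹).hom.appLE _ _ _ b = b
    have : ∀ (σ : X ⟶ X) (hσ : π ⁻¹ᵁ V ≤ σ ⁻¹ᵁ (π ⁻¹ᵁ V)), σ = 𝟙 X → σ.appLE _ _ hσ b = b := by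
      rintro σ hσ rfl
      exact rres_self b
    exact this _ _ (by rw [inv_one, act_one_hom])
  mul_smul g h b := by
    have h0 : (act (g * h)⁻¹).hom = (act g⁻¹).hom ≫ (act h⁻¹).hom := by
      rw [mul_inv_rev, act_mul_hom]
    have : ∀ (σ τ υ : X ⟶ X) (hυ : υ = σ ≫ τ) (hσ : σ ≫ π = π) (hτ : τ ≫ π = π)
        (h : υ ≫ π = π), υ.appLE _ _ (preimage_le_preimage_of_comp_eq h V) b =
          σ.appLE _ _ (preimage_le_preimage_of_comp_eq hσ V)
            (τ.appLE _ _ (preimage_le_preimage_of_comp_eq hτ V) b) := by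
      rintro σ τ υ rfl hσ hτ h
      exact appLE_preimage_comp hσ hτ V h b
    exact this _ _ _ h0 (hinv g⁻¹) (hinv h⁻¹) (hinv (g * h)⁻¹)
  smul_zero g := map_zero (CommRingCat.Hom.hom _)
  smul_add g := map_add (CommRingCat.Hom.hom _)
  smul_one g := map_one (CommRingCat.Hom.hom _)
  smul_mul g := map_mul (CommRingCat.Hom.hom _)

variable [IsIntegral X]

/-- The left action of `G` on the function field: the element `g` acts by `(g⁻¹)^*`. -/
noncomputable abbrev functionFieldAction : MulSemiringAction G X.functionField where
  smul g f := functionFieldMap (act g⁻¹).hom f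
  one_smul f := by
    change functionFieldMap (act 1⁻¹).hom f = f
    rw [functionFieldMap_congr (g := 𝟙 X) (by rw [inv_one, act_one_hom]), functionFieldMap_id]
    rfl
  mul_smul g h f := by
    change functionFieldMap (act (g * h)⁻¹).hom f =
      functionFieldMap (act g⁻¹).hom (functionFieldMap (act h⁻¹).hom f)
    rw [functionFieldMap_congr (g := (act g⁻¹).hom ≫ (act h⁻¹).hom)
      (by rw [mul_inv_rev, act_mul_hom]), functionFieldMap_comp]
    rfl
  smul_zero g := map_zero _
  smul_add g := map_add _
  smul_one g := map_one _
  smul_mul g := map_mul _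

lemma sectionAction_smul_algebraMap (hinv : ∀ g, (act g).hom ≫ π = π) (V : Y.Opens)
    [Nonempty (π ⁻¹ᵁ V)] :
    letI := sectionAction act hinv V
    letI := functionFieldAction act
    SMulDistribClass G Γ(X, π ⁻¹ᵁ V) X.functionField := by
  let _ := sectionAction act hinv V
  let _ := functionFieldAction act
  refine ⟨fun g b f => ?_⟩
  rw [Algebra.smul_def, Algebra.smul_def, smul_mul']
  congr 1
  exact functionFieldMap_appLE _ _ _ _ _

variable [IsIntegral Y] [Finite G] {act} {b : Closeds Y}

lemma nonempty_preimage (hπ : IsDominant π) (V : Y.Opens) [Nonempty V] : Nonempty (π ⁻¹ᵁ V) := by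
  refine ⟨⟨genericPoint X, ?_⟩⟩
  change π (genericPoint X) ∈ V
  rw [map_genericPoint]
  exact ((genericPoint_spec Y).mem_open_set_iff V.isOpen).2 (by simpa using ‹Nonempty V›)

lemma appLE_app_of_comp_eq {σ : X ⟶ X} (hσ : σ ≫ π = π) {V : Y.Opens}
    (h : π ⁻¹ᵁ V ≤ σ ⁻¹ᵁ (π ⁻¹ᵁ V)) (r : Γ(Y, V)) :
    σ.appLE _ _ h (π.app V r) = π.app V r := by
  have : ∀ (τ : X ⟶ Y) (hτ : π ⁻¹ᵁ V ≤ τ ⁻¹ᵁ V), τ = π → τ.appLE V (π ⁻¹ᵁ V) hτ = π.app V := by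
    rintro τ hτ rfl
    exact Scheme.Hom.appLE_eq_app _
  refine Eq.trans ?_ (ConcreteCategory.congr_hom (this (σ ≫ π) h hσ) r)
  rw [← Scheme.Hom.appLE_eq_app π, ← ConcreteCategory.comp_apply, Scheme.Hom.appLE_comp_appLE]

lemma isGaloisGroup_section (hπ : IsTameOddCover act π b) {V : Y.Opens} (hV : IsAffineOpen V)
    [Nonempty V] :
    letI := (π.app V).hom.toAlgebra
    letI := sectionAction act hπ.quotient.invariant V
    IsGaloisGroup G Γ(Y, V) Γ(X, π ⁻¹ᵁ V) := by
  have hdom := hπ.quotient.isDominant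
  have hfin := hπ.quotient.isFinite
  let _ := (π.app V).hom.toAlgebra
  let _ := sectionAction act hπ.quotient.invariant V
  let _ := functionFieldAction act
  have hne := nonempty_preimage hdom V
  have hd := sectionAction_smul_algebraMap act hπ.quotient.invariant V
  have hinv := hπ.quotient.invariant
  have hfr := functionField_isFractionRing_of_isAffineOpen X (π ⁻¹ᵁ V) (hV.preimage π)
  have hξ : π (genericPoint X) ∈ b.compl := by
    rw [map_genericPoint]
    exact hπ.normalCrossings.genericPoint_notMem
  refine ⟨⟨fun {g g'} h => ?_⟩, ⟨fun g a s => ?_⟩, ⟨fun s hs => ?_⟩⟩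
  · have h1 : ∀ f : X.functionField, g • f = g' • f := fun f => by
      obtain ⟨a, c, hc, rfl⟩ := IsFractionRing.div_surjective (A := Γ(X, π ⁻¹ᵁ V)) f
      rw [smul_div₀', smul_div₀', ← algebraMap.smul', ← algebraMap.smul', ← algebraMap.smul',
        ← algebraMap.smul', h, h]
    have h2 : ∀ f : X.functionField, (g'⁻¹ * g) • f = f := fun f => by
      rw [mul_smul, h1, inv_smul_smul]
    have h3 := eq_one_of_functionFieldMap_eq hπ.torsor hξ (g := (g'⁻¹ * g)⁻¹) (RingHom.ext h2)
    rwa [inv_eq_one, inv_mul_eq_one, eq_comm] at h3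
  · rw [Algebra.smul_def, Algebra.smul_def, smul_mul']
    congr 1
    exact appLE_app_of_comp_eq (hinv g⁻¹) _ a
  · refine hπ.quotient.exists_of_invariant V s fun g h => ?_
    have h1 : ∀ g' (h' : π ⁻¹ᵁ V ≤ (act g').hom ⁻¹ᵁ (π ⁻¹ᵁ V)), g' = g →
      (act g').hom.appLE (π ⁻¹ᵁ V) (π ⁻¹ᵁ V) h' s = (act g).hom.appLE (π ⁻¹ᵁ V) (π ⁻¹ᵁ V) h s := by
      rintro _ _ rfl
      rfl
    exact (h1 g⁻¹⁻¹ (preimage_le_preimage_of_comp_eq (hinv _) V) (inv_inv g)).symm.trans (hs g⁻¹)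

end GaloisGroup

/-! ### Tame covers on affine charts -/

section TameChart

open WithZero IsLocalRing

variable {X Y : Scheme.{u}} {G : Type v} [Group G] {act : G →* Aut X} {π : X ⟶ Y}

/-- An automorphism which acts trivially on the functions modulo the prime of `x` belongs to the
inertia group of `x`. -/
lemma fromSpecResidueField_comp_eq {W : X.Opens} (hW : IsAffineOpen W) {x : X} (hx : x ∈ W)
    {σ : X ⟶ X} (hσ : W ≤ σ ⁻¹ᵁ W) (h : ∀ s, σ.appLE W W hσ s - s ∈ pointIdeal hW x hx) :
    X.fromSpecResidueField x ≫ σ = X.fromSpecResidueField x := by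
  have h1 : X.fromSpecResidueField x =
      Spec.map (X.presheaf.germ W x hx ≫ X.residue x) ≫ hW.fromSpec := by
    rw [Scheme.fromSpecResidueField, ← hW.fromSpecStalk_eq_fromSpecStalk hx,
      IsAffineOpen.fromSpecStalk, Spec.map_comp, Category.assoc]
  rw [h1, Category.assoc, ← hW.SpecMap_appLE_fromSpec σ hW hσ, ← Category.assoc, ← Spec.map_comp]
  congr 2
  refine CommRingCat.hom_ext (RingHom.ext fun s => ?_)
  have h2 := (mem_pointIdeal_iff hW hx).1 (h s)
  rw [map_sub, ← residue_eq_zero_iff, map_sub, sub_eq_zero] at h2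
  exact h2

/-- The ramification index of `π` at the point which corresponds to a prime ideal. -/
noncomputable def idealRamificationIndex (π : X ⟶ Y) {W : X.Opens} (hW : IsAffineOpen W)
    (P : Ideal Γ(X, W)) : ℕ := by
  classical
  exact if h : P.IsPrime then ramificationIndex π (hW.fromSpec ⟨P, h⟩) else 0

lemma idealRamificationIndex_pointIdeal {W : X.Opens} (hW : IsAffineOpen W) {x : X} (hx : x ∈ W) :
    idealRamificationIndex π hW (pointIdeal hW x hx) = ramificationIndex π x := by
  rw [idealRamificationIndex, dif_pos (hW.primeIdealOf ⟨x, hx⟩).isPrime]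
  congr 1
  exact hW.fromSpec_primeIdealOf ⟨x, hx⟩

lemma height_eq_one_iff {W : X.Opens} (hW : IsAffineOpen W) {x : X} (hx : x ∈ W) :
    (pointIdeal hW x hx).height = 1 ↔ ringKrullDim (X.presheaf.stalk x) = 1 := by
  rw [← height_pointIdeal hW hx]
  norm_cast

/-- The valuations attached to the primes of height one of a regular domain. -/
lemma exists_forall_isAdicValuation (B : Type u) [CommRing B] [IsDomain B] [IsRegularRing B]
    (K : Type*) [Field K] [Algebra B K] [IsFractionRing B K] :
    ∃ v : Ideal B → Valuation K (WithZero (Multiplicative ℤ)),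
      ∀ P : Ideal B, P.IsPrime → P.height = 1 → IsAdicValuation P (v P) := by
  have hv : ∀ P : Ideal B, ∃ v : Valuation K (WithZero (Multiplicative ℤ)),
      P.IsPrime → P.height = 1 → IsAdicValuation P v := fun P => by
    by_cases hP : P.IsPrime ∧ P.height = 1
    · have := hP.1
      obtain ⟨v, hv⟩ := exists_isAdicValuation K P hP.2
      exact ⟨v, fun _ _ => hv⟩
    · classical exact ⟨1, fun h1 h2 => (hP ⟨h1, h2⟩).elim⟩
  choose v hv using hv
  exact ⟨v, hv⟩

variable [IsIntegral X] [IsIntegral Y] [IsNoetherian X] [Finite G] {b : Closeds Y}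

namespace IsTameOddCover

lemma isNoetherianRing_stalk (hπ : IsTameOddCover act π b) (x : X) :
    IsNoetherianRing (X.presheaf.stalk x) :=
  have := hπ.regular x
  inferInstance

lemma formallyUnramified_stalkMap (hπ : IsTameOddCover act π b) {x : X} (hx : π x ∉ b) :
    (π.stalkMap x).hom.FormallyUnramified :=
  formallyUnramified_stalkMap_of_etale_restrict π hπ.torsor.1 hx

lemma ramificationIndex_eq_one (hπ : IsTameOddCover act π b) {x : X}
    (hdim : ringKrullDim (X.presheaf.stalk x) = 1) (hx : π x ∉ b) : ramificationIndex π x = 1 := by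
  have := hπ.quotient.isFinite
  have := hπ.isNoetherianRing_stalk x
  exact TameTwist.ramificationIndex_eq_one (hπ.formallyUnramified_stalkMap hx) hdim

lemma isTameAt (hπ : IsTameOddCover act π b) {x : X}
    (hdim : ringKrullDim (X.presheaf.stalk x) = 1) : IsTameAt π x := by
  by_cases hx : π x ∈ b
  · exact hπ.tame x hdim hx
  · have := hπ.quotient.isFinite
    refine ⟨?_, isSeparable_residueFieldMap (hπ.formallyUnramified_stalkMap hx)⟩
    rw [hπ.ramificationIndex_eq_one hdim hx, Nat.cast_one]
    exact one_ne_zero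

lemma isRegularRing (hπ : IsTameOddCover act π b) {W : X.Opens} (hW : IsAffineOpen W) :
    IsRegularRing Γ(X, W) := isRegularRing_section hπ.regular hW

variable {V : Y.Opens}

lemma exists_under_ne_zero (hπ : IsTameOddCover act π b) (hV : IsAffineOpen V) [Nonempty V]
    [Nonempty (π ⁻¹ᵁ V)]
    (hW : IsAffineOpen (π ⁻¹ᵁ V)) {x : X} (hx : x ∈ π ⁻¹ᵁ V)
    (hdim : ringKrullDim (X.presheaf.stalk x) = 1) :
    letI := (π.app V).hom.toAlgebra
    ∃ r ∈ (pointIdeal hW x hx).under Γ(Y, V),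
      algebraMap Γ(X, π ⁻¹ᵁ V) X.functionField (algebraMap Γ(Y, V) Γ(X, π ⁻¹ᵁ V) r) ≠ 0 := by
  have := hπ.quotient.isDominant
  have := hπ.quotient.isFinite
  let _ := (π.app V).hom.toAlgebra
  have hint : Algebra.IsIntegral Γ(Y, V) Γ(X, π ⁻¹ᵁ V) :=
    have : Module.Finite Γ(Y, V) Γ(X, π ⁻¹ᵁ V) := IsFinite.finite_app π V hV
    inferInstance
  have hfr := functionField_isFractionRing_of_isAffineOpen X (π ⁻¹ᵁ V) hW
  have hne : pointIdeal hW x hx ≠ ⊥ :=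
    Ideal.ne_bot_of_height_eq_one ((height_eq_one_iff hW hx).2 hdim)
  obtain ⟨r, hr, hr0⟩ := (Submodule.ne_bot_iff _).1
    (Ideal.IsIntegral.comap_ne_bot (R := Γ(Y, V)) hne)
  refine ⟨r, hr, ?_⟩
  rw [map_ne_zero_iff _ (IsFractionRing.injective _ _)]
  exact (map_ne_zero_iff _ (hπ.quotient.injective V)).2 hr0

lemma flat_app (hπ : IsTameOddCover act π b) (hV : IsAffineOpen V) : (π.app V).hom.Flat := by
  have := hπ.quotient.isFinite
  have := hπ.flat
  rw [← Scheme.Hom.appLE_eq_app]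
  exact π.flat_appLE hV (hV.preimage π) le_rfl

lemma card_inertia_pointIdeal (hπ : IsTameOddCover act π b) (hV : IsAffineOpen V) [Nonempty V]
    (hW : IsAffineOpen (π ⁻¹ᵁ V)) {x : X} (hx : x ∈ π ⁻¹ᵁ V)
    (hdim : ringKrullDim (X.presheaf.stalk x) = 1) :
    letI := sectionAction act hπ.quotient.invariant V
    Nat.card ((pointIdeal hW x hx).inertia G) = ramificationIndex π x := by
  have hfin := hπ.quotient.isFinite
  have hflat := hπ.flat
  let _ := (π.app V).hom.toAlgebra
  let _ := sectionAction act hπ.quotient.invariant V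
  have hG := isGaloisGroup_section hπ hV
  have hne := nonempty_preimage hπ.quotient.isDominant V
  have := hπ.isRegularRing hW
  have : Module.Finite Γ(Y, V) Γ(X, π ⁻¹ᵁ V) := IsFinite.finite_app π V hV
  have : Module.Flat Γ(Y, V) Γ(X, π ⁻¹ᵁ V) := hπ.flat_app hV
  have hfr := functionField_isFractionRing_of_isAffineOpen X (π ⁻¹ᵁ V) hW
  obtain ⟨v, hv⟩ := exists_isAdicValuation X.functionField (pointIdeal hW x hx)
    ((height_eq_one_iff hW hx).2 hdim)
  rw [← (ramificationIndex_spec π hW hx hV hv (hπ.exists_under_ne_zero hV hW hx hdim)).2.2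
    inferInstance]
  exact card_inertia_eq_ramificationIdx _ _
    (isSeparable_residueField_pointIdeal π hW hx hV (hπ.isTameAt hdim).2)

lemma exists_isTameRamification (hπ : IsTameOddCover act π b) (hV : IsAffineOpen V) [Nonempty V]
    [Nonempty (π ⁻¹ᵁ V)] (hW : IsAffineOpen (π ⁻¹ᵁ V)) :
    letI := (π.app V).hom.toAlgebra
    letI := sectionAction act hπ.quotient.invariant V
    ∃ v : Ideal Γ(X, π ⁻¹ᵁ V) → Valuation X.functionField (WithZero (Multiplicative ℤ)),
      IsTameRamification Γ(Y, V) G v (idealRamificationIndex π hW) := by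
  let _ := (π.app V).hom.toAlgebra
  let _ := sectionAction act hπ.quotient.invariant V
  have := hπ.isRegularRing hW
  have hfr := functionField_isFractionRing_of_isAffineOpen X (π ⁻¹ᵁ V) hW
  obtain ⟨v, hv⟩ := exists_forall_isAdicValuation Γ(X, π ⁻¹ᵁ V) X.functionField
  have key : ∀ P : Ideal Γ(X, π ⁻¹ᵁ V), ∀ hP : P.IsPrime, P.height = 1 →
      ∃ (x : X) (hx : x ∈ π ⁻¹ᵁ V), pointIdeal hW x hx = P ∧
        ringKrullDim (X.presheaf.stalk x) = 1 := fun P hP hP1 => by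
    obtain ⟨x, hx, rfl⟩ := exists_pointIdeal_eq hW P hP
    exact ⟨x, hx, rfl, (height_eq_one_iff hW hx).1 hP1⟩
  refine ⟨v, hv, ?_, ?_, ?_⟩
  · intro P hP hP1
    obtain ⟨x, hx, rfl, hdim⟩ := key P hP hP1
    rw [idealRamificationIndex_pointIdeal]
    exact (ramificationIndex_spec π hW hx hV (hv _ hP hP1)
      (hπ.exists_under_ne_zero hV hW hx hdim)).1
  · intro P hP hP1
    obtain ⟨x, hx, rfl, hdim⟩ := key P hP hP1
    rw [idealRamificationIndex_pointIdeal]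
    exact (ramificationIndex_spec π hW hx hV (hv _ hP hP1)
      (hπ.exists_under_ne_zero hV hW hx hdim)).2.1
  · intro P hP hP1 h0
    obtain ⟨x, hx, rfl, hdim⟩ := key P hP hP1
    have h1 : (Nat.card ((pointIdeal hW x hx).inertia G) : Γ(X,
        π ⁻¹ᵁ V) ⧸ pointIdeal hW x hx) = 0 :=
      h0
    rw [hπ.card_inertia_pointIdeal hV hW hx hdim, ← map_natCast (Ideal.Quotient.mk _),
      Ideal.Quotient.eq_zero_iff_mem, mem_pointIdeal_iff, map_natCast, ← residue_eq_zero_iff,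
      map_natCast] at h1
    exact (hπ.isTameAt hdim).1 h1

/-- The ramification index at a point of codimension one is the order of its inertia group, which is
contained in the inertia group of a closed specialization. -/
lemma odd_ramificationIndex (hπ : IsTameOddCover act π b) {x : X}
    (hdim : ringKrullDim (X.presheaf.stalk x) = 1) : Odd (ramificationIndex π x) := by
  have := hπ.quotient.isFinite
  have hinv := hπ.quotient.invariant
  obtain ⟨z, hz, hzcl⟩ := (isClosed_closure (s := {x})).exists_closed_singleton
    ⟨x, subset_closure rfl⟩
  have hxz : x ⤳ z := specializes_iff_mem_closure.2 hz
  obtain ⟨_, ⟨V, hV, rfl⟩, hzV, -⟩ := Y.isBasis_affineOpens.exists_subset_of_mem_open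
    (Set.mem_univ (π z)) isOpen_univ
  have hV : IsAffineOpen V := hV
  have : Nonempty V := ⟨⟨_, hzV⟩⟩
  have hW := hV.preimage π
  have hz' : z ∈ π ⁻¹ᵁ V := hzV
  have hx : x ∈ π ⁻¹ᵁ V := hxz.mem_open (π ⁻¹ᵁ V).isOpen hz'
  let _ := sectionAction act hinv V
  have hle : pointIdeal hW x hx ≤ pointIdeal hW z hz' := fun s hs => by
    rw [mem_pointIdeal_iff] at hs ⊢
    by_contra h
    rw [mem_maximalIdeal, mem_nonunits_iff, not_not] at h
    refine hs ?_
    rw [← X.presheaf.germ_stalkSpecializes_apply hz' hxz]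
    exact h.map _
  have hsub : (pointIdeal hW x hx).inertia G ≤ inertia act z := fun g hg => by
    rw [← Subgroup.inv_mem_iff]
    exact fromSpecResidueField_comp_eq hW hz' _ fun s => hle (hg s)
  rw [← hπ.card_inertia_pointIdeal hV hW hx hdim]
  exact (hπ.odd_inertia z hzcl).of_dvd_nat (Subgroup.card_dvd_of_le hsub)

end IsTameOddCover

end TameChart

/-! ### Affine base change -/

section AffineBaseChange

lemma exists_basis_of_isLocalizedModule {R : Type u} {M M' : Type*} [CommRing R] [AddCommGroup M]
    [Module R M]
    (S : Submonoid R) (Rₛ : Type*) [CommRing Rₛ] [Algebra R Rₛ] [IsLocalization S Rₛ]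
        [AddCommGroup M']
    [Module R M'] [Module Rₛ M'] [IsScalarTower R Rₛ M'] (f : M →ₗ[R] M') [IsLocalizedModule S f]
    {ι : Type*} (β : Module.Basis ι (Localization S) (LocalizedModule S M)) :
    Nonempty (Module.Basis ι Rₛ M') := by
  let e : Localization S ≃ₐ[R] Rₛ := IsLocalization.algEquiv S _ _
  let _ : Module Rₛ (LocalizedModule S M) := Module.compHom _ e.symm.toRingEquiv.toRingHom
  have hsmul : ∀ (c : Rₛ) (x : LocalizedModule S M), c • x = e.symm c • x := fun _ _ => rfl
  have h : ∀ (c : Localization S) (x : LocalizedModule S M), e c • x = c • x := fun c x => by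
    rw [hsmul, e.symm_apply_apply]
  have : IsScalarTower R Rₛ (LocalizedModule S M) := ⟨fun r c x => by
    rw [hsmul, hsmul, map_smul, smul_assoc]⟩
  let g : LocalizedModule S M ≃ₗ[Rₛ] M' :=
    (IsLocalizedModule.iso S f).extendScalarsOfIsLocalization S Rₛ
  exact ⟨(β.mapCoeffs e.toRingEquiv h).map g⟩

/-- A basis of `S` over `R` is a basis of `S ⊗_R T` over `T`. -/
lemma exists_basis_of_isPushout {R S T P : CommRingCat.{u}} {f : R ⟶ S} {g : R ⟶ T} {i : S ⟶ P}
    {j : T ⟶ P} (h : IsPushout f g i j) {ι : Type*}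
    (β : letI := f.hom.toAlgebra; Module.Basis ι R S) :
    letI := j.hom.toAlgebra
    letI := f.hom.toAlgebra
    ∃ c : Module.Basis ι T P, ∀ k, c k = i (β k) := by
  let _ := f.hom.toAlgebra
  let _ := g.hom.toAlgebra
  let _ := i.hom.toAlgebra
  let _ := j.hom.toAlgebra
  let _ := (f ≫ i).hom.toAlgebra
  have : IsScalarTower R S P := .of_algebraMap_eq fun _ => rfl
  have : IsScalarTower R T P := .of_algebraMap_eq fun r => ConcreteCategory.congr_hom h.w r
  have h' : Algebra.IsPushout R T S P := (CommRingCat.isPushout_iff_isPushout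
    (R := R) (S := S) (R' := T) (S' := P)).1 h.flip
  exact ⟨h'.out.basis β, fun k => h'.out.basis_apply β k⟩

lemma _root_.CategoryTheory.IsPushout.nonempty_basis {R S T P : CommRingCat.{u}} {f : R ⟶ S}
    {g : R ⟶ T} {i : S ⟶ P}
    {j : T ⟶ P} (h : IsPushout f g i j) {r : R}
    (hg : letI := g.hom.toAlgebra; IsLocalization.Away r T) {ι : Type*}
    (β : letI := f.hom.toAlgebra
      Module.Basis ι (Localization (.powers r)) (LocalizedModule.Away r S)) :
    letI := j.hom.toAlgebra
    Nonempty (Module.Basis ι T P) := by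
  let _ := f.hom.toAlgebra
  let _ := g.hom.toAlgebra
  let _ := i.hom.toAlgebra
  let _ := j.hom.toAlgebra
  let _ := (f ≫ i).hom.toAlgebra
  have : IsScalarTower R S P := .of_algebraMap_eq fun _ => rfl
  have : IsScalarTower R T P := .of_algebraMap_eq fun r => ConcreteCategory.congr_hom h.w r
  have h' : Algebra.IsPushout R T S P := (CommRingCat.isPushout_iff_isPushout
    (R := R) (S := S) (R' := T) (S' := P)).1 h.flip
  have := (isLocalizedModule_iff_isBaseChange (.powers r) T
    (IsScalarTower.toAlgHom R S P).toLinearMap).2 h'.out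
  exact exists_basis_of_isLocalizedModule (.powers r) T (IsScalarTower.toAlgHom R S P).toLinearMap β

variable {X Y Z T : Scheme.{u}} {π : X ⟶ Y} {φ : Z ⟶ Y} {s : T ⟶ X} {p : T ⟶ Z}

lemma preimage_preimage_le (H : IsPullback s p π φ) (V : Y.Opens) :
    p ⁻¹ᵁ (φ ⁻¹ᵁ V) ≤ s ⁻¹ᵁ (π ⁻¹ᵁ V) := by
  rw [← Scheme.Hom.comp_preimage, ← Scheme.Hom.comp_preimage, H.w]

/-- Affine base change: a basis of the functions on `π⁻¹ V` over those on `V` is a frame of the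
direct image of the structure sheaf after any base change. -/
lemma isFrame_structure_of_basis (H : IsPullback s p π φ) {V : Y.Opens} (hV : IsAffineOpen V)
    (hW : IsAffineOpen (π ⁻¹ᵁ V)) {ι : Type*} [Fintype ι]
    (β : letI := (π.app V).hom.toAlgebra; Module.Basis ι Γ(Y, V) Γ(X, π ⁻¹ᵁ V)) :
    letI := (π.app V).hom.toAlgebra
    IsFrame ((Scheme.Modules.pushforward p).obj (structureModule T)) (φ ⁻¹ᵁ V)
      fun i => toStructure (s.appLE (π ⁻¹ᵁ V) (p ⁻¹ᵁ (φ ⁻¹ᵁ V)) (preimage_preimage_le H V)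
        (β i)) := by
  let _ := (π.app V).hom.toAlgebra
  refine isFrame_of_cover {W | IsAffineOpen W} (fun W hW z hz => ?_) fun W hWa hWV t => ?_
  · obtain ⟨_, ⟨W', hW', rfl⟩, hz', h⟩ := Z.isBasis_affineOpens.exists_subset_of_mem_open hz W.isOpen
    exact ⟨W', hW', hz', h⟩
  · have hUY : p ⁻¹ᵁ W = s ⁻¹ᵁ (π ⁻¹ᵁ V) ⊓ p ⁻¹ᵁ W := by
      refine (inf_eq_right.2 ?_).symm
      exact le_trans (fun z hz => hWV hz) (preimage_preimage_le H V)
    have hiso := isIso_pushoutSection_of_isAffineOpen H hWV le_rfl hUY hV hWa hW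
    have hpush := (isIso_pushoutSection_iff H hWV le_rfl hUY).1 hiso
    have key : ∃ c : (letI := (p.app W).hom.toAlgebra; Module.Basis ι Γ(Z, W) Γ(T, p ⁻¹ᵁ W)),
        ∀ k, c k = s.appLE (π ⁻¹ᵁ V) (p ⁻¹ᵁ W) (hUY.le.trans inf_le_left) (β k) := by
      rw [Scheme.Hom.appLE_eq_app, Scheme.Hom.appLE_eq_app] at hpush
      exact exists_basis_of_isPushout hpush β
    obtain ⟨c, hc⟩ := key
    let _ := (p.app W).hom.toAlgebra
    have hsum : ∀ d : ι → Γ(Z, W), ofStructure (∑ i, d i •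
        res ((Scheme.Modules.pushforward p).obj (structureModule T)) hWV (toStructure
          (s.appLE (π ⁻¹ᵁ V) (p ⁻¹ᵁ (φ ⁻¹ᵁ V)) (preimage_preimage_le H V) (β i)) :
            Γ((Scheme.Modules.pushforward p).obj (structureModule T), φ ⁻¹ᵁ V))) =
        ∑ i, d i • c i := fun d => by
      refine Finset.sum_congr rfl fun i _ => ?_
      rw [hc]
      change p.app W (d i) * _ = p.app W (d i) * _
      congr 1
      have h1 := Scheme.Hom.appLE_map s (V := p ⁻¹ᵁ (φ ⁻¹ᵁ V)) (preimage_preimage_le H V)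
        (homOfLE (fun z hz => hWV hz : p ⁻¹ᵁ W ≤ p ⁻¹ᵁ (φ ⁻¹ᵁ V))).op
      exact ConcreteCategory.congr_hom h1 (β i)
    refine ⟨c.repr (ofStructure t), ?_, fun d hd => ?_⟩
    · refine (c.sum_repr (ofStructure t)).symm.trans ?_
      exact (hsum _).symm
    · have h2 : ofStructure t = ∑ i, d i • c i := (congrArg _ hd).trans (hsum d)
      rw [h2, c.repr_sum_self]

end AffineBaseChange

section FreeCharts

/-- Noetherianity descends along faithfully flat ring extensions. -/
lemma isNoetherianRing_of_faithfullyFlat (A B : Type*) [CommRing A] [CommRing B] [Algebra A B]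
    [Module.FaithfullyFlat A B] [IsNoetherianRing B] : IsNoetherianRing A := by
  rw [isNoetherianRing_iff, isNoetherian_iff']
  have hinj : Function.Injective (Ideal.map (algebraMap A B)) :=
    Function.LeftInverse.injective (g := Ideal.comap (algebraMap A B)) fun I =>
      Ideal.comap_map_eq_self_of_faithfullyFlat I
  have hmono : StrictMono (Ideal.map (algebraMap A B)) :=
    (Monotone.strictMono_of_injective (fun _ _ h => Ideal.map_mono h) hinj)
  exact hmono.wellFoundedGT

variable {X Y : Scheme.{u}} {G : Type v} [Group G] {act : G →* Aut X} {π : X ⟶ Y}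
  [IsIntegral X] [IsIntegral Y] [IsNoetherian X] [Finite G] {b : Closeds Y}

/-- Locally on the base, the functions upstairs are free over those downstairs. -/
lemma IsTameOddCover.exists_basis_section (hπ : IsTameOddCover act π b) {y : Y} (O : Y.Opens)
    (hy : y ∈ O) : ∃ V : Y.Opens, IsAffineOpen V ∧ V ≤ O ∧ y ∈ V ∧ ∃ n : ℕ,
      letI := (π.app V).hom.toAlgebra
      Nonempty (Module.Basis (Fin n) Γ(Y, V) Γ(X, π ⁻¹ᵁ V)) := by
  have hfin := hπ.quotient.isFinite
  have hflat := hπ.flat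
  obtain ⟨_, ⟨V, hV, rfl⟩, hyV, hVO⟩ := Y.isBasis_affineOpens.exists_subset_of_mem_open hy O.isOpen
  have hV : IsAffineOpen V := hV
  have hW := hV.preimage π
  have : Nonempty V := ⟨⟨y, hyV⟩⟩
  have hne := nonempty_preimage hπ.quotient.isDominant V
  let _ := (π.app V).hom.toAlgebra
  have : Module.Finite Γ(Y, V) Γ(X, π ⁻¹ᵁ V) := IsFinite.finite_app π V hV
  have : Module.Flat Γ(Y, V) Γ(X, π ⁻¹ᵁ V) := hπ.flat_app hV
  have : FaithfulSMul Γ(Y, V) Γ(X, π ⁻¹ᵁ V) :=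
    (faithfulSMul_iff_algebraMap_injective _ _).2 (hπ.quotient.injective V)
  have : Module.FaithfullyFlat Γ(Y, V) Γ(X, π ⁻¹ᵁ V) := inferInstance
  have : IsNoetherianRing Γ(X, π ⁻¹ᵁ V) := IsLocallyNoetherian.component_noetherian ⟨_, hW⟩
  have : IsNoetherianRing Γ(Y, V) := isNoetherianRing_of_faithfullyFlat _ Γ(X, π ⁻¹ᵁ V)
  have : Module.FinitePresentation Γ(Y, V) Γ(X, π ⁻¹ᵁ V) :=
    Module.finitePresentation_of_finite _ _
  let P := pointIdeal hV y hyV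
  have : Module.Free (Localization.AtPrime P) (LocalizedModule P.primeCompl Γ(X, π ⁻¹ᵁ V)) :=
    Module.free_of_flat_of_isLocalRing
  obtain ⟨f, hf, hfree, -⟩ := Module.FinitePresentation.exists_free_localizedModule_powers
    P.primeCompl (LocalizedModule.mkLinearMap P.primeCompl Γ(X, π ⁻¹ᵁ V)) (Localization.AtPrime P)
  let V' := Y.basicOpen f
  let B' := Γ(X, X.basicOpen (π.app V f))
  have hV'V : V' ≤ V := Y.basicOpen_le f
  have hyV' : y ∈ V' := by
    have h1 : f ∉ pointIdeal hV y hyV := hf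
    rw [mem_pointIdeal_iff, IsLocalRing.mem_maximalIdeal, mem_nonunits_iff, not_not] at h1
    exact (Y.mem_basicOpen f y hyV).2 h1
  refine ⟨V', hV.basicOpen f, hV'V.trans hVO, hyV', ?_⟩
  have hfinite : Module.Finite (Localization (.powers f)) (LocalizedModule.Away f Γ(X, π ⁻¹ᵁ V)) :=
    inferInstance
  have hiso := isIso_pushoutSection_of_isAffineOpen (f := 𝟙 Y) (g := 𝟙 X) (iX := π) (iY := π)
    (IsPullback.id_horiz π) (US := V) (UT := V') (UX := π ⁻¹ᵁ V) (UY := π ⁻¹ᵁ V') hV'V le_rfl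
    (inf_eq_right.2 fun x hx => hV'V hx).symm hV (hV.basicOpen f) hW
  have hpush := (isIso_pushoutSection_iff _ _ _ _).1 hiso
  rw [Scheme.Hom.appLE_eq_app, Scheme.Hom.appLE_eq_app] at hpush
  have hloc := hV.isLocalization_basicOpen f
  exact ⟨_, hpush.nonempty_basis hloc ((Module.Free.chooseBasis _ _).reindex (Fintype.equivFin _))⟩

end FreeCharts

/-! ### Frames after base change -/

section BaseChangeFrames

variable {T Z : Scheme.{u}} {p : T ⟶ Z} {M : T.Modules} {W : Z.Opens} {ι : Type*} [Fintype ι]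

/-- If `l` generates a line bundle over `p⁻¹ W` and the `β i` are a frame of `p_* 𝒪` over `W`, then
the `β i • l` are a frame of the direct image of the line bundle. -/
lemma isFrame_pushforward_smul {l : Γ(M, p ⁻¹ᵁ W)} (hl : IsFrame M (p ⁻¹ᵁ W) fun _ : Unit => l)
    {β : ι → Γ(T, p ⁻¹ᵁ W)}
    (hβ : IsFrame ((Scheme.Modules.pushforward p).obj (structureModule T)) W
      fun i => toStructure (β i)) :
    IsFrame ((Scheme.Modules.pushforward p).obj M) W
      fun i => (β i • l : Γ(M, p ⁻¹ᵁ W)) := by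
  intro V h s
  have hp : p ⁻¹ᵁ V ≤ p ⁻¹ᵁ W := fun x hx => h hx
  have hsum : ∀ c : ι → Γ(Z, V), (∑ i, c i • res ((Scheme.Modules.pushforward p).obj M) h
      (β i • l : Γ(M, p ⁻¹ᵁ W)) : Γ((Scheme.Modules.pushforward p).obj M, V)) =
      ((∑ i, p.app V (c i) * rres hp (β i)) • res M hp l : Γ(M, p ⁻¹ᵁ V)) := fun c => by
    rw [Finset.sum_smul]
    refine Finset.sum_congr rfl fun i _ => ?_
    change p.app V (c i) • res M hp (β i • l) = _
    rw [res_smul, smul_smul]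
  have hsum' : ∀ c : ι → Γ(Z, V), (∑ i, c i • res ((Scheme.Modules.pushforward p).obj
      (structureModule T)) h (toStructure (β i)) :
        Γ((Scheme.Modules.pushforward p).obj (structureModule T), V)) =
      toStructure (∑ i, p.app V (c i) * rres hp (β i)) := fun c => rfl
  obtain ⟨r, hr, hr'⟩ := hl (p ⁻¹ᵁ V) hp s
  obtain ⟨c, hc, hc'⟩ := hβ V h (toStructure (r ()))
  simp only [Finset.univ_unique, Finset.sum_singleton] at hr hr'
  refine ⟨c, ?_, fun d hd => hc' d ?_⟩
  · refine Eq.trans ?_ (hsum c).symm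
    exact hr.trans (congrArg (fun t : Γ(T, p ⁻¹ᵁ V) => t • res M hp l)
      (hc.trans (hsum' c) : r () = _))
  · have h1 := hr' (fun _ => ∑ i, p.app V (d i) * rres hp (β i)) (hd.trans (hsum d))
    exact (congrFun h1 ()).symm.trans (hsum' d).symm

lemma IsFrame.congr {E : Z.Modules} {b b' : ι → Γ(E, W)} (hb : IsFrame E W b)
    (h : ∀ i, b i = b' i) : IsFrame E W b' := by
  rwa [← funext h]

variable {X Y : Scheme.{u}}

lemma preimage_pullback_eq (φ : Z ⟶ Y) (π : X ⟶ Y) (V : Y.Opens) :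
    pullback.fst φ π ⁻¹ᵁ (φ ⁻¹ᵁ V) = pullback.snd φ π ⁻¹ᵁ (π ⁻¹ᵁ V) := by
  rw [← Scheme.Hom.comp_preimage, ← Scheme.Hom.comp_preimage, pullback.condition]

lemma along_baseChangeMap (φ : Z ⟶ Y) (π : X ⟶ Y) (L : X.Modules) {V : Y.Opens}
    (s : Γ(L, π ⁻¹ᵁ V)) :
    along (U := V) (baseChangeMap φ π L) s = res _ (preimage_pullback_eq φ π V).le
      (along (unitMap (pullback.snd φ π) L) s) := by
  rfl

lemma isFrame_pushforward_of_basis {π : X ⟶ Y} {L : X.Modules} {V : Y.Opens} (hV : IsAffineOpen V)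
    (hW : IsAffineOpen (π ⁻¹ᵁ V)) {l : Γ(L, π ⁻¹ᵁ V)}
    (hl : IsFrame L (π ⁻¹ᵁ V) fun _ : Unit => l)
    (β : letI := (π.app V).hom.toAlgebra; Module.Basis ι Γ(Y, V) Γ(X, π ⁻¹ᵁ V)) :
    letI := (π.app V).hom.toAlgebra
    IsFrame ((Scheme.Modules.pushforward π).obj L) V fun i => (β i • l : Γ(L, π ⁻¹ᵁ V)) := by
  let _ := (π.app V).hom.toAlgebra
  exact isFrame_pushforward_smul hl (β := β)
    (IsFrame.congr (isFrame_structure_of_basis (s := 𝟙 X) (p := π) (IsPullback.id_horiz π) hV hW β)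
      fun i => rres_self (β i))

/-- The base change morphism takes a frame of the direct image of a line bundle to a frame. -/
lemma isFramed_baseChangeMap (φ : Z ⟶ Y) (π : X ⟶ Y) (L : X.Modules)
    (H : ∀ y : Y, ∃ V : Y.Opens, y ∈ V ∧ IsAffineOpen V ∧ IsAffineOpen (π ⁻¹ᵁ V) ∧
      (∃ l : Γ(L, π ⁻¹ᵁ V), IsFrame L (π ⁻¹ᵁ V) fun _ : Unit => l) ∧ ∃ n : ℕ,
        letI := (π.app V).hom.toAlgebra
        Nonempty (Module.Basis (Fin n) Γ(Y, V) Γ(X, π ⁻¹ᵁ V))) :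
    IsFramed (baseChangeMap φ π L) := by
  intro y
  obtain ⟨V, hyV, hV, hW, ⟨l, hl⟩, n, ⟨β⟩⟩ := H y
  let _ := (π.app V).hom.toAlgebra
  have h2 := isFrame_structure_of_basis (IsPullback.of_hasPullback φ π).flip hV hW β
  have h3 := (hl.pullback (pullback.snd φ π)).restrict (preimage_pullback_eq φ π V).le
  refine ⟨V, hyV, n, _, isFrame_pushforward_of_basis hV hW hl β,
    IsFrame.congr (isFrame_pushforward_smul h3 h2) fun i => ?_⟩
  refine Eq.symm ((along_baseChangeMap φ π L _).trans ?_)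
  refine (congrArg (res _ (preimage_pullback_eq φ π V).le)
    (along_smul (unitMap (pullback.snd φ π) L) (β i) l)).trans ?_
  exact res_smul _ _ _ _

end BaseChangeFrames

/-! ### Pole orders and the trace -/

section Cotangent

open IsLocalRing

lemma linearIndependent_toCotangent_iff {R : Type*} [CommRing R] [IsLocalRing R] {κ : Type*}
    [Fintype κ] {x : κ → R} (hx : ∀ i, x i ∈ maximalIdeal R) :
    LinearIndependent (ResidueField R) (fun i => (maximalIdeal R).toCotangent ⟨x i, hx i⟩) ↔
      ∀ c : κ → R, ∑ i, c i * x i ∈ maximalIdeal R ^ 2 →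
        ∀ i, c i ∈ maximalIdeal R := by
  have key : ∀ c : κ → R, ∑ i, residue R (c i) • (maximalIdeal R).toCotangent ⟨x i, hx i⟩ = 0 ↔
      ∑ i, c i * x i ∈ maximalIdeal R ^ 2 := fun c => by
    have h1 : ∑ i, residue R (c i) • (maximalIdeal R).toCotangent ⟨x i, hx i⟩ =
        (maximalIdeal R).toCotangent (∑ i, c i • ⟨x i, hx i⟩) := by
      rw [map_sum]
      exact Finset.sum_congr rfl fun i _ => by
        rw [map_smul, ← algebraMap_smul (ResidueField R) (c i)]; rfl
    rw [h1, Ideal.toCotangent_eq_zero]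
    simp
  rw [Fintype.linearIndependent_iff]
  constructor
  · intro h c hc i
    rw [← residue_eq_zero_iff]
    exact h (fun i => residue R (c i)) ((key c).2 hc) i
  · intro h g hg i
    choose c hc using fun i => residue_surjective (g i)
    rw [← hc, residue_eq_zero_iff]
    refine h c ((key c).1 ?_) i
    simpa only [hc] using hg

lemma linearIndependent_toCotangent_of_ringEquiv {R R' : Type*} [CommRing R] [IsLocalRing R]
    [CommRing R'] [IsLocalRing R'] (e : R ≃+* R') {κ : Type*} [Finite κ] {x : κ → R} {x' : κ → R'}
    (hx : ∀ i, x i ∈ maximalIdeal R) (hx' : ∀ i, x' i ∈ maximalIdeal R')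
    (h : ∀ i, e (x i) = x' i)
    (hli : LinearIndependent (ResidueField R) fun i => (maximalIdeal R).toCotangent ⟨x i, hx i⟩) :
    LinearIndependent (ResidueField R') fun i =>
      (maximalIdeal R').toCotangent ⟨x' i, hx' i⟩ := by
  cases nonempty_fintype κ
  rw [linearIndependent_toCotangent_iff] at hli ⊢
  have hmem : ∀ (n : ℕ) (r : R), e r ∈ maximalIdeal R' ^ n ↔ r ∈ maximalIdeal R ^ n := fun n r => by
    rw [← IsLocalRing.map_ringEquiv_maximalIdeal e, ← Ideal.map_pow, Ideal.mem_map_of_equiv]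
    exact ⟨fun ⟨s, hs, hsr⟩ => e.injective hsr ▸ hs, fun hr => ⟨r, hr, rfl⟩⟩
  intro c hc i
  have h1 := hli (fun i => e.symm (c i)) (by
    rw [← hmem, map_sum]
    simpa only [map_mul, e.apply_symm_apply, h] using hc) i
  have h2 := hmem 1 (e.symm (c i))
  rw [pow_one, pow_one, e.apply_symm_apply] at h2
  exact h2.2 h1

end Cotangent

section PoleOrder

open WithZero

variable {X : Scheme.{u}} [IsIntegral X]

/-- The rational function `l` generates, near the point `x` of codimension one, the functions with a
pole of order at most `k`. -/
def GeneratesPoleOrder (x : X) (k : ℕ) (l : X.functionField) : Prop :=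
  l ≠ 0 ∧ HasPoleOrderLE x k l ∧ ∀ f, HasPoleOrderLE x k f → HasPoleOrderLE x 0 (f / l)

lemma generatesPoleOrder_iff {W : X.Opens} (hW : IsAffineOpen W) [Nonempty W] {x : X} (hx : x ∈ W)
    {v : Valuation X.functionField (WithZero (Multiplicative ℤ))}
    (hv : IsAdicValuation (pointIdeal hW x hx) v) (k : ℕ) (l : X.functionField) :
    GeneratesPoleOrder x k l ↔ v l = exp (k : ℤ) := by
  simp only [GeneratesPoleOrder, hasPoleOrderLE_iff hW hx hv]
  constructor
  · rintro ⟨h0, h1, h2⟩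
    refine le_antisymm h1 ?_
    obtain ⟨t, ht⟩ := hv.exists_eq
    have h3 := h2 ((algebraMap Γ(X, W) X.functionField t)⁻¹ ^ k) (by
      rw [map_pow, map_inv₀, ht, ← exp_neg, ← exp_nsmul]; simp)
    rw [map_div₀, map_pow, map_inv₀, ht, ← exp_neg, ← exp_nsmul, Nat.cast_zero, exp_zero,
      div_le_one₀ ((Valuation.pos_iff v).2 h0)] at h3
    simpa using h3
  · intro h
    refine ⟨(Valuation.ne_zero_iff v).1 (by rw [h]; exact exp_ne_zero), h.le, fun f hf => ?_⟩
    rw [map_div₀, h, Nat.cast_zero, exp_zero, div_le_one₀ exp_pos]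
    exact hf

end PoleOrder

section Chart

open WithZero IsLocalRing

variable {X Y : Scheme.{u}} {G : Type v} [Group G] {act : G →* Aut X} {π : X ⟶ Y}
  [IsIntegral X] [IsIntegral Y]

lemma isScalarTower_functionField (hdom : IsDominant π) (V : Y.Opens) [Nonempty V]
    [Nonempty (π ⁻¹ᵁ V)] :
    letI := (π.app V).hom.toAlgebra
    letI := (functionFieldMap π).toAlgebra
    letI : Algebra Γ(Y, V) X.functionField :=
      ((algebraMap Γ(X, π ⁻¹ᵁ V) X.functionField).comp (π.app V).hom).toAlgebra
    IsScalarTower Γ(Y, V) Y.functionField X.functionField := by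
  let _ := (π.app V).hom.toAlgebra
  let _ := (functionFieldMap π).toAlgebra
  let _ : Algebra Γ(Y, V) X.functionField :=
      ((algebraMap Γ(X, π ⁻¹ᵁ V) X.functionField).comp (π.app V).hom).toAlgebra
  exact .of_algebraMap_eq fun r => (functionFieldMap_algebraMap π V r).symm

variable [IsNoetherian X] [Finite G] {b : Closeds Y} {V : Y.Opens}

namespace IsTameOddCover

lemma isGaloisGroup_functionField (hπ : IsTameOddCover act π b) :
    letI := hπ.quotient.isDominant
    letI := (functionFieldMap π).toAlgebra
    letI := functionFieldAction act
    IsGaloisGroup G Y.functionField X.functionField := by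
  have hdom := hπ.quotient.isDominant
  have hfin := hπ.quotient.isFinite
  obtain ⟨_, ⟨V, hV, rfl⟩, hyV, -⟩ := Y.isBasis_affineOpens.exists_subset_of_mem_open
    (Set.mem_univ (genericPoint Y)) isOpen_univ
  have hV : IsAffineOpen V := hV
  have : Nonempty V := ⟨⟨_, hyV⟩⟩
  have hW := hV.preimage π
  have hne := nonempty_preimage hdom V
  let _ := (π.app V).hom.toAlgebra
  let _ := sectionAction act hπ.quotient.invariant V
  let _ := (functionFieldMap π).toAlgebra
  let _ := functionFieldAction act
  let _ : Algebra Γ(Y, V) X.functionField :=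
      ((algebraMap Γ(X, π ⁻¹ᵁ V) X.functionField).comp (π.app V).hom).toAlgebra
  have := isGaloisGroup_section hπ hV
  have := sectionAction_smul_algebraMap act hπ.quotient.invariant V
  have := isScalarTower_functionField hdom V
  have : IsScalarTower Γ(Y, V) Γ(X, π ⁻¹ᵁ V) X.functionField := .of_algebraMap_eq fun _ => rfl
  have := functionField_isFractionRing_of_isAffineOpen X (π ⁻¹ᵁ V) hW
  have := functionField_isFractionRing_of_isAffineOpen Y V hV
  exact IsGaloisGroup.to_isFractionRing G Γ(Y, V) Γ(X, π ⁻¹ᵁ V) Y.functionField X.functionField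

/-- The trace form takes values in the structure sheaf. -/
lemma exists_algebraMap_eq_trace_mul (hπ : IsTameOddCover act π b) (hV : IsAffineOpen V)
    [Nonempty V]
    {s t : X.functionField}
    (hs : ∀ x ∈ π ⁻¹ᵁ V, ringKrullDim (X.presheaf.stalk x) = 1 →
      HasPoleOrderLE x ((ramificationIndex π x - 1) / 2) s)
    (ht : ∀ x ∈ π ⁻¹ᵁ V, ringKrullDim (X.presheaf.stalk x) = 1 →
      HasPoleOrderLE x ((ramificationIndex π x - 1) / 2) t) :
    letI := hπ.quotient.isDominant
    letI := (functionFieldMap π).toAlgebra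
    ∃ r : Γ(Y, V), algebraMap Γ(Y, V) Y.functionField r =
      Algebra.trace Y.functionField X.functionField (s * t) := by
  have hdom := hπ.quotient.isDominant
  have hfin := hπ.quotient.isFinite
  have hW := hV.preimage π
  have hne := nonempty_preimage hdom V
  let _ := (π.app V).hom.toAlgebra
  let _ := sectionAction act hπ.quotient.invariant V
  let _ := (functionFieldMap π).toAlgebra
  let _ := functionFieldAction act
  let _ : Algebra Γ(Y, V) X.functionField :=
      ((algebraMap Γ(X, π ⁻¹ᵁ V) X.functionField).comp (π.app V).hom).toAlgebra
  have := isGaloisGroup_section hπ hV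
  have := hπ.isGaloisGroup_functionField
  have := sectionAction_smul_algebraMap act hπ.quotient.invariant V
  have := isScalarTower_functionField hdom V
  have : IsScalarTower Γ(Y, V) Γ(X, π ⁻¹ᵁ V) X.functionField := .of_algebraMap_eq fun _ => rfl
  have := functionField_isFractionRing_of_isAffineOpen X (π ⁻¹ᵁ V) hW
  have := functionField_isFractionRing_of_isAffineOpen Y V hV
  have := hπ.isRegularRing hW
  obtain ⟨v, hv⟩ := hπ.exists_isTameRamification hV hW
  -- `s t` has a pole of order at most `2 (e - 1) / 2 = e - 1`, as `e` is odd
  refine exists_algebraMap_eq_trace (G := G) hv fun P hP hP1 => ?_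
  obtain ⟨x, hx, rfl⟩ := exists_pointIdeal_eq hW P hP
  have hdim := (height_eq_one_iff hW hx).1 hP1
  have h1 := (hasPoleOrderLE_iff hW hx (hv.isAdic _ hP hP1) _ _).1 (hs x hx hdim)
  have h2 := (hasPoleOrderLE_iff hW hx (hv.isAdic _ hP hP1) _ _).1 (ht x hx hdim)
  obtain ⟨m, hm⟩ := hπ.odd_ramificationIndex hdim
  rw [idealRamificationIndex_pointIdeal, map_mul]
  refine (mul_le_mul' h1 h2).trans_eq ?_
  rw [← exp_add, hm]
  congr 1
  have : (2 * m + 1 - 1) / 2 = m := by omega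
  rw [this]
  push_cast
  ring

end IsTameOddCover

end Chart

/-! ### Local generators of the square root of the inverse different -/

section Chart

open WithZero IsLocalRing

variable {X Y : Scheme.{u}} {G : Type v} [Group G] {act : G →* Aut X} {π : X ⟶ Y}
  [IsIntegral X] [IsIntegral Y] [IsNoetherian X] [Finite G] {b : Closeds Y} {V : Y.Opens}

lemma mem_basicOpen_iff_notMem_pointIdeal {Y : Scheme.{u}} {V : Y.Opens} (hV : IsAffineOpen V)
    {y : Y} (hy : y ∈ V)
    (r : Γ(Y, V)) : y ∈ Y.basicOpen r ↔ r ∉ pointIdeal hV y hy := by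
  rw [mem_pointIdeal_iff, mem_maximalIdeal, mem_nonunits_iff, not_not, Y.mem_basicOpen r y hy]

namespace IsTameOddCover

/-- The square root of the inverse different is locally, on the base, generated by one function. -/
lemma exists_generatesPoleOrder (hπ : IsTameOddCover act π b) (y : Y) :
    ∃ O : Y.Opens, y ∈ O ∧ ∃ l : X.functionField, l ≠ 0 ∧ ∀ x ∈ π ⁻¹ᵁ O,
      ringKrullDim (X.presheaf.stalk x) = 1 →
        GeneratesPoleOrder x ((ramificationIndex π x - 1) / 2) l := by
  have hdom := hπ.quotient.isDominant
  have hfin := hπ.quotient.isFinite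
  obtain ⟨_, ⟨V, hV, rfl⟩, hyV, -⟩ := Y.isBasis_affineOpens.exists_subset_of_mem_open
    (Set.mem_univ y) isOpen_univ
  have hV : IsAffineOpen V := hV
  have : Nonempty V := ⟨⟨_, hyV⟩⟩
  have hW := hV.preimage π
  have hne := nonempty_preimage hdom V
  let _ := (π.app V).hom.toAlgebra
  let _ := sectionAction act hπ.quotient.invariant V
  have := functionField_isFractionRing_of_isAffineOpen X (π ⁻¹ᵁ V) hW
  have := hπ.isRegularRing hW
  have : Module.Finite Γ(Y, V) Γ(X, π ⁻¹ᵁ V) := IsFinite.finite_app π V hV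
  have : FaithfulSMul Γ(Y, V) Γ(X, π ⁻¹ᵁ V) :=
    (faithfulSMul_iff_algebraMap_injective _ _).2 (hπ.quotient.injective V)
  obtain ⟨v, hv⟩ := hπ.exists_isTameRamification hV hW
  have hgen : genericPoint Y ∈ V :=
    ((genericPoint_spec Y).mem_open_set_iff V.isOpen).2 (by simpa using ‹Nonempty V›)
  -- a nonzero function `a` on `V` that vanishes on the branch locus, which contains the image of
  -- the support of the divisor
  obtain ⟨a, hab, hga⟩ := hV.exists_basicOpen_le (V := b.compl)
    ⟨genericPoint Y, hπ.normalCrossings.genericPoint_notMem⟩ hgen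
  have ha0 : a ≠ 0 := by
    rintro rfl
    rw [Scheme.basicOpen_zero] at hga
    exact hga
  let k : Ideal Γ(X, π ⁻¹ᵁ V) → ℕ := fun P => (idealRamificationIndex π hW P - 1) / 2
  obtain ⟨l, hl0, f, hf, hl⟩ := exists_forall_valuation_eq_exp (A := Γ(Y, V)) hv.isAdic k
    (a₀ := algebraMap Γ(Y, V) Γ(X, π ⁻¹ᵁ V) a)
    ((map_ne_zero_iff _ (hπ.quotient.injective V)).2 ha0) (fun P hP hP1 hk => by
      obtain ⟨x, hx, rfl⟩ := exists_pointIdeal_eq hW P hP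
      by_contra ha
      have h1 : a ∉ pointIdeal hV (π x) hx := by
        rw [← under_pointIdeal π hW hx hV]
        exact ha
      refine hk ?_
      change (idealRamificationIndex π hW (pointIdeal hW x hx) - 1) / 2 = 0
      rw [idealRamificationIndex_pointIdeal, hπ.ramificationIndex_eq_one
        ((height_eq_one_iff hW hx).1 hP1) (hab ((mem_basicOpen_iff_notMem_pointIdeal hV hx a).2 h1))])
    (pointIdeal hV y hyV)
  refine ⟨Y.basicOpen f, ?_, l, hl0, fun x hx hdim => ?_⟩
  · exact (mem_basicOpen_iff_notMem_pointIdeal hV hyV f).2 hf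
  · have hxV : x ∈ π ⁻¹ᵁ V := Y.basicOpen_le f hx
    have hP1 := (height_eq_one_iff hW hxV).2 hdim
    refine (generatesPoleOrder_iff hW hxV (hv.isAdic _ inferInstance hP1) _ _).2 ?_
    rw [hl _ inferInstance hP1]
    · change exp (((idealRamificationIndex π hW (pointIdeal hW x hxV) - 1) / 2 : ℕ) : ℤ) = _
      rw [idealRamificationIndex_pointIdeal]
    · have h1 := (mem_basicOpen_iff_notMem_pointIdeal hV hxV f).1 hx
      rw [← under_pointIdeal π hW hxV hV] at h1
      exact h1

/-- Over a chart `V` on which `l` generates the square root of the inverse different and over which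
`π` is free: the lattice generated by `l` contains its dual for the trace form, and the trace is
locally surjective. -/
lemma exists_trace_isUnit (hπ : IsTameOddCover act π b) (hV : IsAffineOpen V)
    [Nonempty V] {l : X.functionField} (hl0 : l ≠ 0)
    (hl : ∀ x ∈ π ⁻¹ᵁ V, ringKrullDim (X.presheaf.stalk x) = 1 →
      GeneratesPoleOrder x ((ramificationIndex π x - 1) / 2) l) {ι : Type*} [Fintype ι]
    (β : letI := (π.app V).hom.toAlgebra; Module.Basis ι Γ(Y, V) Γ(X, π ⁻¹ᵁ V)) :
    letI := hπ.quotient.isDominant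
    letI := (functionFieldMap π).toAlgebra
    letI := nonempty_preimage hπ.quotient.isDominant V
    (∀ s : X.functionField, (∀ c : Γ(X, π ⁻¹ᵁ V), ∃ r : Γ(Y, V),
      algebraMap Γ(Y, V) Y.functionField r = Algebra.trace Y.functionField X.functionField
        (s * (l * algebraMap Γ(X, π ⁻¹ᵁ V) X.functionField c))) →
      ∃ c, s = algebraMap Γ(X, π ⁻¹ᵁ V) X.functionField c * l) ∧
    (∃ c : Module.Basis ι Y.functionField X.functionField,
      ∀ i, c i = algebraMap Γ(X, π ⁻¹ᵁ V) X.functionField (β i)) ∧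
    ∀ y ∈ V, ∃ (c : Γ(X, π ⁻¹ᵁ V)) (r : Γ(Y, V)), algebraMap Γ(Y, V) Y.functionField r =
      Algebra.trace Y.functionField X.functionField
        (algebraMap Γ(X, π ⁻¹ᵁ V) X.functionField c) ∧ y ∈ Y.basicOpen r := by
  have hdom := hπ.quotient.isDominant
  have hfin := hπ.quotient.isFinite
  have hW := hV.preimage π
  have hne := nonempty_preimage hdom V
  let _ := (π.app V).hom.toAlgebra
  let _ := sectionAction act hπ.quotient.invariant V
  let _ := (functionFieldMap π).toAlgebra
  let _ := functionFieldAction act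
  let _ : Algebra Γ(Y, V) X.functionField :=
      ((algebraMap Γ(X, π ⁻¹ᵁ V) X.functionField).comp (π.app V).hom).toAlgebra
  have := isGaloisGroup_section hπ hV
  have := hπ.isGaloisGroup_functionField
  have := sectionAction_smul_algebraMap act hπ.quotient.invariant V
  have := isScalarTower_functionField hdom V
  have : IsScalarTower Γ(Y, V) Γ(X, π ⁻¹ᵁ V) X.functionField := .of_algebraMap_eq fun _ => rfl
  have := functionField_isFractionRing_of_isAffineOpen X (π ⁻¹ᵁ V) hW
  have := functionField_isFractionRing_of_isAffineOpen Y V hV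
  have := hπ.isRegularRing hW
  obtain ⟨v, hv⟩ := hπ.exists_isTameRamification hV hW
  let k : Ideal Γ(X, π ⁻¹ᵁ V) → ℕ := fun P => (idealRamificationIndex π hW P - 1) / 2
  have hlv : ∀ P : Ideal Γ(X, π ⁻¹ᵁ V), P.IsPrime → P.height = 1 → v P l = exp (k P : ℤ) := by
    intro P hP hP1
    obtain ⟨x, hx, rfl⟩ := exists_pointIdeal_eq hW P hP
    rw [(generatesPoleOrder_iff hW hx (hv.isAdic _ hP hP1) _ _).1
      (hl x hx ((height_eq_one_iff hW hx).1 hP1))]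
    change _ = exp (((idealRamificationIndex π hW (pointIdeal hW x hx) - 1) / 2 : ℕ) : ℤ)
    rw [idealRamificationIndex_pointIdeal]
  have hek : ∀ P : Ideal Γ(X, π ⁻¹ᵁ V), P.IsPrime → P.height = 1 →
      idealRamificationIndex π hW P = 2 * k P + 1 := by
    intro P hP hP1
    obtain ⟨x, hx, rfl⟩ := exists_pointIdeal_eq hW P hP
    obtain ⟨m, hm⟩ := hπ.odd_ramificationIndex ((height_eq_one_iff hW hx).1 hP1)
    change _ = 2 * ((idealRamificationIndex π hW (pointIdeal hW x hx) - 1) / 2) + 1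
    rw [idealRamificationIndex_pointIdeal]
    omega
  have hb : ∀ P : Ideal Γ(X, π ⁻¹ᵁ V), P.IsPrime → P.height = 1 →
      idealRamificationIndex π hW P ≠ 1 → ∃ (x : X) (hx : x ∈ π ⁻¹ᵁ V), pointIdeal hW x hx = P ∧
        P.under Γ(Y, V) = pointIdeal hV (π x) hx ∧ π x ∈ b := by
    intro P hP hP1 he
    obtain ⟨x, hx, rfl⟩ := exists_pointIdeal_eq hW P hP
    refine ⟨x, hx, rfl, under_pointIdeal π hW hx hV, ?_⟩
    by_contra hxb
    rw [idealRamificationIndex_pointIdeal] at he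
    exact he (hπ.ramificationIndex_eq_one ((height_eq_one_iff hW hx).1 hP1) hxb)
  refine ⟨fun s hs => exists_eq_mul_of_forall_trace (G := G) hv hlv hek hl0 hs,
    exists_basis_fractionField G β, fun y hy => ?_⟩
  suffices H : ∃ (c : Γ(X, π ⁻¹ᵁ V)) (r : Γ(Y, V)), algebraMap Γ(Y, V) Y.functionField r =
      Algebra.trace Y.functionField X.functionField
        (algebraMap Γ(X, π ⁻¹ᵁ V) X.functionField c) ∧ r ∉ pointIdeal hV y hy by
    obtain ⟨c, r, h1, h2⟩ := H
    exact ⟨c, r, h1, (mem_basicOpen_iff_notMem_pointIdeal hV hy r).2 h2⟩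
  by_cases hyb : y ∈ b
  · obtain ⟨U, f, hf, ⟨u, rfl⟩, n, a, hab, hreg⟩ := hπ.normalCrossings y hyb
    obtain ⟨_, ⟨U', hU', rfl⟩, huU', hUV⟩ := U.isBasis_affineOpens.exists_subset_of_mem_open
      (show u ∈ f ⁻¹ᵁ V from hy) (f ⁻¹ᵁ V).isOpen
    have hU' : IsAffineOpen U' := hU'
    have hUV : U' ≤ f ⁻¹ᵁ V := hUV
    let _ := (f.appLE V U' hUV).hom.toAlgebra
    have het : Algebra.Etale Γ(Y, V) Γ(U, U') := f.etale_appLE hV hU' hUV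
    let _ := (U.presheaf.germ U' u huU').hom.toAlgebra
    have hloc := isLocalization_stalk_pointIdeal hU' huU'
    let e : U.presheaf.stalk u ≃ₐ[Γ(U, U')] Localization.AtPrime (pointIdeal hU' u huU') :=
      IsLocalization.algEquiv (pointIdeal hU' u huU').primeCompl _ _
    have hregu := (hreg u).1
    have hunder : ∀ (w : U) (hw : w ∈ U'),
        (pointIdeal hU' w hw).under Γ(Y, V) = pointIdeal hV (f w) (hUV hw) := fun w hw =>
      congrArg PrimeSpectrum.asIdeal (IsAffineOpen.comap_primeIdealOf_appLE V hV U' hU' hUV hw)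
    -- of the equations `aᵢ` of the branch locus keep those that vanish at `u`; they are part of a
    -- regular system of parameters
    let κ := {i // U.presheaf.germ ⊤ u trivial (a i) ∈ maximalIdeal (U.presheaf.stalk u)}
    let a' : κ → Γ(U, U') := fun i => rres (le_top : U' ≤ ⊤) (a i.1)
    have hgerm : ∀ (w : U) (hw : w ∈ U') (i : Fin n),
        U.presheaf.germ U' w hw (rres (le_top : U' ≤ ⊤) (a i)) =
          U.presheaf.germ ⊤ w trivial (a i) := fun w hw i =>
      U.presheaf.germ_res_apply (homOfLE (le_top : U' ≤ ⊤)) w hw (a i)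
    have he : ∀ i : κ, e (U.presheaf.germ ⊤ u trivial (a i.1)) =
        algebraMap Γ(U, U') (Localization.AtPrime (pointIdeal hU' u huU')) (a' i) := fun i => by
      rw [← hgerm u huU']
      exact e.commutes (a' i)
    have hau : ∀ i : κ, algebraMap Γ(U, U') (Localization.AtPrime (pointIdeal hU' u huU')) (a' i) ∈
        maximalIdeal (Localization.AtPrime (pointIdeal hU' u huU')) := fun i => by
      rw [IsLocalization.AtPrime.to_map_mem_maximal_iff _ (pointIdeal hU' u huU'),
        mem_pointIdeal_iff, hgerm u huU']
      exact i.2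
    have hli := linearIndependent_toCotangent_of_ringEquiv e.toRingEquiv
      (x := fun i : κ => U.presheaf.germ ⊤ u trivial (a i.1)) (fun i => i.2) hau he (hreg u).2
    obtain ⟨c, r, h1, h2⟩ := exists_trace_notMem_of_etale (G := G)
        (F := Y.functionField) hv hlv hek hl0 β
      (pointIdeal hU' u huU') (IsRegularLocalRing.of_ringEquiv e.toRingEquiv) a' hau hli
      (fun P hP hP1 heP Q hQ hQu hQP => by
        obtain ⟨x, hx, -, hPx, hxb⟩ := hb P hP hP1 heP
        obtain ⟨w, hw, rfl⟩ := exists_pointIdeal_eq hU' Q hQ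
        -- a point `w` of `U'` over a branch point satisfies one of the equations, and this
        -- equation vanishes at the specialization `u` of `w`
        have hwx : f w = π x := by
          have h3 : pointIdeal hV (f w) (hUV hw) = pointIdeal hV (π x) hx :=
            (hunder w hw).symm.trans (hQP.trans hPx)
          have h4 := PrimeSpectrum.ext h3
          have h5 := congrArg hV.fromSpec h4
          rwa [hV.fromSpec_primeIdealOf, hV.fromSpec_primeIdealOf] at h5
        obtain ⟨i, hi⟩ := (hab w).1 (hwx ▸ hxb)
        have hiw : rres (le_top : U' ≤ ⊤) (a i) ∈ pointIdeal hU' w hw :=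
          (mem_pointIdeal_iff hU' hw).2 (by rwa [hgerm w hw])
        have hiu := (mem_pointIdeal_iff hU' huU').1 (hQu hiw)
        rw [hgerm u huU'] at hiu
        exact ⟨⟨i, hiu⟩, hiw⟩)
    rw [hunder] at h2
    exact ⟨c, r, h1, h2⟩
  · refine exists_trace_notMem_of_unramified (G := G) hv hlv hek hl0 β _ fun P hP hP1 hle => ?_
    by_contra heP
    obtain ⟨x, hx, -, hPx, hxb⟩ := hb P hP hP1 heP
    rw [hPx] at hle
    -- a ramified point `x` over a generization of `y` would force `y` into the closed branch
    -- locus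
    have h1 := ((PrimeSpectrum.le_iff_specializes (hV.primeIdealOf ⟨π x, hx⟩)
      (hV.primeIdealOf ⟨y, hy⟩)).1 hle).map hV.fromSpec.continuous
    rw [hV.fromSpec_primeIdealOf, hV.fromSpec_primeIdealOf] at h1
    exact hyb (h1.mem_closed b.isClosed hxb)

end IsTameOddCover

end Chart

/-! ### The trace form -/

section HalfCodifferentSections

variable {X Y : Scheme.{u}} [IsIntegral X] {π : X ⟶ Y} {W : X.Opens}

/-- The section of `𝒟^{-1/2}` over `W` given by a rational function. -/
noncomputable def halfCodifferent.mk (f : X.functionField)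
    (hf : ∀ x ∈ W, ringKrullDim (X.presheaf.stalk x) = 1 →
      HasPoleOrderLE x ((ramificationIndex π x - 1) / 2) f) : Γ(halfCodifferent π, W) :=
  (⟨fun _ => f, IsLocallyConstant.const f, fun x hx => hf x.1 x.2 hx⟩ : halfCodiffSubgroup π W)

namespace halfCodifferent

lemma value_smul (r : Γ(X, W)) (s : Γ(halfCodifferent π, W)) (x : W) :
    value π (r • s) x = toFunctionField W x r * value π s x := rfl

lemma value_add (s t : Γ(halfCodifferent π, W)) (x : W) :
    value π (s + t) x = value π s x + value π t x := rfl

lemma value_zero (x : W) : value π (0 : Γ(halfCodifferent π, W)) x = 0 := rfl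

lemma value_sum {ι : Type*} (t : Finset ι) (s : ι → Γ(halfCodifferent π, W)) (x : W) :
    value π (∑ i ∈ t, s i) x = ∑ i ∈ t, value π (s i) x := by
  classical
  induction t using Finset.induction_on with
  | empty => exact value_zero x
  | insert a t ha ih => rw [Finset.sum_insert ha, Finset.sum_insert ha, value_add, ih]

lemma ext_value {s t : Γ(halfCodifferent π, W)} (h : ∀ x, value π s x = value π t x) : s = t :=
  Subtype.ext (funext h)

/-- A section of `𝒟^{-1/2}` over an open subset of an integral scheme is a single rational
function. -/
lemma value_eq (s : Γ(halfCodifferent π, W)) (x y : W) : value π s x = value π s y := by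
  have : PreconnectedSpace W := isPreconnected_iff_preconnectedSpace.1
    ((PreirreducibleSpace.isPreirreducible_univ (X := X)).open_subset W.isOpen
      (Set.subset_univ _)).isPreconnected
  have h : IsLocallyConstant (value π s) := (show halfCodiffSubgroup π W from s).2.1
  exact h.apply_eq_of_isPreconnected this.isPreconnected_univ trivial trivial

lemma hasPoleOrderLE_value (s : Γ(halfCodifferent π, W)) (x : X) (hx : x ∈ W)
    (hdim : ringKrullDim (X.presheaf.stalk x) = 1) (y : W) :
    HasPoleOrderLE x ((ramificationIndex π x - 1) / 2) (value π s y) := by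
  rw [value_eq s y ⟨x, hx⟩]
  exact (show halfCodiffSubgroup π W from s).2.2 ⟨x, hx⟩ hdim

end halfCodifferent

/-- A local generator of the square root of the inverse different is a frame. -/
lemma isFrame_halfCodifferent [IsLocallyNoetherian X]
    (hX : ∀ x : X, IsRegularLocalRing (X.presheaf.stalk x)) {l : X.functionField} (hl0 : l ≠ 0)
    (hl : ∀ x ∈ W, ringKrullDim (X.presheaf.stalk x) = 1 →
      GeneratesPoleOrder x ((ramificationIndex π x - 1) / 2) l) :
    IsFrame (halfCodifferent π) W
      fun _ : Unit => halfCodifferent.mk l fun x hx hd => (hl x hx hd).2.1 := by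
  refine isFrame_of_cover {V | IsAffineOpen V ∧ Nonempty V} (fun V _ x hx => ?_) ?_
  · obtain ⟨_, ⟨V', hV', rfl⟩, hx', h⟩ := X.isBasis_affineOpens.exists_subset_of_mem_open hx V.isOpen
    exact ⟨V', ⟨hV', ⟨⟨x, hx'⟩⟩⟩, hx', h⟩
  · rintro V ⟨hV, hne⟩ h s
    have hfr := functionField_isFractionRing_of_isAffineOpen X V hV
    have hreg := isRegularRing_section hX hV
    obtain ⟨x₀⟩ := id hne
    obtain ⟨v, hv⟩ := exists_forall_isAdicValuation Γ(X, V) X.functionField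
    have hval : ∀ (c : Unit → Γ(X, V)) (x : V), halfCodifferent.value π (∑ i, c i •
        res (halfCodifferent π) h (halfCodifferent.mk l fun x hx hd => (hl x hx hd).2.1)) x =
        algebraMap Γ(X, V) X.functionField (c ()) * l := fun c x => by
      rw [Finset.univ_unique, Finset.sum_singleton, halfCodifferent.value_smul,
        toFunctionField_eq_algebraMap]
      rfl
    obtain ⟨r, hr⟩ := exists_eq_algebraMap_of_forall_le_one hv
      (s := halfCodifferent.value π s x₀ / l) fun P hP hP1 => by
        obtain ⟨x, hx, rfl⟩ := exists_pointIdeal_eq hV P hP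
        have hdim := (height_eq_one_iff hV hx).1 hP1
        have h1 := (hl x (h hx) hdim).2.2 _ (halfCodifferent.hasPoleOrderLE_value s x hx hdim x₀)
        rw [hasPoleOrderLE_iff hV hx (hv _ hP hP1)] at h1
        simpa using h1
    refine ⟨fun _ => r, halfCodifferent.ext_value fun x => ?_, fun c hc => funext fun _ => ?_⟩
    · rw [hval, hr, div_mul_cancel₀ _ hl0, halfCodifferent.value_eq s x x₀]
    · refine IsFractionRing.injective Γ(X, V) X.functionField ?_
      have h1 := (congrArg (fun t => halfCodifferent.value π t x₀) hc).trans (hval c x₀)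
      rw [hr]
      exact ((div_eq_iff hl0).2 h1).symm

end HalfCodifferentSections

section TraceForm

variable {X Y : Scheme.{u}} {G : Type v} [Group G] {act : G →* Aut X} {π : X ⟶ Y}
  [IsIntegral X] [IsIntegral Y] {V : Y.Opens}

lemma value_smul_push [IsDominant π] [Nonempty V] (r : Γ(Y, V)) (s : Γ(halfCodifferent π, π ⁻¹ᵁ V))
    (x : π ⁻¹ᵁ V) :
    halfCodifferent.value π (show Γ(halfCodifferent π, π ⁻¹ᵁ V) from
      (r • (show Γ(pushHalfCodifferent π, V) from s))) x =
      functionFieldMap π (algebraMap Γ(Y, V) Y.functionField r) * halfCodifferent.value π s x := by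
  have : Nonempty (π ⁻¹ᵁ V) := ⟨x⟩
  rw [functionFieldMap_algebraMap]
  refine (halfCodifferent.value_smul (π.app V r) s x).trans ?_
  rw [toFunctionField_eq_algebraMap]

lemma function_ext_algebraMap {a a' : Γ(Y, V)}
    (h : ∀ [Nonempty V], algebraMap Γ(Y, V) Y.functionField a = algebraMap Γ(Y,
        V) Y.functionField a') :
    a = a' := by
  refine function_ext _ _ fun y hy => ⟨V, le_rfl, hy, ?_⟩
  have : Nonempty V := ⟨⟨y, hy⟩⟩
  rw [Y.germToFunctionField_injective V h]

/-- The trace form exists. -/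
lemma IsTameOddCover.exists_isTraceForm [IsNoetherian X] [Finite G] {b : Closeds Y}
    (hπ : IsTameOddCover act π b) :
    ∃ Tr : SymmForm (pushHalfCodifferent π), IsTraceForm π hπ.quotient.isDominant Tr := by
  have hdom := hπ.quotient.isDominant
  let _ := (functionFieldMap π).toAlgebra
  -- the relation defining the form is vacuous over `U` only if `π⁻¹ U`, hence `U`, is empty
  let R : ∀ U : Y.Opens, Γ(pushHalfCodifferent π, U) → Γ(pushHalfCodifferent π, U) → Γ(Y,
      U) → Prop :=
    fun U s t a => ∀ (x : X) (hx : x ∈ π ⁻¹ᵁ U), toFunctionField U ⟨π x, hx⟩ a =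
      Algebra.trace Y.functionField X.functionField
        (halfCodifferent.value π (U := π ⁻¹ᵁ U) s ⟨x, hx⟩ * halfCodifferent.value π
            (U := π ⁻¹ᵁ U) t ⟨x, hx⟩)
  have hR : ∀ (U : Y.Opens) [Nonempty U] s t a (x₀ : π ⁻¹ᵁ U), R U s t a ↔
      algebraMap Γ(Y, U) Y.functionField a = Algebra.trace Y.functionField X.functionField
        (halfCodifferent.value π (U := π ⁻¹ᵁ U) s x₀ *
          halfCodifferent.value π (U := π ⁻¹ᵁ U) t x₀) := fun U _ s t a x₀ => by
    constructor
    · intro h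
      rw [← h x₀.1 x₀.2, toFunctionField_eq_algebraMap]
    · intro h x hx
      rw [toFunctionField_eq_algebraMap, h, halfCodifferent.value_eq (W := π ⁻¹ᵁ U) s ⟨x, hx⟩ x₀,
        halfCodifferent.value_eq (W := π ⁻¹ᵁ U) t ⟨x, hx⟩ x₀]
  obtain ⟨Tr, hTr⟩ := exists_symmForm_of_relation R (fun {U V} h s t a hst x hx => by
      have : Nonempty V := ⟨⟨_, hx⟩⟩
      have : Nonempty U := ⟨⟨_, h hx⟩⟩
      have h1 := hst x (h hx)
      rw [toFunctionField_eq_algebraMap] at h1 ⊢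
      exact (algebraMap_rres h a).trans h1)
    (fun U s t a a' h h' => function_ext_algebraMap fun {_} => by
      obtain ⟨x₀⟩ := nonempty_preimage hdom U
      rw [(hR U s t a x₀).1 h, (hR U s t a' x₀).1 h'])
    (fun U s t z hz => by
      obtain ⟨_, ⟨V, hV, rfl⟩, hzV, hVU⟩ :=
        Y.isBasis_affineOpens.exists_subset_of_mem_open hz U.isOpen
      have hV : IsAffineOpen V := hV
      have : Nonempty V := ⟨⟨z, hzV⟩⟩
      obtain ⟨x₀⟩ := nonempty_preimage hdom V
      have hVU' : π ⁻¹ᵁ V ≤ π ⁻¹ᵁ U := fun x hx => hVU hx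
      obtain ⟨a, ha⟩ := hπ.exists_algebraMap_eq_trace_mul hV
        (s := halfCodifferent.value π (U := π ⁻¹ᵁ U) s ⟨x₀.1, hVU' x₀.2⟩)
        (t := halfCodifferent.value π (U := π ⁻¹ᵁ U) t ⟨x₀.1, hVU' x₀.2⟩)
        (fun x hx hd => halfCodifferent.hasPoleOrderLE_value (W := π ⁻¹ᵁ U) s x (hVU' hx) hd _)
        (fun x hx hd => halfCodifferent.hasPoleOrderLE_value (W := π ⁻¹ᵁ U) t x (hVU' hx) hd _)
      exact ⟨V, hVU, hzV, a, (hR V _ _ a x₀).2 ha⟩)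
    (fun U s s' t a a' h h' x hx => by
      rw [map_add, h x hx, h' x hx, ← map_add, ← add_mul]
      rfl)
    (fun U r s t a h x hx => by
      have : Nonempty U := ⟨⟨_, hx⟩⟩
      rw [map_mul, h x hx, toFunctionField_eq_algebraMap, ← smul_eq_mul, ← map_smul]
      congr 1
      rw [Algebra.smul_def, ← mul_assoc]
      congr 1
      exact (value_smul_push r (show Γ(halfCodifferent π, π ⁻¹ᵁ U) from s) ⟨x, hx⟩).symm)
    (fun U s t a h x hx => by rw [h x hx, mul_comm])
  refine ⟨Tr, fun U s t x hx => ?_⟩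
  obtain ⟨_, ⟨V, hV, rfl⟩, hxV, hVU⟩ :=
    Y.isBasis_affineOpens.exists_subset_of_mem_open (show π x ∈ U from hx) U.isOpen
  have hV : IsAffineOpen V := hV
  have hVU : V ≤ U := hVU
  have : Nonempty V := ⟨⟨_, hxV⟩⟩
  have : Nonempty U := ⟨⟨_, hx⟩⟩
  have hVU' : π ⁻¹ᵁ V ≤ π ⁻¹ᵁ U := fun x hx => hVU hx
  obtain ⟨a, ha⟩ := hπ.exists_algebraMap_eq_trace_mul hV
    (s := halfCodifferent.value π s ⟨x, hx⟩) (t := halfCodifferent.value π t ⟨x, hx⟩)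
    (fun x hx hd => halfCodifferent.hasPoleOrderLE_value s x (hVU' hx) hd _)
    (fun x hx hd => halfCodifferent.hasPoleOrderLE_value t x (hVU' hx) hd _)
  have h1 := hTr V (res (pushHalfCodifferent π) hVU s) (res (pushHalfCodifferent π) hVU t) a
    ((hR V _ _ a ⟨x, hxV⟩).2 ha)
  have h2 := (Tr.form_res hVU s t).symm.trans h1
  rw [← ha, ← h2, toFunctionField_eq_algebraMap]
  exact (algebraMap_rres hVU _).symm

end TraceForm

/-! ### Self-duality for the trace form -/

section SymmBundle

variable {X Y : Scheme.{u}} {G : Type v} [Group G] {act : G →* Aut X} {π : X ⟶ Y}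
  [IsIntegral X] [IsIntegral Y] {V : Y.Opens}

lemma IsTraceForm.algebraMap_form {hdom : IsDominant π} {Tr : SymmForm (pushHalfCodifferent π)}
    (hTr : IsTraceForm π hdom Tr) [Nonempty V] (s t : Γ(halfCodifferent π, π ⁻¹ᵁ V))
    (x : π ⁻¹ᵁ V) :
    letI := (functionFieldMap π).toAlgebra
    algebraMap Γ(Y, V) Y.functionField (Tr.form V s t) =
      Algebra.trace Y.functionField X.functionField
        (halfCodifferent.value π s x * halfCodifferent.value π t x) := by
  rw [← hTr V s t x.1 x.2, toFunctionField_eq_algebraMap]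

variable [IsNoetherian X] [Finite G] {b : Closeds Y}

namespace IsTameOddCover

/-- Near each point of `Y` there is an affine chart on which the square root of the inverse
different
is generated by one function and over which `π` is free. -/
lemma exists_chart (hπ : IsTameOddCover act π b) (y : Y) :
    ∃ V : Y.Opens, y ∈ V ∧ IsAffineOpen V ∧ ∃ l : X.functionField, l ≠ 0 ∧
      (∀ x ∈ π ⁻¹ᵁ V, ringKrullDim (X.presheaf.stalk x) = 1 →
        GeneratesPoleOrder x ((ramificationIndex π x - 1) / 2) l) ∧ ∃ n : ℕ,
      letI := (π.app V).hom.toAlgebra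
      Nonempty (Module.Basis (Fin n) Γ(Y, V) Γ(X, π ⁻¹ᵁ V)) := by
  obtain ⟨O, hyO, l, hl0, hl⟩ := hπ.exists_generatesPoleOrder y
  obtain ⟨V, hV, hVO, hyV, n, hβ⟩ := hπ.exists_basis_section O hyO
  exact ⟨V, hyV, hV, l, hl0, fun x hx => hl x (hVO hx), n, hβ⟩

lemma isFramed_baseChangeMap (hπ : IsTameOddCover act π b) {Z : Scheme.{u}} (φ : Z ⟶ Y) :
    IsFramed (baseChangeMap φ π (halfCodifferent π)) :=
  TameTwist.isFramed_baseChangeMap φ π _ fun y => by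
    have := hπ.quotient.isFinite
    obtain ⟨V, hyV, hV, l, hl0, hl, n, hβ⟩ := hπ.exists_chart y
    exact ⟨V, hyV, hV, hV.preimage π, ⟨_, isFrame_halfCodifferent hπ.regular hl0 hl⟩, n, hβ⟩

/-- `π_* 𝒟^{-1/2}` with the trace form is a symmetric bundle: the square root of the inverse
different is its own dual. -/
lemma isSymmBundle_traceForm (hπ : IsTameOddCover act π b) {Tr : SymmForm (pushHalfCodifferent π)}
    (hTr : IsTraceForm π hπ.quotient.isDominant Tr) :
    IsSymmBundle (pushHalfCodifferent π) Tr := by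
  have hdom := hπ.quotient.isDominant
  have hfin := hπ.quotient.isFinite
  refine ⟨isVectorBundle_of_frames fun y => ?_, Tr.nondegenerate_of_gram fun y => ?_⟩
  · obtain ⟨V, hyV, hV, l, hl0, hl, n, ⟨β⟩⟩ := hπ.exists_chart y
    exact ⟨V, hyV, Fin n, inferInstance, _, isFrame_pushforward_of_basis hV (hV.preimage π)
      (isFrame_halfCodifferent hπ.regular hl0 hl) β⟩
  · obtain ⟨V, hyV, hV, l, hl0, hl, n, ⟨β⟩⟩ := hπ.exists_chart y
    have : Nonempty V := ⟨⟨y, hyV⟩⟩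
    have hne := nonempty_preimage hdom V
    obtain ⟨x₀⟩ := id hne
    let _ := (π.app V).hom.toAlgebra
    let _ := (functionFieldMap π).toAlgebra
    let _ := functionFieldAction act
    have hgal := hπ.isGaloisGroup_functionField
    have := IsGaloisGroup.isGalois G Y.functionField X.functionField
    have := IsGaloisGroup.finiteDimensional G Y.functionField X.functionField
    refine ⟨V, hyV, Fin n, inferInstance, inferInstance, _, isFrame_pushforward_of_basis hV
      (hV.preimage π) (isFrame_halfCodifferent hπ.regular hl0 hl) β, ?_⟩
    obtain ⟨hdual, ⟨c, hc⟩, -⟩ := hπ.exists_trace_isUnit hV hl0 hl β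
    let B := Algebra.traceForm Y.functionField X.functionField
    have hB : B.Nondegenerate := traceForm_nondegenerate _ _
    let d := B.dualBasis hB c
    have hd : ∀ i j, Algebra.trace Y.functionField X.functionField (d i * c j) =
        if j = i then 1 else 0 := fun i j => LinearMap.BilinForm.apply_dualBasis_left hB c i j
    have hsmul : ∀ (a : Γ(Y, V)) (x : Γ(X, π ⁻¹ᵁ V)),
        algebraMap Γ(X, π ⁻¹ᵁ V) X.functionField (a • x) =
          algebraMap Γ(Y, V) Y.functionField a • algebraMap Γ(X, π ⁻¹ᵁ V) X.functionField x :=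
      fun a x => by
        rw [Algebra.smul_def (A := X.functionField)]
        exact (map_mul _ (π.app V a) x).trans
          (congrArg (· * _) (functionFieldMap_algebraMap π V a).symm)
    have hsum : ∀ e, ∑ j, algebraMap Γ(Y, V) Y.functionField (β.repr e j) • c j =
        algebraMap Γ(X, π ⁻¹ᵁ V) X.functionField e := fun e => by
      conv_rhs => rw [← β.sum_repr e, map_sum]
      exact Finset.sum_congr rfl fun j _ => by rw [hsmul, hc]
    let E : Fin n → Γ(pushHalfCodifferent π, V) := fun i => (β i •
      halfCodifferent.mk l fun x hx hd => (hl x hx hd).2.1 : Γ(halfCodifferent π, π ⁻¹ᵁ V))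
    have hE : ∀ i, halfCodifferent.value π (U := π ⁻¹ᵁ V) (E i) x₀ = c i * l := fun i => by
      rw [hc, ← toFunctionField_eq_algebraMap x₀]
      exact halfCodifferent.value_smul _ _ _
    -- the dual basis lies in the lattice generated by `l`
    have hex : ∀ i, ∃ e, d i / l = algebraMap Γ(X, π ⁻¹ᵁ V) X.functionField e * l := fun i => by
      refine hdual _ fun e => ?_
      refine ⟨β.repr e i, ?_⟩
      have h1 : d i / l * (l * algebraMap Γ(X, π ⁻¹ᵁ V) X.functionField e) =
          d i * algebraMap Γ(X, π ⁻¹ᵁ V) X.functionField e := by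
        rw [← mul_assoc, div_mul_cancel₀ _ hl0]
      rw [h1, ← hsum, Finset.mul_sum, map_sum]
      simp only [mul_smul_comm, map_smul, hd, smul_eq_mul, mul_ite, mul_one, mul_zero,
        Finset.sum_ite_eq', Finset.mem_univ, if_true]
    choose e he using hex
    refine isUnit_iff_exists_inv'.2 ⟨(Matrix.of fun i k => β.repr (e i) k).det, ?_⟩
    rw [← Matrix.det_mul]
    -- the coordinates `e i` of the dual basis invert the Gram matrix
    have hone : (Matrix.of fun i k => β.repr (e i) k) * gram Tr E = 1 := by
      ext i j
      refine Y.germToFunctionField_injective V ?_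
      change algebraMap Γ(Y, V) Y.functionField _ = algebraMap Γ(Y, V) Y.functionField _
      rw [Matrix.mul_apply, map_sum]
      have h3 : ∀ k, algebraMap Γ(Y, V) Y.functionField
          ((Matrix.of fun i k => β.repr (e i) k) i k * gram Tr E k j) =
          Algebra.trace Y.functionField X.functionField
            ((algebraMap Γ(Y, V) Y.functionField (β.repr (e i) k) • c k) * (l * l * c j)) :=
        fun k => by
          rw [map_mul, smul_mul_assoc, map_smul, smul_eq_mul]
          refine congrArg _ ((hTr.algebraMap_form (E k) (E j) x₀).trans (congrArg _ ?_))
          rw [hE, hE]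
          ring
      rw [Finset.sum_congr rfl fun k _ => h3 k, ← map_sum, ← Finset.sum_mul]
      have h5 : algebraMap Γ(X, π ⁻¹ᵁ V) X.functionField (e i) * (l * l * c j) = d i * c j := by
        rw [← mul_assoc, ← mul_assoc, ← he, div_mul_cancel₀ _ hl0]
      rw [hsum, h5, hd, Matrix.one_apply]
      simp only [eq_comm (a := j)]
      split_ifs <;> simp
    exact (congrArg Matrix.det hone).trans Matrix.det_one

end IsTameOddCover

end SymmBundle

/-! ### The Galois action on the square root of the inverse different -/

section GaloisActionOnSections

variable {X Y : Scheme.{u}} {G : Type v} [Group G] {act : G →* Aut X} {π : X ⟶ Y}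
  [IsIntegral X] {V : Y.Opens}

lemma value_galoisAction (hinv : ∀ g, (act g).hom ≫ π = π) (g : G)
    (s : Γ(pushHalfCodifferent π, V)) (x : π ⁻¹ᵁ V) :
    letI := functionFieldAction act
    halfCodifferent.value π (U := π ⁻¹ᵁ V) ((galoisAction hinv g).app V s) x =
      g • halfCodifferent.value π (U := π ⁻¹ᵁ V) s x := by
  refine Eq.trans (b := functionFieldMap (act g⁻¹).hom (halfCodifferent.value π (U := π ⁻¹ᵁ V) s
    (preimageMap π (act g⁻¹).hom (hinv g⁻¹) V x))) rfl ?_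
  rw [halfCodifferent.value_eq (W := π ⁻¹ᵁ V) s _ x]
  rfl

lemma pushHalfCodifferent_hom_ext {f g : pushHalfCodifferent π ⟶ pushHalfCodifferent π}
    (h : ∀ (V : Y.Opens) (s : Γ(pushHalfCodifferent π, V)) (x : π ⁻¹ᵁ V),
      halfCodifferent.value π (U := π ⁻¹ᵁ V) (f.app V s) x =
        halfCodifferent.value π (U := π ⁻¹ᵁ V) (g.app V s) x) : f = g := by
  ext V s
  exact halfCodifferent.ext_value (W := π ⁻¹ᵁ V) (h V s)

lemma galoisAction_mul (hinv : ∀ g, (act g).hom ≫ π = π) (g h : G) :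
    galoisAction hinv (g * h) = galoisAction hinv h ≫ galoisAction hinv g := by
  let _ := functionFieldAction act
  refine pushHalfCodifferent_hom_ext fun V s x => ?_
  rw [Scheme.Modules.Hom.comp_app, ConcreteCategory.comp_apply]
  exact (value_galoisAction hinv (g * h) s x).trans ((mul_smul g h _).trans
    ((congrArg (g • ·) (value_galoisAction hinv h s x).symm).trans
      (value_galoisAction hinv g _ x).symm))

lemma galoisAction_one (hinv : ∀ g, (act g).hom ≫ π = π) : galoisAction hinv 1 = 𝟙 _ := by
  let _ := functionFieldAction act
  exact pushHalfCodifferent_hom_ext fun V s x =>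
    (value_galoisAction hinv 1 s x).trans (one_smul G _)

variable [IsIntegral Y] [IsNoetherian X] [Finite G] {b : Closeds Y}

namespace IsTameOddCover

/-- The group acts by isometries of the trace form. -/
lemma form_galoisAction (hπ : IsTameOddCover act π b) {Tr : SymmForm (pushHalfCodifferent π)}
    (hTr : IsTraceForm π hπ.quotient.isDominant Tr) (g : G) (V : Y.Opens)
    (s t : Γ(pushHalfCodifferent π, V)) :
    Tr.form V ((galoisAction hπ.quotient.invariant g).app V s)
      ((galoisAction hπ.quotient.invariant g).app V t) = Tr.form V s t := by
  have hdom := hπ.quotient.isDominant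
  let _ := (functionFieldMap π).toAlgebra
  let _ := functionFieldAction act
  have hgal := hπ.isGaloisGroup_functionField
  have := IsGaloisGroup.commutes (G := G) (A := Y.functionField) (B := X.functionField)
  refine function_ext_algebraMap fun {_} => ?_
  obtain ⟨x⟩ := nonempty_preimage hdom V
  refine (hTr.algebraMap_form _ _ x).trans (Eq.trans ?_ (hTr.algebraMap_form s t x).symm)
  have h1 := value_galoisAction hπ.quotient.invariant g s x
  have h2 := value_galoisAction hπ.quotient.invariant g t x
  refine (congrArg _ (congrArg₂ (· * ·) h1 h2)).trans ?_
  simp only []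
  rw [← smul_mul']
  exact Algebra.trace_eq_of_algEquiv
    (MulSemiringAction.toAlgEquiv Y.functionField X.functionField g) _

/-- Multiplication by a function on `π⁻¹ V` with trace one splits the norm. -/
lemma exists_splitsNorm [Fintype G] (hπ : IsTameOddCover act π b) (y : Y) :
    ∃ (U : Y.Opens) (_ : y ∈ U) (n : ℕ) (l v : Fin n → Γ(pushHalfCodifferent π, U)),
      SplitsNorm (galoisAction hπ.quotient.invariant) l v := by
  have hdom := hπ.quotient.isDominant
  have hfin := hπ.quotient.isFinite
  obtain ⟨V, hyV, hV, l, hl0, hl, n, ⟨β⟩⟩ := hπ.exists_chart y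
  have : Nonempty V := ⟨⟨y, hyV⟩⟩
  have hne := nonempty_preimage hdom V
  let _ := (π.app V).hom.toAlgebra
  let _ := (functionFieldMap π).toAlgebra
  let _ := functionFieldAction act
  have hgal := hπ.isGaloisGroup_functionField
  have := IsGaloisGroup.commutes (G := G) (A := Y.functionField) (B := X.functionField)
  obtain ⟨-, -, htr⟩ := hπ.exists_trace_isUnit hV hl0 hl β
  obtain ⟨c, r, hr, hyr⟩ := htr y hyV
  let U := Y.basicOpen r
  have hUV : U ≤ V := Y.basicOpen_le r
  have hUV' : π ⁻¹ᵁ U ≤ π ⁻¹ᵁ V := fun x hx => hUV hx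
  have : Nonempty U := ⟨⟨y, hyr⟩⟩
  have hneU := nonempty_preimage hdom U
  -- over `U`, where the trace `r` of `c` is invertible, `c' = r⁻¹ c` has trace one
  have hunit : IsUnit (rres hUV r) := Y.toRingedSpace.isUnit_res_basicOpen r
  obtain ⟨r', hr'⟩ := isUnit_iff_exists_inv.1 hunit
  let c' : Γ(X, π ⁻¹ᵁ U) := π.app U r' * rres hUV' c
  have hc' : ∑ g : G, g • algebraMap Γ(X, π ⁻¹ᵁ U) X.functionField c' = 1 := by
    rw [← algebraMap_trace_eq_sum Y.functionField]
    have h1 : algebraMap Γ(X, π ⁻¹ᵁ U) X.functionField c' =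
        algebraMap Γ(Y, U) Y.functionField r' • algebraMap Γ(X, π ⁻¹ᵁ V) X.functionField c := by
      rw [map_mul, algebraMap_rres hUV' c, Algebra.smul_def]
      exact congrArg (· * _) (functionFieldMap_algebraMap π U r').symm
    rw [h1, map_smul, ← hr, ← algebraMap_rres hUV r, smul_eq_mul, ← map_mul, mul_comm, hr', map_one,
      map_one]
  let E : Fin n → Γ(pushHalfCodifferent π, U) := fun i => res (pushHalfCodifferent π) hUV
    (β i • halfCodifferent.mk l fun x hx hd => (hl x hx hd).2.1 : Γ(halfCodifferent π, π ⁻¹ᵁ V))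
  have hb : IsFrame (pushHalfCodifferent π) U E :=
    (isFrame_pushforward_of_basis hV (hV.preimage π)
      (isFrame_halfCodifferent hπ.regular hl0 hl) β).restrict hUV
  let mulc : Γ(pushHalfCodifferent π, U) →ₗ[Γ(Y, U)] Γ(pushHalfCodifferent π, U) :=
    { toFun := fun s => (c' • (show Γ(halfCodifferent π, π ⁻¹ᵁ U) from s) :
        Γ(halfCodifferent π, π ⁻¹ᵁ U))
      map_add' := fun s t => smul_add c' (show Γ(halfCodifferent π, π ⁻¹ᵁ U) from s)
        (show Γ(halfCodifferent π, π ⁻¹ᵁ U) from t)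
      map_smul' := fun a s => smul_comm c' (π.app U a) (show Γ(halfCodifferent π, π ⁻¹ᵁ U) from s) }
  refine ⟨U, hyr, n, E, fun i => mulc (E i), hb, fun i => ?_⟩
  have hendo : hb.endo (fun i => mulc (E i)) le_rfl = mulc := by
    refine (hb.basis le_rfl).ext fun i => ?_
    rw [hb.basis_apply, hb.endo_frame, res_self, res_self]
  rw [hendo]
  refine halfCodifferent.ext_value (W := π ⁻¹ᵁ U) fun x => ?_
  let s := E i
  refine (halfCodifferent.value_sum (W := π ⁻¹ᵁ U) _ _ x).trans ?_
  -- `g c' g⁻¹` is the multiplication by `g c'`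
  have key : ∀ g : G, halfCodifferent.value π (U := π ⁻¹ᵁ U)
      ((galoisAction hπ.quotient.invariant g).app U
        (mulc ((galoisAction hπ.quotient.invariant g⁻¹).app U s))) x =
      (g • algebraMap Γ(X, π ⁻¹ᵁ U) X.functionField c') *
        halfCodifferent.value π (U := π ⁻¹ᵁ U) s x := fun g => by
    refine (value_galoisAction hπ.quotient.invariant g _ x).trans ?_
    refine (congrArg (g • ·) ((halfCodifferent.value_smul (W := π ⁻¹ᵁ U) c' _ x).trans
      (congrArg₂ (· * ·) (toFunctionField_eq_algebraMap x c')
        (value_galoisAction hπ.quotient.invariant g⁻¹ s x)))).trans ?_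
    exact (smul_mul' g _ _).trans (congrArg (_ * ·) (smul_inv_smul g _))
  refine (Finset.sum_congr rfl fun g _ => key g).trans ?_
  rw [← Finset.sum_mul, hc', one_mul]

end IsTameOddCover

end GaloisActionOnSections

end TameTwist

theorem theorem0p6 {X Y : Scheme.{u}} [IsIntegral X] [IsIntegral Y] [IsNoetherian X]
    (h2 : IsUnit (2 : Γ(Y, ⊤))) {G : Type v} [Group G] [Finite G] (act : G →* Aut X)
    (π : X ⟶ Y) (b : Closeds Y) (hπ : IsTameOddCover act π b)
    (E : Y.Modules) (q : SymmForm E) (hE : IsSymmBundle E q) (ρ : G →* Aut E)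
    (hρ : ∀ (g : G) (U : Y.Opens) (x y : Γ(E, U)),
      q.form U ((ρ g).hom.app U x) ((ρ g).hom.app U y) = q.form U x y) :
    -- the trace form exists, and so does the twisted form, which is unique;
    ∃ Tr : SymmForm (pushHalfCodifferent π), IsTraceForm π hπ.quotient.isDominant Tr ∧
    ∃ qX : SymmForm (twist (fun g => (ρ g).hom) (galoisAction hπ.quotient.invariant)),
      (∀ q₁, IsTwistForm (fun g => (ρ g).hom) (galoisAction hπ.quotient.invariant) q Tr q₁ ↔
        q₁ = qX) ∧
      -- the twist is a symmetric bundle;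
      IsSymmBundle (twist (fun g => (ρ g).hom) (galoisAction hπ.quotient.invariant)) qX ∧
      -- and it commutes with flat base change:
      ∀ (Z : Scheme.{u}) (φ : Z ⟶ Y) [Flat φ],
        -- the action and the trace form on the base change of `π_* 𝒟^{-1/2}`, and the form `φ^* q`
        ∃ (α' : G → (pushHalfCodifferentBC φ π ⟶ pushHalfCodifferentBC φ π))
          (Tr' : SymmForm (pushHalfCodifferentBC φ π))
          (q' : SymmForm ((Scheme.Modules.pullback φ).obj E)),
          (∀ g, baseChangeMap φ π (halfCodifferent π) ≫
              (Scheme.Modules.pushforward φ).map (α' g) =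
            galoisAction hπ.quotient.invariant g ≫ baseChangeMap φ π (halfCodifferent π)) ∧
          IsCompatibleForm (baseChangeMap φ π (halfCodifferent π)) Tr Tr' ∧
          IsCompatibleForm (unitMap φ E) q q' ∧
          -- the twist of `φ^* E`, and the canonical isometry from the pull-back of the twist of `E`
          ∃ qZ : SymmForm (twist (fun g => (Scheme.Modules.pullback φ).map (ρ g).hom) α'),
            (∀ q₁, IsTwistForm (fun g => (Scheme.Modules.pullback φ).map (ρ g).hom) α' q' Tr' q₁ ↔
              q₁ = qZ) ∧
            IsSymmBundle _ qZ ∧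
            ∃ e : (Scheme.Modules.pullback φ).obj
                (twist (fun g => (ρ g).hom) (galoisAction hπ.quotient.invariant)) ≅
                twist (fun g => (Scheme.Modules.pullback φ).map (ρ g).hom) α',
              IsCanonicalIso (unitMap φ E) (baseChangeMap φ π (halfCodifferent π)) e ∧
              IsCompatibleForm (unitMap φ _ ≫ (Scheme.Modules.pushforward φ).map e.hom) qX qZ :=
  by
  obtain ⟨Tr, hTr⟩ := hπ.exists_isTraceForm
  cases nonempty_fintype G
  obtain ⟨qX, huniq, hX, hbc⟩ := exists_twistForm_baseChange (ρ := fun g => (ρ g).hom)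
    (α := galoisAction hπ.quotient.invariant) hE (hπ.isSymmBundle_traceForm hTr)
    (fun g h => by rw [map_mul]; rfl) (by rw [map_one]; rfl) hρ
    (galoisAction_mul _) (galoisAction_one _) (hπ.form_galoisAction hTr) hπ.exists_splitsNorm
  exact ⟨Tr, hTr, qX, huniq, hX, fun Z φ _ => hbc Z φ _ _ (hπ.isFramed_baseChangeMap φ)⟩
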